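/- Let $d\in\{1,2,3\}$, let $\mathcal R\subset\mathbb R^d$ be a lattice, let $(e_\alpha)_{1\le\alpha\le d}$ be a basis of $\mathbb R^d$, and let $\mu_{\rm F}\in\mathbb R$. Let $V\in H^1_{\rm per}(\mathbb R^d;\mathbb R)$ and $\mathcal A\in H^2_{\rm per}(\mathbb R^d;\mathbb R^d)$ be $\mathcal R$-periodic, with $\nabla\cdot\mathcal A=0$. For $k\in\mathbb R^d$ let $$H_k=\tfrac12(-i\nabla+k+\mathcal A)^2+V$$ on $L^2_{\rm per}$, with domain $H^2_{\rm per}$, let $\lambda_{1,k}\le\lambda_{2,k}\le\cdots$ be its eigenvalues counted with multiplicity, $\lambda_{0,k}=-\infty$, $\gamma_k=\mathbb 1(H_k\le\mu_{\rm F})$, $N_k=\#\{n\ge1:\lambda_{n,k}\le\mu_{\rm F}\}$, and $P_{N,k}=\mathbb 1(H_k\le\lambda_{N,k})$. Let $\partial_\alpha$ be the derivative in $k$ along $e_\alpha$, so that $\partial_\alpha H_k=(-i\nabla+k+\mathcal A)\cdot e_\alpha$. Let $L_k=[H_k,\cdot\,]$ be the Liouvillian, $e^{-itL_k}X=e^{-itH_k}Xe^{itH_k}$,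 and let $L_k^+$ be the inverse of $L_k$ on the bounded operators that are off-diagonal with respect to $P_{N_k,k}$, extended by $0$ to the block-diagonal operators. Fix indices $\alpha,\beta$. There is a constant $C\ge0$ such that the following holds for every $k\in\mathbb R^d$ with $\lambda_{N_k+1,k}-\lambda_{N_k,k}>0$. One has $\gamma_k=P_{N_k,k}$. Put $N=N_k$ and keep $N$ fixed in all derivatives with respect to $k'$ below, writing $$\partial_\beta\gamma_k:=\partial_\beta P_{N,k'}\big|_{k'=k},\qquad \partial_\alpha{\rm Tr}(H_k\gamma_k):=\partial_\alpha{\rm Tr}(H_{k'}P_{N,k'})\big|_{k'=k},$$ and likewise for $\partial_\alpha\partial_\beta{\rm Tr}(H_k\gamma_k)$; these derivatives exist, and if $\mu_{\rm F}$ is not an eigenvalue of $H_k$ then $\gamma_{k'}=P_{N,k'}$ for all $k'$ near $k$, so that they are the derivatives of $\gamma_{k'}$ and of ${\rm Tr}(H_{k'}\gamma_{k'})$ themselves. For every $\varepsilon\ge0$ there is a unique unitary propagator $U(t)$ of $i\partial_tU(t)=H_{k-\varepsilon te_\beta}U(t)$, $U(0)={\rm Id}$, and for all $t\ge0$ the operators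 under the traces below are trace class and $$\begin{aligned}{\rm Tr}\big(\partial_\alpha H_{k-\varepsilon te_\beta}\,U(t)\gamma_kU(t)^*\big)={}&\partial_\alpha{\rm Tr}(H_k\gamma_k)-\varepsilon t\,\partial_\alpha\partial_\beta{\rm Tr}(H_k\gamma_k)\\&+i\varepsilon\,{\rm Tr}\big(\partial_\alpha H_k\,(e^{-itL_k}-1)L_k^+\partial_\beta\gamma_k\big)+\rho,\end{aligned}$$ with $|\rho|\le C\varepsilon^2t^3(1+t^3)$ whenever $\varepsilon t\le1$. The constant $C$ does not depend on $k$, $\varepsilon$, $t$, nor on the gap $\lambda_{N_k+1,k}-\lambda_{N_k,k}$. -/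

import Mathlib

open MeasureTheory Topology Filter
open scoped ContDiff InnerProductSpace

noncomputable section

namespace BlochTransport

/-! ### Abstract operator theory on a complex Hilbert space

Unbounded operators are partially defined linear maps `A : H →ₗ.[ℂ] H`. -/

section Abstract

variable {H : Type*} [NormedAddCommGroup H] [InnerProductSpace ℂ H] [CompleteSpace H]

/-- The eigenspace `ker (A - x)`, `x` real. -/
def eigenspace (A : H →ₗ.[ℂ] H) (x : ℝ) : Submodule ℂ H :=
  A.graph.comap (LinearMap.id.prod ((x : ℂ) • LinearMap.id))

/-- Orthogonal projection onto the (closure of the) eigenspace `ker (A - x)`. -/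
def eigenproj (A : H →ₗ.[ℂ] H) (x : ℝ) : H →L[ℂ] H :=
  (eigenspace A x).topologicalClosure.starProjection

open Classical in
/-- Functional calculus `f(A) = ∑ₓ f(x) 𝟙_{x}(A)` (strongly convergent sum over the eigenvalues) of a
self-adjoint operator with pure point spectrum, for a bounded function `f`. -/
def specFun (A : H →ₗ.[ℂ] H) (f : ℝ → ℂ) : H →L[ℂ] H :=
  if h : ∃ T : H →L[ℂ] H, ∀ u : H, HasSum (fun x : ℝ => f x • eigenproj A x u) (T u) then
    h.choose
  else 0

/-- The spectral projector `𝟙(A ≤ c)`, where `c` may be infinite. -/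
def specProj (A : H →ₗ.[ℂ] H) (c : EReal) : H →L[ℂ] H :=
  specFun A (Set.indicator {x : ℝ | (x : EReal) ≤ c} 1)

/-- The unitary group `exp (-i t A)`. -/
def expGroup (A : H →ₗ.[ℂ] H) (t : ℝ) : H →L[ℂ] H :=
  specFun A fun x => Complex.exp (-(Complex.I * t * x))

/-- The `n`-th eigenvalue of `A` in non-decreasing order, counting multiplicities, for `n = 1, 2, …`:
the least `x` such that the eigenvectors with eigenvalue at most `x` span a space of dimension at
least `n`. For `n = 0` the value is `-∞`. -/
def eigval (A : H →ₗ.[ℂ] H) (n : ℕ) : EReal :=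
  sInf ((fun x : ℝ => (x : EReal)) ''
    {x : ℝ | (n : Cardinal) ≤ Module.rank ℂ ↥(⨆ y : ℝ, ⨆ _ : y ≤ x, eigenspace A y)})

/-- The number of eigenvalues at most `μ`, counting multiplicities. -/
def numBelow (A : H →ₗ.[ℂ] H) (μ : ℝ) : ℕ :=
  Set.ncard {n : ℕ | 1 ≤ n ∧ eigval A n ≤ (μ : EReal)}

/-- A bounded operator `T` is trace class: `Tr |T| < ∞`, where `|T| = (T^* T)^{1/2}`. -/
def IsTraceClass (T : H →L[ℂ] H) : Prop :=
  ∀ (s : Set H) (b : HilbertBasis s ℂ H),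
    Summable fun i => (⟪b i, CFC.abs T (b i)⟫_ℂ).re

/-- For `A` possibly unbounded and `X` bounded: the product `A X` is everywhere defined, bounded and
trace class, and its trace is `τ`. -/
def HasTrace (A : H →ₗ.[ℂ] H) (X : H →L[ℂ] H) (τ : ℂ) : Prop :=
  ∃ T : H →L[ℂ] H, (∀ u, (X u, T u) ∈ A.graph) ∧ IsTraceClass T ∧
    ∀ (s : Set H) (b : HilbertBasis s ℂ H), HasSum (fun i => ⟪b i, T (b i)⟫_ℂ) τ

open Classical in
/-- The trace `Tr (A X)`. -/
def tr (A : H →ₗ.[ℂ] H) (X : H →L[ℂ] H) : ℂ :=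
  if h : ∃ τ, HasTrace A X τ then h.choose else 0

/-- `[A, X] = Y` on the domain of `A`, for bounded `X` and `Y`: the Liouvillian `L_A` maps
`X` to `Y`. -/
def IsCommutator (A : H →ₗ.[ℂ] H) (X Y : H →L[ℂ] H) : Prop :=
  ∀ u f : H, (u, f) ∈ A.graph → (X u, X f + Y u) ∈ A.graph

/-- `X` is off-diagonal with respect to the projector `P`. -/
def IsOffDiag (P X : H →L[ℂ] H) : Prop :=
  P ∘L X ∘L P = 0 ∧ (1 - P) ∘L X ∘L (1 - P) = 0

/-- The off-diagonal part of `X` with respect to the projector `P`. -/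
def offDiag (P X : H →L[ℂ] H) : H →L[ℂ] H :=
  P ∘L X ∘L (1 - P) + (1 - P) ∘L X ∘L P

/-- `X = L⁺ Y`, where `L⁺` is the inverse of the Liouvillian `L_A` on operators that are off-diagonal
with respect to `P`, extended by zero to diagonal operators. -/
def IsPartialInverse (A : H →ₗ.[ℂ] H) (P Y X : H →L[ℂ] H) : Prop :=
  IsOffDiag P X ∧ IsCommutator A X (offDiag P Y)

open Classical in
/-- `L⁺ Y`. -/
def liouvPlus (A : H →ₗ.[ℂ] H) (P Y : H →L[ℂ] H) : H →L[ℂ] H :=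
  if h : ∃ X, IsPartialInverse A P Y X then h.choose else 0

/-- `exp (-i t L_A) X = exp (-i t A) X exp (i t A)`. -/
def liouvExp (A : H →ₗ.[ℂ] H) (t : ℝ) (X : H →L[ℂ] H) : H →L[ℂ] H :=
  expGroup A t ∘L X ∘L expGroup A (-t)

/-- `U` is the unitary propagator (started at time `0`) of `i ∂ₜ U(t) = A(t) U(t)`, `U(0) = 1`, for
a family `A(t)` of operators: on the domain of `A(0)`, the orbit `t ↦ U(t) u` stays in the
domain of `A(t)` and solves the equation. -/
structure IsPropagator (A : ℝ → (H →ₗ.[ℂ] H)) (U : ℝ → (H →L[ℂ] H)) : Prop where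
  unitary : ∀ t, U t ∈ unitary (H →L[ℂ] H)
  zero : U 0 = 1
  solves : ∀ u ∈ (A 0).domain, ∀ t : ℝ, ∃ f : H, (U t u, f) ∈ (A t).graph ∧
    HasDerivAt (fun s => U s u) (-Complex.I • f) t

end Abstract

/-! ### Periodic functions

The lattice is `ℤ a₁ + ⋯ + ℤ a_d` for a basis `a` of `ℝᵈ`. -/

/-- Euclidean space `ℝᵈ`. -/
abbrev E (d : ℕ) : Type := EuclideanSpace ℝ (Fin d)

variable {d : ℕ}

/-- Periodicity with respect to the lattice generated by `a`. -/
def IsPeriodic {F : Type*} (a : Module.Basis (Fin d) ℝ (E d)) (f : E d → F) : Prop :=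
  ∀ R ∈ Submodule.span ℤ (Set.range a), ∀ x, f (x + R) = f x

/-- The unit cell `{∑ yᵢ aᵢ : 0 ≤ yᵢ < 1}`. -/
abbrev cell (a : Module.Basis (Fin d) ℝ (E d)) : Set (E d) := ZSpan.fundamentalDomain a

/-- Lebesgue measure on the unit cell. -/
abbrev cellVol (a : Module.Basis (Fin d) ℝ (E d)) : Measure (E d) := volume.restrict (cell a)

/-- The Hilbert space of locally square integrable periodic functions; such a function is identified
with its restriction to the unit cell. -/
abbrev L2per (a : Module.Basis (Fin d) ℝ (E d)) : Type := Lp ℂ 2 (cellVol a)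

/-- `g` is the weak derivative of the periodic function `u` in the direction `v`; the test functions
are the smooth periodic functions (`u` and `g` are only evaluated on the unit cell). -/
def IsWeakDeriv (a : Module.Basis (Fin d) ℝ (E d)) (v : E d) (u g : E d → ℂ) : Prop :=
  ∀ φ : E d → ℂ, ContDiff ℝ ∞ φ → IsPeriodic a φ →
    ∫ x, u x * fderiv ℝ φ x v ∂(cellVol a) = - ∫ x, g x * φ x ∂(cellVol a)

/-- The periodic Sobolev space `H^m_per`: weak derivatives up to order `m` are square integrable over
the unit cell. -/
def MemHper (a : Module.Basis (Fin d) ℝ (E d)) : ℕ → (E d → ℂ) → Prop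
  | 0, u => MemLp u 2 (cellVol a)
  | m + 1, u => MemLp u 2 (cellVol a) ∧ ∀ v, ∃ g, IsWeakDeriv a v u g ∧ MemHper a m g

section Helpers

variable {a : Module.Basis (Fin d) ℝ (E d)}

theorem MemHper.memLp {m : ℕ} {u : E d → ℂ} (h : MemHper a m u) : MemLp u 2 (cellVol a) := by
  cases m with
  | zero => exact h
  | succ m => exact h.1

theorem memLp_of_continuous {φ : E d → ℂ} (hφ : Continuous φ) : MemLp φ 2 (cellVol a) := by
  have hb : Bornology.IsBounded (cell a) := ZSpan.fundamentalDomain_isBounded a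
  have hc : IsCompact (closure (cell a)) := hb.isCompact_closure
  obtain ⟨C, hC⟩ := hc.exists_bound_of_continuousOn hφ.continuousOn
  have : IsFiniteMeasure (cellVol a) := ⟨by
    rw [Measure.restrict_apply_univ]; exact hb.measure_lt_top⟩
  refine MemLp.of_bound hφ.aestronglyMeasurable C ?_
  refine (ae_restrict_iff' (ZSpan.fundamentalDomain_measurableSet a)).2 (ae_of_all _ ?_)
  intro x hx
  exact hC x (subset_closure hx)

theorem integrable_mul_cont {u φ : E d → ℂ} (hu : MemLp u 2 (cellVol a)) (hφ : Continuous φ) :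
    Integrable (fun x => u x * φ x) (cellVol a) :=
  MemLp.integrable_mul hu (memLp_of_continuous hφ)

theorem continuous_dir {φ : E d → ℂ} (hφ : ContDiff ℝ ∞ φ) (v : E d) :
    Continuous fun x => fderiv ℝ φ x v :=
  (hφ.continuous_fderiv (by simp)).clm_apply continuous_const

theorem IsWeakDeriv.congr {v : E d} {u u' g g' : E d → ℂ} (h : IsWeakDeriv a v u g)
    (hu : u =ᵐ[cellVol a] u') (hg : g =ᵐ[cellVol a] g') : IsWeakDeriv a v u' g' := by
  intro φ h1 h2
  have e1 : ∫ x, u x * fderiv ℝ φ x v ∂(cellVol a) = ∫ x, u' x * fderiv ℝ φ x v ∂(cellVol a) :=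
    integral_congr_ae (hu.mul (ae_eq_refl (fun x => fderiv ℝ φ x v)))
  have e2 : ∫ x, g x * φ x ∂(cellVol a) = ∫ x, g' x * φ x ∂(cellVol a) :=
    integral_congr_ae (hg.mul (ae_eq_refl φ))
  rw [← e1, ← e2]
  exact h φ h1 h2

theorem IsWeakDeriv.add {v : E d} {u u' g g' : E d → ℂ} (h : IsWeakDeriv a v u g)
    (h' : IsWeakDeriv a v u' g') (hu : MemLp u 2 (cellVol a)) (hu' : MemLp u' 2 (cellVol a))
    (hg : MemLp g 2 (cellVol a)) (hg' : MemLp g' 2 (cellVol a)) :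
    IsWeakDeriv a v (u + u') (g + g') := by
  intro φ h1 h2
  have c1 := continuous_dir h1 v
  have c2 := h1.continuous
  simp only [Pi.add_apply, add_mul]
  rw [integral_add (integrable_mul_cont hu c1) (integrable_mul_cont hu' c1),
    integral_add (integrable_mul_cont hg c2) (integrable_mul_cont hg' c2), h φ h1 h2, h' φ h1 h2]
  ring

theorem IsWeakDeriv.smul {v : E d} {u g : E d → ℂ} (c : ℂ) (h : IsWeakDeriv a v u g) :
    IsWeakDeriv a v (c • u) (c • g) := by
  intro φ h1 h2
  simp only [Pi.smul_apply, smul_eq_mul, mul_assoc, integral_const_mul]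
  rw [h φ h1 h2]
  ring

theorem isWeakDeriv_zero (v : E d) : IsWeakDeriv a v 0 0 := by
  intro φ _ _
  simp

theorem MemHper.congr {m : ℕ} {u u' : E d → ℂ} (h : MemHper a m u)
    (hu : u =ᵐ[cellVol a] u') : MemHper a m u' := by
  cases m with
  | zero => exact (memLp_congr_ae hu).1 h
  | succ m =>
    refine ⟨(memLp_congr_ae hu).1 h.1, fun v => ?_⟩
    obtain ⟨g, hg, hg'⟩ := h.2 v
    exact ⟨g, hg.congr hu (ae_eq_refl _), hg'⟩

theorem MemHper.add {m : ℕ} : ∀ {u u' : E d → ℂ}, MemHper a m u → MemHper a m u' →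
    MemHper a m (u + u') := by
  induction m with
  | zero => intro u u' h h'; exact MemLp.add h h'
  | succ m ih =>
    intro u u' h h'
    refine ⟨h.1.add h'.1, fun v => ?_⟩
    obtain ⟨g, hg, hg1⟩ := h.2 v
    obtain ⟨g', hg', hg1'⟩ := h'.2 v
    exact ⟨g + g', hg.add hg' h.1 h'.1 hg1.memLp hg1'.memLp, ih hg1 hg1'⟩

theorem MemHper.smul {m : ℕ} (c : ℂ) : ∀ {u : E d → ℂ}, MemHper a m u →
    MemHper a m (c • u) := by
  induction m with
  | zero => intro u h; exact MemLp.const_smul h c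
  | succ m ih =>
    intro u h
    refine ⟨h.1.const_smul c, fun v => ?_⟩
    obtain ⟨g, hg, hg1⟩ := h.2 v
    exact ⟨c • g, hg.smul c, ih hg1⟩

theorem memHper_zero (m : ℕ) : MemHper a m 0 := by
  induction m with
  | zero => exact MemLp.zero
  | succ m ih => exact ⟨MemLp.zero, fun v => ⟨0, isWeakDeriv_zero v, ih⟩⟩

end Helpers

/-! ### The Bloch Hamiltonians -/

/-- The graph of the operator `(-i∇ + k + 𝒜) · v` on `L²_per`. -/
def kinGraph (a : Module.Basis (Fin d) ℝ (E d)) (A : E d → E d) (k v : E d) :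
    Submodule ℂ (L2per a × L2per a) where
  carrier := {p | ∃ g : L2per a, IsWeakDeriv a v p.1 g ∧
    p.2 =ᵐ[cellVol a] fun x => -Complex.I * g x + ((⟪k + A x, v⟫_ℝ : ℝ) : ℂ) * p.1 x}
  add_mem' := by
    rintro ⟨u, f⟩ ⟨u', f'⟩ ⟨g, hg, hf⟩ ⟨g', hg', hf'⟩
    refine ⟨g + g', ?_, ?_⟩
    · exact (hg.add hg' (Lp.memLp _) (Lp.memLp _) (Lp.memLp _) (Lp.memLp _)).congr
        (Lp.coeFn_add u u').symm (Lp.coeFn_add g g').symm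
    · filter_upwards [hf, hf', Lp.coeFn_add u u', Lp.coeFn_add g g', Lp.coeFn_add f f']
        with x h1 h2 h3 h4 h5
      simp only [Prod.mk_add_mk, Pi.add_apply] at *
      rw [h3, h4, h5, h1, h2]
      ring
  zero_mem' := by
    refine ⟨0, ?_, ?_⟩
    · exact (isWeakDeriv_zero v).congr (Lp.coeFn_zero ℂ 2 _).symm (Lp.coeFn_zero ℂ 2 _).symm
    · filter_upwards [Lp.coeFn_zero ℂ 2 (cellVol a)] with x h
      simp only [Prod.fst_zero, Prod.snd_zero, h, Pi.zero_apply]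
      ring
  smul_mem' := by
    rintro c ⟨u, f⟩ ⟨g, hg, hf⟩
    refine ⟨c • g, ?_, ?_⟩
    · exact (hg.smul c).congr (Lp.coeFn_smul c u).symm (Lp.coeFn_smul c g).symm
    · filter_upwards [hf, Lp.coeFn_smul c u, Lp.coeFn_smul c g, Lp.coeFn_smul c f]
        with x h1 h3 h4 h5
      simp only [Prod.smul_mk, Pi.smul_apply, smul_eq_mul] at *
      rw [h3, h4, h5, h1]
      ring

/-- The directional derivative `∂_v H_k = (-i∇ + k + 𝒜) · v` of the Bloch Hamiltonian with respect to
`k`. -/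
def dHam (a : Module.Basis (Fin d) ℝ (E d)) (A : E d → E d) (k v : E d) :
    L2per a →ₗ.[ℂ] L2per a :=
  (kinGraph a A k v).toLinearPMap

/-- The graph of the operator `½ (-i∇ + k + 𝒜)² + V` with domain `H²_per`: here
`w j = (-i∂ⱼ + kⱼ + 𝒜ⱼ) u` and `z j = (-i∂ⱼ + kⱼ + 𝒜ⱼ) (w j)`. -/
def hamGraph (a : Module.Basis (Fin d) ℝ (E d)) (A : E d → E d) (V : E d → ℝ) (k : E d) :
    Submodule ℂ (L2per a × L2per a) where
  carrier := {p | MemHper a 2 p.1 ∧ ∃ w z : Fin d → L2per a,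
    (∀ j, (p.1, w j) ∈ kinGraph a A k (EuclideanSpace.single j 1)) ∧
    (∀ j, (w j, z j) ∈ kinGraph a A k (EuclideanSpace.single j 1)) ∧
    p.2 =ᵐ[cellVol a] fun x => (1 / 2 : ℂ) * (∑ j, z j : L2per a) x + (V x : ℂ) * p.1 x}
  add_mem' := by
    rintro ⟨u, f⟩ ⟨u', f'⟩ ⟨hu, w, z, hw, hz, hf⟩ ⟨hu', w', z', hw', hz', hf'⟩
    refine ⟨(hu.add hu').congr (Lp.coeFn_add u u').symm, w + w', z + z',
      fun j => add_mem (hw j) (hw' j), fun j => add_mem (hz j) (hz' j), ?_⟩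
    have hs : (∑ j, (z + z') j : L2per a) = (∑ j, z j) + ∑ j, z' j := by
      simp [Finset.sum_add_distrib]
    rw [hs]
    filter_upwards [hf, hf', Lp.coeFn_add u u', Lp.coeFn_add f f',
      Lp.coeFn_add (∑ j, z j) (∑ j, z' j)] with x h1 h2 h3 h4 h5
    simp only [Prod.mk_add_mk, Pi.add_apply] at *
    rw [h3, h4, h5, h1, h2]
    ring
  zero_mem' := by
    refine ⟨(memHper_zero 2).congr (Lp.coeFn_zero ℂ 2 _).symm, 0, 0,
      fun j => zero_mem _, fun j => zero_mem _, ?_⟩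
    have hs : (∑ j, (0 : Fin d → L2per a) j) = 0 := by simp
    rw [hs]
    filter_upwards [Lp.coeFn_zero ℂ 2 (cellVol a)] with x h
    simp only [Prod.fst_zero, Prod.snd_zero, h, Pi.zero_apply]
    ring
  smul_mem' := by
    rintro c ⟨u, f⟩ ⟨hu, w, z, hw, hz, hf⟩
    refine ⟨(hu.smul c).congr (Lp.coeFn_smul c u).symm, c • w, c • z,
      fun j => Submodule.smul_mem _ c (hw j), fun j => Submodule.smul_mem _ c (hz j), ?_⟩
    have hs : (∑ j, (c • z) j : L2per a) = c • ∑ j, z j := by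
      simp [Finset.smul_sum]
    rw [hs]
    filter_upwards [hf, Lp.coeFn_smul c u, Lp.coeFn_smul c f, Lp.coeFn_smul c (∑ j, z j)]
      with x h1 h3 h4 h5
    simp only [Prod.smul_mk, Pi.smul_apply, smul_eq_mul] at *
    rw [h3, h4, h5, h1]
    ring

/-- The Bloch Hamiltonian `H_k = ½ (-i∇ + k + 𝒜)² + V`. -/
def ham (a : Module.Basis (Fin d) ℝ (E d)) (A : E d → E d) (V : E d → ℝ) (k : E d) :
    L2per a →ₗ.[ℂ] L2per a :=
  (hamGraph a A V k).toLinearPMap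

/-- `P_{N,k} = 𝟙(H_k ≤ λ_{N,k})`. -/
def bandProj (a : Module.Basis (Fin d) ℝ (E d)) (A : E d → E d) (V : E d → ℝ) (N : ℕ) (k : E d) :
    L2per a →L[ℂ] L2per a :=
  specProj (ham a A V k) (eigval (ham a A V k) N)

/-- The fiber `γ_k = 𝟙(H_k ≤ μ_F)` of the ground-state density matrix. -/
def densityMatrix (a : Module.Basis (Fin d) ℝ (E d)) (A : E d → E d) (V : E d → ℝ) (μF : ℝ)
    (k : E d) : L2per a →L[ℂ] L2per a :=
  specProj (ham a A V k) (μF : EReal)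

/-- `Tr (H_k P_{N,k})`. -/
def bandEnergy (a : Module.Basis (Fin d) ℝ (E d)) (A : E d → E d) (V : E d → ℝ) (N : ℕ) (k : E d) :
    ℂ :=
  tr (ham a A V k) (bandProj a A V N k)

end BlochTransport

end

open BlochTransport

/-!
The constant can be chosen independently of the gap because no step of the expansion divides by an
energy difference.

Write `u` for the solution of `i u' = H (k - ε s w) u` that starts at an eigenvector `φ` of `H k` with
eigenvalue `x ≤ μF`. Since `H (k - ε s w) = H k - ε s ∂H + ε² s² ‖w‖² / 2`, where `∂H` is the derivative
of `H` at `k` in the direction `w`, first-order perturbation theory suggests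
`u t ≈ exp (-i t x) (φ + ε χ)` with `χ = κ_t (H k - x) (∂H φ)` and
`κ_t (θ) = i ∫₀ᵗ s exp (-i (t - s) θ) ds`. The kernel satisfies `|κ_t| ≤ t²` uniformly in `θ`, so `χ` is
bounded without reference to the spectrum (`corrector`). The remaining error is an inhomogeneity of
order `ε²` in Duhamel's formula, which contains `∂H χ`. That vector is controlled because `∂H` maps the
domain of `H k` to its form domain, with a bound that is uniform in `k`, and functions of `H k` preserve
the form domain (`norm_grad_corrector_le`, `norm_orbit_sub_le`, `exists_orbit_expansion`).

Summing over the occupied states, the contributions of transitions between two occupied states cancel in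
pairs, because the conjugate of `κ_t (-θ)` is `-κ_t (θ)`. For an empty state of energy `y` the identity
`θ κ_t (θ) = t - i (exp (-i t θ) - 1) / θ` with `θ = y - x`, together with
`⟨y, ∂H x⟩ = -(y - x) ⟨y, (∂P) x⟩`, turns the first-order term into a multiple of `t ∂P`, which is the
second derivative of the band energy, and the term with the dephased partial inverse of the Liouvillian
(`sum_corrector`, `norm_current_sub_le`). The number of occupied states is bounded uniformly in `k` by a
Hilbert–Schmidt bound on the resolvent (`ncard_le`), and this gives `exists_linear_response`.

These arguments are carried out for a `RegularFamily`, a quadratic family of symmetric operators with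
common domain, compact resolvent and bounds that are uniform in the parameter. The smoothness of the
spectral projector near a level outside the spectrum is obtained without contour integrals: a rational
function of the resolvent is close to an involution, and its exact sign is a smooth function of it
(`eventually_contDiffAt_specProj`). If `μF` is an eigenvalue, the level is first raised into the gap
above it. Traces of nearby projectors are compared by conjugation with an intertwiner
(`hasTrace_conj`). The propagator is the limit of Galerkin approximations in an eigenbasis of `H k`, for
which `‖(H (k - t e) + c) u t‖` grows at most exponentially, uniformly in the truncation
(`exists_isOrbit`).

It remains to see that the Bloch Hamiltonians form a regular family. In the basis of plane waves the
kinetic energy is diagonal, and `∑ (‖ξ + k‖² / 2 + M)⁻²` over the dual lattice tends to zero as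
`M → ∞`, uniformly in `k`, because `d ≤ 3`. Hence the potentials are bounded by half of the shifted
kinetic energy (`exists_shift`), as operators and therefore also as quadratic forms, by logarithmic
convexity (`norm_inner_le_of_relBound`). The resolvent is a Neumann series, and the commutator of the
momentum with the vector potential gives the mapping property of the derivative (`regularFamily`). The
plane waves are complete by the theorem of Stone and Weierstrass, weak derivatives become multiplication
by wave vectors (`isWeakDeriv_iff`), and so the operators defined by weak derivatives are those of the
Fourier representation (`ham_eq_op`).
-/
noncomputable section

set_option linter.unusedSectionVars false

namespace BlochTransport

/-! ### Diagonal operators with respect to a Hilbert basis -/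

section Diagonal

variable {ι : Type*} {H : Type*} [NormedAddCommGroup H] [InnerProductSpace ℂ H]

theorem hilbertBasis_ext (b : HilbertBasis ι ℂ H) {x y : H} (h : ∀ i, ⟪b i, x⟫_ℂ = ⟪b i, y⟫_ℂ) :
    x = y := by
  apply b.repr.injective
  ext i
  simpa [HilbertBasis.repr_apply_apply] using h i

theorem hilbertBasis_clm_ext {F : Type*} [NormedAddCommGroup F] [NormedSpace ℂ F]
    (b : HilbertBasis ι ℂ H) {S T : H →L[ℂ] F} (h : ∀ i, S (b i) = T (b i)) : S = T := by
  refine ContinuousLinearMap.ext_on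
    (Submodule.dense_iff_topologicalClosure_eq_top.2 b.dense_span) ?_
  rintro _ ⟨i, rfl⟩
  exact h i

theorem hasSum_norm_sq_inner (b : HilbertBasis ι ℂ H) (u : H) :
    HasSum (fun i => ‖⟪b i, u⟫_ℂ‖ ^ 2) (‖u‖ ^ 2) := by
  have h := b.hasSum_inner_mul_inner u u
  have h2 := Complex.reCLM.hasSum h
  convert h2 using 1
  · ext i
    simp only [Complex.reCLM_apply]
    rw [← inner_conj_symm u (b i), mul_comm, Complex.mul_conj, Complex.ofReal_re,
      Complex.normSq_eq_norm_sq]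
  · rw [inner_self_eq_norm_sq_to_K]
    norm_cast

theorem memℓp_diag (b : HilbertBasis ι ℂ H) {m : ι → ℂ} {K : ℝ} (hm : ∀ i, ‖m i‖ ≤ K) (u : H) :
    Memℓp (fun i => m i * ⟪b i, u⟫_ℂ) 2 := by
  rw [memℓp_gen_iff (by norm_num)]
  have h := (hasSum_norm_sq_inner b u).summable.mul_left (K ^ 2)
  refine Summable.of_nonneg_of_le (fun i => by positivity) (fun i => ?_) h
  simp only [ENNReal.toReal_ofNat, Real.rpow_two, norm_mul, mul_pow]
  gcongr
  exact hm i

open Classical in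
/-- The bounded operator which is diagonal in the Hilbert basis `b`, with bounded eigenvalues `m i`;
it is `0` by convention if `m` is unbounded. -/
def diagOp (b : HilbertBasis ι ℂ H) (m : ι → ℂ) : H →L[ℂ] H :=
  if hm : ∃ K : ℝ, ∀ i, ‖m i‖ ≤ K then
    LinearMap.mkContinuous
      { toFun := fun u => b.repr.symm ⟨fun i => m i * ⟪b i, u⟫_ℂ, memℓp_diag b hm.choose_spec u⟩
        map_add' := fun u v => by
          rw [← map_add]
          congr 1
          ext i
          exact (congrArg (m i * ·) (inner_add_right _ _ _)).trans (mul_add _ _ _)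
        map_smul' := fun c u => by
          rw [RingHom.id_apply, ← map_smul]
          congr 1
          ext i
          exact (congrArg (m i * ·) (inner_smul_right _ _ _)).trans (mul_left_comm _ _ _) } hm.choose (by
        intro u
        by_cases hι : IsEmpty ι
        · have : u = 0 := hilbertBasis_ext b (fun i => hι.elim i)
          rw [this, norm_zero, mul_zero]
          simp only [LinearMap.coe_mk, AddHom.coe_mk, LinearIsometryEquiv.norm_map, inner_zero_right,
            mul_zero]
          exact (norm_eq_zero.2 (by ext i; rfl)).le
        rw [not_isEmpty_iff] at hι
        have hK : 0 ≤ hm.choose := (norm_nonneg _).trans (hm.choose_spec hι.some)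
        simp only [LinearMap.coe_mk, AddHom.coe_mk, LinearIsometryEquiv.norm_map]
        rw [← sq_le_sq₀ (norm_nonneg _) (by positivity), mul_pow]
        have h1 := lp.hasSum_norm (p := 2) (by norm_num) (⟨fun i => m i * ⟪b i, u⟫_ℂ,
          memℓp_diag b hm.choose_spec u⟩ : lp (fun _ : ι => ℂ) 2)
        simp only [ENNReal.toReal_ofNat, Real.rpow_two] at h1
        refine hasSum_le (fun i => ?_) h1 ((hasSum_norm_sq_inner b u).mul_left (hm.choose ^ 2))
        simp only [norm_mul, mul_pow]
        gcongr
        exact hm.choose_spec i)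
  else 0

variable (b : HilbertBasis ι ℂ H) {m m' : ι → ℂ}

theorem inner_diagOp (hm : ∃ K : ℝ, ∀ i, ‖m i‖ ≤ K) (u : H) (i : ι) :
    ⟪b i, diagOp b m u⟫_ℂ = m i * ⟪b i, u⟫_ℂ := by
  rw [diagOp, dif_pos hm, ← HilbertBasis.repr_apply_apply]
  simp

theorem diagOp_apply_self (hm : ∃ K : ℝ, ∀ i, ‖m i‖ ≤ K) (i : ι) :
    diagOp b m (b i) = m i • b i := by
  classical
  refine hilbertBasis_ext b fun j => ?_
  rw [inner_diagOp b hm, inner_smul_right, orthonormal_iff_ite.1 b.orthonormal]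
  split_ifs with h
  · rw [h]
  · simp

theorem eq_diagOp (hm : ∃ K : ℝ, ∀ i, ‖m i‖ ≤ K) {T : H →L[ℂ] H} (h : ∀ i, T (b i) = m i • b i) :
    T = diagOp b m :=
  hilbertBasis_clm_ext b fun i => by rw [h, diagOp_apply_self b hm]

theorem norm_diagOp_apply_le {K : ℝ} (hK : 0 ≤ K) (hm : ∀ i, ‖m i‖ ≤ K) (u : H) :
    ‖diagOp b m u‖ ≤ K * ‖u‖ := by
  rw [← sq_le_sq₀ (norm_nonneg _) (by positivity), mul_pow]
  refine hasSum_le (fun i => ?_) (hasSum_norm_sq_inner b (diagOp b m u))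
    ((hasSum_norm_sq_inner b u).mul_left (K ^ 2))
  rw [inner_diagOp b ⟨K, hm⟩, norm_mul, mul_pow]
  gcongr
  exact hm i

theorem norm_diagOp_le {K : ℝ} (hK : 0 ≤ K) (hm : ∀ i, ‖m i‖ ≤ K) : ‖diagOp b m‖ ≤ K :=
  ContinuousLinearMap.opNorm_le_bound _ hK (norm_diagOp_apply_le b hK hm)

theorem hasSum_diagOp (hm : ∃ K : ℝ, ∀ i, ‖m i‖ ≤ K) (u : H) :
    HasSum (fun i => (m i * ⟪b i, u⟫_ℂ) • b i) (diagOp b m u) := by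
  have h := b.hasSum_repr (diagOp b m u)
  simpa only [HilbertBasis.repr_apply_apply, inner_diagOp b hm] using h

theorem hasSum_inner_smul (u : H) : HasSum (fun i => ⟪b i, u⟫_ℂ • b i) u := by
  simpa only [HilbertBasis.repr_apply_apply] using b.hasSum_repr u

theorem diagOp_symm (hm : ∃ K : ℝ, ∀ i, ‖m i‖ ≤ K) (u v : H) :
    ⟪diagOp b m u, v⟫_ℂ = ⟪u, diagOp b (fun i => (starRingEnd ℂ) (m i)) v⟫_ℂ := by
  have hm' : ∃ K : ℝ, ∀ i, ‖(starRingEnd ℂ) (m i)‖ ≤ K := by simpa using hm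
  rw [← (b.hasSum_inner_mul_inner (diagOp b m u) v).tsum_eq,
    ← (b.hasSum_inner_mul_inner u _).tsum_eq]
  congr 1
  ext i
  rw [inner_diagOp b hm', ← inner_conj_symm, inner_diagOp b hm, map_mul, inner_conj_symm]
  ring

end Diagonal

/-! ### Finite rank operators and their traces -/

section FiniteRank

variable {ι : Type*} {H : Type*} [NormedAddCommGroup H] [InnerProductSpace ℂ H] [CompleteSpace H]

theorem norm_abs_apply (T : H →L[ℂ] H) (u : H) : ‖CFC.abs T u‖ = ‖T u‖ := by
  have h1 : IsSelfAdjoint (CFC.abs T) := CFC.abs_nonneg T |>.isSelfAdjoint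
  have h : ⟪CFC.abs T u, CFC.abs T u⟫_ℂ = ⟪T u, T u⟫_ℂ := by
    have e : (CFC.abs T * CFC.abs T) u = (star T * T) u := by rw [CFC.abs_mul_abs]
    have e2 : ⟪CFC.abs T u, CFC.abs T u⟫_ℂ = ⟪u, (CFC.abs T * CFC.abs T) u⟫_ℂ := by
      rw [mul_apply_eq_comp]
      nth_rewrite 1 [← h1.star_eq]
      rw [ContinuousLinearMap.star_eq_adjoint, ContinuousLinearMap.adjoint_inner_left]
    rw [e2, e, mul_apply_eq_comp, ContinuousLinearMap.star_eq_adjoint,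
      ContinuousLinearMap.adjoint_inner_right]
  rw [inner_self_eq_norm_sq_to_K, inner_self_eq_norm_sq_to_K] at h
  have h' : ‖CFC.abs T u‖ ^ 2 = ‖T u‖ ^ 2 := by exact_mod_cast h
  exact (sq_eq_sq₀ (norm_nonneg _) (norm_nonneg _)).1 h'

theorem isTraceClass_of_finite_rank {s : Finset ι} {x y : ι → H} {T : H →L[ℂ] H}
    (hT : ∀ u, T u = ∑ i ∈ s, ⟪y i, u⟫_ℂ • x i) : IsTraceClass T := by
  intro S b
  let W : Submodule ℂ H := Submodule.span ℂ (y '' s)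
  have : FiniteDimensional ℂ W := FiniteDimensional.span_of_finite ℂ ((s.finite_toSet).image y)
  let w := stdOrthonormalBasis ℂ W
  -- `|T|` vanishes on the orthogonal complement of `W`
  have hker : ∀ u ∈ Wᗮ, CFC.abs T u = 0 := by
    intro u hu
    rw [← norm_eq_zero, norm_abs_apply, hT, Finset.sum_eq_zero, norm_zero]
    intro i hi
    have : ⟪y i, u⟫_ℂ = 0 := hu _ (Submodule.subset_span ⟨i, hi, rfl⟩)
    rw [this, zero_smul]
  have habs : ∀ u, CFC.abs T u = ∑ l, ⟪(w l : H), u⟫_ℂ • CFC.abs T (w l) := by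
    intro u
    have h1 : u = W.starProjection u + (u - W.starProjection u) := by abel
    have h2 : W.starProjection u = ∑ l, ⟪(w l : H), u⟫_ℂ • (w l : H) := by
      simpa using w.orthogonalProjectionOnto_apply_eq_sum u
        |> congrArg (Subtype.val)
    conv_lhs => rw [h1]
    rw [map_add, hker _ (W.sub_starProjection_mem_orthogonal u), add_zero, h2, map_sum]
    simp
  have hsum : Summable fun i => ∑ l, ⟪(w l : H), b i⟫_ℂ * ⟪b i, CFC.abs T (w l)⟫_ℂ :=
    summable_sum fun l _ => b.summable_inner_mul_inner _ _
  have := (Complex.reCLM.summable hsum)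
  refine this.congr fun i => ?_
  simp only [Complex.reCLM_apply]
  rw [habs (b i), inner_sum]
  simp [inner_smul_right]

theorem hasSum_trace_of_finite_rank {κ : Type*} {s : Finset ι} {x y : ι → H} {T : H →L[ℂ] H}
    (hT : ∀ u, T u = ∑ i ∈ s, ⟪y i, u⟫_ℂ • x i) (b : HilbertBasis κ ℂ H) :
    HasSum (fun j => ⟪b j, T (b j)⟫_ℂ) (∑ i ∈ s, ⟪y i, x i⟫_ℂ) := by
  have h : HasSum (fun j => ∑ i ∈ s, ⟪y i, b j⟫_ℂ * ⟪b j, x i⟫_ℂ) (∑ i ∈ s, ⟪y i, x i⟫_ℂ) :=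
    hasSum_sum fun i _ => b.hasSum_inner_mul_inner _ _
  convert h using 1
  ext j
  rw [hT, inner_sum]
  simp [inner_smul_right]

/-- A finite rank operator `T = A X` has trace `∑ᵢ ⟪yᵢ, xᵢ⟫` if `T = ∑ᵢ ⟪yᵢ, ·⟫ xᵢ`. -/
theorem hasTrace_of_finite_rank {A : H →ₗ.[ℂ] H} {X T : H →L[ℂ] H} {s : Finset ι} {x y : ι → H}
    (hg : ∀ u, (X u, T u) ∈ A.graph) (hT : ∀ u, T u = ∑ i ∈ s, ⟪y i, u⟫_ℂ • x i) :
    HasTrace A X (∑ i ∈ s, ⟪y i, x i⟫_ℂ) :=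
  ⟨T, hg, isTraceClass_of_finite_rank hT, fun _ b => hasSum_trace_of_finite_rank hT b⟩

theorem HasTrace.unique {A : H →ₗ.[ℂ] H} {X : H →L[ℂ] H} {τ τ' : ℂ} (h : HasTrace A X τ)
    (h' : HasTrace A X τ') : τ = τ' := by
  obtain ⟨T, hg, -, hs⟩ := h
  obtain ⟨T', hg', -, hs'⟩ := h'
  obtain ⟨w, b, -⟩ := exists_hilbertBasis ℂ H
  have : T = T' := ContinuousLinearMap.ext fun u => A.mem_graph_snd_inj (hg u) (hg' u) rfl
  subst this
  exact (hs w b).unique (hs' w b)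

theorem HasTrace.tr_eq {A : H →ₗ.[ℂ] H} {X : H →L[ℂ] H} {τ : ℂ} (h : HasTrace A X τ) :
    tr A X = τ := by
  have hex : ∃ τ, HasTrace A X τ := ⟨τ, h⟩
  rw [tr, dif_pos hex]
  exact hex.choose_spec.unique h

end FiniteRank

/-! ### Eigenbases of compact self-adjoint operators -/

section Compact

universe u

variable {H : Type u} [NormedAddCommGroup H] [InnerProductSpace ℂ H] [CompleteSpace H]

theorem exists_eigenbasis {T : H →L[ℂ] H} (hc : IsCompactOperator T)
    (hs : (T : H →ₗ[ℂ] H).IsSymmetric) :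
    ∃ (ι : Type u) (b : HilbertBasis ι ℂ H) (m : ι → ℂ), ∀ i, T (b i) = m i • b i := by
  let V : ℂ → Submodule ℂ H := fun μ => Module.End.eigenspace (T : H →ₗ[ℂ] H) μ
  have hV : OrthogonalFamily ℂ (fun μ => V μ) fun μ => (V μ).subtypeₗᵢ :=
    hs.orthogonalFamily_eigenspaces
  have hcl : ∀ μ, IsClosed (V μ : Set H) := by
    intro μ
    have : (V μ : Set H) = {x | T x = μ • x} := by
      ext x; simp [V]
    rw [this]
    exact isClosed_eq T.continuous (continuous_const_smul μ)
  have : ∀ μ, CompleteSpace (V μ) := fun μ => (hcl μ).completeSpace_coe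
  choose w b hb using fun μ => exists_hilbertBasis ℂ (V μ)
  have hon : Orthonormal ℂ (fun a : Σ μ, w μ => ((b a.1 a.2 : V a.1) : H)) :=
    hV.orthonormal_sigma_orthonormal (v_family := fun μ => b μ)
    (fun μ => (b μ).orthonormal)
  have hbot : (Submodule.span ℂ (Set.range fun a : Σ μ, w μ => ((b a.1 a.2 : V a.1) : H)))ᗮ = ⊥ := by
    rw [eq_bot_iff]
    intro x hx
    have h1 : x ∈ (⨆ μ, V μ)ᗮ := by
      rw [← Submodule.iInf_orthogonal, Submodule.mem_iInf]
      intro μ v hv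
      have hv' := (b μ).hasSum_repr ⟨v, hv⟩
      have h2 := (V μ).subtypeL.hasSum hv'
      have h3 := h2.mapL ((innerSL ℂ x))
      have h4 : ⟪x, v⟫_ℂ = 0 := by
        refine h3.unique ?_
        convert hasSum_zero with i
        have : ⟪((b μ i : V μ) : H), x⟫_ℂ = 0 := hx _ (Submodule.subset_span ⟨⟨μ, i⟩, rfl⟩)
        have h5 : ⟪x, ((b μ i : V μ) : H)⟫_ℂ = 0 := by rw [← inner_conj_symm, this, map_zero]
        simp [h5]
      rw [← inner_conj_symm, h4, map_zero]
    rw [T.orthogonalComplement_iSup_eigenspaces_eq_bot hc hs] at h1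
    exact h1
  refine ⟨(Σ μ, w μ), HilbertBasis.mkOfOrthogonalEqBot hon hbot, fun a => a.1, fun a => ?_⟩
  rw [HilbertBasis.coe_mkOfOrthogonalEqBot]
  exact Module.End.mem_eigenspace_iff.1 (b a.1 a.2).2

end Compact

/-! ### Functional calculus and counting of eigenvalues in an eigenbasis -/

section Eigenbasis

universe u

variable {ι : Type*} {H : Type u} [NormedAddCommGroup H] [InnerProductSpace ℂ H] [CompleteSpace H]

theorem mem_eigenspace_iff {A : H →ₗ.[ℂ] H} {x : ℝ} {u : H} :
    u ∈ eigenspace A x ↔ (u, (x : ℂ) • u) ∈ A.graph := Iff.rfl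

/-- The symmetric operator `A` has the orthonormal eigenbasis `b`, with eigenvalues `ev i` that
accumulate only at `+∞`. -/
structure IsEigenbasis (A : H →ₗ.[ℂ] H) (b : HilbertBasis ι ℂ H) (ev : ι → ℝ) : Prop where
  symm : ∀ {u f v g : H}, (u, f) ∈ A.graph → (v, g) ∈ A.graph → ⟪f, v⟫_ℂ = ⟪u, g⟫_ℂ
  mem : ∀ i, (b i, (ev i : ℂ) • b i) ∈ A.graph
  finite : ∀ x, {i | ev i ≤ x}.Finite

variable {A : H →ₗ.[ℂ] H} {b : HilbertBasis ι ℂ H} {ev : ι → ℝ}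

namespace IsEigenbasis

theorem inner_graph (h : IsEigenbasis A b ev) {u f : H} (hu : (u, f) ∈ A.graph) (i : ι) :
    ⟪b i, f⟫_ℂ = ev i * ⟪b i, u⟫_ℂ := by
  rw [← h.symm (h.mem i) hu, inner_smul_left, Complex.conj_ofReal]

theorem inner_eq_zero (h : IsEigenbasis A b ev) {x : ℝ} {u : H} (hu : u ∈ eigenspace A x) {i : ι} (hi : ev i ≠ x) :
    ⟪b i, u⟫_ℂ = 0 := by
  have h1 := h.inner_graph (mem_eigenspace_iff.1 hu) i
  rw [inner_smul_right] at h1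
  have h2 : ((x : ℂ) - ev i) * ⟪b i, u⟫_ℂ = 0 := by rw [sub_mul, h1, sub_self]
  rcases mul_eq_zero.1 h2 with h3 | h3
  · exact absurd (by exact_mod_cast (sub_eq_zero.1 h3).symm) hi
  · exact h3

theorem eigenproj_basis (h : IsEigenbasis A b ev) (x : ℝ) (i : ι) [Decidable (ev i = x)] :
    eigenproj A x (b i) = if ev i = x then b i else 0 := by
  rw [eigenproj]
  split_ifs with hi
  · rw [Submodule.starProjection_eq_self_iff]
    exact Submodule.le_topologicalClosure _ (by rw [← hi]; exact h.mem i)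
  · rw [Submodule.starProjection_apply_eq_zero_iff, Submodule.orthogonal_closure]
    intro u hu
    rw [← inner_conj_symm, h.inner_eq_zero hu hi, map_zero]

theorem hasSum_specFun (h : IsEigenbasis A b ev) {f : ℝ → ℂ} (hf : ∃ K : ℝ, ∀ i, ‖f (ev i)‖ ≤ K) (u : H) :
    HasSum (fun x : ℝ => f x • eigenproj A x u) (diagOp b (fun i => f (ev i)) u) := by
  classical
  have h1 := hasSum_diagOp b hf u
  rw [← (Equiv.sigmaFiberEquiv ev).hasSum_iff] at h1
  refine HasSum.sigma h1 fun x => ?_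
  have h2 := ((eigenproj A x).hasSum (hasSum_inner_smul b u)).const_smul (f x)
  have h3 : ∀ i, i ∉ Set.range (fun c : {i // ev i = x} => (c : ι)) →
      f x • (eigenproj A x) (⟪b i, u⟫_ℂ • b i) = 0 := by
    intro i hi
    have : ev i ≠ x := fun e => hi ⟨⟨i, e⟩, rfl⟩
    rw [map_smul, h.eigenproj_basis, if_neg this, smul_zero, smul_zero]
  have h4 := (Function.Injective.hasSum_iff (f := fun i =>
    f x • (eigenproj A x) (⟪b i, u⟫_ℂ • b i)) Subtype.val_injective h3).2 h2
  convert h4 using 1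
  ext ⟨i, hi⟩
  simp only [Function.comp, Equiv.sigmaFiberEquiv_apply]
  rw [map_smul, h.eigenproj_basis, if_pos hi, hi, smul_smul]

theorem specFun_eq (h : IsEigenbasis A b ev) {f : ℝ → ℂ} (hf : ∃ K : ℝ, ∀ i, ‖f (ev i)‖ ≤ K) :
    specFun A f = diagOp b fun i => f (ev i) := by
  have hex : ∃ T : H →L[ℂ] H, ∀ u : H, HasSum (fun x : ℝ => f x • eigenproj A x u) (T u) :=
    ⟨_, h.hasSum_specFun hf⟩
  rw [specFun, dif_pos hex]
  exact ContinuousLinearMap.ext fun u => (hex.choose_spec u).unique (h.hasSum_specFun hf u)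

theorem expGroup_eq (h : IsEigenbasis A b ev) (t : ℝ) :
    expGroup A t = diagOp b fun i => Complex.exp (-(Complex.I * t * ev i)) := by
  refine h.specFun_eq ⟨1, fun i => ?_⟩
  rw [show -(Complex.I * t * ev i) = ((-(t * ev i) : ℝ) : ℂ) * Complex.I by push_cast; ring,
    Complex.norm_exp_ofReal_mul_I]

theorem specProj_eq (h : IsEigenbasis A b ev) (c : EReal) [∀ i, Decidable ((ev i : EReal) ≤ c)] :
    specProj A c = diagOp b fun i => if (ev i : EReal) ≤ c then 1 else 0 := by
  rw [specProj, h.specFun_eq]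
  · congr 1
    ext i
    simp [Set.indicator_apply]
  · refine ⟨1, fun i => ?_⟩
    by_cases hi : (ev i : EReal) ≤ c <;> simp [hi]

theorem iSup_eigenspace (h : IsEigenbasis A b ev) (x : ℝ) :
    (⨆ y : ℝ, ⨆ _ : y ≤ x, eigenspace A y) =
      Submodule.span ℂ (Set.range fun i : {i | ev i ≤ x} => b i) := by
  apply le_antisymm
  · refine iSup₂_le fun y hy u hu => ?_
    have h1 := hasSum_inner_smul b u
    have h2 := hasSum_sum_of_ne_finset_zero (L := .unconditional ι) (f := fun i => ⟪b i, u⟫_ℂ • b i)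
      (s := (h.finite x).toFinset) (fun i hi => by
        rw [h.inner_eq_zero hu, zero_smul]
        rintro rfl
        exact hi (by simpa using hy))
    rw [h1.unique h2]
    refine Submodule.sum_mem _ fun i hi => Submodule.smul_mem _ _ (Submodule.subset_span ?_)
    exact ⟨⟨i, by simpa using hi⟩, rfl⟩
  · rw [Submodule.span_le]
    rintro _ ⟨⟨i, hi⟩, rfl⟩
    exact Submodule.mem_iSup_of_mem (ev i) (Submodule.mem_iSup_of_mem hi (h.mem i))

theorem natCast_le_rank_iff (h : IsEigenbasis A b ev) (x : ℝ) (n : ℕ) :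
    (n : Cardinal) ≤ Module.rank ℂ ↥(⨆ y : ℝ, ⨆ _ : y ≤ x, eigenspace A y) ↔
      n ≤ {i | ev i ≤ x}.ncard := by
  have hli : LinearIndependent ℂ (fun i : {i | ev i ≤ x} => b i) :=
    b.orthonormal.linearIndependent.comp _ Subtype.val_injective
  rw [h.iSup_eigenspace, rank_span hli]
  have hfin := (h.finite x).to_subtype
  have hr : (Set.range fun i : {i | ev i ≤ x} => b i).Finite := Set.finite_range _
  rw [← Set.cast_ncard hr, Nat.cast_le, ← Set.image_univ, Set.ncard_image_of_injective _
    hli.injective, Set.ncard_univ, _root_.Nat.card_coe_set_eq]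

theorem exists_gap (h : IsEigenbasis A b ev) (x : ℝ) : ∃ y > x, ∀ i, ev i ≤ y → ev i ≤ x := by
  let s := ((h.finite (x + 1)).toFinset.filter fun i => x < ev i).image ev
  by_cases hs : s.Nonempty
  · have hm := s.min'_mem hs
    simp only [s, Finset.mem_image, Finset.mem_filter, Set.Finite.mem_toFinset,
      Set.mem_ofPred_eq] at hm
    obtain ⟨j, ⟨-, hj⟩, hj'⟩ := hm
    refine ⟨min (x + 1) ((x + s.min' hs) / 2), lt_min (by linarith) (by rw [← hj']; linarith),
      fun i hi => ?_⟩
    by_contra hx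
    rw [le_min_iff] at hi
    rw [not_le] at hx
    have : s.min' hs ≤ ev i := s.min'_le _ (by
      simp only [s, Finset.mem_image, Finset.mem_filter, Set.Finite.mem_toFinset,
        Set.mem_ofPred_eq]
      exact ⟨i, ⟨hi.1, hx⟩, rfl⟩)
    linarith [hi.2]
  · refine ⟨x + 1, by linarith, fun i hi => ?_⟩
    by_contra hx
    rw [not_le] at hx
    exact hs ⟨ev i, by
      simp only [s, Finset.mem_image, Finset.mem_filter, Set.Finite.mem_toFinset,
        Set.mem_ofPred_eq]
      exact ⟨i, ⟨hi, hx⟩, rfl⟩⟩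

theorem eigval_le_iff (h : IsEigenbasis A b ev) (n : ℕ) (x : ℝ) :
    eigval A n ≤ (x : EReal) ↔ n ≤ {i | ev i ≤ x}.ncard := by
  constructor
  · intro hle
    obtain ⟨y, hy, hgap⟩ := h.exists_gap x
    have hlt : eigval A n < (y : EReal) := hle.trans_lt (EReal.coe_lt_coe_iff.2 hy)
    obtain ⟨_, ⟨z, hz, rfl⟩, hzy⟩ := sInf_lt_iff.1 hlt
    have hz' := (h.natCast_le_rank_iff z n).1 hz
    refine hz'.trans (Set.ncard_le_ncard (fun i hi => hgap i ?_) (h.finite x))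
    exact le_trans hi (EReal.coe_lt_coe_iff.1 hzy).le
  · intro hn
    exact sInf_le ⟨x, (h.natCast_le_rank_iff x n).2 hn, rfl⟩

theorem numBelow_eq (h : IsEigenbasis A b ev) (μ : ℝ) : numBelow A μ = {i | ev i ≤ μ}.ncard := by
  have : {n : ℕ | 1 ≤ n ∧ eigval A n ≤ (μ : EReal)} =
      (Finset.Icc 1 {i | ev i ≤ μ}.ncard : Finset ℕ) := by
    ext n
    simp [h.eigval_le_iff]
  rw [numBelow, this, Set.ncard_coe_finset, Nat.card_Icc]
  omega

theorem le_eigval_iff (h : IsEigenbasis A b ev) {μ : ℝ} {N : ℕ} (hN : {i | ev i ≤ μ}.ncard = N) (i : ι) :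
    (ev i : EReal) ≤ eigval A N ↔ ev i ≤ μ := by
  constructor
  · intro hi
    exact EReal.coe_le_coe_iff.1 (hi.trans ((h.eigval_le_iff N μ).2 hN.ge))
  · intro hi
    by_contra hlt
    rw [not_le] at hlt
    obtain ⟨y, hy1, hy2⟩ := EReal.lt_iff_exists_real_btwn.1 hlt
    have h1 := (h.eigval_le_iff N y).1 hy1.le
    rw [EReal.coe_lt_coe_iff] at hy2
    have h2 : {i | ev i ≤ y}.ncard < {i | ev i ≤ μ}.ncard := by
      refine Set.ncard_lt_ncard ⟨fun j hj => le_trans hj (hy2.le.trans hi), fun hs => ?_⟩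
        (h.finite μ)
      exact absurd (hs hi) (not_le.2 hy2)
    omega

/-- The projector onto the `N` lowest bands is the spectral projector below any level `μ` that has
exactly `N` eigenvalues below it. -/
theorem specProj_eigval (h : IsEigenbasis A b ev) {μ : ℝ} {N : ℕ} (hN : {i | ev i ≤ μ}.ncard = N) :
    specProj A (eigval A N) = specProj A (μ : EReal) := by
  classical
  rw [h.specProj_eq, h.specProj_eq]
  congr 1
  ext i
  simp only [h.le_eigval_iff hN, EReal.coe_le_coe_iff]

theorem eigenspace_eq_bot_iff (h : IsEigenbasis A b ev) (x : ℝ) : eigenspace A x = ⊥ ↔ ∀ i, ev i ≠ x := by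
  constructor
  · rintro hbot i rfl
    have : b i ∈ eigenspace A (ev i) := h.mem i
    rw [hbot, Submodule.mem_bot] at this
    exact b.orthonormal.ne_zero i this
  · intro hne
    rw [eq_bot_iff]
    intro u hu
    rw [Submodule.mem_bot]
    exact hilbertBasis_ext b fun i => by rw [h.inner_eq_zero hu (hne i), inner_zero_right]

end IsEigenbasis

end Eigenbasis

/-! ### Quadratic families of self-adjoint operators -/

/-- A family `H k = H0 + P k + ‖k‖² / 2` of symmetric operators with a common domain `D`, quadratic in
the parameter `k ∈ E`. -/
structure QuadFamily (E 𝓗 : Type*) [NormedAddCommGroup E] [InnerProductSpace ℝ E]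
    [NormedAddCommGroup 𝓗] [InnerProductSpace ℂ 𝓗] where
  D : Submodule ℂ 𝓗
  H0 : D →ₗ[ℂ] 𝓗
  P : E → D →ₗ[ℂ] 𝓗
  P_add : ∀ v w u, P (v + w) u = P v u + P w u
  P_smul : ∀ (r : ℝ) v u, P (r • v) u = (r : ℂ) • P v u
  H0_symm : ∀ u v : D, ⟪H0 u, (v : 𝓗)⟫_ℂ = ⟪(u : 𝓗), H0 v⟫_ℂ
  P_symm : ∀ (w : E) (u v : D), ⟪P w u, (v : 𝓗)⟫_ℂ = ⟪(u : 𝓗), P w v⟫_ℂ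

namespace QuadFamily

variable {E 𝓗 : Type*} [NormedAddCommGroup E] [InnerProductSpace ℝ E]
  [NormedAddCommGroup 𝓗] [InnerProductSpace ℂ 𝓗] (F : QuadFamily E 𝓗)

/-- The operator `H k`. -/
def ham (k : E) : F.D →ₗ[ℂ] 𝓗 := F.H0 + F.P k + ((‖k‖ ^ 2 / 2 : ℝ) : ℂ) • F.D.subtype

/-- The derivative of the family at `k` in the direction `v`. -/
def grad (k v : E) : F.D →ₗ[ℂ] 𝓗 := F.P v + ((⟪k, v⟫_ℝ : ℝ) : ℂ) • F.D.subtype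

/-- The operator `H k` as a partially defined operator. -/
def op (k : E) : 𝓗 →ₗ.[ℂ] 𝓗 := ⟨F.D, F.ham k⟩

variable {F}

theorem ham_apply (k : E) (u : F.D) :
    F.ham k u = F.H0 u + F.P k u + ((‖k‖ ^ 2 / 2 : ℝ) : ℂ) • (u : 𝓗) := rfl

theorem grad_apply (k v : E) (u : F.D) :
    F.grad k v u = F.P v u + ((⟪k, v⟫_ℝ : ℝ) : ℂ) • (u : 𝓗) := rfl

theorem ham_add (k q : E) (u : F.D) :
    F.ham (k + q) u = F.ham k u + F.grad k q u + ((‖q‖ ^ 2 / 2 : ℝ) : ℂ) • (u : 𝓗) := by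
  rw [ham_apply, ham_apply, grad_apply, F.P_add, norm_add_sq_real,
    show (‖k‖ ^ 2 + 2 * ⟪k, q⟫_ℝ + ‖q‖ ^ 2) / 2 = ‖k‖ ^ 2 / 2 + ⟪k, q⟫_ℝ + ‖q‖ ^ 2 / 2 by ring]
  push_cast
  simp only [add_smul]
  abel

theorem grad_add_left (k q v : E) (u : F.D) :
    F.grad (k + q) v u = F.grad k v u + ((⟪q, v⟫_ℝ : ℝ) : ℂ) • (u : 𝓗) := by
  rw [grad_apply, grad_apply, inner_add_left]
  push_cast
  rw [add_smul, add_assoc]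

theorem grad_add (k v w : E) (u : F.D) : F.grad k (v + w) u = F.grad k v u + F.grad k w u := by
  rw [grad_apply, grad_apply, grad_apply, F.P_add, inner_add_right]
  push_cast
  rw [add_smul]
  abel

theorem grad_smul (k : E) (r : ℝ) (v : E) (u : F.D) :
    F.grad k (r • v) u = (r : ℂ) • F.grad k v u := by
  rw [grad_apply, grad_apply, F.P_smul, inner_smul_right, smul_add, smul_smul]
  push_cast
  rfl

theorem grad_symm (k w : E) (u v : F.D) :
    ⟪F.grad k w u, (v : 𝓗)⟫_ℂ = ⟪(u : 𝓗), F.grad k w v⟫_ℂ := by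
  simp only [grad_apply, inner_add_left, inner_add_right, F.P_symm, inner_smul_left,
    inner_smul_right, Complex.conj_ofReal]

theorem ham_symm (k : E) (u v : F.D) :
    ⟪F.ham k u, (v : 𝓗)⟫_ℂ = ⟪(u : 𝓗), F.ham k v⟫_ℂ := by
  simp only [ham_apply, inner_add_left, inner_add_right, F.P_symm, F.H0_symm, inner_smul_left,
    inner_smul_right, Complex.conj_ofReal]

theorem mem_graph_op {k : E} {u f : 𝓗} :
    (u, f) ∈ (F.op k).graph ↔ ∃ h : u ∈ F.D, F.ham k ⟨u, h⟩ = f := by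
  rw [LinearPMap.mem_graph_iff]
  constructor
  · rintro ⟨⟨y, hy⟩, rfl, rfl⟩
    exact ⟨hy, rfl⟩
  · rintro ⟨h, rfl⟩
    exact ⟨⟨u, h⟩, rfl, rfl⟩

theorem mem_graph_op_coe {k : E} (u : F.D) : ((u : 𝓗), F.ham k u) ∈ (F.op k).graph :=
  mem_graph_op.2 ⟨u.2, rfl⟩

end QuadFamily

/-- A quadratic family with compact resolvent, together with bounds that are uniform in the parameter:
`H k + c ≥ 1`, the derivatives of the family are controlled by the form of `H k + c`, and they map
the domain to the form domain. The operators `R k` are the inverses of `H k + c`. -/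
structure RegularFamily (E 𝓗 : Type*) [NormedAddCommGroup E] [InnerProductSpace ℝ E]
    [NormedAddCommGroup 𝓗] [InnerProductSpace ℂ 𝓗] extends QuadFamily E 𝓗 where
  c : ℝ
  R : E → 𝓗 →L[ℂ] 𝓗
  R_mem : ∀ k f, R k f ∈ D
  ham_R : ∀ k f, toQuadFamily.ham k ⟨R k f, R_mem k f⟩ + (c : ℂ) • R k f = f
  lower : ∀ k (u : D), ‖(u : 𝓗)‖ ^ 2 ≤ (⟪(u : 𝓗), toQuadFamily.ham k u + (c : ℂ) • (u : 𝓗)⟫_ℂ).re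
  C₁ : ℝ
  C₁_nonneg : 0 ≤ C₁
  form : ∀ k v (u : D), ‖toQuadFamily.grad k v u‖ ^ 2 ≤
    C₁ ^ 2 * ‖v‖ ^ 2 * (⟪(u : 𝓗), toQuadFamily.ham k u + (c : ℂ) • (u : 𝓗)⟫_ℂ).re
  C₂ : ℝ
  C₂_nonneg : 0 ≤ C₂
  reg : ∀ k v (u' u : D),
    ‖⟪toQuadFamily.grad k v u', toQuadFamily.ham k u + (c : ℂ) • (u : 𝓗)⟫_ℂ‖ ^ 2 ≤
      C₂ ^ 2 * ‖v‖ ^ 2 * ‖toQuadFamily.ham k u' + (c : ℂ) • (u' : 𝓗)‖ ^ 2 *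
        (⟪(u : 𝓗), toQuadFamily.ham k u + (c : ℂ) • (u : 𝓗)⟫_ℂ).re
  compact : ∀ k, IsCompactOperator (R k)
  K : ℝ
  hilbertSchmidt : ∀ k (n : ℕ) (φ : Fin n → 𝓗), Orthonormal ℂ φ → ∑ i, ‖R k (φ i)‖ ^ 2 ≤ K

namespace RegularFamily

open QuadFamily

variable {E 𝓗 : Type*} [NormedAddCommGroup E] [InnerProductSpace ℝ E]
  [NormedAddCommGroup 𝓗] [InnerProductSpace ℂ 𝓗] (F : RegularFamily E 𝓗)

/-- The operator `H k + c`. -/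
def lam (k : E) : F.D →ₗ[ℂ] 𝓗 := F.ham k + (F.c : ℂ) • F.D.subtype

/-- The resolvent `R k` as a map to the domain. -/
def Rd (k : E) : 𝓗 →ₗ[ℂ] F.D := (F.R k : 𝓗 →ₗ[ℂ] 𝓗).codRestrict F.D (F.R_mem k)

variable {F}

theorem lam_apply (k : E) (u : F.D) : F.lam k u = F.ham k u + (F.c : ℂ) • (u : 𝓗) := rfl

theorem coe_Rd (k : E) (f : 𝓗) : (F.Rd k f : 𝓗) = F.R k f := rfl

theorem ham_eq (k : E) (u : F.D) : F.ham k u = F.lam k u - (F.c : ℂ) • (u : 𝓗) := by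
  rw [lam_apply, add_sub_cancel_right]

theorem lam_Rd (k : E) (f : 𝓗) : F.lam k (F.Rd k f) = f := F.ham_R k f

theorem lam_symm (k : E) (u v : F.D) :
    ⟪F.lam k u, (v : 𝓗)⟫_ℂ = ⟪(u : 𝓗), F.lam k v⟫_ℂ := by
  simp only [lam_apply, inner_add_left, inner_add_right, ham_symm, inner_smul_left,
    inner_smul_right, Complex.conj_ofReal]

theorem norm_sq_le_form (k : E) (u : F.D) :
    ‖(u : 𝓗)‖ ^ 2 ≤ (⟪(u : 𝓗), F.lam k u⟫_ℂ).re := F.lower k u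

theorem norm_grad_sq_le (k v : E) (u : F.D) :
    ‖F.grad k v u‖ ^ 2 ≤ F.C₁ ^ 2 * ‖v‖ ^ 2 * (⟪(u : 𝓗), F.lam k u⟫_ℂ).re := F.form k v u

theorem form_le (k : E) (u : F.D) :
    (⟪(u : 𝓗), F.lam k u⟫_ℂ).re ≤ ‖(u : 𝓗)‖ * ‖F.lam k u‖ :=
  (Complex.re_le_norm _).trans (norm_inner_le_norm _ _)

theorem norm_le_lam (k : E) (u : F.D) : ‖(u : 𝓗)‖ ≤ ‖F.lam k u‖ := by
  have h := (norm_sq_le_form k u).trans (form_le k u)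
  rcases (norm_nonneg (u : 𝓗)).eq_or_lt with h0 | h0
  · rw [← h0]; exact norm_nonneg _
  · rw [sq] at h
    exact le_of_mul_le_mul_left h h0

theorem norm_grad_le (k v : E) (u : F.D) : ‖F.grad k v u‖ ≤ F.C₁ * ‖v‖ * ‖F.lam k u‖ := by
  have hC := F.C₁_nonneg
  rw [← sq_le_sq₀ (norm_nonneg _) (by positivity), mul_pow, mul_pow]
  refine (norm_grad_sq_le k v u).trans ?_
  gcongr
  refine (form_le k u).trans ?_
  rw [sq]
  gcongr
  exact norm_le_lam k u

theorem Rd_lam (k : E) (u : F.D) : F.Rd k (F.lam k u) = u := by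
  have h := norm_le_lam k (F.Rd k (F.lam k u) - u)
  rw [map_sub, lam_Rd, sub_self, norm_zero] at h
  have h' := norm_le_zero_iff.1 h
  exact sub_eq_zero.1 (Subtype.ext h')

theorem R_lam (k : E) (u : F.D) : F.R k (F.lam k u) = u := congrArg Subtype.val (Rd_lam k u)

theorem R_symm (k : E) (f g : 𝓗) : ⟪F.R k f, g⟫_ℂ = ⟪f, F.R k g⟫_ℂ := by
  have h := lam_symm k (F.Rd k f) (F.Rd k g)
  rw [lam_Rd, lam_Rd, coe_Rd, coe_Rd] at h
  exact h.symm

theorem lam_add (k q : E) (u : F.D) :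
    F.lam (k + q) u = F.lam k u + F.grad k q u + ((‖q‖ ^ 2 / 2 : ℝ) : ℂ) • (u : 𝓗) := by
  rw [lam_apply, lam_apply, ham_add]
  abel

variable (F)

/-- The bounded operator `∂ᵥH(k) (H k + c)⁻¹`, linear in `v`. -/
def gradR (k : E) : E →L[ℝ] (𝓗 →L[ℂ] 𝓗) :=
  LinearMap.mkContinuous
    { toFun := fun v => LinearMap.mkContinuous (F.grad k v ∘ₗ F.Rd k) (F.C₁ * ‖v‖) fun f => by
        have h := norm_grad_le k v (F.Rd k f)
        rwa [lam_Rd] at h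
      map_add' := fun v w => by
        ext f
        exact grad_add k v w (F.Rd k f)
      map_smul' := fun r v => by
        ext f
        exact grad_smul k r v (F.Rd k f) } F.C₁ fun v =>
    LinearMap.mkContinuous_norm_le _ (mul_nonneg F.C₁_nonneg (norm_nonneg v)) fun f => by
      have h := norm_grad_le k v (F.Rd k f)
      rwa [lam_Rd] at h

/-- The bounded operator `(H (k + q) + c) (H k + c)⁻¹`. -/
def transfer (k q : E) : 𝓗 →L[ℂ] 𝓗 := 1 + F.gradR k q + ((‖q‖ ^ 2 / 2 : ℝ)) • F.R k

variable {F}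

theorem gradR_apply (k v : E) (f : 𝓗) : F.gradR k v f = F.grad k v (F.Rd k f) := rfl

theorem transfer_apply (k q : E) (f : 𝓗) : F.transfer k q f = F.lam (k + q) (F.Rd k f) := by
  rw [lam_add, lam_Rd]
  rfl

/-- The transfer operators form a cocycle, so that they are invertible. -/
theorem transfer_mul_transfer (k q : E) : F.transfer (k + q) (-q) * F.transfer k q = 1 := by
  ext f
  rw [mul_apply_eq_comp, transfer_apply, transfer_apply, Rd_lam, add_neg_cancel_right, lam_Rd]
  rfl

theorem transfer_mul_transfer' (k q : E) : F.transfer k q * F.transfer (k + q) (-q) = 1 := by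
  have := transfer_mul_transfer (F := F) (k + q) (-q)
  rwa [add_neg_cancel_right, neg_neg] at this

/-- The unit of the algebra of bounded operators given by `transfer`. -/
def transferUnit (F : RegularFamily E 𝓗) (k q : E) : (𝓗 →L[ℂ] 𝓗)ˣ :=
  ⟨F.transfer k q, F.transfer (k + q) (-q), transfer_mul_transfer' k q, transfer_mul_transfer k q⟩

variable [CompleteSpace 𝓗]

theorem contDiff_transfer (k : E) : ContDiff ℝ ∞ (fun k' => F.transfer k (k' - k)) := by
  have h1 : ContDiff ℝ ∞ (fun k' : E => k' - k) := contDiff_id.sub contDiff_const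
  refine (contDiff_const.add ((F.gradR k).contDiff.comp h1)).add ?_
  exact (((contDiff_norm_sq ℝ).comp h1).div_const 2).smul contDiff_const

theorem contDiff_inverse_transfer (k : E) :
    ContDiff ℝ ∞ (fun k' => Ring.inverse (F.transfer k (k' - k))) := by
  rw [contDiff_iff_contDiffAt]
  intro k'
  exact (contDiffAt_ringInverse ℝ (F.transferUnit k (k' - k))).comp k' (contDiff_transfer k).contDiffAt

theorem inverse_transfer (k k' : E) :
    Ring.inverse (F.transfer k (k' - k)) = F.transfer k' (k - k') := by
  have h := Ring.inverse_unit (F.transferUnit k (k' - k))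
  have h2 : (((F.transferUnit k (k' - k))⁻¹ : (𝓗 →L[ℂ] 𝓗)ˣ) : 𝓗 →L[ℂ] 𝓗) =
      F.transfer (k + (k' - k)) (-(k' - k)) := rfl
  rw [h2, add_sub_cancel, neg_sub] at h
  exact h

/-- The resolvent at `k'`, through the inverse of an operator that depends polynomially on `k'` with
values in the bounded operators. -/
theorem R_eq (k k' : E) : F.R k' = F.R k * Ring.inverse (F.transfer k (k' - k)) := by
  rw [inverse_transfer]
  ext f
  rw [mul_apply_eq_comp, transfer_apply, add_sub_cancel, R_lam, coe_Rd]

theorem gradR_eq (k k' v : E) :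
    F.gradR k' v = (F.gradR k v + (⟪k' - k, v⟫_ℝ : ℝ) • F.R k) *
      Ring.inverse (F.transfer k (k' - k)) := by
  rw [inverse_transfer]
  ext f
  rw [mul_apply_eq_comp, transfer_apply, add_sub_cancel, add_apply, gradR_apply,
    gradR_apply, Rd_lam, smul_apply, R_lam]
  nth_rewrite 1 [← add_sub_cancel k k']
  rw [grad_add_left]
  rfl

theorem contDiff_R : ContDiff ℝ ∞ F.R := by
  have : F.R = fun k' => F.R 0 * Ring.inverse (F.transfer 0 (k' - 0)) := by
    ext1 k'; exact R_eq 0 k'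
  rw [this]
  exact contDiff_const.mul (contDiff_inverse_transfer 0)

theorem contDiff_gradR (v : E) : ContDiff ℝ ∞ (fun k => F.gradR k v) := by
  have : (fun k => F.gradR k v) = fun k' => (F.gradR 0 v + (⟪k' - 0, v⟫_ℝ : ℝ) • F.R 0) *
      Ring.inverse (F.transfer 0 (k' - 0)) := by
    ext1 k'; exact gradR_eq 0 k' v
  rw [this]
  have h1 : ContDiff ℝ ∞ (fun k' : E => ⟪k' - 0, v⟫_ℝ) :=
    (contDiff_id.sub contDiff_const).inner ℝ contDiff_const
  have h2 : ContDiff ℝ ∞ (fun k' : E => F.gradR 0 v + (⟪k' - 0, v⟫_ℝ : ℝ) • F.R 0) :=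
    contDiff_const.add (h1.smul contDiff_const)
  exact h2.mul (contDiff_inverse_transfer 0)

/-! ### The eigenbasis of a member of the family -/

universe u

variable {𝓗 : Type u} [NormedAddCommGroup 𝓗] [InnerProductSpace ℂ 𝓗] [CompleteSpace 𝓗]
  {F : RegularFamily E 𝓗}

theorem finite_of_norm_R {ι : Type*} {k : E} {φ : ι → 𝓗} (hφ : Orthonormal ℂ φ) {s : Finset ι}
    {δ : ℝ} (hδ : 0 ≤ δ) (hs : ∀ i ∈ s, δ ≤ ‖F.R k (φ i)‖) : s.card * δ ^ 2 ≤ F.K := by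
  have h := F.hilbertSchmidt k s.card (fun i => φ (s.equivFin.symm i))
    (hφ.comp _ (Subtype.val_injective.comp s.equivFin.symm.injective))
  refine le_trans ?_ h
  rw [show (s.card : ℝ) * δ ^ 2 = ∑ _i : Fin s.card, δ ^ 2 by simp]
  refine Finset.sum_le_sum fun i _ => ?_
  gcongr
  exact hs _ (s.equivFin.symm i).2

theorem exists_isEigenbasis (F : RegularFamily E 𝓗) (k : E) :
    ∃ (ι : Type u) (b : HilbertBasis ι ℂ 𝓗) (ev : ι → ℝ), IsEigenbasis (F.op k) b ev := by
  obtain ⟨ι, b, m, hm⟩ := exists_eigenbasis (F.compact k) (fun f g => R_symm k f g)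
  have hne : ∀ i, m i ≠ 0 := by
    intro i h0
    have h1 := lam_Rd (F := F) k (b i)
    have h2 : F.Rd k (b i) = 0 := Subtype.ext (by rw [coe_Rd, hm, h0, zero_smul]; rfl)
    rw [h2, map_zero] at h1
    exact b.orthonormal.ne_zero i h1.symm
  have hmem : ∀ i, b i ∈ F.D := by
    intro i
    have h1 := F.D.smul_mem (m i)⁻¹ (F.R_mem k (b i))
    rwa [hm, smul_smul, inv_mul_cancel₀ (hne i), one_smul] at h1
  have hlam : ∀ i, F.lam k ⟨b i, hmem i⟩ = (m i)⁻¹ • b i := by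
    intro i
    have h1 : (⟨b i, hmem i⟩ : F.D) = (m i)⁻¹ • F.Rd k (b i) := Subtype.ext (by
      rw [Submodule.coe_smul, coe_Rd, hm, smul_smul, inv_mul_cancel₀ (hne i), one_smul])
    rw [h1, map_smul, lam_Rd]
  have hreal : ∀ i, ((m i).re : ℂ) = m i := by
    intro i
    have h1 := R_symm (F := F) k (b i) (b i)
    rw [hm, inner_smul_left, inner_smul_right, inner_self_eq_norm_sq_to_K, b.orthonormal.1] at h1
    simp only [RCLike.ofReal_one, one_pow, mul_one] at h1
    exact Complex.conj_eq_iff_real.1 h1 |>.elim fun r hr => by rw [hr]; simp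
  have hham : ∀ i, F.ham k ⟨b i, hmem i⟩ = (((m i).re⁻¹ - F.c : ℝ) : ℂ) • b i := by
    intro i
    have h1 := hlam i
    rw [ham_eq, h1]
    push_cast
    rw [hreal, sub_smul]
  have hpos : ∀ i, 1 ≤ (m i).re⁻¹ := by
    intro i
    have h1 := norm_sq_le_form (F := F) k ⟨b i, hmem i⟩
    rw [hlam, inner_smul_right, inner_self_eq_norm_sq_to_K, b.orthonormal.1, ← hreal] at h1
    have h3 : (((m i).re : ℂ)⁻¹).re = (m i).re⁻¹ := by norm_cast
    simpa [h3] using h1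
  refine ⟨ι, b, fun i => (m i).re⁻¹ - F.c, ?_, fun i => mem_graph_op.2 ⟨hmem i, hham i⟩, ?_⟩
  · intro u f v g hu hv
    obtain ⟨hu', rfl⟩ := mem_graph_op.1 hu
    obtain ⟨hv', rfl⟩ := mem_graph_op.1 hv
    exact ham_symm k ⟨u, hu'⟩ ⟨v, hv'⟩
  · intro x
    by_contra hinf
    have hinf : {i | (m i).re⁻¹ - F.c ≤ x}.Infinite := hinf
    obtain ⟨i0, hi0⟩ := hinf.nonempty
    have hx : 0 < x + F.c := by
      have h1 : (m i0).re⁻¹ - F.c ≤ x := hi0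
      have h2 := hpos i0
      linarith
    obtain ⟨n, hn⟩ := exists_nat_gt (F.K * (x + F.c) ^ 2)
    obtain ⟨s, hs, hcard⟩ := hinf.exists_subset_card_eq n
    have h1 := finite_of_norm_R (F := F) (k := k) b.orthonormal (s := s) (δ := (x + F.c)⁻¹)
      (by positivity) (fun i hi => by
        rw [hm, norm_smul, b.orthonormal.1, mul_one, ← hreal, Complex.norm_real]
        refine le_trans ?_ (le_abs_self _)
        have h2 : (m i).re⁻¹ - F.c ≤ x := hs hi
        have h3 : 0 < (m i).re := inv_pos.1 (lt_of_lt_of_le one_pos (hpos i))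
        exact inv_le_of_inv_le₀ h3 (by linarith))
    rw [hcard, inv_pow, ← div_eq_mul_inv, div_le_iff₀ (by positivity)] at h1
    linarith

section

variable {ι : Type*} {k : E} {b : HilbertBasis ι ℂ 𝓗} {ev : ι → ℝ}

theorem basis_mem (h : IsEigenbasis (F.op k) b ev) (i : ι) : b i ∈ F.D :=
  (mem_graph_op.1 (h.mem i)).1

theorem lam_basis (h : IsEigenbasis (F.op k) b ev) (i : ι) :
    F.lam k ⟨b i, basis_mem h i⟩ = ((ev i + F.c : ℝ) : ℂ) • b i := by
  obtain ⟨h1, h2⟩ := mem_graph_op.1 (h.mem i)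
  rw [lam_apply, h2]
  push_cast
  rw [add_smul]

theorem one_le_ev (h : IsEigenbasis (F.op k) b ev) (i : ι) : 1 ≤ ev i + F.c := by
  have h1 := norm_sq_le_form (F := F) k ⟨b i, basis_mem h i⟩
  rw [lam_basis h, inner_smul_right, inner_self_eq_norm_sq_to_K, b.orthonormal.1] at h1
  simpa using h1

theorem R_basis (h : IsEigenbasis (F.op k) b ev) (i : ι) :
    F.R k (b i) = (((ev i + F.c)⁻¹ : ℝ) : ℂ) • b i := by
  have h1 := congrArg (F.R k) (lam_basis h i)
  have h2 := one_le_ev h i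
  have h3 : ((ev i + F.c : ℝ) : ℂ) ≠ 0 := by
    rw [Complex.ofReal_ne_zero]; linarith
  rw [R_lam, map_smul] at h1
  rw [Complex.ofReal_inv, eq_inv_smul_iff₀ h3]
  exact h1.symm

/-- The number of eigenvalues below a given level is bounded uniformly in the parameter. -/
theorem ncard_le (h : IsEigenbasis (F.op k) b ev) {μ : ℝ} (hμ : 0 < μ + F.c) :
    ({i | ev i ≤ μ}.ncard : ℝ) ≤ F.K * (μ + F.c) ^ 2 := by
  have hf := h.finite μ
  have h1 := finite_of_norm_R (F := F) (k := k) b.orthonormal (s := hf.toFinset)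
    (δ := (μ + F.c)⁻¹) (by positivity) (fun i hi => by
      have hi' : ev i ≤ μ := by simpa using hi
      have h1 := one_le_ev h i
      rw [R_basis h, norm_smul, b.orthonormal.1, mul_one, Complex.norm_real]
      refine le_trans ?_ (le_abs_self _)
      exact inv_anti₀ (by linarith) (by linarith))
  rw [inv_pow, ← div_eq_mul_inv, div_le_iff₀ (by positivity)] at h1
  rwa [Set.ncard_eq_toFinset_card _ hf]

theorem inner_lam (h : IsEigenbasis (F.op k) b ev) (i : ι) (u : F.D) :
    ⟪b i, F.lam k u⟫_ℂ = ((ev i + F.c : ℝ) : ℂ) * ⟪b i, (u : 𝓗)⟫_ℂ := by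
  have h1 := lam_symm k ⟨b i, basis_mem h i⟩ u
  rw [lam_basis h, inner_smul_left, Complex.conj_ofReal] at h1
  exact h1.symm

end

end RegularFamily

/-! ### Smooth dependence of spectral projectors -/

/-- A smooth square root near the identity of a Banach algebra. -/
theorem exists_smooth_sqrt (𝔸 : Type*) [NormedRing 𝔸] [NormedAlgebra ℝ 𝔸] [CompleteSpace 𝔸] :
    ∃ δ : ℝ, 0 < δ ∧ δ < 1 ∧ ∃ g : 𝔸 → 𝔸, (∀ W, ‖W - 1‖ < δ → ContDiffAt ℝ 2 g W) ∧
      ∀ X, ‖X - 1‖ < δ → g (X * X) = X := by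
  let f : 𝔸 → 𝔸 := fun X => X * X
  have hf : ContDiff ℝ 2 f := contDiff_id.mul contDiff_id
  let e : 𝔸 ≃L[ℝ] 𝔸 := ContinuousLinearEquiv.smulLeft (Units.mk0 (2 : ℝ) two_ne_zero)
  have hf' : HasFDerivAt f (e : 𝔸 →L[ℝ] 𝔸) 1 := by
    have h := (hasFDerivAt_id (𝕜 := ℝ) (1 : 𝔸)).mul' (hasFDerivAt_id (𝕜 := ℝ) (1 : 𝔸))
    refine h.congr_fderiv ?_
    ext x
    simp only [id, one_smul, MulOpposite.op_one]
    exact (two_smul ℝ x).symm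
  have h2 : (2 : WithTop ℕ∞) ≠ 0 := by norm_num
  let φ := hf.contDiffAt.toOpenPartialHomeomorph f hf' h2
  have hφ : ∀ x, φ x = x * x := fun x => rfl
  have hsrc : (1 : 𝔸) ∈ φ.source :=
    hf.contDiffAt.mem_toOpenPartialHomeomorph_source hf' h2
  have hg := hf.contDiffAt.to_localInverse (f := f) hf' h2
  have hf1 : f 1 = 1 := by simp [f]
  rw [hf1] at hg
  have hg' := hg.eventually (by decide)
  obtain ⟨δ₁, hδ₁, h₁⟩ := Metric.eventually_nhds_iff.1 hg'
  obtain ⟨δ₂, hδ₂, h₂⟩ := Metric.eventually_nhds_iff.1 (φ.open_source.mem_nhds hsrc)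
  refine ⟨min (min δ₁ δ₂) (1 / 2), by positivity, (min_le_right _ _).trans_lt (by norm_num),
    _, fun W hW => h₁ ?_, fun X hX => ?_⟩
  · rw [dist_eq_norm]
    exact hW.trans_le ((min_le_left _ _).trans (min_le_left _ _))
  · have : X ∈ φ.source := h₂ (by
      rw [dist_eq_norm]
      exact hX.trans_le ((min_le_left _ _).trans (min_le_right _ _)))
    have h3 := φ.left_inv this
    exact h3

section DiagUnit

variable {ι H : Type*} [NormedAddCommGroup H] [InnerProductSpace ℂ H] [CompleteSpace H]

theorem inverse_eq_diagOp (b : HilbertBasis ι ℂ H) {m : ι → ℂ} {T : H →L[ℂ] H}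
    (hT : ∀ i, T (b i) = m i • b i) (h0 : ∀ i, m i ≠ 0) (hK : ∃ K : ℝ, ∀ i, ‖(m i)⁻¹‖ ≤ K) :
    IsUnit T ∧ Ring.inverse T = diagOp b fun i => (m i)⁻¹ := by
  have h1 : T * diagOp b (fun i => (m i)⁻¹) = 1 := by
    refine hilbertBasis_clm_ext b fun i => ?_
    rw [mul_apply_eq_comp, diagOp_apply_self b hK, map_smul, hT, smul_smul,
      inv_mul_cancel₀ (h0 i), one_smul]
    rfl
  have h2 : diagOp b (fun i => (m i)⁻¹) * T = 1 := by
    refine hilbertBasis_clm_ext b fun i => ?_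
    rw [mul_apply_eq_comp, hT, map_smul, diagOp_apply_self b hK, smul_smul,
      mul_inv_cancel₀ (h0 i), one_smul]
    rfl
  let U : (H →L[ℂ] H)ˣ := ⟨T, _, h1, h2⟩
  exact ⟨⟨U, rfl⟩, Ring.inverse_unit U⟩

theorem pow_apply_eigen {T : H →L[ℂ] H} {u : H} {r : ℂ} (h : T u = r • u) (m : ℕ) :
    (T ^ m) u = r ^ m • u := by
  induction m with
  | zero => simp
  | succ m ih => rw [pow_succ', mul_apply_eq_comp, ih, map_smul, h, smul_smul, pow_succ]

end DiagUnit

/-- The rational function whose values on `r ≥ 0` approach the sign of `r - a` as `m → ∞`. -/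
def softSign (a : ℝ) (m : ℕ) (r : ℝ) : ℝ := (r ^ m - a ^ m) / (r ^ m + a ^ m)

theorem one_sub_softSign_sq {a r : ℝ} (ha : 0 < a) (hr : 0 < r) (m : ℕ) :
    1 - softSign a m r ^ 2 = 4 * (r ^ m * a ^ m) / (r ^ m + a ^ m) ^ 2 := by
  have h1 : 0 < r ^ m := by positivity
  have h2 : 0 < a ^ m := by positivity
  rw [softSign]
  field_simp
  ring

/-- The convergence is geometric away from `r = a`. -/
theorem abs_softSign_sq_sub_one_le {a r q : ℝ} (ha : 0 < a) (hr : 0 < r) (m : ℕ)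
    (h : r ≤ q * a ∨ a ≤ q * r) : |softSign a m r ^ 2 - 1| ≤ 4 * q ^ m := by
  have h1 : 0 < r ^ m := by positivity
  have h2 : 0 < a ^ m := by positivity
  have hq : 0 < q := by
    by_contra hq
    rw [not_lt] at hq
    rcases h with h | h
    · nlinarith
    · nlinarith
  rw [abs_sub_comm, one_sub_softSign_sq ha hr, abs_of_nonneg (by positivity), div_le_iff₀ (by positivity)]
  rcases h with h | h
  · have h3 : r ^ m ≤ q ^ m * a ^ m := by
      rw [← mul_pow]; exact pow_le_pow_left₀ hr.le h m
    have h4 : 0 < q ^ m := by positivity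
    nlinarith [mul_le_mul_of_nonneg_right h3 h2.le, mul_pos h4 h1, mul_pos h4 h2,
      mul_pos (mul_pos h4 h1) h2, mul_pos (mul_pos h4 h1) h1]
  · have h3 : a ^ m ≤ q ^ m * r ^ m := by
      rw [← mul_pow]; exact pow_le_pow_left₀ ha.le h m
    have h4 : 0 < q ^ m := by positivity
    nlinarith [mul_le_mul_of_nonneg_right h3 h1.le, mul_pos h4 h1, mul_pos h4 h2,
      mul_pos (mul_pos h4 h1) h2, mul_pos (mul_pos h4 h2) h2]

theorem softSign_pos_iff {a r : ℝ} (ha : 0 < a) (hr : 0 < r) {m : ℕ} (hm : m ≠ 0) :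
    0 < softSign a m r ↔ a < r := by
  rw [softSign, div_pos_iff_of_pos_right (by positivity), sub_pos]
  exact pow_lt_pow_iff_left₀ ha.le hr.le hm

theorem softSign_self (a : ℝ) (m : ℕ) : softSign a m a = 0 := by simp [softSign]

namespace RegularFamily

open QuadFamily

universe u

variable {E : Type*} {𝓗 : Type u} [NormedAddCommGroup E] [InnerProductSpace ℝ E]
  [NormedAddCommGroup 𝓗] [InnerProductSpace ℂ 𝓗] [CompleteSpace 𝓗] {F : RegularFamily E 𝓗}

/-- `softSign` of the resolvent. -/
def signR (F : RegularFamily E 𝓗) (a : ℝ) (m : ℕ) (k : E) : 𝓗 →L[ℂ] 𝓗 :=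
  (F.R k ^ m - a ^ m • (1 : 𝓗 →L[ℂ] 𝓗)) * Ring.inverse (F.R k ^ m + a ^ m • (1 : 𝓗 →L[ℂ] 𝓗))

section

variable {ι : Type*} {k : E} {b : HilbertBasis ι ℂ 𝓗} {ev : ι → ℝ}

theorem denominator_signR (h : IsEigenbasis (F.op k) b ev) {a : ℝ} (ha : 0 < a) (m : ℕ) :
    IsUnit (F.R k ^ m + a ^ m • (1 : 𝓗 →L[ℂ] 𝓗)) ∧
      Ring.inverse (F.R k ^ m + a ^ m • (1 : 𝓗 →L[ℂ] 𝓗)) =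
        diagOp b fun i => (((((ev i + F.c)⁻¹) ^ m + a ^ m : ℝ)) : ℂ)⁻¹ := by
  have hpos : ∀ i, a ^ m ≤ ((ev i + F.c)⁻¹) ^ m + a ^ m := fun i => by
    have := one_le_ev h i
    have : 0 < (ev i + F.c)⁻¹ := by positivity
    have : 0 < (ev i + F.c)⁻¹ ^ m := by positivity
    linarith
  have ham : 0 < a ^ m := by positivity
  refine inverse_eq_diagOp b (fun i => ?_) (fun i => ?_) ⟨(a ^ m)⁻¹, fun i => ?_⟩
  · rw [add_apply, pow_apply_eigen (R_basis h i), smul_apply]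
    push_cast
    rw [add_smul]
    congr 1
    norm_cast
  · rw [Complex.ofReal_ne_zero]
    exact (ham.trans_le (hpos i)).ne'
  · rw [norm_inv, Complex.norm_real, Real.norm_of_nonneg (ham.le.trans (hpos i))]
    exact inv_anti₀ ham (hpos i)

theorem signR_basis (h : IsEigenbasis (F.op k) b ev) {a : ℝ} (ha : 0 < a) (m : ℕ) (i : ι) :
    F.signR a m k (b i) = (softSign a m (ev i + F.c)⁻¹ : ℂ) • b i := by
  have ham : 0 < a ^ m := by positivity
  rw [signR, (denominator_signR h ha m).2, mul_apply_eq_comp, diagOp_apply_self, map_smul,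
    sub_apply, pow_apply_eigen (R_basis h i), smul_apply]
  · rw [softSign]
    have e : (a ^ m • (1 : 𝓗 →L[ℂ] 𝓗) (b i)) = ((a ^ m : ℝ) : ℂ) • b i := rfl
    rw [e, ← sub_smul, smul_smul]
    congr 1
    push_cast
    ring
  · refine ⟨(a ^ m)⁻¹, fun i => ?_⟩
    have := one_le_ev h i
    have : 0 < (ev i + F.c)⁻¹ := by positivity
    have : 0 < (ev i + F.c)⁻¹ ^ m := by positivity
    rw [norm_inv, Complex.norm_real, Real.norm_of_nonneg (by positivity)]
    exact inv_anti₀ ham (by linarith)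

end

theorem contDiff_signR {a : ℝ} (ha : 0 < a) (m : ℕ) : ContDiff ℝ ∞ (F.signR a m) := by
  have h1 : ContDiff ℝ ∞ fun k => F.R k ^ m := contDiff_R.pow m
  refine (h1.sub contDiff_const).mul ?_
  rw [contDiff_iff_contDiffAt]
  intro k
  obtain ⟨ι, b, ev, h⟩ := exists_isEigenbasis F k
  obtain ⟨U, hU⟩ := (denominator_signR h ha m).1
  have h2 := contDiffAt_ringInverse (n := ∞) ℝ U
  rw [hU] at h2
  exact h2.comp k (h1.add contDiff_const).contDiffAt

/-- At a level `μ` which is not an eigenvalue, `softSign` of the resolvent is nearly an involution. -/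
theorem exists_norm_signR_sq_sub_one_lt {k : E} {μ : ℝ} (hμ : 0 < μ + F.c)
    (hne : eigenspace (F.op k) μ = ⊥) {δ : ℝ} (hδ : 0 < δ) :
    ∃ m : ℕ, m ≠ 0 ∧ ‖F.signR (μ + F.c)⁻¹ m k * F.signR (μ + F.c)⁻¹ m k - 1‖ < δ := by
  obtain ⟨ι, b, ev, h⟩ := exists_isEigenbasis F k
  rw [h.eigenspace_eq_bot_iff] at hne
  obtain ⟨y, hy, hgap⟩ := h.exists_gap μ
  -- `x` is the largest eigenvalue below `μ`, or a level between `-c` and `μ` if there is none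
  obtain ⟨x, hx0, hx, hxμ⟩ : ∃ x, 0 < x + F.c ∧ x < μ ∧ ∀ i, ev i ≤ μ → ev i ≤ x := by
    have hf := h.finite μ
    by_cases hs : hf.toFinset.Nonempty
    · refine ⟨hf.toFinset.sup' hs ev, ?_, ?_, fun i hi => Finset.le_sup' ev (by simpa using hi)⟩
      · obtain ⟨i, hi⟩ := hs
        have := Finset.le_sup' ev hi
        have := one_le_ev h i
        linarith
      · rw [Finset.sup'_lt_iff]
        intro i hi
        exact lt_of_le_of_ne (by simpa using hi) (hne i)
    · refine ⟨μ - (μ + F.c) / 2, by linarith, by linarith, fun i hi => ?_⟩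
      exact absurd ⟨i, by simpa using hi⟩ hs
  let q := max ((x + F.c) / (μ + F.c)) ((μ + F.c) / (y + F.c))
  have hy0 : 0 < y + F.c := by linarith
  have hq1 : q < 1 := by
    refine max_lt ?_ ?_
    · rw [div_lt_one hμ]; linarith
    · rw [div_lt_one hy0]; linarith
  have hq0 : 0 < q := lt_max_of_lt_left (by positivity)
  obtain ⟨m, hm⟩ := exists_pow_lt_of_lt_one (show 0 < δ / 8 by positivity) hq1
  have hpow : 4 * q ^ (m + 1) < δ := by
    have h1 : q ^ (m + 1) ≤ q ^ m := pow_le_pow_of_le_one hq0.le hq1.le (Nat.le_succ m)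
    linarith
  refine ⟨m + 1, Nat.succ_ne_zero m, lt_of_le_of_lt ?_ hpow⟩
  have ha : 0 < (μ + F.c)⁻¹ := by positivity
  have hbd : ∀ i, ‖((softSign (μ + F.c)⁻¹ (m + 1) (ev i + F.c)⁻¹ ^ 2 - 1 : ℝ) : ℂ)‖
      ≤ 4 * q ^ (m + 1) := by
    intro i
    have hi := one_le_ev h i
    rw [Complex.norm_real]
    refine abs_softSign_sq_sub_one_le ha (by positivity) _ ?_
    have hμ' : 0 < ev i + F.c := by linarith
    rcases le_or_gt (ev i) y with hle | hgt
    · right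
      have h1 := hxμ i (hgap i hle)
      have h2 : (x + F.c) / (μ + F.c) * (ev i + F.c)⁻¹ ≤ q * (ev i + F.c)⁻¹ :=
        mul_le_mul_of_nonneg_right (le_max_left _ _) (by positivity)
      refine le_trans ?_ h2
      rw [div_mul_eq_mul_div, ← div_eq_mul_inv, inv_eq_one_div]
      gcongr
      rw [one_le_div hμ']
      linarith
    · left
      have h2 : (μ + F.c) / (y + F.c) * (μ + F.c)⁻¹ ≤ q * (μ + F.c)⁻¹ :=
        mul_le_mul_of_nonneg_right (le_max_right _ _) (by positivity)
      refine le_trans ?_ h2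
      rw [div_mul_eq_mul_div, mul_inv_cancel₀ hμ.ne', ← one_div]
      exact one_div_le_one_div_of_le hy0 (by linarith)
  rw [eq_diagOp b ⟨_, hbd⟩ (T := F.signR (μ + F.c)⁻¹ (m + 1) k * F.signR (μ + F.c)⁻¹ (m + 1) k - 1)]
  · exact norm_diagOp_le b (by positivity) hbd
  · intro i
    rw [sub_apply, mul_apply_eq_comp, signR_basis h ha, map_smul, signR_basis h ha, smul_smul]
    push_cast
    rw [sub_smul, sq, one_smul]
    rfl

/-- If `μ` is not an eigenvalue of `H k`, the same holds for all nearby parameters, and the spectral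
projector below `μ` is a `C²` function of the parameter near `k`. -/
theorem eventually_contDiffAt_specProj {k : E} {μ : ℝ} (hμ : 0 < μ + F.c)
    (hne : eigenspace (F.op k) μ = ⊥) :
    ∀ᶠ k' in 𝓝 k, eigenspace (F.op k') μ = ⊥ ∧
      ContDiffAt ℝ 2 (fun k' => specProj (F.op k') (μ : EReal)) k' := by
  obtain ⟨δ, hδ, hδ1, g, hg1, hg2⟩ := exists_smooth_sqrt (𝓗 →L[ℂ] 𝓗)
  obtain ⟨m, hm, hlt⟩ := exists_norm_signR_sq_sub_one_lt hμ hne hδ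
  set a := (μ + F.c)⁻¹ with ha_def
  have ha : 0 < a := by positivity
  let Z := F.signR a m
  have hZ : ContDiff ℝ ∞ Z := contDiff_signR ha m
  -- the sign of `Z` is `Z (Z²)^{-1/2}`
  let Q : E → 𝓗 →L[ℂ] 𝓗 := fun k' => (1 / 2 : ℝ) • (1 + Z k' * Ring.inverse (g (Z k' * Z k')))
  have key : ∀ k', ‖Z k' * Z k' - 1‖ < δ → eigenspace (F.op k') μ = ⊥ ∧ ContDiffAt ℝ 2 Q k' ∧
      specProj (F.op k') (μ : EReal) = Q k' := by
    intro k' hk'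
    obtain ⟨ι, b, ev, h⟩ := exists_isEigenbasis F k'
    let z : ι → ℝ := fun i => softSign a m (ev i + F.c)⁻¹
    have hpos : ∀ i, 0 < (ev i + F.c)⁻¹ := fun i => by
      have := one_le_ev h i
      positivity
    have hZb : ∀ i, Z k' (b i) = (z i : ℂ) • b i := signR_basis h ha m
    have hz1 : ∀ i, |z i ^ 2 - 1| ≤ ‖Z k' * Z k' - 1‖ := by
      intro i
      have h1 := (Z k' * Z k' - 1).le_opNorm (b i)
      have h2 : (Z k' * Z k' - 1) (b i) = ((z i ^ 2 - 1 : ℝ) : ℂ) • b i := by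
        rw [sub_apply, mul_apply_eq_comp, hZb, map_smul, hZb, smul_smul]
        push_cast
        rw [sub_smul, sq, one_smul]
        rfl
      rwa [h2, norm_smul, b.orthonormal.1, mul_one, mul_one, Complex.norm_real] at h1
    have hz2 : ∀ i, |(|z i| - 1)| ≤ ‖Z k' * Z k' - 1‖ := by
      intro i
      refine le_trans ?_ (hz1 i)
      rw [← sq_abs, show |z i| ^ 2 - 1 = (|z i| - 1) * (|z i| + 1) by ring, abs_mul]
      refine le_mul_of_one_le_right (abs_nonneg _) ?_
      rw [abs_of_nonneg (by positivity)]
      linarith [abs_nonneg (z i)]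
    have hz3 : ∀ i, 1 - δ ≤ |z i| := fun i => by
      have h1 := (abs_le.1 (hz2 i)).1
      linarith
    have hz4 : ∀ i, z i ≠ 0 := fun i h0 => by
      have h1 := hz3 i
      rw [h0, abs_zero] at h1
      linarith
    have hbd : ∀ i, ‖((|z i| : ℝ) : ℂ)‖ ≤ 2 := fun i => by
      have h1 := (abs_le.1 (hz2 i)).2
      rw [Complex.norm_real, Real.norm_of_nonneg (abs_nonneg _)]
      linarith
    -- the modulus `X = |Z|` is the square root of `Z²` near the identity
    let X := diagOp b fun i => ((|z i| : ℝ) : ℂ)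
    have hXb : ∀ i, X (b i) = ((|z i| : ℝ) : ℂ) • b i := diagOp_apply_self b ⟨2, hbd⟩
    have hX1 : ‖X - 1‖ < δ := by
      refine lt_of_le_of_lt ?_ hk'
      have hbd' : ∀ i, ‖((|z i| - 1 : ℝ) : ℂ)‖ ≤ ‖Z k' * Z k' - 1‖ := fun i => by
        rw [Complex.norm_real]; exact hz2 i
      rw [eq_diagOp b ⟨_, hbd'⟩ (T := X - 1)]
      · exact norm_diagOp_le b (norm_nonneg _) hbd'
      · intro i
        rw [sub_apply, hXb]
        push_cast
        rw [sub_smul, one_smul]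
        rfl
    have hXX : X * X = Z k' * Z k' := by
      refine hilbertBasis_clm_ext b fun i => ?_
      rw [mul_apply_eq_comp, mul_apply_eq_comp, hXb, hZb, map_smul, map_smul, hXb, hZb, smul_smul,
        smul_smul]
      congr 1
      norm_cast
      exact abs_mul_abs_self _
    have hgX : g (Z k' * Z k') = X := by rw [← hXX]; exact hg2 X hX1
    obtain ⟨hXu, hXi⟩ := inverse_eq_diagOp b hXb (fun i => by simpa using hz4 i)
      ⟨(1 - δ)⁻¹, fun i => by
        rw [norm_inv, Complex.norm_real, Real.norm_of_nonneg (abs_nonneg _)]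
        exact inv_anti₀ (by linarith) (hz3 i)⟩
    have hevne : ∀ i, ev i ≠ μ := fun i hi => hz4 i (by
      simp only [z, hi]
      exact softSign_self a m)
    refine ⟨(h.eigenspace_eq_bot_iff μ).2 hevne, ?_, ?_⟩
    · have hZ2 : ContDiffAt ℝ 2 Z k' := (contDiff_infty.1 hZ 2).contDiffAt
      have h1 : ContDiffAt ℝ 2 (fun k' => g (Z k' * Z k')) k' :=
        (hg1 (Z k' * Z k') hk').comp k' (hZ2.mul hZ2)
      obtain ⟨U, hU⟩ := hXu
      have h2 := contDiffAt_ringInverse (n := 2) ℝ U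
      rw [hU, ← hgX] at h2
      have h2' : ContDiffAt ℝ 2 (fun k' => Ring.inverse (g (Z k' * Z k'))) k' :=
        ContDiffAt.comp (g := Ring.inverse) (f := fun k' => g (Z k' * Z k')) k' h2 h1
      have h3 : ContDiffAt ℝ 2 (fun k' => 1 + Z k' * Ring.inverse (g (Z k' * Z k'))) k' :=
        contDiffAt_const.add (hZ2.mul h2')
      exact h3.const_smul (1 / 2 : ℝ)
    · classical
      rw [h.specProj_eq]
      symm
      refine eq_diagOp b ⟨1, fun i => by split_ifs <;> simp⟩ fun i => ?_
      simp only [Q]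
      rw [smul_apply, add_apply, mul_apply_eq_comp, hgX, hXi, diagOp_apply_self b
        ⟨(1 - δ)⁻¹, fun i => by
        rw [norm_inv, Complex.norm_real, Real.norm_of_nonneg (abs_nonneg _)]
        exact inv_anti₀ (by linarith) (hz3 i)⟩, map_smul, hZb, smul_smul]
      have e1 : ∀ r : ℝ, (1 / 2 : ℝ) • ((1 : 𝓗 →L[ℂ] 𝓗) (b i) + (r : ℂ) • b i) =
          ((1 / 2 * (1 + r) : ℝ) : ℂ) • b i := by
        intro r
        rw [show (1 : 𝓗 →L[ℂ] 𝓗) (b i) = b i from rfl]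
        push_cast
        rw [← Complex.coe_smul, smul_add, smul_smul, mul_add, add_smul]
        push_cast
        simp
      have e2 : ((|z i| : ℝ) : ℂ)⁻¹ * (z i : ℂ) = ((|z i|⁻¹ * z i : ℝ) : ℂ) := by push_cast; rfl
      rw [e2, e1]
      have hsgn : 0 < z i ↔ ev i < μ := by
        simp only [z]
        rw [softSign_pos_iff ha (hpos i) hm, ha_def, inv_lt_inv₀ hμ (inv_pos.1 (hpos i))]
        constructor <;> intro h <;> linarith
      rcases lt_or_gt_of_ne (hz4 i) with hneg | hpos'
      · rw [if_neg, abs_of_neg hneg, inv_neg, neg_mul, inv_mul_cancel₀ (hz4 i)]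
        · norm_num
        · rw [EReal.coe_le_coe_iff, not_le]
          refine lt_of_le_of_ne (not_lt.1 fun hlt => ?_) (hevne i).symm
          exact absurd (hsgn.2 hlt) hneg.le.not_gt
      · rw [if_pos, abs_of_pos hpos', inv_mul_cancel₀ (hz4 i)]
        · norm_num
        · rw [EReal.coe_le_coe_iff]
          exact (hsgn.1 hpos').le
  have hopen : ∀ᶠ k' in 𝓝 k, ‖Z k' * Z k' - 1‖ < δ := by
    have hc : Continuous fun k' => ‖Z k' * Z k' - 1‖ :=
      ((hZ.continuous.mul hZ.continuous).sub continuous_const).norm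
    exact (hc.tendsto k).eventually (gt_mem_nhds hlt)
  filter_upwards [hopen.eventually_nhds] with k' hk'
  refine ⟨(key k' hk'.self_of_nhds).1, (key k' hk'.self_of_nhds).2.1.congr_of_eventuallyEq ?_⟩
  filter_upwards [hk'] with k'' hk''
  exact (key k'' hk'').2.2

end RegularFamily

/-! ### Conjugation of nearby projectors -/

/-- The operator that intertwines two projectors; it is invertible if they are close. -/
def intertwiner {𝔸 : Type*} [Ring 𝔸] (P Q : 𝔸) : 𝔸 := Q * P + (1 - Q) * (1 - P)

/-- The intertwiner carries the range of `P` to the range of `Q`. -/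
theorem mul_intertwiner {𝔸 : Type*} [Ring 𝔸] {P Q : 𝔸} (hP : P * P = P) (hQ : Q * Q = Q) :
    Q * intertwiner P Q = intertwiner P Q * P := by
  have h1 : Q * (1 - Q) = 0 := by rw [mul_sub, mul_one, hQ, sub_self]
  have h2 : (1 - P) * P = 0 := by rw [sub_mul, one_mul, hP, sub_self]
  rw [intertwiner, mul_add, add_mul, ← mul_assoc, ← mul_assoc, h1, hQ, mul_assoc, hP, mul_assoc, h2]
  simp

theorem intertwiner_self {𝔸 : Type*} [Ring 𝔸] {P : 𝔸} (hP : P * P = P) : intertwiner P P = 1 := by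
  rw [intertwiner, hP, mul_sub, mul_one, sub_mul, one_mul, hP]
  abel

section Spectral

universe u

variable {ι : Type*} {H : Type u} [NormedAddCommGroup H] [InnerProductSpace ℂ H] [CompleteSpace H]
  {A : H →ₗ.[ℂ] H} {b : HilbertBasis ι ℂ H} {ev : ι → ℝ}

namespace IsEigenbasis

theorem specProj_basis_of_le (h : IsEigenbasis A b ev) {μ : ℝ} {i : ι} (hi : ev i ≤ μ) :
    specProj A (μ : EReal) (b i) = b i := by
  classical
  rw [h.specProj_eq, diagOp_apply_self b ⟨1, fun i => by split_ifs <;> simp⟩, if_pos, one_smul]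
  exact_mod_cast hi

theorem specProj_basis_of_lt (h : IsEigenbasis A b ev) {μ : ℝ} {i : ι} (hi : μ < ev i) :
    specProj A (μ : EReal) (b i) = 0 := by
  classical
  rw [h.specProj_eq, diagOp_apply_self b ⟨1, fun i => by split_ifs <;> simp⟩, if_neg, zero_smul]
  exact_mod_cast hi.not_ge

theorem specProj_apply (h : IsEigenbasis A b ev) (μ : ℝ) (u : H) :
    specProj A (μ : EReal) u = ∑ i ∈ (h.finite μ).toFinset, ⟪b i, u⟫_ℂ • b i := by
  classical
  have h1 := (specProj A (μ : EReal)).hasSum (hasSum_inner_smul b u)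
  have h2 : ∀ i, specProj A (μ : EReal) (⟪b i, u⟫_ℂ • b i) =
      if i ∈ (h.finite μ).toFinset then ⟪b i, u⟫_ℂ • b i else 0 := by
    intro i
    rw [map_smul]
    split_ifs with hi
    · rw [h.specProj_basis_of_le (by simpa using hi)]
    · rw [h.specProj_basis_of_lt (by simpa using hi), smul_zero]
  rw [funext h2] at h1
  have h3 := hasSum_sum_of_ne_finset_zero (L := .unconditional ι)
    (f := fun i => if i ∈ (h.finite μ).toFinset then ⟪b i, u⟫_ℂ • b i else 0)
    (s := (h.finite μ).toFinset) (fun i hi => if_neg hi)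
  rw [h1.unique h3]
  exact Finset.sum_congr rfl fun i hi => if_pos hi

theorem specProj_mul_self (h : IsEigenbasis A b ev) (μ : ℝ) :
    specProj A (μ : EReal) * specProj A (μ : EReal) = specProj A (μ : EReal) := by
  refine hilbertBasis_clm_ext b fun i => ?_
  rw [mul_apply_eq_comp]
  rcases le_or_gt (ev i) μ with hi | hi
  · rw [h.specProj_basis_of_le hi, h.specProj_basis_of_le hi]
  · rw [h.specProj_basis_of_lt hi, map_zero]

theorem specProj_symm (h : IsEigenbasis A b ev) (μ : ℝ) (u v : H) :
    ⟪specProj A (μ : EReal) u, v⟫_ℂ = ⟪u, specProj A (μ : EReal) v⟫_ℂ := by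
  classical
  rw [h.specProj_eq, diagOp_symm b ⟨1, fun i => by split_ifs <;> simp⟩]
  congr 3
  ext i
  split_ifs <;> simp

theorem numBelow_eq_finrank (h : IsEigenbasis A b ev) (μ : ℝ) :
    numBelow A μ = Module.finrank ℂ (LinearMap.range (specProj A (μ : EReal) : H →ₗ[ℂ] H)) := by
  have hfin := (h.finite μ).fintype
  have hli : LinearIndependent ℂ (fun i : {i | ev i ≤ μ} => b i) :=
    b.orthonormal.linearIndependent.comp _ Subtype.val_injective
  have hr : LinearMap.range (specProj A (μ : EReal) : H →ₗ[ℂ] H) =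
      Submodule.span ℂ (Set.range fun i : {i | ev i ≤ μ} => b i) := by
    apply le_antisymm
    · rintro _ ⟨u, rfl⟩
      rw [ContinuousLinearMap.coe_coe, h.specProj_apply]
      refine Submodule.sum_mem _ fun i hi => Submodule.smul_mem _ _ (Submodule.subset_span ?_)
      exact ⟨⟨i, by simpa using hi⟩, rfl⟩
    · rw [Submodule.span_le]
      rintro _ ⟨⟨i, hi⟩, rfl⟩
      exact ⟨b i, h.specProj_basis_of_le hi⟩
  rw [h.numBelow_eq, hr, finrank_span_eq_card hli, ← _root_.Nat.card_coe_set_eq,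
    Nat.card_eq_fintype_card]

end IsEigenbasis

/-- Projectors that are conjugated by the intertwiner have the same rank. -/
theorem finrank_range_eq {P Q : H →L[ℂ] H} (hP : P * P = P) (hQ : Q * Q = Q)
    (hG : IsUnit (intertwiner P Q)) :
    Module.finrank ℂ (LinearMap.range (Q : H →ₗ[ℂ] H)) =
      Module.finrank ℂ (LinearMap.range (P : H →ₗ[ℂ] H)) := by
  obtain ⟨U, hU⟩ := hG
  have hinj : Function.Injective ((intertwiner P Q : H →L[ℂ] H) : H →ₗ[ℂ] H) := by
    intro x y hxy
    have h1 : ∀ z, (↑U⁻¹ : H →L[ℂ] H) (intertwiner P Q z) = z := fun z => by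
      rw [← hU, ← mul_apply_eq_comp, U.inv_mul]; rfl
    rw [← h1 x, ← h1 y]
    exact congrArg _ hxy
  have hmap : LinearMap.range (Q : H →ₗ[ℂ] H) =
      (LinearMap.range (P : H →ₗ[ℂ] H)).map ((intertwiner P Q : H →L[ℂ] H) : H →ₗ[ℂ] H) := by
    have hcomm : ∀ x, Q (intertwiner P Q x) = intertwiner P Q (P x) := fun x => by
      rw [← mul_apply_eq_comp, mul_intertwiner hP hQ, mul_apply_eq_comp]
    ext y
    constructor
    · rintro ⟨x, rfl⟩
      refine ⟨P ((↑U⁻¹ : H →L[ℂ] H) x), ⟨_, rfl⟩, ?_⟩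
      have h1 : intertwiner P Q ((↑U⁻¹ : H →L[ℂ] H) x) = x := by
        rw [← hU, ← mul_apply_eq_comp, U.mul_inv]; rfl
      have h2 := hcomm ((↑U⁻¹ : H →L[ℂ] H) x)
      rw [h1] at h2
      exact h2.symm
    · rintro ⟨_, ⟨x, rfl⟩, rfl⟩
      exact ⟨intertwiner P Q x, hcomm x⟩
  rw [hmap]
  exact (Submodule.equivMapOfInjective _ hinj _).finrank_eq.symm

/-- The trace of an operator with values in the range of a projector `Q`, computed by conjugating `Q`
with a nearby projector `P`. -/
theorem hasTrace_conj {P Q T : H →L[ℂ] H} {s : Finset ι} (hP : P * P = P) (hQ : Q * Q = Q)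
    (hG : IsUnit (intertwiner P Q)) (hs : ∀ u, P u = ∑ i ∈ s, ⟪b i, u⟫_ℂ • b i)
    (hT : ∀ u, (Q u, T u) ∈ A.graph) :
    HasTrace A Q (∑ i ∈ s, ⟪b i, (Ring.inverse (intertwiner P Q) * T * intertwiner P Q) (b i)⟫_ℂ) := by
  obtain ⟨U, hU⟩ := hG
  have hinv : Ring.inverse (intertwiner P Q) = ↑U⁻¹ := by rw [← hU, Ring.inverse_unit]
  have hTQ : ∀ u, T (Q u) = T u := fun u =>
    A.mem_graph_snd_inj (hT (Q u)) (hT u) (by rw [← mul_apply_eq_comp, hQ])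
  have h1 : ∀ u, T u = ∑ i ∈ s, ⟪ContinuousLinearMap.adjoint (↑U⁻¹ : H →L[ℂ] H) (b i), u⟫_ℂ •
      T (intertwiner P Q (b i)) := by
    intro u
    have h2 : Q u = intertwiner P Q (P ((↑U⁻¹ : H →L[ℂ] H) u)) := by
      rw [← mul_apply_eq_comp (intertwiner P Q), ← mul_intertwiner hP hQ, mul_apply_eq_comp,
        ← mul_apply_eq_comp (intertwiner P Q), ← hU, U.mul_inv]
      rfl
    rw [← hTQ, h2, hs]
    simp only [map_sum, map_smul, ContinuousLinearMap.adjoint_inner_left]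
  have h3 := hasTrace_of_finite_rank hT h1
  convert h3 using 2 with i
  rw [hinv, ContinuousLinearMap.adjoint_inner_left]
  rfl

end Spectral

/-- Mixed second line derivatives of a `C²` function commute. -/
theorem lineDeriv_lineDeriv_comm {E G : Type*} [NormedAddCommGroup E] [NormedSpace ℝ E]
    [NormedAddCommGroup G] [NormedSpace ℝ G] {f : E → G} {x : E} (hf : ContDiffAt ℝ 2 f x)
    (v w : E) : lineDeriv ℝ (fun y => lineDeriv ℝ f y v) x w =
      lineDeriv ℝ (fun y => lineDeriv ℝ f y w) x v := by
  have h1 : ∀ᶠ y in 𝓝 x, DifferentiableAt ℝ f y :=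
    (hf.eventually (by decide)).mono fun y hy => hy.differentiableAt (by norm_num)
  have h2 : DifferentiableAt ℝ (fderiv ℝ f) x :=
    (hf.fderiv_right (m := 1) (by norm_num)).differentiableAt (by norm_num)
  have h3 : ∀ v w : E, lineDeriv ℝ (fun y => lineDeriv ℝ f y v) x w =
      fderiv ℝ (fderiv ℝ f) x w v := by
    intro v w
    have e1 : (fun y => lineDeriv ℝ f y v) =ᶠ[𝓝 x] fun y => fderiv ℝ f y v := by
      filter_upwards [h1] with y hy
      exact hy.lineDeriv_eq_fderiv
    rw [e1.lineDeriv_eq]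
    have h4 : HasFDerivAt (fun y => fderiv ℝ f y v)
        ((ContinuousLinearMap.apply ℝ G v).comp (fderiv ℝ (fderiv ℝ f) x)) x :=
      (ContinuousLinearMap.apply ℝ G v).hasFDerivAt.comp x h2.hasFDerivAt
    rw [h4.differentiableAt.lineDeriv_eq_fderiv, h4.fderiv]
    rfl
  rw [h3, h3]
  exact (hf.isSymmSndFDerivAt (by simp)).eq w v

/-! ### Derivatives of spectral projectors and of the band energy -/

section Calculus

variable {ι : Type*} {H : Type*} [NormedAddCommGroup H] [InnerProductSpace ℂ H] [CompleteSpace H]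

theorem hasDerivAt_clm_apply {T : ℝ → H →L[ℂ] H} {T' : H →L[ℂ] H} {t : ℝ}
    (h : HasDerivAt T T' t) (u : H) : HasDerivAt (fun s => T s u) (T' u) t :=
  ((ContinuousLinearMap.apply ℂ H u).restrictScalars ℝ).hasFDerivAt.comp_hasDerivAt t h

/-- The trace of a bounded operator compressed to the span of finitely many basis vectors. -/
def cornerTrace (b : HilbertBasis ι ℂ H) (s : Finset ι) : (H →L[ℂ] H) →L[ℝ] ℂ :=
  ∑ i ∈ s, ((innerSL ℂ (b i)).restrictScalars ℝ).comp
    ((ContinuousLinearMap.apply ℂ H (b i)).restrictScalars ℝ)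

theorem cornerTrace_apply (b : HilbertBasis ι ℂ H) (s : Finset ι) (T : H →L[ℂ] H) :
    cornerTrace b s T = ∑ i ∈ s, ⟪b i, T (b i)⟫_ℂ := by
  simp [cornerTrace]

end Calculus

namespace RegularFamily

open QuadFamily

universe u

variable {E : Type*} {𝓗 : Type u} [NormedAddCommGroup E] [InnerProductSpace ℝ E]
  [NormedAddCommGroup 𝓗] [InnerProductSpace ℂ 𝓗] [CompleteSpace 𝓗]

/-- The spectral projector of `H k` below the fixed level `μ`. -/
def proj (F : RegularFamily E 𝓗) (μ : ℝ) (k : E) : 𝓗 →L[ℂ] 𝓗 := specProj (F.op k) (μ : EReal)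

/-- The bounded operator `(H k + c) 𝟙(H k ≤ μ)`. -/
def lamProj (F : RegularFamily E 𝓗) (μ : ℝ) (k : E) : 𝓗 →L[ℂ] 𝓗 :=
  Ring.inverse (F.R k * F.proj μ k + (1 - F.proj μ k)) * F.proj μ k

/-- The bounded operator `H k 𝟙(H k ≤ μ)`. -/
def hamProj (F : RegularFamily E 𝓗) (μ : ℝ) (k : E) : 𝓗 →L[ℂ] 𝓗 :=
  F.lamProj μ k - F.c • F.proj μ k

/-- The bounded operator `∂ᵥH(k) 𝟙(H k ≤ μ)`. -/
def gradProj (F : RegularFamily E 𝓗) (μ : ℝ) (k v : E) : 𝓗 →L[ℂ] 𝓗 :=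
  F.gradR k v * F.lamProj μ k

/-- The derivative `∂ᵥH(k)` as a partially defined operator with domain `D`. -/
def gradOp (F : RegularFamily E 𝓗) (k v : E) : 𝓗 →ₗ.[ℂ] 𝓗 := ⟨F.D, F.grad k v⟩

variable {F : RegularFamily E 𝓗}

theorem proj_mul_self (F : RegularFamily E 𝓗) (μ : ℝ) (k : E) :
    F.proj μ k * F.proj μ k = F.proj μ k := by
  obtain ⟨ι, b, ev, h⟩ := exists_isEigenbasis F k
  exact h.specProj_mul_self μ

theorem proj_proj (F : RegularFamily E 𝓗) (μ : ℝ) (k : E) (u : 𝓗) :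
    F.proj μ k (F.proj μ k u) = F.proj μ k u := by
  rw [← mul_apply_eq_comp, proj_mul_self]

theorem proj_symm (F : RegularFamily E 𝓗) (μ : ℝ) (k : E) (u v : 𝓗) :
    ⟪F.proj μ k u, v⟫_ℂ = ⟪u, F.proj μ k v⟫_ℂ := by
  obtain ⟨ι, b, ev, h⟩ := exists_isEigenbasis F k
  exact h.specProj_symm μ u v

section

variable {ι : Type*} {k : E} {b : HilbertBasis ι ℂ 𝓗} {ev : ι → ℝ} {μ : ℝ}

theorem denominator_lamProj (h : IsEigenbasis (F.op k) b ev) :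
    IsUnit (F.R k * F.proj μ k + (1 - F.proj μ k)) ∧ ∀ i, ev i ≤ μ →
      Ring.inverse (F.R k * F.proj μ k + (1 - F.proj μ k)) (b i) =
        ((ev i + F.c : ℝ) : ℂ) • b i := by
  let m : ι → ℂ := fun i => if ev i ≤ μ then (((ev i + F.c)⁻¹ : ℝ) : ℂ) else 1
  have h0 : ∀ i, ev i + F.c ≠ 0 := fun i => by
    have := one_le_ev h i
    linarith
  have hm : ∀ i, (F.R k * F.proj μ k + (1 - F.proj μ k)) (b i) = m i • b i := by
    intro i
    rw [add_apply, mul_apply_eq_comp, sub_apply]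
    by_cases hi : ev i ≤ μ
    · simp only [m, if_pos hi]
      rw [proj, h.specProj_basis_of_le hi, R_basis h]
      simp
    · simp only [m, if_neg hi]
      rw [proj, h.specProj_basis_of_lt (not_le.1 hi)]
      simp
  have hK : ∀ i, ‖(m i)⁻¹‖ ≤ max (μ + F.c) 1 := by
    intro i
    by_cases hi : ev i ≤ μ
    · simp only [m, if_pos hi]
      rw [Complex.ofReal_inv, inv_inv, Complex.norm_real, Real.norm_of_nonneg]
      · exact (by linarith : ev i + F.c ≤ μ + F.c).trans (le_max_left _ _)
      · linarith [one_le_ev h i]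
    · simp only [m, if_neg hi]
      simp
  obtain ⟨h1, h2⟩ := inverse_eq_diagOp b hm (fun i => by
    simp only [m]
    split_ifs
    · rw [Complex.ofReal_ne_zero]; exact inv_ne_zero (h0 i)
    · exact one_ne_zero) ⟨_, hK⟩
  refine ⟨h1, fun i hi => ?_⟩
  rw [h2, diagOp_apply_self b ⟨_, hK⟩]
  simp only [m, if_pos hi]
  rw [Complex.ofReal_inv, inv_inv]

theorem lamProj_basis (h : IsEigenbasis (F.op k) b ev) {i : ι} (hi : ev i ≤ μ) :
    F.lamProj μ k (b i) = ((ev i + F.c : ℝ) : ℂ) • b i := by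
  rw [lamProj, mul_apply_eq_comp, proj, h.specProj_basis_of_le hi]
  exact (denominator_lamProj h).2 i hi

theorem R_lamProj (F : RegularFamily E 𝓗) (k : E) (u : 𝓗) :
    F.R k (F.lamProj μ k u) = F.proj μ k u := by
  obtain ⟨ι, b, ev, h⟩ := exists_isEigenbasis F k
  have : F.R k * F.lamProj μ k = F.proj μ k := by
    refine hilbertBasis_clm_ext b fun i => ?_
    rw [mul_apply_eq_comp]
    rcases le_or_gt (ev i) μ with hi | hi
    · rw [lamProj_basis h hi, map_smul, R_basis h, smul_smul, proj, h.specProj_basis_of_le hi,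
        ← Complex.ofReal_mul, mul_inv_cancel₀, Complex.ofReal_one, one_smul]
      linarith [one_le_ev h i]
    · rw [lamProj, mul_apply_eq_comp, proj, h.specProj_basis_of_lt hi, map_zero, map_zero]
  rw [← this, mul_apply_eq_comp]

theorem proj_mem (F : RegularFamily E 𝓗) (k : E) (u : 𝓗) :
    F.proj μ k u ∈ F.D := by
  rw [← R_lamProj F]
  exact F.R_mem _ _

theorem Rd_lamProj (F : RegularFamily E 𝓗) (k : E) (u : 𝓗) :
    F.Rd k (F.lamProj μ k u) = ⟨F.proj μ k u, proj_mem F k u⟩ :=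
  Subtype.ext (R_lamProj F k u)

theorem ham_proj (F : RegularFamily E 𝓗) (k : E) (u : 𝓗) :
    F.ham k ⟨F.proj μ k u, proj_mem F k u⟩ = F.hamProj μ k u := by
  rw [ham_eq, ← Rd_lamProj F, lam_Rd, coe_Rd, R_lamProj F]
  rfl

theorem grad_proj (F : RegularFamily E 𝓗) (k v : E) (u : 𝓗) :
    F.grad k v ⟨F.proj μ k u, proj_mem F k u⟩ = F.gradProj μ k v u := by
  rw [← Rd_lamProj F]
  rfl

theorem hamProj_graph (F : RegularFamily E 𝓗) (k : E) (u : 𝓗) :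
    (F.proj μ k u, F.hamProj μ k u) ∈ (F.op k).graph :=
  mem_graph_op.2 ⟨proj_mem F k u, ham_proj F k u⟩

theorem gradProj_graph (F : RegularFamily E 𝓗) (k v : E) (u : 𝓗) :
    (F.proj μ k u, F.gradProj μ k v u) ∈ (F.gradOp k v).graph := by
  rw [LinearPMap.mem_graph_iff]
  exact ⟨⟨_, proj_mem F k u⟩, rfl, grad_proj F k v u⟩

theorem contDiffAt_lamProj (hP : ContDiffAt ℝ 2 (F.proj μ) k) :
    ContDiffAt ℝ 2 (F.lamProj μ) k := by
  obtain ⟨ι, b, ev, h⟩ := exists_isEigenbasis F k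
  obtain ⟨U, hU⟩ := (denominator_lamProj h).1
  have h1 : ContDiffAt ℝ 2 (fun k => F.R k * F.proj μ k + (1 - F.proj μ k)) k :=
    (((contDiff_infty.1 contDiff_R 2).contDiffAt).mul hP).add (contDiffAt_const.sub hP)
  have h2 := contDiffAt_ringInverse (n := 2) ℝ U
  rw [hU] at h2
  have h3 : ContDiffAt ℝ 2 (fun k => Ring.inverse (F.R k * F.proj μ k + (1 - F.proj μ k))) k :=
    ContDiffAt.comp (g := Ring.inverse) (f := fun k => F.R k * F.proj μ k + (1 - F.proj μ k)) k h2 h1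
  exact h3.mul hP

theorem contDiffAt_hamProj (hP : ContDiffAt ℝ 2 (F.proj μ) k) :
    ContDiffAt ℝ 2 (F.hamProj μ) k :=
  (contDiffAt_lamProj hP).sub (hP.const_smul F.c)

theorem contDiffAt_gradProj (hP : ContDiffAt ℝ 2 (F.proj μ) k) (v : E) :
    ContDiffAt ℝ 2 (fun k => F.gradProj μ k v) k :=
  ((contDiff_infty.1 (contDiff_gradR v) 2).contDiffAt).mul (contDiffAt_lamProj hP)

/-! ### Traces near a base point -/

/-- The intertwiner of the projectors at `k` and at `k'`. -/
def twist (F : RegularFamily E 𝓗) (μ : ℝ) (k k' : E) : 𝓗 →L[ℂ] 𝓗 :=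
  intertwiner (F.proj μ k) (F.proj μ k')

theorem twist_self (F : RegularFamily E 𝓗) (μ : ℝ) (k : E) : F.twist μ k k = 1 :=
  intertwiner_self (proj_mul_self F μ k)

theorem contDiffAt_twist (hP : ContDiffAt ℝ 2 (F.proj μ) k) : ContDiffAt ℝ 2 (F.twist μ k) k :=
  (hP.mul contDiffAt_const).add ((contDiffAt_const.sub hP).mul contDiffAt_const)

theorem eventually_isUnit_twist (hP : ContDiffAt ℝ 2 (F.proj μ) k) :
    ∀ᶠ k' in 𝓝 k, IsUnit (F.twist μ k k') := by
  have h1 := (contDiffAt_twist hP).continuousAt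
  have h2 : {x : 𝓗 →L[ℂ] 𝓗 | IsUnit x} ∈ 𝓝 (F.twist μ k k) := by
    rw [twist_self]
    exact Units.isOpen.mem_nhds isUnit_one
  exact h1 h2

/-- The number of eigenvalues below `μ` is locally constant as long as `μ` is not an eigenvalue. -/
theorem eventually_numBelow (hP : ContDiffAt ℝ 2 (F.proj μ) k) :
    ∀ᶠ k' in 𝓝 k, numBelow (F.op k') μ = numBelow (F.op k) μ := by
  filter_upwards [eventually_isUnit_twist hP] with k' hk'
  obtain ⟨ι, b, ev, h⟩ := exists_isEigenbasis F k
  obtain ⟨ι', b', ev', h'⟩ := exists_isEigenbasis F k'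
  rw [h.numBelow_eq_finrank, h'.numBelow_eq_finrank]
  exact finrank_range_eq (proj_mul_self F μ k) (proj_mul_self F μ k') hk'

theorem eventually_hasTrace (h : IsEigenbasis (F.op k) b ev) (hP : ContDiffAt ℝ 2 (F.proj μ) k)
    {A : E → 𝓗 →ₗ.[ℂ] 𝓗} {T : E → 𝓗 →L[ℂ] 𝓗}
    (hT : ∀ k' u, (F.proj μ k' u, T k' u) ∈ (A k').graph) :
    ∀ᶠ k' in 𝓝 k, HasTrace (A k') (F.proj μ k') (cornerTrace b (h.finite μ).toFinset
      (Ring.inverse (F.twist μ k k') * T k' * F.twist μ k k')) := by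
  filter_upwards [eventually_isUnit_twist hP] with k' hk'
  rw [cornerTrace_apply]
  exact hasTrace_conj (proj_mul_self F μ k) (proj_mul_self F μ k') hk' (h.specProj_apply μ) (hT k')

theorem hasTrace_base (h : IsEigenbasis (F.op k) b ev) {A : 𝓗 →ₗ.[ℂ] 𝓗} {T : 𝓗 →L[ℂ] 𝓗}
    (hT : ∀ u, (F.proj μ k u, T u) ∈ A.graph) :
    HasTrace A (F.proj μ k) (cornerTrace b (h.finite μ).toFinset T) := by
  rw [cornerTrace_apply]
  refine hasTrace_of_finite_rank hT fun u => ?_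
  have h1 : T (F.proj μ k u) = T u :=
    A.mem_graph_snd_inj (hT (F.proj μ k u)) (hT u) (proj_proj F μ k u)
  rw [← h1, proj, h.specProj_apply, map_sum]
  simp

theorem contDiffAt_tr (hP : ContDiffAt ℝ 2 (F.proj μ) k)
    {A : E → 𝓗 →ₗ.[ℂ] 𝓗} {T : E → 𝓗 →L[ℂ] 𝓗} (hT2 : ContDiffAt ℝ 2 T k)
    (hT : ∀ k' u, (F.proj μ k' u, T k' u) ∈ (A k').graph) :
    ContDiffAt ℝ 2 (fun k' => tr (A k') (F.proj μ k')) k := by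
  obtain ⟨ι, b, ev, h⟩ := exists_isEigenbasis F k
  have hI : ContDiffAt ℝ 2 (fun k' => Ring.inverse (F.twist μ k k')) k := by
    refine ContDiffAt.comp (g := Ring.inverse) (f := F.twist μ k) k ?_ (contDiffAt_twist hP)
    rw [twist_self]
    exact contDiffAt_ringInverse (n := 2) ℝ (1 : (𝓗 →L[ℂ] 𝓗)ˣ)
  refine ContDiffAt.congr_of_eventuallyEq
    ((cornerTrace b (h.finite μ).toFinset).contDiff.contDiffAt.comp k
      ((hI.mul hT2).mul (contDiffAt_twist hP))) ?_
  filter_upwards [eventually_hasTrace h hP hT] with k' hk'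
  exact hk'.tr_eq

end

/-! ### The derivative of the projector -/

theorem hasDerivAt_ham (k v : E) (u : F.D) :
    HasDerivAt (fun t : ℝ => F.ham (k + t • v) u) (F.grad k v u) 0 := by
  have h1 : (fun t : ℝ => F.ham (k + t • v) u) = fun t : ℝ => F.ham k u + t • F.grad k v u +
      (t ^ 2 * (‖v‖ ^ 2 / 2)) • (u : 𝓗) := by
    ext1 t
    rw [ham_add, grad_smul, norm_smul, mul_pow, Real.norm_eq_abs, sq_abs, mul_div_assoc]
    rfl
  rw [h1]
  have h2 := (((hasDerivAt_id (0 : ℝ)).smul_const (F.grad k v u)).const_add (F.ham k u)).add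
    (((hasDerivAt_pow 2 (0 : ℝ)).mul_const (‖v‖ ^ 2 / 2)).smul_const (u : 𝓗))
  refine HasDerivAt.congr_deriv (f := fun t : ℝ => F.ham k u + t • F.grad k v u +
      (t ^ 2 * (‖v‖ ^ 2 / 2)) • (u : 𝓗)) h2 ?_
  simp

theorem hasDerivAt_grad (k v w : E) (u : F.D) :
    HasDerivAt (fun t : ℝ => F.grad (k + t • v) w u) ((⟪v, w⟫_ℝ : ℝ) • (u : 𝓗)) 0 := by
  have h1 : (fun t : ℝ => F.grad (k + t • v) w u) = fun t : ℝ => F.grad k w u +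
      (t * ⟪v, w⟫_ℝ) • (u : 𝓗) := by
    ext1 t
    rw [grad_add_left, inner_smul_left]
    rfl
  rw [h1]
  have h2 := (((hasDerivAt_id (0 : ℝ)).mul_const ⟪v, w⟫_ℝ).smul_const (u : 𝓗)).const_add
    (F.grad k w u)
  simpa using h2

section

variable {ι : Type*} {k v : E} {b : HilbertBasis ι ℂ 𝓗} {ev : ι → ℝ} {μ : ℝ} {P' : 𝓗 →L[ℂ] 𝓗}

theorem dproj_symm (hd : HasLineDerivAt ℝ (F.proj μ) P' k v) (u w : 𝓗) :
    ⟪P' u, w⟫_ℂ = ⟪u, P' w⟫_ℂ := by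
  have h1 := (hasDerivAt_clm_apply hd u).inner ℂ (hasDerivAt_const (0 : ℝ) w)
  have h2 := (hasDerivAt_const (0 : ℝ) u).inner ℂ (hasDerivAt_clm_apply hd w)
  have h3 : (fun t : ℝ => ⟪F.proj μ (k + t • v) u, w⟫_ℂ) =
      fun t : ℝ => ⟪u, F.proj μ (k + t • v) w⟫_ℂ := by
    ext1 t; exact proj_symm F μ _ u w
  rw [h3] at h1
  have h4 := h1.unique h2
  simpa using h4

theorem dproj_leibniz (hd : HasLineDerivAt ℝ (F.proj μ) P' k v) :
    P' * F.proj μ k + F.proj μ k * P' = P' := by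
  have h1 := HasDerivAt.mul hd hd
  have h2 : ((fun t : ℝ => F.proj μ (k + t • v)) * fun t : ℝ => F.proj μ (k + t • v)) =
      fun t : ℝ => F.proj μ (k + t • v) := by
    ext1 t; exact proj_mul_self F μ _
  rw [h2] at h1
  have h3 := h1.unique hd
  simpa using h3

theorem proj_dproj_proj (hd : HasLineDerivAt ℝ (F.proj μ) P' k v) (u : 𝓗) :
    F.proj μ k (P' (F.proj μ k u)) = 0 := by
  have h1 := congrArg (fun T => (F.proj μ k * T * F.proj μ k) u) (dproj_leibniz hd)
  simp only [mul_add, add_mul, add_apply, mul_apply_eq_comp, proj_proj] at h1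
  simpa using h1

theorem dproj_offDiag (hd : HasLineDerivAt ℝ (F.proj μ) P' k v) :
    offDiag (F.proj μ k) P' = P' := by
  ext u
  have h1 := proj_dproj_proj hd u
  have h2 := congrArg (fun T : 𝓗 →L[ℂ] 𝓗 => T u) (dproj_leibniz hd)
  simp only [add_apply, mul_apply_eq_comp] at h2
  simp only [offDiag, add_apply, ContinuousLinearMap.comp_apply, sub_apply, map_sub, h1]
  rw [show (1 : 𝓗 →L[ℂ] 𝓗) u = u from rfl, show ∀ x, (1 : 𝓗 →L[ℂ] 𝓗) x = x from fun _ => rfl]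
  rw [sub_zero, sub_zero, add_comm]
  exact h2

theorem inner_ham_proj (F : RegularFamily E 𝓗) (μ : ℝ) (k : E) (u w : F.D) :
    ⟪F.ham k u, F.proj μ k w⟫_ℂ = ⟪(u : 𝓗), F.proj μ k (F.ham k w)⟫_ℂ := by
  obtain ⟨ι, b, ev, h⟩ := exists_isEigenbasis F k
  rw [proj, h.specProj_apply, h.specProj_apply, inner_sum, inner_sum]
  refine Finset.sum_congr rfl fun i _ => ?_
  have h1 := h.inner_graph (mem_graph_op_coe u) i
  have h2 := h.inner_graph (mem_graph_op_coe w) i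
  rw [inner_smul_right, inner_smul_right, h2, ← inner_conj_symm _ (b i), h1, map_mul,
    Complex.conj_ofReal, inner_conj_symm]
  ring

/-- First order perturbation theory: the off-diagonal matrix elements of the derivative of the
projector. -/
theorem inner_dproj (h : IsEigenbasis (F.op k) b ev) (hd : HasLineDerivAt ℝ (F.proj μ) P' k v)
    {i j : ι} (hi : ev i ≤ μ) (hj : μ < ev j) :
    ((ev j : ℂ) - ev i) * ⟪b j, P' (b i)⟫_ℂ = -⟪b j, F.grad k v ⟨b i, basis_mem h i⟩⟫_ℂ := by
  obtain ⟨hbi, hi'⟩ := mem_graph_op.1 (h.mem i)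
  obtain ⟨hbj, hj'⟩ := mem_graph_op.1 (h.mem j)
  have h1 := (hasDerivAt_ham k v (⟨b j, hbj⟩ : F.D)).inner ℂ (hasDerivAt_clm_apply hd (b i))
  have h3 : (fun t : ℝ => ⟪F.ham (k + t • v) (⟨b j, hbj⟩ : F.D), F.proj μ (k + t • v) (b i)⟫_ℂ) =
      fun t : ℝ => ⟪F.proj μ (k + t • v) (b j), F.ham (k + t • v) (⟨b i, hbi⟩ : F.D)⟫_ℂ := by
    ext1 t
    rw [proj_symm]
    exact inner_ham_proj F μ _ ⟨b j, hbj⟩ ⟨b i, hbi⟩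
  have h2 := (hasDerivAt_clm_apply hd (b j)).inner ℂ (hasDerivAt_ham k v (⟨b i, hbi⟩ : F.D))
  rw [h3] at h1
  have h4 := h1.unique h2
  simp only [zero_smul, add_zero] at h4
  rw [hi', hj', proj, h.specProj_basis_of_le hi, h.specProj_basis_of_lt hj, inner_zero_left,
    zero_add, inner_smul_right, inner_smul_left, Complex.conj_ofReal, dproj_symm hd,
    grad_symm k v ⟨b j, hbj⟩ ⟨b i, hbi⟩] at h4
  rw [sub_mul, sub_eq_iff_eq_add, ← h4]
  abel

/-- The derivative at the base point of the trace of a family of operators that factor through the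
projector. -/
theorem hasLineDerivAt_tr (h : IsEigenbasis (F.op k) b ev) (hP : ContDiffAt ℝ 2 (F.proj μ) k)
    (hd : HasLineDerivAt ℝ (F.proj μ) P' k v)
    {A : E → 𝓗 →ₗ.[ℂ] 𝓗} {T : E → 𝓗 →L[ℂ] 𝓗} {T' : 𝓗 →L[ℂ] 𝓗}
    (hT2 : HasLineDerivAt ℝ T T' k v)
    (hT : ∀ k' u, (F.proj μ k' u, T k' u) ∈ (A k').graph) :
    HasLineDerivAt ℝ (fun k' => tr (A k') (F.proj μ k'))
      (∑ i ∈ (h.finite μ).toFinset, (⟪b i, T' (b i)⟫_ℂ + ⟪P' (b i), T k (b i)⟫_ℂ)) k v := by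
  set s := (h.finite μ).toFinset with hs
  set P := F.proj μ k with hPdef
  have e0 : k + (0 : ℝ) • v = k := by simp
  -- the intertwiner and its inverse
  have hG : HasDerivAt (fun t : ℝ => F.twist μ k (k + t • v)) (P' * P + -P' * (1 - P)) 0 := by
    have h1 := (HasDerivAt.mul_const hd P).add ((HasDerivAt.const_sub 1 hd).mul_const (1 - P))
    exact h1
  have hI : HasDerivAt (fun t : ℝ => Ring.inverse (F.twist μ k (k + t • v)))
      (-(P' * P + -P' * (1 - P))) 0 := by
    have h1 := hasFDerivAt_ringInverse (𝕜 := ℝ) (1 : (𝓗 →L[ℂ] 𝓗)ˣ)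
    have h2 : ((1 : (𝓗 →L[ℂ] 𝓗)ˣ) : 𝓗 →L[ℂ] 𝓗) = F.twist μ k (k + (0 : ℝ) • v) := by
      rw [e0, twist_self]; rfl
    rw [h2] at h1
    have h3 := h1.comp_hasDerivAt (0 : ℝ) hG
    refine HasDerivAt.congr_deriv h3 ?_
    simp
  have hT2' : HasDerivAt (fun t : ℝ => T (k + t • v)) T' 0 := hT2
  have h5 := (cornerTrace b s).hasFDerivAt.comp_hasDerivAt (0 : ℝ) ((hI.mul hT2').mul hG)
  have hlim : Tendsto (fun t : ℝ => k + t • v) (𝓝 0) (𝓝 k) := by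
    have : Continuous fun t : ℝ => k + t • v := by fun_prop
    simpa using this.tendsto 0
  have h6 : HasDerivAt (fun t : ℝ => tr (A (k + t • v)) (F.proj μ (k + t • v))) _ 0 :=
    h5.congr_of_eventuallyEq (by
      filter_upwards [hlim.eventually (eventually_hasTrace h hP hT)] with t ht
      exact ht.tr_eq)
  refine h6.congr_deriv ?_
  rw [cornerTrace_apply]
  refine Finset.sum_congr rfl fun i hi => ?_
  have hi' : ev i ≤ μ := by simpa [hs] using hi
  have hPb : P (b i) = b i := h.specProj_basis_of_le hi'
  have hTP : ∀ u, T k (P u) = T k u := fun u =>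
    (A k).mem_graph_snd_inj (hT k (P u)) (hT k u) (proj_proj F μ k u)
  have hone : ∀ x, (1 : 𝓗 →L[ℂ] 𝓗) x = x := fun _ => rfl
  have hPP' : P (P' (b i)) = 0 := by
    have := proj_dproj_proj hd (b i)
    rwa [← hPdef, hPb] at this
  have hTP' : T k (P' (b i)) = 0 := by rw [← hTP, hPP', map_zero]
  have hin : ⟪b i, P' (P (T k (b i)))⟫_ℂ = 0 := by
    have h1 := proj_dproj_proj hd (T k (b i))
    nth_rewrite 1 [← hPb]
    rw [hPdef, proj_symm]
    rw [← hPdef, h1, inner_zero_right]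
  have e1 : ⟪P' (b i), T k (b i)⟫_ℂ = ⟪b i, P' (T k (b i))⟫_ℂ := dproj_symm hd _ _
  simp only [Pi.mul_apply, e0, twist_self, Ring.inverse_one, one_mul, mul_one, add_apply,
    mul_apply_eq_comp, sub_apply, neg_apply, hPb, hone, sub_self, map_zero, neg_zero, add_zero,
    hTP', map_sub, inner_add_right, inner_sub_right, inner_neg_right, hin, e1]
  ring

theorem hasLineDerivAt_energy (h : IsEigenbasis (F.op k) b ev)
    (hP : ContDiffAt ℝ 2 (F.proj μ) k) (v : E) :
    HasLineDerivAt ℝ (fun k' => tr (F.op k') (F.proj μ k'))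
      (tr (F.gradOp k v) (F.proj μ k)) k v := by
  have hd := (hP.differentiableAt (by norm_num)).lineDifferentiableAt (v := v) |>.hasLineDerivAt
  set P' := lineDeriv ℝ (F.proj μ) k v
  have hT := ((contDiffAt_hamProj hP).differentiableAt
    (by norm_num)).lineDifferentiableAt (v := v) |>.hasLineDerivAt
  set T' := lineDeriv ℝ (F.hamProj μ) k v
  have h1 := hasLineDerivAt_tr h hP hd hT (hamProj_graph F)
  have h2 := hasTrace_base (μ := μ) h (gradProj_graph F k v)
  rw [h2.tr_eq]
  convert h1 using 1
  rw [cornerTrace_apply]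
  refine Finset.sum_congr rfl fun i hi => ?_
  have hi' : ev i ≤ μ := by simpa using hi
  have hPb : F.proj μ k (b i) = b i := h.specProj_basis_of_le hi'
  obtain ⟨hbi, hbi'⟩ := mem_graph_op.1 (h.mem i)
  have hPd : ⟪b i, P' (b i)⟫_ℂ = 0 := by
    have h1 := proj_dproj_proj hd (b i)
    rw [hPb] at h1
    nth_rewrite 1 [← hPb]
    rw [proj_symm, h1, inner_zero_right]
  have hHb : F.hamProj μ k (b i) = (ev i : ℂ) • b i := by
    rw [← ham_proj F, ← hbi']
    congr 1
    exact Subtype.ext hPb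
  have hGb : F.gradProj μ k v (b i) = F.grad k v ⟨b i, hbi⟩ := by
    rw [← grad_proj F]
    congr 1
    exact Subtype.ext hPb
  have h3 : HasDerivAt (fun t : ℝ => ⟪b i, F.hamProj μ (k + t • v) (b i)⟫_ℂ)
      ⟪b i, T' (b i)⟫_ℂ 0 := by
    have := (hasDerivAt_const (0 : ℝ) (b i)).inner ℂ (hasDerivAt_clm_apply hT (b i))
    simpa using this
  have h4 : (fun t : ℝ => ⟪b i, F.hamProj μ (k + t • v) (b i)⟫_ℂ) =
      fun t : ℝ => ⟪F.ham (k + t • v) ⟨b i, hbi⟩, F.proj μ (k + t • v) (b i)⟫_ℂ := by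
    ext1 t
    rw [← ham_proj F]
    exact (ham_symm _ (⟨b i, hbi⟩ : F.D) ⟨_, proj_mem F _ _⟩).symm
  rw [h4] at h3
  have h5 := h3.unique ((hasDerivAt_ham k v ⟨b i, hbi⟩).inner ℂ (hasDerivAt_clm_apply hd (b i)))
  simp only [zero_smul, add_zero] at h5
  rw [h5, hHb, hbi', hPb, inner_smul_left, inner_smul_right, hPd, dproj_symm hd, hPd, hGb,
    grad_symm k v ⟨b i, hbi⟩ ⟨b i, hbi⟩]
  simp

theorem hasLineDerivAt_tr_grad (h : IsEigenbasis (F.op k) b ev)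
    (hP : ContDiffAt ℝ 2 (F.proj μ) k) (hd : HasLineDerivAt ℝ (F.proj μ) P' k v) (w : E) :
    HasLineDerivAt ℝ (fun k' => tr (F.gradOp k' w) (F.proj μ k'))
      (∑ i ∈ (h.finite μ).toFinset, ((⟪v, w⟫_ℝ : ℂ) +
        ⟪F.grad k w ⟨b i, basis_mem h i⟩, P' (b i)⟫_ℂ +
        ⟪P' (b i), F.grad k w ⟨b i, basis_mem h i⟩⟫_ℂ)) k v := by
  have hT := ((contDiffAt_gradProj hP w).differentiableAt
    (by norm_num)).lineDifferentiableAt (v := v) |>.hasLineDerivAt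
  set T' := lineDeriv ℝ (fun k => F.gradProj μ k w) k v
  have h1 := hasLineDerivAt_tr h hP hd hT (fun k' u => gradProj_graph F k' w u)
  convert h1 using 1
  refine Finset.sum_congr rfl fun i hi => ?_
  have hi' : ev i ≤ μ := by simpa using hi
  have hPb : F.proj μ k (b i) = b i := h.specProj_basis_of_le hi'
  have hbi := basis_mem h i
  have hGb : F.gradProj μ k w (b i) = F.grad k w ⟨b i, hbi⟩ := by
    rw [← grad_proj F]
    congr 1
    exact Subtype.ext hPb
  have h3 : HasDerivAt (fun t : ℝ => ⟪b i, F.gradProj μ (k + t • v) w (b i)⟫_ℂ)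
      ⟪b i, T' (b i)⟫_ℂ 0 := by
    have := (hasDerivAt_const (0 : ℝ) (b i)).inner ℂ (hasDerivAt_clm_apply hT (b i))
    simpa using this
  have h4 : (fun t : ℝ => ⟪b i, F.gradProj μ (k + t • v) w (b i)⟫_ℂ) =
      fun t : ℝ => ⟪F.grad (k + t • v) w ⟨b i, hbi⟩, F.proj μ (k + t • v) (b i)⟫_ℂ := by
    ext1 t
    rw [← grad_proj F]
    exact (grad_symm _ w (⟨b i, hbi⟩ : F.D) ⟨_, proj_mem F _ _⟩).symm
  rw [h4] at h3
  have h5 := h3.unique ((hasDerivAt_grad k v w ⟨b i, hbi⟩).inner ℂ (hasDerivAt_clm_apply hd (b i)))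
  simp only [zero_smul, add_zero] at h5
  have e : ⟪(⟪v, w⟫_ℝ : ℝ) • b i, b i⟫_ℂ = (⟪v, w⟫_ℝ : ℂ) := by
    rw [← Complex.coe_smul, inner_smul_left, inner_self_eq_norm_sq_to_K, b.orthonormal.1]
    simp
  rw [h5, hPb, hGb, e]
  ring

end

end RegularFamily

/-! ### Linear differential equations -/

section LinearODE

variable {X : Type*} [NormedAddCommGroup X] [NormedSpace ℝ X] [CompleteSpace X]

/-- The terms of the Dyson series of the equation `u' = A u`, `u 0 = x`. -/
def dyson (A : ℝ → X →L[ℝ] X) (x : X) : ℕ → ℝ → X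
  | 0 => fun _ => x
  | n + 1 => fun t => ∫ s in (0 : ℝ)..t, A s (dyson A x n s)

variable {A : ℝ → X →L[ℝ] X}

theorem continuous_dyson (hA : Continuous A) (x : X) (n : ℕ) : Continuous (dyson A x n) := by
  induction n with
  | zero => exact continuous_const
  | succ n ih =>
    exact intervalIntegral.continuous_primitive
      (fun _ _ => (hA.clm_apply ih).intervalIntegrable _ _) 0

theorem hasDerivAt_dyson (hA : Continuous A) (x : X) (n : ℕ) (t : ℝ) :
    HasDerivAt (dyson A x (n + 1)) (A t (dyson A x n t)) t := by
  have h := hA.clm_apply (continuous_dyson hA x n)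
  exact intervalIntegral.integral_hasDerivAt_right (h.intervalIntegrable _ _)
    (h.stronglyMeasurableAtFilter _ _) h.continuousAt

/-- The weight `cosh (2 M t)` makes the step of the Dyson series a contraction by `1 / 2`. -/
theorem norm_dyson_le (x : X) {M T : ℝ} (hM : 0 < M)
    (hAM : ∀ t, |t| ≤ T → ‖A t‖ ≤ M) (n : ℕ) :
    ∀ t, |t| ≤ T → ‖dyson A x n t‖ ≤ ‖x‖ * (1 / 2) ^ n * Real.cosh (2 * M * t) := by
  induction n with
  | zero =>
    intro t _
    simp only [dyson, pow_zero, mul_one]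
    exact le_mul_of_one_le_right (norm_nonneg x) (Real.one_le_cosh _)
  | succ n ih =>
    intro t ht
    let g : ℝ → ℝ := fun s => ‖x‖ * (1 / 2) ^ n * (M * Real.cosh (2 * M * s))
    have hg : Continuous g := by fun_prop
    have h1 : ‖∫ s in (0 : ℝ)..t, A s (dyson A x n s)‖ ≤ |∫ s in (0 : ℝ)..t, g s| := by
      refine intervalIntegral.norm_integral_le_abs_of_norm_le ?_ (hg.intervalIntegrable _ _)
      refine (ae_restrict_iff' measurableSet_uIoc).2 (ae_of_all _ fun s hs => ?_)
      have hs' : |s| ≤ T := by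
        refine le_trans ?_ ht
        rcases le_total 0 t with h0 | h0
        · rw [Set.uIoc_of_le h0] at hs
          rw [abs_of_pos hs.1, abs_of_nonneg h0]; exact hs.2
        · rw [Set.uIoc_of_ge h0] at hs
          rw [abs_of_nonpos hs.2, abs_of_nonpos h0]; linarith [hs.1]
      refine ((A s).le_opNorm _).trans ?_
      have h2 := mul_le_mul (hAM s hs') (ih s hs') (norm_nonneg _) hM.le
      refine h2.trans (le_of_eq ?_)
      simp only [g]
      ring
    have h2 : ∫ s in (0 : ℝ)..t, g s = ‖x‖ * (1 / 2) ^ (n + 1) * Real.sinh (2 * M * t) := by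
      have h3 : ∀ s ∈ Set.uIcc 0 t, HasDerivAt
          (fun s => ‖x‖ * (1 / 2) ^ (n + 1) * Real.sinh (2 * M * s)) (g s) s := by
        intro s _
        have := (((hasDerivAt_id s).const_mul (2 * M)).sinh).const_mul (‖x‖ * (1 / 2) ^ (n + 1))
        refine this.congr_deriv ?_
        simp only [g, id]
        ring
      rw [intervalIntegral.integral_eq_sub_of_hasDerivAt h3 (hg.intervalIntegrable _ _)]
      simp
    rw [h2, abs_mul, abs_of_nonneg (by positivity)] at h1
    refine h1.trans ?_
    gcongr
    rw [abs_le]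
    have := Real.cosh_sq_sub_sinh_sq (2 * M * t)
    have hc := Real.cosh_pos (2 * M * t)
    constructor <;> nlinarith

theorem exists_linear_ode (hA : Continuous A) (x : X) :
    ∃ u : ℝ → X, u 0 = x ∧ ∀ t, HasDerivAt u (A t (u t)) t := by
  have hbd : ∀ T : ℝ, ∃ M, 0 < M ∧ ∀ t, |t| ≤ T → ‖A t‖ ≤ M := by
    intro T
    obtain ⟨M, hM⟩ := (isCompact_Icc (a := -T) (b := T)).exists_bound_of_continuousOn
      hA.continuousOn
    exact ⟨max M 1, by positivity, fun t ht => (hM t (abs_le.1 ht)).trans (le_max_left _ _)⟩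
  have hsum : ∀ t, Summable fun n => dyson A x n t := by
    intro t
    obtain ⟨M, hM, h1⟩ := hbd |t|
    refine Summable.of_norm_bounded ((summable_geometric_two.mul_left ‖x‖).mul_right
      (Real.cosh (2 * M * t))) fun n => norm_dyson_le x hM h1 n t le_rfl
  refine ⟨fun t => ∑' n, dyson A x n t, ?_, fun t => ?_⟩
  · refine (tsum_eq_single 0 ?_).trans ?_
    · intro n hn
      obtain ⟨m, rfl⟩ := Nat.exists_eq_succ_of_ne_zero hn
      simp [dyson]
    · rfl
  · obtain ⟨M, hM, h1⟩ := hbd (|t| + 1)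
    let g' : ℕ → ℝ → X := fun n => match n with
      | 0 => fun _ => 0
      | n + 1 => fun t => A t (dyson A x n t)
    have hcosh : ∀ y : ℝ, |y| ≤ |t| + 1 →
        Real.cosh (2 * M * y) ≤ Real.cosh (2 * M * (|t| + 1)) := by
      intro y hy
      rw [Real.cosh_le_cosh, abs_mul (2 * M), abs_mul (2 * M),
        abs_of_nonneg (by positivity : (0 : ℝ) ≤ |t| + 1)]
      gcongr
    have h2 := hasDerivAt_tsum_of_isPreconnected (t := Set.Ioo (-(|t| + 1)) (|t| + 1))
      (u := fun n => 2 * M * ‖x‖ * (1 / 2) ^ n * Real.cosh (2 * M * (|t| + 1)))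
      (g := dyson A x) (g' := g') (y₀ := 0) (y := t)
      ((summable_geometric_two.mul_left (2 * M * ‖x‖)).mul_right _) isOpen_Ioo
      isPreconnected_Ioo (by
        intro n y _
        cases n with
        | zero => exact hasDerivAt_const y x
        | succ n => exact hasDerivAt_dyson hA x n y) (by
        intro n y hy
        have hy' : |y| ≤ |t| + 1 := abs_le.2 ⟨hy.1.le, hy.2.le⟩
        cases n with
        | zero =>
          simp only [g', norm_zero]
          have := Real.cosh_pos (2 * M * (|t| + 1))
          positivity
        | succ n =>
          refine ((A y).le_opNorm _).trans ?_
          refine (mul_le_mul (h1 y hy') (norm_dyson_le x hM h1 n y hy') (norm_nonneg _)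
            hM.le).trans ?_
          rw [pow_succ, show 2 * M * ‖x‖ * ((1 / 2 : ℝ) ^ n * (1 / 2)) *
            Real.cosh (2 * M * (|t| + 1)) = M * (‖x‖ * (1 / 2) ^ n *
            Real.cosh (2 * M * (|t| + 1))) by ring]
          gcongr
          exact hcosh y hy') (by
        constructor <;> linarith [abs_nonneg t]) (hsum 0) (by
        constructor
        · linarith [neg_abs_le t]
        · linarith [le_abs_self t])
    refine h2.congr_deriv ?_
    have h3 : HasSum (fun n => g' (n + 1) t) (A t (∑' n, dyson A x n t)) :=
      (hsum t).hasSum.mapL (A t)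
    have h4 := (hasSum_nat_add_iff (f := fun n => g' n t) 1).1 h3
    simp only [Finset.range_one, Finset.sum_singleton, g', add_zero] at h4
    exact h4.tsum_eq

/-- Gronwall's inequality, in both directions of time. -/
theorem le_exp_mul_of_abs_deriv_le {f f' : ℝ → ℝ} {κ T : ℝ} (hf : ∀ t, HasDerivAt f (f' t) t)
    (h : ∀ t, |t| ≤ T → |f' t| ≤ κ * f t) {t : ℝ} (ht : |t| ≤ T) :
    f t ≤ Real.exp (κ * |t|) * f 0 := by
  have key : ∀ (g g' : ℝ → ℝ), (∀ t, HasDerivAt g (g' t) t) → (∀ t, |t| ≤ T → |g' t| ≤ κ * g t) →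
      ∀ t, 0 ≤ t → t ≤ T → g t ≤ Real.exp (κ * t) * g 0 := by
    intro g g' hg hg' t h0 ht
    let w : ℝ → ℝ := fun s => Real.exp (-(κ * s)) * g s
    have hw : ∀ s, HasDerivAt w (Real.exp (-(κ * s)) * (g' s - κ * g s)) s := by
      intro s
      have := (((hasDerivAt_id s).const_mul κ).neg.exp).mul (hg s)
      refine this.congr_deriv ?_
      simp only [Pi.neg_apply, id]
      ring
    have hanti : AntitoneOn w (Set.Icc 0 t) := by
      refine antitoneOn_of_deriv_nonpos (convex_Icc 0 t)
        (fun s _ => (hw s).continuousAt.continuousWithinAt)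
        (fun s _ => (hw s).differentiableAt.differentiableWithinAt) fun s hs => ?_
      rw [interior_Icc] at hs
      rw [(hw s).deriv]
      have h1 := hg' s (by rw [abs_of_pos hs.1]; linarith [hs.2])
      have h2 := (le_abs_self _).trans h1
      exact mul_nonpos_of_nonneg_of_nonpos (Real.exp_pos _).le (by linarith)
    have h1 := hanti ⟨le_rfl, h0⟩ ⟨h0, le_rfl⟩ h0
    simp only [w, mul_zero, neg_zero, Real.exp_zero, one_mul] at h1
    rw [Real.exp_neg, inv_mul_le_iff₀ (Real.exp_pos _)] at h1
    exact h1
  rcases le_total 0 t with h0 | h0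
  · rw [abs_of_nonneg h0] at ht ⊢
    exact key f f' hf h t h0 ht
  · rw [abs_of_nonpos h0] at ht ⊢
    have h1 := key (fun s => f (-s)) (fun s => -f' (-s)) (fun s => by
      have := (hf (-s)).comp s (hasDerivAt_neg s)
      refine this.congr_deriv ?_
      ring) (fun s hs => by
        rw [abs_neg]
        exact h (-s) (by rwa [abs_neg])) (-t) (by linarith) ht
    simpa using h1

end LinearODE

/-! ### Weak limits along an ultrafilter -/

section Weak

variable {H : Type*} [NormedAddCommGroup H] [InnerProductSpace ℂ H] [CompleteSpace H]

theorem exists_weak_limit {α : Type*} (𝒰 : Ultrafilter α) {y : α → H} {C : ℝ}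
    (hy : ∀ᶠ n in 𝒰, ‖y n‖ ≤ C) :
    ∃ y' : H, ∀ f : H, Tendsto (fun n => ⟪f, y n⟫_ℂ) 𝒰 (𝓝 ⟪f, y'⟫_ℂ) := by
  have hc := WeakDual.isCompact_closedBall (𝕜 := ℂ) (0 : StrongDual ℂ H) C
  let 𝒱 : Ultrafilter (WeakDual ℂ H) :=
    𝒰.map fun n => StrongDual.toWeakDual (InnerProductSpace.toDual ℂ H (y n))
  obtain ⟨x, -, hx⟩ := hc.ultrafilter_le_nhds' 𝒱 (by
    refine Ultrafilter.mem_map.2 (Ultrafilter.mem_coe.1 ?_)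
    filter_upwards [hy] with n hn
    simpa using hn)
  refine ⟨(InnerProductSpace.toDual ℂ H).symm (WeakDual.toStrongDual x), fun f => ?_⟩
  have h1 : Tendsto (fun n => StrongDual.toWeakDual (InnerProductSpace.toDual ℂ H (y n)) f) 𝒰
      (𝓝 (x f)) := ((WeakDual.eval_continuous f).tendsto x).comp hx
  have h2 := (Complex.continuous_conj.tendsto _).comp h1
  have e : ⟪f, (InnerProductSpace.toDual ℂ H).symm (WeakDual.toStrongDual x)⟫_ℂ =
      (starRingEnd ℂ) (x f) := by
    rw [← inner_conj_symm, InnerProductSpace.toDual_symm_apply]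
    rfl
  rw [e]
  refine h2.congr fun n => ?_
  rw [← inner_conj_symm f]
  rfl

theorem norm_le_of_weak_limit {α : Type*} {l : Filter α} [l.NeBot] {y : α → H} {y' : H} {C : ℝ}
    (hy : ∀ᶠ n in l, ‖y n‖ ≤ C) (h : Tendsto (fun n => ⟪y', y n⟫_ℂ) l (𝓝 ⟪y', y'⟫_ℂ)) :
    ‖y'‖ ≤ C := by
  have h1 := (Complex.continuous_re.tendsto _).comp h
  have h2 : (⟪y', y'⟫_ℂ).re ≤ ‖y'‖ * C := by
    refine le_of_tendsto h1 ?_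
    filter_upwards [hy] with n hn
    refine (Complex.re_le_norm _).trans ((norm_inner_le_norm _ _).trans ?_)
    gcongr
  rw [inner_self_eq_norm_sq_to_K] at h2
  have h3 : ‖y'‖ ^ 2 ≤ ‖y'‖ * C := by
    have : ((‖y'‖ : ℂ) ^ 2).re = ‖y'‖ ^ 2 := by norm_cast
    rw [← this]; exact h2
  obtain ⟨n, hn⟩ := hy.exists
  rcases (norm_nonneg y').eq_or_lt with h0 | h0
  · rw [← h0]; exact (norm_nonneg _).trans hn
  · rw [sq] at h3
    exact le_of_mul_le_mul_left h3 h0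

/-- A function with a quadratic Taylor remainder is differentiable. -/
theorem hasDerivAt_of_norm_sub_le {X : Type*} [NormedAddCommGroup X] [NormedSpace ℝ X]
    {u : ℝ → X} {u' : X} {s K : ℝ}
    (h : ∀ᶠ t in 𝓝 s, ‖u t - u s - (t - s) • u'‖ ≤ K * |t - s| ^ 2) : HasDerivAt u u' s := by
  rw [hasDerivAt_iff_isLittleO]
  refine Asymptotics.IsBigO.trans_isLittleO (g := fun t => (t - s) ^ 2) ?_ ?_
  · refine Asymptotics.IsBigO.of_bound K ?_
    filter_upwards [h] with t ht
    rwa [norm_pow, Real.norm_eq_abs]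
  · have h1 : Tendsto (fun t : ℝ => t - s) (𝓝 s) (𝓝 0) := by
      have : Continuous fun t : ℝ => t - s := by fun_prop
      simpa using this.tendsto s
    have h2 := (Asymptotics.isLittleO_pow_id (𝕜 := ℝ) (n := 2) (by norm_num)).comp_tendsto h1
    exact h2

end Weak

/-! ### Galerkin approximations of a moving Hamiltonian -/

section Galerkin

variable {H : Type*} [NormedAddCommGroup H] [InnerProductSpace ℂ H] [CompleteSpace H]

theorem hasDerivAt_clm_comp {T : ℝ → H →L[ℂ] H} {T' : H →L[ℂ] H} {u : ℝ → H} {u' : H} {t : ℝ}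
    (hT : HasDerivAt T T' t) (hu : HasDerivAt u u' t) :
    HasDerivAt (fun s => T s (u s)) (T' (u t) + T t u') t := by
  have h1 := (ContinuousLinearMap.restrictScalarsL ℂ H H ℝ ℝ).hasFDerivAt.comp_hasDerivAt t hT
  exact h1.clm_apply hu

theorem re_inner_self_I_smul {S : H → H} {w : H} (hS : ⟪S w, w⟫_ℂ = ⟪w, S w⟫_ℂ) :
    (⟪w, -Complex.I • S w⟫_ℂ).re = 0 := by
  have h1 := inner_conj_symm (𝕜 := ℂ) w (S w)
  rw [hS] at h1
  have h2 := congrArg Complex.im h1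
  rw [Complex.conj_im] at h2
  have h3 : (⟪w, S w⟫_ℂ).im = 0 := by linarith
  rw [inner_smul_right]
  simp [h3]

theorem hasDerivAt_norm_sq {w : ℝ → H} {r : H} {S : H → H} {t : ℝ}
    (hS : ⟪S (w t), w t⟫_ℂ = ⟪w t, S (w t)⟫_ℂ)
    (hw : HasDerivAt w (-Complex.I • S (w t) + r) t) :
    HasDerivAt (fun s => ‖w s‖ ^ 2) (2 * (⟪w t, r⟫_ℂ).re) t := by
  have h1 := Complex.reCLM.hasFDerivAt.comp_hasDerivAt t (hw.inner ℂ hw)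
  have h2 : (fun s => ‖w s‖ ^ 2) = Complex.reCLM ∘ fun s => ⟪w s, w s⟫_ℂ := by
    ext1 s
    exact (inner_self_eq_norm_sq (𝕜 := ℂ) (w s)).symm
  rw [h2]
  refine h1.congr_deriv ?_
  have h3 := re_inner_self_I_smul hS
  have h4 : (⟪w t, -Complex.I • S (w t) + r⟫_ℂ).re = (⟪w t, r⟫_ℂ).re := by
    rw [inner_add_right, Complex.add_re, h3, zero_add]
  rw [← inner_conj_symm (-Complex.I • S (w t) + r), Complex.reCLM_apply, Complex.add_re,
    Complex.conj_re, h4, two_mul]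

/-- The truncation of a quadratic path of Hamiltonians to the range of a projector `J`: bounded
operators `T t` with derivative `-G t`, such that `G t` is bounded relative to `T t + c`. -/
structure GalerkinPath (H : Type*) [NormedAddCommGroup H] [InnerProductSpace ℂ H] (c a ε : ℝ) where
  J : H →L[ℂ] H
  T : ℝ → H →L[ℂ] H
  G : ℝ → H →L[ℂ] H
  deriv_T : ∀ t, HasDerivAt T (-G t) t
  deriv_G : ∀ t, HasDerivAt G (-(ε ^ 2 • J)) t
  symm : ∀ t f g, ⟪T t f, g⟫_ℂ = ⟪f, T t g⟫_ℂ
  J_T : ∀ t f, J (T t f) = T t f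
  bound : ∀ t f, J f = f → ‖G t f‖ ≤ a * ‖T t f + (c : ℂ) • f‖

namespace GalerkinPath

variable {c a ε : ℝ} (g : GalerkinPath H c a ε)

/-- Solutions of the truncated Schrödinger equation. -/
structure IsSolution (u : ℝ → H) : Prop where
  deriv : ∀ t, HasDerivAt u (-Complex.I • g.T t (u t)) t
  mem : ∀ t, g.J (u t) = u t

theorem exists_isSolution {x : H} (hx : g.J x = x) : ∃ u, u 0 = x ∧ g.IsSolution u := by
  have hc : Continuous fun t => (-Complex.I • g.T t).restrictScalars ℝ := by
    have h1 : Continuous g.T := continuous_iff_continuousAt.2 fun t => (g.deriv_T t).continuousAt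
    exact (ContinuousLinearMap.restrictScalarsL ℂ H H ℝ ℝ).continuous.comp
      (h1.const_smul (-Complex.I))
  obtain ⟨u, hu0, hu⟩ := exists_linear_ode hc x
  have hu' : ∀ t, HasDerivAt u (-Complex.I • g.T t (u t)) t := hu
  refine ⟨u, hu0, hu', fun t => ?_⟩
  have h1 : ∀ s, HasDerivAt (fun s => g.J (u s) - u s) 0 s := by
    intro s
    have h2 := ((g.J.restrictScalars ℝ).hasFDerivAt.comp_hasDerivAt s (hu' s)).sub (hu' s)
    refine h2.congr_deriv ?_
    change g.J (-Complex.I • g.T s (u s)) - _ = 0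
    rw [map_smul, g.J_T, sub_self]
  have h2 := is_const_of_deriv_eq_zero (fun s => (h1 s).differentiableAt)
    (fun s => (h1 s).deriv) t 0
  rw [hu0, hx, sub_self] at h2
  exact sub_eq_zero.1 h2

variable {g} {u : ℝ → H}

/-- The image of a solution under `T t + c`. -/
def lift (g : GalerkinPath H c a ε) (u : ℝ → H) (t : ℝ) : H := g.T t (u t) + (c : ℂ) • u t

/-- The derivative of `lift`. -/
def liftDeriv (g : GalerkinPath H c a ε) (u : ℝ → H) (t : ℝ) : H :=
  -Complex.I • g.T t (g.lift u t) + -g.G t (u t)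

theorem T_eq (t : ℝ) : g.T t (u t) = g.lift u t - (c : ℂ) • u t := by simp [lift]

theorem IsSolution.J_lift (hu : g.IsSolution u) (t : ℝ) : g.J (g.lift u t) = g.lift u t := by
  rw [lift, map_add, map_smul, g.J_T, hu.mem]

theorem IsSolution.norm_eq (hu : g.IsSolution u) (t : ℝ) : ‖u t‖ = ‖u 0‖ := by
  have h1 : ∀ s, HasDerivAt (fun s => ‖u s‖ ^ 2) 0 s := by
    intro s
    have h2 := hasDerivAt_norm_sq (r := 0) (S := g.T s) (g.symm s _ _)
      (by rw [add_zero]; exact hu.deriv s)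
    simpa using h2
  have h2 := is_const_of_deriv_eq_zero (fun s => (h1 s).differentiableAt)
    (fun s => (h1 s).deriv) t 0
  exact (sq_eq_sq₀ (norm_nonneg _) (norm_nonneg _)).1 h2

theorem IsSolution.hasDerivAt_lift (hu : g.IsSolution u) (t : ℝ) :
    HasDerivAt (g.lift u) (g.liftDeriv u t) t := by
  have h1 := (hasDerivAt_clm_comp (g.deriv_T t) (hu.deriv t)).add ((hu.deriv t).const_smul (c : ℂ))
  refine h1.congr_deriv ?_
  simp only [liftDeriv, lift, map_add, map_smul, neg_apply]
  module

theorem IsSolution.norm_lift_le (hu : g.IsSolution u) (t : ℝ) :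
    ‖g.lift u t‖ ≤ Real.exp (a * |t|) * ‖g.lift u 0‖ := by
  have h1 : ∀ s, HasDerivAt (fun s => ‖g.lift u s‖ ^ 2)
      (2 * (⟪g.lift u s, -g.G s (u s)⟫_ℂ).re) s := fun s =>
    hasDerivAt_norm_sq (S := g.T s) (g.symm s _ _) (hu.hasDerivAt_lift s)
  have h2 := le_exp_mul_of_abs_deriv_le (κ := 2 * a) (T := |t|) h1 (fun s _ => by
    rw [abs_mul, abs_two, mul_assoc]
    gcongr
    refine (Complex.abs_re_le_norm _).trans ((norm_inner_le_norm _ _).trans ?_)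
    rw [norm_neg, sq, mul_left_comm]
    gcongr
    exact g.bound s _ (hu.mem s)) (t := t) le_rfl
  rw [← sq_le_sq₀ (norm_nonneg _) (by positivity), mul_pow, ← Real.exp_nat_mul]
  refine h2.trans (le_of_eq ?_)
  push_cast
  ring_nf

theorem IsSolution.hasDerivAt_liftDeriv (hu : g.IsSolution u) (t : ℝ) :
    HasDerivAt (g.liftDeriv u) (-Complex.I • g.T t (g.liftDeriv u t) +
      (((ε ^ 2 : ℝ) : ℂ) • u t + (2 * Complex.I) • g.G t (g.lift u t) -
        (Complex.I * c) • g.G t (u t))) t := by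
  have h1 := ((hasDerivAt_clm_comp (g.deriv_T t) (hu.hasDerivAt_lift t)).const_smul
    (-Complex.I)).add (hasDerivAt_clm_comp (g.deriv_G t) (hu.deriv t)).neg
  refine h1.congr_deriv ?_
  simp only [neg_apply, smul_apply, hu.mem, map_smul, T_eq, map_sub]
  rw [← Complex.coe_smul]
  module

/-- The bound on the second derivative is uniform in the truncation. -/
theorem IsSolution.norm_liftDeriv_le (hu : g.IsSolution u) (ha : 0 ≤ a) {T : ℝ} {X V Z : ℝ}
    (hX : ‖u 0‖ ≤ X) (hV : ‖g.lift u 0‖ ≤ V) (hZ : ‖g.liftDeriv u 0‖ ≤ Z) {t : ℝ} (ht : |t| ≤ T) :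
    ‖g.liftDeriv u t‖ ^ 2 + 1 ≤ Real.exp ((4 * a + (ε ^ 2 * X + (2 * a ^ 2 + 3 * |c| * a) *
      (Real.exp (a * T) * V))) * T) * (Z ^ 2 + 1) := by
  set B := ε ^ 2 * X + (2 * a ^ 2 + 3 * |c| * a) * (Real.exp (a * T) * V) with hB
  have hV0 := (norm_nonneg _).trans hV
  have hX0 := (norm_nonneg _).trans hX
  have hB0 : 0 ≤ B := by positivity
  have h1 : ∀ s, HasDerivAt (fun s => ‖g.liftDeriv u s‖ ^ 2 + 1) _ s := fun s =>
    (hasDerivAt_norm_sq (S := g.T s) (g.symm s _ _) (hu.hasDerivAt_liftDeriv s)).add_const 1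
  have h2 := le_exp_mul_of_abs_deriv_le (κ := 4 * a + B) (T := T) h1 (fun s hs => by
    set z := g.liftDeriv u s with hz
    set v := g.lift u s with hv
    have hvV : ‖v‖ ≤ Real.exp (a * T) * V := by
      refine (hu.norm_lift_le s).trans ?_
      gcongr
    have hGu : ‖g.G s (u s)‖ ≤ a * ‖v‖ := g.bound s _ (hu.mem s)
    have hTv : g.T s v = Complex.I • (z + g.G s (u s)) := by
      rw [hz, liftDeriv, neg_add_cancel_right, smul_smul]
      simp [hv]
    have hGv : ‖g.G s v‖ ≤ a * (‖z‖ + a * ‖v‖ + |c| * ‖v‖) := by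
      refine (g.bound s v (hu.J_lift s)).trans ?_
      gcongr
      refine (norm_add_le _ _).trans ?_
      rw [hTv, norm_smul, norm_smul, Complex.norm_I, one_mul, Complex.norm_real, Real.norm_eq_abs]
      gcongr
      exact (norm_add_le _ _).trans (by gcongr)
    have hr : ‖((ε ^ 2 : ℝ) : ℂ) • u s + (2 * Complex.I) • g.G s v - (Complex.I * c) • g.G s (u s)‖
        ≤ 2 * a * ‖z‖ + B := by
      refine (norm_sub_le _ _).trans ?_
      have e1 : ‖((ε ^ 2 : ℝ) : ℂ) • u s + (2 * Complex.I) • g.G s v‖ ≤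
          ε ^ 2 * X + 2 * (a * (‖z‖ + a * ‖v‖ + |c| * ‖v‖)) := by
        refine (norm_add_le _ _).trans ?_
        rw [norm_smul, norm_smul, Complex.norm_real, Real.norm_of_nonneg (sq_nonneg ε), hu.norm_eq,
          norm_mul, Complex.norm_I, mul_one, Complex.norm_ofNat]
        gcongr
      have e2 : ‖(Complex.I * c) • g.G s (u s)‖ ≤ |c| * (a * ‖v‖) := by
        rw [norm_smul, norm_mul, Complex.norm_I, one_mul, Complex.norm_real, Real.norm_eq_abs]
        gcongr
      have e3 : (2 * a ^ 2 + 3 * |c| * a) * ‖v‖ ≤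
          (2 * a ^ 2 + 3 * |c| * a) * (Real.exp (a * T) * V) := by gcongr
      nlinarith [e1, e2, e3]
    rw [abs_mul, abs_two]
    have h3 : |(⟪z, ((ε ^ 2 : ℝ) : ℂ) • u s + (2 * Complex.I) • g.G s v -
        (Complex.I * c) • g.G s (u s)⟫_ℂ).re| ≤ ‖z‖ * (2 * a * ‖z‖ + B) :=
      (Complex.abs_re_le_norm _).trans ((norm_inner_le_norm _ _).trans (by gcongr))
    have h4 : 0 ≤ B * (‖z‖ - 1) ^ 2 := by positivity
    nlinarith [h3, h4, ha]) ht
  refine h2.trans ?_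
  have : 0 ≤ T := (abs_nonneg t).trans ht
  gcongr

/-- A quadratic Taylor estimate that is uniform in the truncation. -/
theorem exists_taylor_bound (ha : 0 ≤ a) (c ε X V Z T : ℝ) : ∃ K : ℝ,
    ∀ (g : GalerkinPath H c a ε) (u : ℝ → H), g.IsSolution u → ‖u 0‖ ≤ X → ‖g.lift u 0‖ ≤ V →
      ‖g.liftDeriv u 0‖ ≤ Z → ∀ s t, |s| ≤ T → |t| ≤ T →
        ‖u t - u s - (t - s) • (-Complex.I • (g.lift u s - (c : ℂ) • u s))‖ ≤ K * |t - s| ^ 2 := by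
  obtain ⟨Y, hY0, hY⟩ : ∃ Y : ℝ, 0 ≤ Y ∧ Real.exp ((4 * a + (ε ^ 2 * X + (2 * a ^ 2 + 3 * |c| * a) *
      (Real.exp (a * T) * V))) * T) * (Z ^ 2 + 1) ≤ Y :=
    ⟨_, by positivity, le_rfl⟩
  set W := Real.exp (a * T) * V with hW
  have key : ∀ (g : GalerkinPath H c a ε) (u : ℝ → H), g.IsSolution u → ‖u 0‖ ≤ X →
      ‖g.lift u 0‖ ≤ V → ‖g.liftDeriv u 0‖ ≤ Z → ∀ s t, |s| ≤ T → |t| ≤ T →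
      ‖g.lift u t - g.lift u s‖ ≤ Y * |t - s| := by
    intro g u hu hX hV hZ s t hs ht
    have h1 := (convex_Icc (-T) T).norm_image_sub_le_of_norm_hasDerivWithin_le (f := g.lift u)
      (f' := g.liftDeriv u) (C := Y) (fun r _ => (hu.hasDerivAt_lift r).hasDerivWithinAt)
      (fun r hr => by
        have h2 := (hu.norm_liftDeriv_le ha hX hV hZ (abs_le.2 hr)).trans hY
        nlinarith [sq_nonneg (‖g.liftDeriv u r‖ - 1)]) (abs_le.1 hs) (abs_le.1 ht)
    simpa using h1
  refine ⟨Y + |c| * (W + |c| * X), fun g u hu hX hV hZ s t hs ht => ?_⟩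
  have hV0 := (norm_nonneg _).trans hV
  have hX0 := (norm_nonneg _).trans hX
  have hTu : ∀ r, |r| ≤ T → ‖g.T r (u r)‖ ≤ W + |c| * X := by
    intro r hr
    rw [T_eq]
    refine (norm_sub_le _ _).trans ?_
    rw [norm_smul, Complex.norm_real, Real.norm_eq_abs, hu.norm_eq]
    gcongr
    refine (hu.norm_lift_le r).trans ?_
    rw [hW]
    gcongr
  have hulip : ∀ r, |r| ≤ T → ‖u r - u s‖ ≤ (W + |c| * X) * |r - s| := by
    intro r hr
    have h1 := (convex_Icc (-T) T).norm_image_sub_le_of_norm_hasDerivWithin_le (f := u)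
      (f' := fun r => -Complex.I • g.T r (u r)) (C := W + |c| * X)
      (fun r _ => (hu.deriv r).hasDerivWithinAt) (fun r hr => by
        rw [norm_smul, norm_neg, Complex.norm_I, one_mul]
        exact hTu r (abs_le.2 hr)) (abs_le.1 hs) (abs_le.1 hr)
    simpa using h1
  -- mean value inequality for the remainder on the interval between `s` and `t`
  set w := -Complex.I • (g.lift u s - (c : ℂ) • u s) with hw
  have h1 := (convex_uIcc s t).norm_image_sub_le_of_norm_hasDerivWithin_le
    (f := fun r => u r - (r - s) • w)
    (f' := fun r => -Complex.I • g.T r (u r) - w) (C := (Y + |c| * (W + |c| * X)) * |t - s|)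
    (x := s) (y := t)
    (fun r _ => by
      have h2 := (hu.deriv r).sub (((hasDerivAt_id r).sub_const s).smul_const w)
      rw [one_smul] at h2
      exact h2.hasDerivWithinAt)
    (fun r hr => by
      have hr' : |r| ≤ T := by
        rw [abs_le] at *
        rcases le_total s t with h | h
        · rw [Set.uIcc_of_le h] at hr
          exact ⟨hs.1.trans hr.1, hr.2.trans ht.2⟩
        · rw [Set.uIcc_of_ge h] at hr
          exact ⟨ht.1.trans hr.1, hr.2.trans hs.2⟩
      have hrs : |r - s| ≤ |t - s| := Set.abs_sub_left_of_mem_uIcc hr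
      have e : -Complex.I • g.T r (u r) - w = -Complex.I • ((g.lift u r - g.lift u s) -
          (c : ℂ) • (u r - u s)) := by
        rw [hw, T_eq]
        module
      rw [e, norm_smul, norm_neg, Complex.norm_I, one_mul]
      refine (norm_sub_le _ _).trans ?_
      rw [norm_smul, Complex.norm_real, Real.norm_eq_abs, add_mul, mul_assoc |c|]
      have h3 := key g u hu hX hV hZ s r hs hr'
      have h4 := hulip r hr'
      have h5 : 0 ≤ W + |c| * X := by positivity
      gcongr
      · exact h3.trans (by gcongr)
      · exact h4.trans (by gcongr))
    Set.left_mem_uIcc Set.right_mem_uIcc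
  simp only [sub_self, zero_smul, sub_zero, Real.norm_eq_abs] at h1
  rw [sq, ← mul_assoc]
  refine le_trans (le_of_eq ?_) h1
  congr 1
  abel

end GalerkinPath

end Galerkin

/-! ### Truncation to finitely many basis vectors -/

section Trunc

variable {ι : Type*} {H : Type*} [NormedAddCommGroup H] [InnerProductSpace ℂ H] [CompleteSpace H]

/-- The orthogonal projection onto the span of finitely many basis vectors. -/
def trunc (b : HilbertBasis ι ℂ H) (s : Finset ι) : H →L[ℂ] H :=
  ∑ i ∈ s, (innerSL ℂ (b i)).smulRight (b i)

theorem trunc_apply (b : HilbertBasis ι ℂ H) (s : Finset ι) (f : H) :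
    trunc b s f = ∑ i ∈ s, ⟪b i, f⟫_ℂ • b i := by
  simp [trunc]

theorem inner_trunc [DecidableEq ι] (b : HilbertBasis ι ℂ H) (s : Finset ι) (j : ι) (f : H) :
    ⟪b j, trunc b s f⟫_ℂ = if j ∈ s then ⟪b j, f⟫_ℂ else 0 := by
  rw [trunc_apply, inner_sum]
  simp only [inner_smul_right, orthonormal_iff_ite.1 b.orthonormal, mul_ite, mul_one, mul_zero]
  exact Finset.sum_ite_eq s j _

theorem trunc_symm (b : HilbertBasis ι ℂ H) (s : Finset ι) (f g : H) :
    ⟪trunc b s f, g⟫_ℂ = ⟪f, trunc b s g⟫_ℂ := by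
  rw [trunc_apply, trunc_apply, sum_inner, inner_sum]
  refine Finset.sum_congr rfl fun i _ => ?_
  rw [inner_smul_left, inner_smul_right, inner_conj_symm, mul_comm]

theorem trunc_trunc (b : HilbertBasis ι ℂ H) {s s' : Finset ι} (hs : s ⊆ s') (f : H) :
    trunc b s' (trunc b s f) = trunc b s f := by
  classical
  refine hilbertBasis_ext b fun j => ?_
  rw [inner_trunc, inner_trunc]
  by_cases hj : j ∈ s
  · simp [hj, hs hj]
  · simp [hj]

theorem norm_trunc_le (b : HilbertBasis ι ℂ H) (s : Finset ι) (f : H) : ‖trunc b s f‖ ≤ ‖f‖ := by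
  have h1 : ‖trunc b s f‖ ^ 2 ≤ ‖trunc b s f‖ * ‖f‖ := by
    have h2 : ⟪trunc b s f, f⟫_ℂ = ⟪trunc b s f, trunc b s f⟫_ℂ := by
      rw [trunc_symm b s f (trunc b s f), trunc_trunc b subset_rfl, trunc_symm]
    have h3 := norm_inner_le_norm (𝕜 := ℂ) (trunc b s f) f
    rw [h2, inner_self_eq_norm_sq_to_K] at h3
    simpa using h3
  rcases (norm_nonneg (trunc b s f)).eq_or_lt with h0 | h0
  · rw [← h0]; exact norm_nonneg _
  · rw [sq] at h1
    exact le_of_mul_le_mul_left h1 h0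

theorem tendsto_trunc (b : HilbertBasis ι ℂ H) (f : H) :
    Tendsto (fun s => trunc b s f) atTop (𝓝 f) := by
  have h := b.hasSum_repr f
  simp only [HilbertBasis.repr_apply_apply] at h
  simp only [trunc_apply]
  exact h

theorem trunc_basis (b : HilbertBasis ι ℂ H) {s : Finset ι} {i : ι} (hi : i ∈ s) :
    trunc b s (b i) = b i := by
  classical
  rw [trunc_apply]
  simp only [orthonormal_iff_ite.1 b.orthonormal, ite_smul, one_smul, zero_smul]
  rw [Finset.sum_ite_eq' s i (fun j => b j), if_pos hi]

end Trunc

/-- Weak convergence. -/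
def WeakTendsto {α H : Type*} [NormedAddCommGroup H] [InnerProductSpace ℂ H] (y : α → H)
    (l : Filter α) (y' : H) : Prop :=
  ∀ f : H, Tendsto (fun n => ⟪f, y n⟫_ℂ) l (𝓝 ⟪f, y'⟫_ℂ)

namespace WeakTendsto

variable {α H : Type*} [NormedAddCommGroup H] [InnerProductSpace ℂ H] {l : Filter α} {y z : α → H}
  {y' z' : H}

theorem sub (hy : WeakTendsto y l y') (hz : WeakTendsto z l z') :
    WeakTendsto (fun n => y n - z n) l (y' - z') := fun f => by
  simp only [inner_sub_right]
  exact (hy f).sub (hz f)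

theorem smul (hy : WeakTendsto y l y') (c : ℂ) : WeakTendsto (fun n => c • y n) l (c • y') :=
  fun f => by
    simp only [inner_smul_right]
    exact (hy f).const_mul c

theorem unique [l.NeBot] (hy : WeakTendsto y l y') (hz : WeakTendsto y l z') : y' = z' :=
  ext_inner_left ℂ fun f => tendsto_nhds_unique (hy f) (hz f)

end WeakTendsto

namespace RegularFamily

open QuadFamily

universe u

variable {E : Type*} {𝓗 : Type u} [NormedAddCommGroup E] [InnerProductSpace ℝ E]
  [NormedAddCommGroup 𝓗] [InnerProductSpace ℂ 𝓗] [CompleteSpace 𝓗] {F : RegularFamily E 𝓗}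

section

variable {ι : Type*} {k : E} {b : HilbertBasis ι ℂ 𝓗} {ev : ι → ℝ}

/-- `trunc` as a map to the domain. -/
def truncD (h : IsEigenbasis (F.op k) b ev) (s : Finset ι) : 𝓗 →ₗ[ℂ] F.D :=
  ∑ i ∈ s, (innerSL ℂ (b i) : 𝓗 →ₗ[ℂ] ℂ).smulRight (⟨b i, basis_mem h i⟩ : F.D)

theorem truncD_apply (h : IsEigenbasis (F.op k) b ev) (s : Finset ι) (f : 𝓗) :
    truncD h s f = ∑ i ∈ s, ⟪b i, f⟫_ℂ • (⟨b i, basis_mem h i⟩ : F.D) := by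
  simp [truncD]

theorem coe_truncD (h : IsEigenbasis (F.op k) b ev) (s : Finset ι) (f : 𝓗) :
    (truncD h s f : 𝓗) = trunc b s f := by
  rw [truncD_apply, trunc_apply]
  simp

theorem trunc_mem (h : IsEigenbasis (F.op k) b ev) (s : Finset ι) (f : 𝓗) : trunc b s f ∈ F.D := by
  rw [← coe_truncD h]
  exact (truncD h s f).2

theorem lam_truncD (h : IsEigenbasis (F.op k) b ev) (s : Finset ι) (u : F.D) :
    F.lam k (truncD h s u) = trunc b s (F.lam k u) := by
  rw [truncD_apply, trunc_apply, map_sum]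
  refine Finset.sum_congr rfl fun i _ => ?_
  rw [map_smul, lam_basis h, inner_lam h, smul_smul, mul_comm]

theorem trunc_lam_truncD (h : IsEigenbasis (F.op k) b ev) {s s' : Finset ι} (hs : s ⊆ s')
    (f : 𝓗) : trunc b s' (F.lam k (truncD h s f)) = F.lam k (truncD h s f) := by
  have h1 : truncD h s f = truncD h s (truncD h s f : 𝓗) := Subtype.ext (by
    rw [coe_truncD, coe_truncD, trunc_trunc b subset_rfl])
  rw [h1, lam_truncD, trunc_trunc b hs]

/-- The compression of an operator with domain `D` to the span of finitely many eigenvectors. -/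
def compress (h : IsEigenbasis (F.op k) b ev) (s : Finset ι) (A : F.D →ₗ[ℂ] 𝓗) : 𝓗 →L[ℂ] 𝓗 :=
  ∑ i ∈ s, (innerSL ℂ (b i)).smulRight (trunc b s (A ⟨b i, basis_mem h i⟩))

theorem compress_apply (h : IsEigenbasis (F.op k) b ev) (s : Finset ι) (A : F.D →ₗ[ℂ] 𝓗) (f : 𝓗) :
    compress h s A f = trunc b s (A (truncD h s f)) := by
  rw [truncD_apply, map_sum, map_sum, compress, sum_apply]
  refine Finset.sum_congr rfl fun i _ => ?_
  rw [map_smul, map_smul]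
  rfl

theorem compress_ham (h : IsEigenbasis (F.op k) b ev) (s : Finset ι) (e : E) (t : ℝ) :
    compress h s (F.ham (k - t • e)) = compress h s (F.ham k) - t • compress h s (F.grad k e) +
      (t ^ 2 * (‖e‖ ^ 2 / 2)) • trunc b s := by
  ext f
  rw [add_apply, sub_apply, smul_apply, smul_apply, compress_apply, compress_apply, compress_apply,
    sub_eq_add_neg k, ham_add, map_add, map_add, map_smul, coe_truncD, trunc_trunc b subset_rfl,
    ← neg_smul, grad_smul, map_smul, norm_smul, mul_pow, Real.norm_eq_abs, sq_abs, mul_div_assoc,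
    neg_sq, sub_eq_add_neg (trunc b s _)]
  push_cast
  rw [neg_smul, Complex.coe_smul, ← Complex.coe_smul (t ^ 2 * (‖e‖ ^ 2 / 2))]
  push_cast
  rfl

theorem compress_grad (h : IsEigenbasis (F.op k) b ev) (s : Finset ι) (e : E) (t : ℝ) :
    compress h s (F.grad (k - t • e) e) = compress h s (F.grad k e) -
      (t * ‖e‖ ^ 2) • trunc b s := by
  ext f
  rw [sub_apply, smul_apply, compress_apply, compress_apply, sub_eq_add_neg k, grad_add_left,
    map_add, map_smul, coe_truncD, trunc_trunc b subset_rfl, inner_neg_left, inner_smul_left,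
    real_inner_self_eq_norm_sq, sub_eq_add_neg (trunc b s _), ← neg_smul, ← Complex.coe_smul]
  rfl

/-- The Galerkin approximation of the path `t ↦ H (k - t e)` by eigenvectors of `H k`. -/
def galerkin (h : IsEigenbasis (F.op k) b ev) (s : Finset ι) (e : E) :
    GalerkinPath 𝓗 F.c (F.C₁ * ‖e‖) ‖e‖ where
  J := trunc b s
  T t := compress h s (F.ham (k - t • e))
  G t := compress h s (F.grad (k - t • e) e)
  deriv_T t := by
    have h1 : (fun t => compress h s (F.ham (k - t • e))) = fun t : ℝ =>
        compress h s (F.ham k) - t • compress h s (F.grad k e) +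
          (t ^ 2 * (‖e‖ ^ 2 / 2)) • trunc b s := funext fun t => compress_ham h s e t
    rw [h1, compress_grad]
    have h2 := (((hasDerivAt_id t).smul_const (compress h s (F.grad k e))).const_sub
      (compress h s (F.ham k))).add
      (((hasDerivAt_pow 2 t).mul_const (‖e‖ ^ 2 / 2)).smul_const (trunc b s))
    refine HasDerivAt.congr_deriv h2 ?_
    simp only [one_smul, neg_sub, Nat.cast_ofNat, Nat.add_one_sub_one, pow_one]
    rw [show 2 * t * (‖e‖ ^ 2 / 2) = t * ‖e‖ ^ 2 by ring]
    abel
  deriv_G t := by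
    have h1 : (fun t => compress h s (F.grad (k - t • e) e)) = fun t : ℝ =>
        compress h s (F.grad k e) - (t * ‖e‖ ^ 2) • trunc b s :=
      funext fun t => compress_grad h s e t
    rw [h1]
    have h2 := (((hasDerivAt_id t).mul_const (‖e‖ ^ 2)).smul_const (trunc b s)).const_sub
      (compress h s (F.grad k e))
    refine HasDerivAt.congr_deriv h2 ?_
    rw [one_mul]
  symm t f g := by
    rw [compress_apply, compress_apply, trunc_symm, ← trunc_symm b s f, ← coe_truncD h,
      ← coe_truncD h]
    exact ham_symm _ _ _
  J_T t f := by rw [compress_apply, trunc_trunc b subset_rfl]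
  bound t f hf := by
    set y := truncD h s f
    have hy : (y : 𝓗) = f := by rw [← hf]; exact coe_truncD h s f
    have h1 : (⟪(y : 𝓗), F.lam (k - t • e) y⟫_ℂ).re ≤
        ‖f‖ * ‖compress h s (F.ham (k - t • e)) f + (F.c : ℂ) • f‖ := by
      have h2 : ⟪(y : 𝓗), F.lam (k - t • e) y⟫_ℂ =
          ⟪f, compress h s (F.ham (k - t • e)) f + (F.c : ℂ) • f⟫_ℂ := by
        rw [lam_apply, hy, inner_add_right, inner_add_right, compress_apply]
        congr 1
        rw [← trunc_symm, hf]
      rw [h2]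
      exact (Complex.re_le_norm _).trans (norm_inner_le_norm _ _)
    have h2 : ‖f‖ ≤ ‖compress h s (F.ham (k - t • e)) f + (F.c : ℂ) • f‖ := by
      have h3 := (norm_sq_le_form (k - t • e) y).trans h1
      rw [hy] at h3
      rcases (norm_nonneg f).eq_or_lt with h0 | h0
      · rw [← h0]; exact norm_nonneg _
      · rw [sq] at h3
        exact le_of_mul_le_mul_left h3 h0
    have hC := F.C₁_nonneg
    rw [compress_apply]
    refine (norm_trunc_le b s _).trans ?_
    rw [← sq_le_sq₀ (norm_nonneg _) (by positivity), mul_pow, mul_pow]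
    refine (norm_grad_sq_le _ e y).trans ?_
    gcongr
    refine h1.trans ?_
    rw [sq]
    gcongr

end

/-! ### Orbits of the moving Hamiltonian -/

/-- `u` solves `i u' = H (k - t e) u`. -/
structure IsOrbit (F : RegularFamily E 𝓗) (k e : E) (u : ℝ → 𝓗) : Prop where
  mem : ∀ t, u t ∈ F.D
  deriv : ∀ t, HasDerivAt u (-Complex.I • F.ham (k - t • e) ⟨u t, mem t⟩) t

namespace IsOrbit

variable {k e : E} {u w : ℝ → 𝓗}

theorem sub (hu : F.IsOrbit k e u) (hw : F.IsOrbit k e w) :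
    F.IsOrbit k e (fun t => u t - w t) := by
  refine ⟨fun t => F.D.sub_mem (hu.mem t) (hw.mem t), fun t => ?_⟩
  refine ((hu.deriv t).sub (hw.deriv t)).congr_deriv ?_
  rw [← smul_sub, ← map_sub]
  rfl

theorem add (hu : F.IsOrbit k e u) (hw : F.IsOrbit k e w) :
    F.IsOrbit k e (fun t => u t + w t) := by
  refine ⟨fun t => F.D.add_mem (hu.mem t) (hw.mem t), fun t => ?_⟩
  refine ((hu.deriv t).add (hw.deriv t)).congr_deriv ?_
  rw [← smul_add, ← map_add]
  rfl

theorem smul (hu : F.IsOrbit k e u) (c : ℂ) : F.IsOrbit k e (fun t => c • u t) := by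
  refine ⟨fun t => F.D.smul_mem c (hu.mem t), fun t => ?_⟩
  refine ((hu.deriv t).const_smul c).congr_deriv ?_
  rw [smul_comm, ← map_smul]
  rfl

theorem norm_eq (hu : F.IsOrbit k e u) (s t : ℝ) : ‖u s‖ = ‖u t‖ := by
  have h1 : ∀ s, HasDerivAt (fun s => ‖u s‖ ^ 2) 0 s := by
    intro s
    have h2 := hasDerivAt_norm_sq (r := 0) (w := u)
      (S := fun _ => F.ham (k - s • e) ⟨u s, hu.mem s⟩)
      (ham_symm _ ⟨u s, hu.mem s⟩ ⟨u s, hu.mem s⟩) (by rw [add_zero]; exact hu.deriv s)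
    simpa using h2
  have h2 := is_const_of_deriv_eq_zero (fun s => (h1 s).differentiableAt)
    (fun s => (h1 s).deriv) s t
  exact (sq_eq_sq₀ (norm_nonneg _) (norm_nonneg _)).1 h2

theorem unique (hu : F.IsOrbit k e u) (hw : F.IsOrbit k e w) {t₀ : ℝ} (h0 : u t₀ = w t₀) :
    u = w := by
  ext1 t
  have h1 := (hu.sub hw).norm_eq t t₀
  rw [h0, sub_self, norm_zero, norm_eq_zero] at h1
  exact sub_eq_zero.1 h1

theorem shift (hu : F.IsOrbit k e u) (s : ℝ) : F.IsOrbit (k - s • e) e (fun t => u (t + s)) := by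
  refine ⟨fun t => hu.mem _, fun t => ?_⟩
  have h1 := (hu.deriv (t + s)).comp_add_const t s
  rw [show k - (t + s) • e = k - s • e - t • e by rw [add_smul]; abel] at h1
  exact h1

/-- The image of the orbit under `H (k - t e) + c`. -/
def lift (hu : F.IsOrbit k e u) (t : ℝ) : 𝓗 := F.lam (k - t • e) ⟨u t, hu.mem t⟩

theorem deriv_lift (hu : F.IsOrbit k e u) (t : ℝ) :
    HasDerivAt u (-Complex.I • (hu.lift t - (F.c : ℂ) • u t)) t := by
  have h := hu.deriv t
  rwa [ham_eq] at h

end IsOrbit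

end RegularFamily

namespace RegularFamily

open QuadFamily

universe u

variable {E : Type*} {𝓗 : Type u} [NormedAddCommGroup E] [InnerProductSpace ℝ E]
  [NormedAddCommGroup 𝓗] [InnerProductSpace ℂ 𝓗] [CompleteSpace 𝓗] {F : RegularFamily E 𝓗}

section

variable {ι : Type*} {k : E} {b : HilbertBasis ι ℂ 𝓗} {ev : ι → ℝ}

/-- A vector is orthogonal to the images of all basis vectors under `H (k + q) + c` only if it
vanishes. -/
theorem eq_zero_of_inner_lam (h : IsEigenbasis (F.op k) b ev) (q : E) {w : 𝓗}
    (hw : ∀ i, ⟪F.lam (k + q) ⟨b i, basis_mem h i⟩, w⟫_ℂ = 0) : w = 0 := by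
  have h1 : ∀ i, ⟪F.transfer k q (b i), w⟫_ℂ = 0 := by
    intro i
    have h2 : F.Rd k (b i) = (((ev i + F.c)⁻¹ : ℝ) : ℂ) • (⟨b i, basis_mem h i⟩ : F.D) :=
      Subtype.ext (R_basis h i)
    rw [transfer_apply, h2, map_smul, inner_smul_left, hw, mul_zero]
  have h2 : ContinuousLinearMap.adjoint (F.transfer k q) w = 0 :=
    hilbertBasis_ext b fun i => by
      rw [ContinuousLinearMap.adjoint_inner_right, h1, inner_zero_right]
  have h3 : F.transfer k q (F.transfer (k + q) (-q) w) = w := by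
    rw [← mul_apply_eq_comp, transfer_mul_transfer']
    rfl
  have h4 : ⟪w, w⟫_ℂ = 0 := by
    nth_rewrite 1 [← h3]
    rw [← ContinuousLinearMap.adjoint_inner_right, h2, inner_zero_right]
  exact inner_self_eq_zero.1 h4

theorem eq_R_of_inner_lam (h : IsEigenbasis (F.op k) b ev) (q : E) {u v : 𝓗}
    (huv : ∀ i, ⟪F.lam (k + q) ⟨b i, basis_mem h i⟩, u⟫_ℂ = ⟪b i, v⟫_ℂ) : u = F.R (k + q) v := by
  rw [← sub_eq_zero]
  refine eq_zero_of_inner_lam h q fun i => ?_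
  rw [inner_sub_right, huv, sub_eq_zero, ← coe_Rd, lam_symm (k + q) ⟨b i, basis_mem h i⟩, lam_Rd]

/-- Existence of orbits for initial data in the span of finitely many eigenvectors: the Galerkin
approximations converge weakly along an ultrafilter. -/
theorem exists_isOrbit_of_trunc (h : IsEigenbasis (F.op k) b ev) (e : E) {s₀ : Finset ι} {x : 𝓗}
    (hx : trunc b s₀ x = x) (hxD : x ∈ F.D) :
    ∃ u, ∃ hu : F.IsOrbit k e u, u 0 = x ∧
      ∀ t, ‖hu.lift t‖ ≤ Real.exp (F.C₁ * ‖e‖ * |t|) * ‖F.lam k ⟨x, hxD⟩‖ := by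
  have ha : 0 ≤ F.C₁ * ‖e‖ := mul_nonneg F.C₁_nonneg (norm_nonneg e)
  have k0 : k - (0 : ℝ) • e = k := by simp
  have hfix : ∀ s, s₀ ⊆ s → trunc b s x = x := fun s hs => by rw [← hx, trunc_trunc b hs]
  have hD : ∀ s, s₀ ⊆ s → truncD h s x = ⟨x, hxD⟩ := fun s hs =>
    Subtype.ext (by rw [coe_truncD]; exact hfix s hs)
  set v₀ := F.lam k ⟨x, hxD⟩ with hv₀
  have hv₀fix : ∀ s, s₀ ⊆ s → trunc b s v₀ = v₀ := fun s hs => by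
    rw [hv₀, ← hD s₀ subset_rfl, trunc_lam_truncD h hs]
  have hv₀D : v₀ ∈ F.D := by
    rw [← hv₀fix s₀ subset_rfl]
    exact trunc_mem h s₀ _
  -- the truncated solutions
  have hex : ∀ s : Finset ι, ∃ u, s₀ ⊆ s → u 0 = x ∧ (galerkin h s e).IsSolution u := by
    intro s
    by_cases hs : s₀ ⊆ s
    · obtain ⟨u, h1, h2⟩ := (galerkin h s e).exists_isSolution (x := x) (hfix s hs)
      exact ⟨u, fun _ => ⟨h1, h2⟩⟩
    · exact ⟨0, fun h' => absurd h' hs⟩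
  choose y hy using hex
  have hlift0 : ∀ s, s₀ ⊆ s → (galerkin h s e).lift (y s) 0 = v₀ := by
    intro s hs
    change compress h s (F.ham (k - (0 : ℝ) • e)) (y s 0) + (F.c : ℂ) • y s 0 = v₀
    rw [(hy s hs).1, k0, compress_apply, hD s hs, ham_eq, map_sub, map_smul, hfix s hs, ← hv₀,
      hv₀fix s hs, sub_add_cancel]
  set Z := ‖F.ham k ⟨v₀, hv₀D⟩‖ + ‖F.grad k e ⟨x, hxD⟩‖ with hZ
  have hderiv0 : ∀ s, s₀ ⊆ s → ‖(galerkin h s e).liftDeriv (y s) 0‖ ≤ Z := by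
    intro s hs
    have h1 : truncD h s v₀ = ⟨v₀, hv₀D⟩ := Subtype.ext (by rw [coe_truncD]; exact hv₀fix s hs)
    rw [GalerkinPath.liftDeriv, hlift0 s hs, (hy s hs).1]
    change ‖-Complex.I • compress h s (F.ham (k - (0 : ℝ) • e)) v₀ +
      -compress h s (F.grad (k - (0 : ℝ) • e) e) x‖ ≤ Z
    rw [k0, compress_apply, compress_apply, h1, hD s hs]
    refine (norm_add_le _ _).trans ?_
    rw [norm_smul, norm_neg, norm_neg, Complex.norm_I, one_mul]
    exact add_le_add (norm_trunc_le _ _ _) (norm_trunc_le _ _ _)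
  let 𝒰 : Ultrafilter (Finset ι) := Ultrafilter.of atTop
  have h𝒰 : (𝒰 : Filter (Finset ι)) ≤ atTop := Ultrafilter.of_le atTop
  have hlarge : ∀ s', ∀ᶠ s in (𝒰 : Filter (Finset ι)), s' ⊆ s := fun s' =>
    h𝒰 (eventually_ge_atTop s')
  have hyb : ∀ t, ∀ᶠ s in (𝒰 : Filter (Finset ι)), ‖y s t‖ ≤ ‖x‖ := by
    intro t
    filter_upwards [hlarge s₀] with s hs
    rw [(hy s hs).2.norm_eq, (hy s hs).1]
  have hvb : ∀ t, ∀ᶠ s in (𝒰 : Filter (Finset ι)), ‖(galerkin h s e).lift (y s) t‖ ≤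
      Real.exp (F.C₁ * ‖e‖ * |t|) * ‖v₀‖ := by
    intro t
    filter_upwards [hlarge s₀] with s hs
    have := (hy s hs).2.norm_lift_le t
    rwa [hlift0 s hs] at this
  choose u hu using fun t => exists_weak_limit 𝒰 (hyb t)
  choose v hv using fun t => exists_weak_limit 𝒰 (hvb t)
  have hu' : ∀ t, WeakTendsto (fun s => y s t) 𝒰 (u t) := hu
  have hv' : ∀ t, WeakTendsto (fun s => (galerkin h s e).lift (y s) t) 𝒰 (v t) := hv
  -- tested against a basis vector, the truncated `H + c` acts as the full one once the truncation
  -- contains that vector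
  have huR : ∀ t, u t = F.R (k - t • e) (v t) := by
    intro t
    rw [sub_eq_add_neg]
    refine eq_R_of_inner_lam h _ fun i => ?_
    rw [← sub_eq_add_neg]
    refine tendsto_nhds_unique (hu t _) ((hv t (b i)).congr' ?_)
    filter_upwards [hlarge s₀, hlarge {i}] with s hs hi
    have hJ := (hy s hs).2.mem t
    change trunc b s (y s t) = y s t at hJ
    have hi' : trunc b s (b i) = b i := trunc_basis b (by simpa using hi)
    have hc : (truncD h s (y s t) : 𝓗) = y s t := by rw [coe_truncD, hJ]
    change ⟪b i, compress h s (F.ham (k - t • e)) (y s t) + (F.c : ℂ) • y s t⟫_ℂ = _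
    rw [compress_apply, inner_add_right, ← trunc_symm, hi', ← inner_add_right]
    nth_rewrite 2 [← hc]
    rw [← lam_apply, ← hc, ← lam_symm _ ⟨b i, basis_mem h i⟩]
    simp only [hc]
  have hmem : ∀ t, u t ∈ F.D := fun t => by rw [huR]; exact F.R_mem _ _
  have hlam : ∀ t, F.lam (k - t • e) ⟨u t, hmem t⟩ = v t := by
    intro t
    have h1 : (⟨u t, hmem t⟩ : F.D) = F.Rd (k - t • e) (v t) := Subtype.ext (huR t)
    rw [h1, lam_Rd]
  -- the quadratic Taylor estimate is uniform in the truncation and passes to the weak limit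
  have horb : F.IsOrbit k e u := by
    refine ⟨hmem, fun t₀ => ?_⟩
    rw [ham_eq, hlam]
    obtain ⟨K, hK⟩ := GalerkinPath.exists_taylor_bound (H := 𝓗) ha F.c ‖e‖ ‖x‖ ‖v₀‖ Z (|t₀| + 1)
    refine hasDerivAt_of_norm_sub_le (K := K) ?_
    have hnear : ∀ᶠ t in 𝓝 t₀, |t| ≤ |t₀| + 1 := by
      have := (continuous_abs.tendsto t₀).eventually (eventually_lt_nhds (lt_add_one |t₀|))
      exact this.mono fun t ht => ht.le
    filter_upwards [hnear] with t ht
    have h1 := (((hu' t).sub (hu' t₀)).sub ((((hv' t₀).sub ((hu' t₀).smul (F.c : ℂ))).smul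
      (-Complex.I)).smul ((t - t₀ : ℝ) : ℂ)))
    rw [← Complex.coe_smul]
    refine norm_le_of_weak_limit ?_ (h1 _)
    filter_upwards [hlarge s₀] with s hs
    have h2 := (hK (galerkin h s e) (y s) (hy s hs).2 (by rw [(hy s hs).1])
      (by rw [hlift0 s hs]) (hderiv0 s hs) t₀ t (by linarith) ht)
    rwa [← Complex.coe_smul] at h2
  refine ⟨u, horb, ?_, fun t => ?_⟩
  · refine (hu' 0).unique (z' := x) fun f => ?_
    refine tendsto_const_nhds.congr' ?_
    filter_upwards [hlarge s₀] with s hs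
    rw [(hy s hs).1]
  · change ‖F.lam (k - t • e) ⟨u t, hmem t⟩‖ ≤ _
    rw [hlam]
    exact norm_le_of_weak_limit (hvb t) (hv t _)

end

/-- Existence of orbits for all initial data in the domain: the orbits of truncated initial data
converge locally uniformly, together with their images under `H + c`. -/
theorem exists_isOrbit (F : RegularFamily E 𝓗) (k e : E) (x : F.D) :
    ∃ u, ∃ hu : F.IsOrbit k e u, u 0 = x ∧
      ∀ t, ‖hu.lift t‖ ≤ Real.exp (F.C₁ * ‖e‖ * |t|) * ‖F.lam k x‖ := by
  obtain ⟨ι, b, ev, h⟩ := exists_isEigenbasis F k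
  have ha : 0 ≤ F.C₁ * ‖e‖ := mul_nonneg F.C₁_nonneg (norm_nonneg e)
  choose y hy hy0 hyb using fun s : Finset ι => exists_isOrbit_of_trunc h e (s₀ := s)
    (x := trunc b s x) (trunc_trunc b subset_rfl _) (trunc_mem h s _)
  have hlamx : ∀ s, F.lam k ⟨trunc b s x, trunc_mem h s _⟩ = trunc b s (F.lam k x) := by
    intro s
    rw [← lam_truncD h]
    congr 1
    exact Subtype.ext (coe_truncD h s _).symm
  -- differences of orbits are orbits of differences
  have hdiff : ∀ s s' t, ‖(hy s).lift t - (hy s').lift t‖ ≤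
      Real.exp (F.C₁ * ‖e‖ * |t|) * ‖trunc b s (F.lam k x) - trunc b s' (F.lam k x)‖ := by
    classical
    intro s s' t
    obtain ⟨w, hw, hw0, hwb⟩ := exists_isOrbit_of_trunc h e (s₀ := s ∪ s')
      (x := trunc b s x - trunc b s' x) (by
        rw [map_sub, trunc_trunc b Finset.subset_union_left,
          trunc_trunc b Finset.subset_union_right])
      (F.D.sub_mem (trunc_mem h s _) (trunc_mem h s' _))
    have h1 : (fun t => y s t - y s' t) = w :=
      ((hy s).sub (hy s')).unique hw (t₀ := 0) (by rw [hy0, hy0, hw0])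
    have h2 : (hy s).lift t - (hy s').lift t = hw.lift t := by
      rw [IsOrbit.lift, IsOrbit.lift, ← map_sub, IsOrbit.lift]
      congr 1
      exact Subtype.ext (congrFun h1 t)
    rw [h2]
    refine (hwb t).trans (le_of_eq ?_)
    rw [← hlamx, ← hlamx, ← map_sub]
    rfl
  have hdiff' : ∀ s s' t, ‖y s t - y s' t‖ = ‖trunc b s x - trunc b s' (x : 𝓗)‖ := by
    intro s s' t
    have h1 := ((hy s).sub (hy s')).norm_eq t 0
    rwa [hy0, hy0] at h1
  have hcau : ∀ z : 𝓗, Tendsto (fun m : Finset ι × Finset ι => ‖trunc b m.1 z - trunc b m.2 z‖)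
      (atTop ×ˢ atTop) (𝓝 0) := by
    intro z
    have h1 := ((tendsto_trunc b z).comp tendsto_fst).sub ((tendsto_trunc b z).comp tendsto_snd)
    rw [sub_self] at h1
    simpa using h1.norm
  have huc : ∀ {z : Finset ι → ℝ → 𝓗} {M : ℝ → ℝ} {z₀ : 𝓗}, (∀ s s' t, ‖z s t - z s' t‖ ≤
      M |t| * ‖trunc b s z₀ - trunc b s' z₀‖) → Monotone M → ∃ z' : ℝ → 𝓗,
      ∀ T, TendstoUniformlyOn z z' atTop (Set.Ioo (-T) T) := by
    intro z M z₀ hz hM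
    have h1 : ∀ T, UniformCauchySeqOn z atTop (Set.Ioo (-T) T) := by
      intro T U hU
      obtain ⟨δ, hδ, hδU⟩ := Metric.mem_uniformity_dist.1 hU
      have h2 := (hcau z₀).const_mul (M T)
      rw [mul_zero] at h2
      filter_upwards [h2.eventually (eventually_lt_nhds hδ)] with m hm t ht
      apply hδU
      rw [dist_eq_norm]
      refine (hz _ _ _).trans_lt (lt_of_le_of_lt ?_ hm)
      gcongr
      exact hM (abs_le.2 ⟨ht.1.le, ht.2.le⟩)
    have h2 : ∀ t, ∃ z', Tendsto (fun s => z s t) atTop (𝓝 z') := fun t =>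
      cauchy_map_iff_exists_tendsto.1 ((h1 (|t| + 1)).cauchy_map (x := t)
        ⟨by linarith [neg_abs_le t], by linarith [le_abs_self t]⟩)
    choose z' hz' using h2
    exact ⟨z', fun T => (h1 T).tendstoUniformlyOn_of_tendsto fun t _ => hz' t⟩
  obtain ⟨v, hv⟩ := huc (z := fun s t => (hy s).lift t)
    (M := fun r => Real.exp (F.C₁ * ‖e‖ * r)) (z₀ := F.lam k x) hdiff
    (fun p q hpq => Real.exp_le_exp.2 (mul_le_mul_of_nonneg_left hpq ha))
  obtain ⟨u, hu⟩ := huc (z := y) (M := fun _ => 1) (z₀ := x) (fun s s' t => by rw [hdiff' s s' t, one_mul])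
    monotone_const
  have hIoo : ∀ t : ℝ, t ∈ Set.Ioo (-(|t| + 1)) (|t| + 1) := fun t =>
    ⟨by linarith [neg_abs_le t], by linarith [le_abs_self t]⟩
  have hvt : ∀ t, Tendsto (fun s => (hy s).lift t) atTop (𝓝 (v t)) := fun t =>
    (hv _).tendsto_at (hIoo t)
  have hut : ∀ t, Tendsto (fun s => y s t) atTop (𝓝 (u t)) := fun t => (hu _).tendsto_at (hIoo t)
  have huR : ∀ t, u t = F.R (k - t • e) (v t) := by
    intro t
    refine tendsto_nhds_unique (hut t) ((((F.R (k - t • e)).continuous.tendsto _).comp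
      (hvt t)).congr fun s => ?_)
    exact R_lam _ ⟨y s t, (hy s).mem t⟩
  have hmem : ∀ t, u t ∈ F.D := fun t => by rw [huR]; exact F.R_mem _ _
  have hlam : ∀ t, F.lam (k - t • e) ⟨u t, hmem t⟩ = v t := by
    intro t
    have h1 : (⟨u t, hmem t⟩ : F.D) = F.Rd (k - t • e) (v t) := Subtype.ext (huR t)
    rw [h1, lam_Rd]
  have hsmul : ∀ a : ℂ, UniformContinuous fun z : 𝓗 => a • z := fun a =>
    uniformContinuous_const_smul a
  refine ⟨u, ⟨hmem, fun t => ?_⟩, ?_, fun t => ?_⟩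
  · rw [ham_eq, hlam]
    have h1 := (hsmul (-Complex.I)).comp_tendstoUniformlyOn
      ((hv (|t| + 1)).sub ((hsmul (F.c : ℂ)).comp_tendstoUniformlyOn (hu (|t| + 1))))
    exact hasDerivAt_of_tendstoUniformlyOn isOpen_Ioo h1
      (Eventually.of_forall fun s r _ => (hy s).deriv_lift r) (fun r _ => hut r) (hIoo t)
  · refine tendsto_nhds_unique (hut 0) ((tendsto_trunc b (x : 𝓗)).congr fun s => (hy0 s).symm)
  · change ‖F.lam (k - t • e) ⟨u t, hmem t⟩‖ ≤ _
    rw [hlam]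
    refine le_of_tendsto (hvt t).norm (Eventually.of_forall fun s => (hyb s t).trans ?_)
    rw [hlamx]
    gcongr
    exact norm_trunc_le _ _ _

/-! ### The propagator -/

theorem dense_D (F : RegularFamily E 𝓗) : Dense (F.D : Set 𝓗) := by
  obtain ⟨ι, b, ev, h⟩ := exists_isEigenbasis F 0
  exact fun x => mem_closure_of_tendsto (tendsto_trunc b x)
    (Eventually.of_forall fun s => trunc_mem h s x)

/-- The orbit starting at `x`. -/
def orbit (F : RegularFamily E 𝓗) (k e : E) (x : F.D) : ℝ → 𝓗 := (exists_isOrbit F k e x).choose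

theorem isOrbit_orbit (F : RegularFamily E 𝓗) (k e : E) (x : F.D) :
    F.IsOrbit k e (F.orbit k e x) := (exists_isOrbit F k e x).choose_spec.choose

theorem orbit_zero (F : RegularFamily E 𝓗) (k e : E) (x : F.D) : F.orbit k e x 0 = x :=
  (exists_isOrbit F k e x).choose_spec.choose_spec.1

theorem norm_lift_orbit_le (F : RegularFamily E 𝓗) (k e : E) (x : F.D) (t : ℝ) :
    ‖(isOrbit_orbit F k e x).lift t‖ ≤ Real.exp (F.C₁ * ‖e‖ * |t|) * ‖F.lam k x‖ :=
  (exists_isOrbit F k e x).choose_spec.choose_spec.2 t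

theorem IsOrbit.eq_orbit {k e : E} {u : ℝ → 𝓗} (hu : F.IsOrbit k e u) :
    u = F.orbit k e ⟨u 0, hu.mem 0⟩ :=
  hu.unique (isOrbit_orbit F k e _) (t₀ := 0)
    (orbit_zero F k e ⟨u 0, hu.mem 0⟩).symm

/-- The propagator on the domain. -/
def propagatorD (F : RegularFamily E 𝓗) (k e : E) (t : ℝ) : F.D →L[ℂ] 𝓗 :=
  LinearMap.mkContinuous
    { toFun := fun x => F.orbit k e x t
      map_add' := fun x y => by
        refine congrFun ((isOrbit_orbit F k e (x + y)).unique
          ((isOrbit_orbit F k e x).add (isOrbit_orbit F k e y)) (t₀ := 0) ?_) t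
        rw [orbit_zero, orbit_zero, orbit_zero]
        rfl
      map_smul' := fun a x => by
        refine congrFun ((isOrbit_orbit F k e (a • x)).unique
          ((isOrbit_orbit F k e x).smul a) (t₀ := 0) ?_) t
        rw [orbit_zero, orbit_zero]
        rfl } 1 fun x => by
    have h := (isOrbit_orbit F k e x).norm_eq t 0
    rw [orbit_zero] at h
    rw [one_mul]
    exact h.le

/-- The propagator of `i u' = H (k - t e) u` started at time `0`. -/
def propagator (F : RegularFamily E 𝓗) (k e : E) (t : ℝ) : 𝓗 →L[ℂ] 𝓗 :=
  (F.propagatorD k e t).extend F.D.subtypeL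

theorem propagator_apply (F : RegularFamily E 𝓗) (k e : E) (t : ℝ) (x : F.D) :
    F.propagator k e t x = F.orbit k e x t :=
  (F.propagatorD k e t).extend_eq
    (e := F.D.subtypeL) (by simpa [DenseRange] using F.dense_D)
    isUniformEmbedding_subtype_val.isUniformInducing x

theorem propagator_zero (F : RegularFamily E 𝓗) (k e : E) : F.propagator k e 0 = 1 := by
  ext x
  refine congrFun (Continuous.ext_on F.dense_D (F.propagator k e 0).continuous continuous_id
    fun x hx => ?_) x
  rw [propagator_apply F k e 0 ⟨x, hx⟩, orbit_zero]
  rfl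

theorem norm_propagator (F : RegularFamily E 𝓗) (k e : E) (t : ℝ) (x : 𝓗) :
    ‖F.propagator k e t x‖ = ‖x‖ := by
  refine congrFun (Continuous.ext_on F.dense_D (F.propagator k e t).continuous.norm
    continuous_norm fun x hx => ?_) x
  change ‖F.propagator k e t x‖ = ‖x‖
  rw [propagator_apply F k e t ⟨x, hx⟩, (isOrbit_orbit F k e _).norm_eq t 0, orbit_zero]

/-- The propagator is surjective, because the evolution may be run backwards from time `t`. -/
theorem exists_propagator_eq (F : RegularFamily E 𝓗) (k e : E) (t : ℝ) {y : 𝓗} (hy : y ∈ F.D) :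
    ∃ x, F.propagator k e t x = y := by
  have h1 := isOrbit_orbit F (k - t • e) e ⟨y, hy⟩
  have h2 := h1.shift (-t)
  rw [neg_smul, sub_neg_eq_add, sub_add_cancel] at h2
  have h3 := h2.eq_orbit
  refine ⟨_, (propagator_apply F k e t ⟨_, h2.mem 0⟩).trans ?_⟩
  rw [← h3]
  change F.orbit (k - t • e) e ⟨y, hy⟩ (t + -t) = y
  rw [add_neg_cancel, orbit_zero]

theorem propagator_mem_unitary (F : RegularFamily E 𝓗) (k e : E) (t : ℝ) :
    F.propagator k e t ∈ unitary (𝓗 →L[ℂ] 𝓗) := by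
  have h1 : star (F.propagator k e t) * F.propagator k e t = 1 := by
    rw [ContinuousLinearMap.star_eq_adjoint]
    exact (ContinuousLinearMap.norm_map_iff_adjoint_comp_self _).1 (norm_propagator F k e t)
  refine ⟨h1, ?_⟩
  ext x
  refine congrFun (Continuous.ext_on F.dense_D
    (F.propagator k e t * star (F.propagator k e t)).continuous continuous_id fun y hy => ?_) x
  obtain ⟨z, rfl⟩ := exists_propagator_eq F k e t hy
  rw [mul_apply_eq_comp, ← mul_apply_eq_comp (star _), h1]
  rfl

theorem isPropagator_propagator (F : RegularFamily E 𝓗) (k e : E) :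
    IsPropagator (fun t => F.op (k - t • e)) (F.propagator k e) where
  unitary := propagator_mem_unitary F k e
  zero := propagator_zero F k e
  solves u hu' t := by
    have hu : u ∈ F.D := hu'
    have h := isOrbit_orbit F k e ⟨u, hu⟩
    have e1 : (fun s => F.propagator k e s u) = F.orbit k e ⟨u, hu⟩ :=
      funext fun s => propagator_apply F k e s ⟨u, hu⟩
    refine ⟨F.ham (k - t • e) ⟨_, h.mem t⟩, ?_, ?_⟩
    · have e2 := congrFun e1 t
      change F.propagator k e t u = _ at e2
      rw [e2]
      exact mem_graph_op.2 ⟨h.mem t, rfl⟩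
    · rw [e1]
      exact h.deriv t

theorem _root_.BlochTransport.IsPropagator.eq_propagator {k e : E} {U : ℝ → 𝓗 →L[ℂ] 𝓗}
    (hU : IsPropagator (fun t => F.op (k - t • e)) U) : U = F.propagator k e := by
  ext t x
  refine congrFun (Continuous.ext_on F.dense_D (U t).continuous (F.propagator k e t).continuous
    fun x hx => ?_) x
  choose f hf using hU.solves x hx
  have h1 : F.IsOrbit k e (fun s => U s x) := by
    refine ⟨fun s => (mem_graph_op.1 (hf s).1).1, fun s => ?_⟩
    obtain ⟨h2, h3⟩ := mem_graph_op.1 (hf s).1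
    rw [h3]
    exact (hf s).2
  rw [propagator_apply F k e t ⟨x, hx⟩]
  refine congrFun (h1.unique (isOrbit_orbit F k e ⟨x, hx⟩) (t₀ := 0) ?_) t
  rw [orbit_zero, hU.zero]
  rfl

end RegularFamily

/-! ### The first-order response kernels -/

section Kernel

/-- The kernel `∫₀ᵗ exp (-i s θ) ds`. -/
def sigmaKernel (t θ : ℝ) : ℂ := ∫ s in (0 : ℝ)..t, Complex.exp (-(Complex.I * s * θ))

/-- The kernel `i ∫₀ᵗ s exp (-i (t - s) θ) ds`, written as an iterated integral. -/
def kappaKernel (t θ : ℝ) : ℂ := Complex.I * ∫ s in (0 : ℝ)..t, sigmaKernel s θ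

theorem norm_exp_neg_I (s θ : ℝ) : ‖Complex.exp (-(Complex.I * s * θ))‖ = 1 := by
  rw [show -(Complex.I * s * θ) = ((-(s * θ) : ℝ) : ℂ) * Complex.I by push_cast; ring,
    Complex.norm_exp_ofReal_mul_I]

theorem hasDerivAt_sigmaKernel (t θ : ℝ) :
    HasDerivAt (fun t => sigmaKernel t θ) (Complex.exp (-(Complex.I * t * θ))) t := by
  have h : Continuous fun s : ℝ => Complex.exp (-(Complex.I * s * θ)) := by fun_prop
  exact intervalIntegral.integral_hasDerivAt_right (h.intervalIntegrable _ _)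
    (h.stronglyMeasurableAtFilter _ _) h.continuousAt

theorem hasDerivAt_kappaKernel (t θ : ℝ) :
    HasDerivAt (fun t => kappaKernel t θ) (Complex.I * sigmaKernel t θ) t := by
  have h : Continuous fun s : ℝ => sigmaKernel s θ :=
    continuous_iff_continuousAt.2 fun s => (hasDerivAt_sigmaKernel s θ).continuousAt
  exact (intervalIntegral.integral_hasDerivAt_right (h.intervalIntegrable _ _)
    (h.stronglyMeasurableAtFilter _ _) h.continuousAt).const_mul Complex.I

theorem sigmaKernel_zero (θ : ℝ) : sigmaKernel 0 θ = 0 := by simp [sigmaKernel]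

theorem kappaKernel_zero (θ : ℝ) : kappaKernel 0 θ = 0 := by simp [kappaKernel]

theorem norm_sigmaKernel_sub_le (s t θ : ℝ) :
    ‖sigmaKernel t θ - sigmaKernel s θ‖ ≤ |t - s| := by
  have h := convex_univ.norm_image_sub_le_of_norm_hasDerivWithin_le (C := 1) (x := s) (y := t)
    (fun r _ => (hasDerivAt_sigmaKernel r θ).hasDerivWithinAt)
    (fun r _ => (norm_exp_neg_I r θ).le) (Set.mem_univ _) (Set.mem_univ _)
  simpa using h

theorem norm_sigmaKernel_le (t θ : ℝ) : ‖sigmaKernel t θ‖ ≤ |t| := by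
  simpa [sigmaKernel_zero] using norm_sigmaKernel_sub_le 0 t θ

theorem norm_kappaKernel_taylor (s t θ : ℝ) :
    ‖kappaKernel t θ - kappaKernel s θ - (t - s) * (Complex.I * sigmaKernel s θ)‖ ≤
      |t - s| ^ 2 := by
  have h := (convex_uIcc s t).norm_image_sub_le_of_norm_hasDerivWithin_le
    (f := fun r : ℝ => kappaKernel r θ - ((r : ℂ) - s) * (Complex.I * sigmaKernel s θ))
    (f' := fun r : ℝ => Complex.I * sigmaKernel r θ - 1 * (Complex.I * sigmaKernel s θ))
    (C := |t - s|) (x := s) (y := t)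
    (fun r _ => ((hasDerivAt_kappaKernel r θ).sub ((((hasDerivAt_id r).ofReal_comp).sub_const
      (s : ℂ)).mul_const (Complex.I * sigmaKernel s θ))).hasDerivWithinAt)
    (fun r hr => by
      rw [one_mul, ← mul_sub, norm_mul, Complex.norm_I, one_mul]
      exact (norm_sigmaKernel_sub_le s r θ).trans (Set.abs_sub_left_of_mem_uIcc hr))
    Set.left_mem_uIcc Set.right_mem_uIcc
  rw [sq]
  refine le_trans (le_of_eq ?_) h
  congr 1
  ring

theorem norm_kappaKernel_le (t θ : ℝ) : ‖kappaKernel t θ‖ ≤ t ^ 2 := by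
  simpa [kappaKernel_zero, sigmaKernel_zero] using norm_kappaKernel_taylor 0 t θ

theorem mul_sigmaKernel (t θ : ℝ) :
    θ * sigmaKernel t θ = Complex.I * (Complex.exp (-(Complex.I * t * θ)) - 1) := by
  have h1 : ∀ s : ℝ, HasDerivAt (fun s : ℝ => θ * sigmaKernel s θ -
      Complex.I * (Complex.exp (-(Complex.I * s * θ)) - 1)) 0 s := by
    intro s
    have h2 := (((((hasDerivAt_id s).ofReal_comp.const_mul Complex.I).mul_const (θ : ℂ)).fun_neg.cexp).sub_const
      1).const_mul Complex.I
    refine (((hasDerivAt_sigmaKernel s θ).const_mul (θ : ℂ)).sub h2).congr_deriv ?_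
    simp only [id, Complex.ofReal_one]
    linear_combination (-θ * Complex.exp (-(Complex.I * s * θ))) * (-Complex.I_sq)
  have h3 := is_const_of_deriv_eq_zero (fun s => (h1 s).differentiableAt)
    (fun s => (h1 s).deriv) t 0
  simp only [sigmaKernel_zero, Complex.ofReal_zero, mul_zero, zero_mul, neg_zero, Complex.exp_zero,
    sub_self] at h3
  exact sub_eq_zero.1 h3

/-- The kernels are regularized quotients by `θ`, without a singularity at `θ = 0`. -/
theorem mul_kappaKernel (t θ : ℝ) : θ * kappaKernel t θ = t - sigmaKernel t θ := by
  have h1 : ∀ s : ℝ, HasDerivAt (fun s : ℝ => θ * kappaKernel s θ -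
      (s - sigmaKernel s θ)) 0 s := by
    intro s
    refine (((hasDerivAt_kappaKernel s θ).const_mul (θ : ℂ)).sub
      ((hasDerivAt_id s).ofReal_comp.sub (hasDerivAt_sigmaKernel s θ))).congr_deriv ?_
    have := mul_sigmaKernel s θ
    simp only [Complex.ofReal_one]
    linear_combination Complex.I * this + (Complex.exp (-(Complex.I * s * θ)) - 1) * Complex.I_sq
  have h3 := is_const_of_deriv_eq_zero (fun s => (h1 s).differentiableAt)
    (fun s => (h1 s).deriv) t 0
  simp only [kappaKernel_zero, sigmaKernel_zero, Complex.ofReal_zero, mul_zero, sub_self] at h3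
  exact sub_eq_zero.1 h3

theorem hasDerivAt_conj {f : ℝ → ℂ} {f' : ℂ} {t : ℝ} (h : HasDerivAt f f' t) :
    HasDerivAt (fun s => (starRingEnd ℂ) (f s)) ((starRingEnd ℂ) f') t :=
  (Complex.conjCLE.toContinuousLinearMap.hasFDerivAt).comp_hasDerivAt t h

theorem conj_sigmaKernel (t θ : ℝ) :
    (starRingEnd ℂ) (sigmaKernel t (-θ)) = sigmaKernel t θ := by
  have h1 : ∀ s : ℝ, HasDerivAt (fun s : ℝ => (starRingEnd ℂ) (sigmaKernel s (-θ)) -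
      sigmaKernel s θ) 0 s := by
    intro s
    refine ((hasDerivAt_conj (hasDerivAt_sigmaKernel s (-θ))).sub
      (hasDerivAt_sigmaKernel s θ)).congr_deriv ?_
    rw [← Complex.exp_conj, sub_eq_zero]
    congr 1
    simp
  have h3 := is_const_of_deriv_eq_zero (fun s => (h1 s).differentiableAt)
    (fun s => (h1 s).deriv) t 0
  simp only [sigmaKernel_zero, map_zero, sub_self] at h3
  exact sub_eq_zero.1 h3

theorem conj_kappaKernel (t θ : ℝ) :
    (starRingEnd ℂ) (kappaKernel t (-θ)) = -kappaKernel t θ := by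
  have h1 : ∀ s : ℝ, HasDerivAt (fun s : ℝ => (starRingEnd ℂ) (kappaKernel s (-θ)) +
      kappaKernel s θ) 0 s := by
    intro s
    refine ((hasDerivAt_conj (hasDerivAt_kappaKernel s (-θ))).add
      (hasDerivAt_kappaKernel s θ)).congr_deriv ?_
    rw [map_mul, conj_sigmaKernel, Complex.conj_I]
    ring
  have h3 := is_const_of_deriv_eq_zero (fun s => (h1 s).differentiableAt)
    (fun s => (h1 s).deriv) t 0
  simp only [kappaKernel_zero, map_zero, add_zero] at h3
  exact eq_neg_of_add_eq_zero_left h3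

end Kernel

namespace RegularFamily

open QuadFamily

universe u

variable {E : Type*} {𝓗 : Type u} [NormedAddCommGroup E] [InnerProductSpace ℝ E]
  [NormedAddCommGroup 𝓗] [InnerProductSpace ℂ 𝓗] [CompleteSpace 𝓗] {F : RegularFamily E 𝓗}

/-- Duhamel's principle: an approximate solution stays close to the orbit. -/
theorem IsOrbit.norm_sub_le {k e : E} {u y d : ℝ → 𝓗} (hu : F.IsOrbit k e u)
    (hy : ∀ t, y t ∈ F.D)
    (hd : ∀ t, HasDerivAt y (-Complex.I • F.ham (k - t • e) ⟨y t, hy t⟩ + d t) t)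
    (h0 : y 0 = u 0) {t δ : ℝ} (ht : 0 ≤ t) (hδ : ∀ s, 0 ≤ s → s ≤ t → ‖d s‖ ≤ δ) :
    ‖u t - y t‖ ≤ δ * t := by
  -- the orbit that passes through the remainder at time `t`
  have hmem : ∀ s, u s - y s ∈ F.D := fun s => F.D.sub_mem (hu.mem s) (hy s)
  have h1 := (isOrbit_orbit F (k - t • e) e ⟨u t - y t, hmem t⟩).shift (-t)
  rw [neg_smul, sub_neg_eq_add, sub_add_cancel] at h1
  set w := fun s => F.orbit (k - t • e) e ⟨u t - y t, hmem t⟩ (s + -t) with hw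
  have hwt : w t = u t - y t := by
    simp only [hw, add_neg_cancel, orbit_zero]
  have h2 : ∀ s, HasDerivAt (fun s => ⟪w s, u s - y s⟫_ℂ) (-⟪w s, d s⟫_ℂ) s := by
    intro s
    refine ((h1.deriv s).inner ℂ ((hu.deriv s).sub (hd s))).congr_deriv ?_
    have h3 := ham_symm (F := F.toQuadFamily) (k - s • e) ⟨w s, h1.mem s⟩ ⟨u s - y s, hmem s⟩
    have h4 : F.ham (k - s • e) ⟨u s - y s, hmem s⟩ =
        F.ham (k - s • e) ⟨u s, hu.mem s⟩ - F.ham (k - s • e) ⟨y s, hy s⟩ := by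
      rw [← map_sub]
      rfl
    change ⟪w s, _⟫_ℂ + ⟪_, u s - y s⟫_ℂ = _
    change ⟪F.ham (k - s • e) ⟨w s, h1.mem s⟩, u s - y s⟫_ℂ = _ at h3
    rw [← sub_sub, ← smul_sub, ← h4, inner_sub_right, inner_smul_right, inner_smul_left, h3]
    simp only [map_neg, Complex.conj_I, neg_neg]
    ring
  have h3 := (convex_Icc 0 t).norm_image_sub_le_of_norm_hasDerivWithin_le (C := ‖u t - y t‖ * δ)
    (x := 0) (y := t) (fun s _ => (h2 s).hasDerivWithinAt) (fun s hs => by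
      rw [norm_neg]
      refine (norm_inner_le_norm _ _).trans ?_
      rw [h1.norm_eq s t, hwt]
      gcongr
      exact hδ s hs.1 hs.2) ⟨le_rfl, ht⟩ ⟨ht, le_rfl⟩
  simp only [hwt, h0, sub_self, inner_zero_right, sub_zero, Real.norm_of_nonneg ht] at h3
  rw [inner_self_eq_norm_sq_to_K, norm_pow, RCLike.norm_ofReal, abs_norm] at h3
  rcases (norm_nonneg (u t - y t)).eq_or_lt with h5 | h5
  · rw [← h5]
    exact mul_nonneg ((norm_nonneg _).trans (hδ 0 le_rfl ht)) ht
  · rw [sq, mul_assoc] at h3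
    exact le_of_mul_le_mul_left h3 h5

section

variable {ι : Type*} {k : E} {b : HilbertBasis ι ℂ 𝓗} {ev : ι → ℝ}

/-- A vector whose coefficients have the required decay belongs to the domain. -/
theorem exists_mem_of_inner_eq (h : IsEigenbasis (F.op k) b ev) {x z : 𝓗}
    (hz : ∀ j, ⟪b j, z⟫_ℂ = ev j * ⟪b j, x⟫_ℂ) : ∃ hx : x ∈ F.D, F.ham k ⟨x, hx⟩ = z := by
  have h1 : x = F.R k (z + (F.c : ℂ) • x) := by
    refine hilbertBasis_ext b fun j => ?_
    have h2 : ((ev j + F.c : ℝ) : ℂ) ≠ 0 := by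
      rw [Complex.ofReal_ne_zero]
      linarith [one_le_ev h j]
    rw [← R_symm, R_basis h, inner_smul_left, inner_add_right, inner_smul_right, hz,
      Complex.conj_ofReal, Complex.ofReal_inv, ← add_mul, ← Complex.ofReal_add,
      inv_mul_cancel_left₀ h2]
  have hx : x ∈ F.D := by rw [h1]; exact F.R_mem _ _
  refine ⟨hx, ?_⟩
  have h2 : (⟨x, hx⟩ : F.D) = F.Rd k (z + (F.c : ℂ) • x) := Subtype.ext h1
  rw [ham_eq, h2, lam_Rd, coe_Rd, ← h1, add_sub_cancel_right]

theorem exists_kappa_bound (ev : ι → ℝ) (t x : ℝ) :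
    ∃ K : ℝ, ∀ j, ‖kappaKernel t (ev j - x)‖ ≤ K := ⟨_, fun _ => norm_kappaKernel_le _ _⟩

theorem exists_sigma_bound (ev : ι → ℝ) (t x : ℝ) :
    ∃ K : ℝ, ∀ j, ‖sigmaKernel t (ev j - x)‖ ≤ K := ⟨_, fun _ => norm_sigmaKernel_le _ _⟩

/-- The first-order correction `κ_t(H - x) g` to a stationary state of energy `x`. -/
def corrector (b : HilbertBasis ι ℂ 𝓗) (ev : ι → ℝ) (x : ℝ) (g : 𝓗) (t : ℝ) : 𝓗 :=
  diagOp b (fun j => kappaKernel t (ev j - x)) g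

/-- The time derivative of `corrector`, up to a factor `i`. -/
def correctorSlope (b : HilbertBasis ι ℂ 𝓗) (ev : ι → ℝ) (x : ℝ) (g : 𝓗) (t : ℝ) : 𝓗 :=
  diagOp b (fun j => sigmaKernel t (ev j - x)) g

theorem inner_corrector (b : HilbertBasis ι ℂ 𝓗) (ev : ι → ℝ) (x : ℝ) (g : 𝓗) (t : ℝ) (j : ι) :
    ⟪b j, corrector b ev x g t⟫_ℂ = kappaKernel t (ev j - x) * ⟪b j, g⟫_ℂ :=
  inner_diagOp b (exists_kappa_bound ev t x) g j

theorem inner_correctorSlope (b : HilbertBasis ι ℂ 𝓗) (ev : ι → ℝ) (x : ℝ) (g : 𝓗) (t : ℝ)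
    (j : ι) : ⟪b j, correctorSlope b ev x g t⟫_ℂ = sigmaKernel t (ev j - x) * ⟪b j, g⟫_ℂ :=
  inner_diagOp b (exists_sigma_bound ev t x) g j

theorem norm_corrector_le (b : HilbertBasis ι ℂ 𝓗) (ev : ι → ℝ) (x : ℝ) (g : 𝓗) (t : ℝ) :
    ‖corrector b ev x g t‖ ≤ t ^ 2 * ‖g‖ :=
  norm_diagOp_apply_le b (sq_nonneg t) (fun _ => norm_kappaKernel_le _ _) g

theorem corrector_zero (b : HilbertBasis ι ℂ 𝓗) (ev : ι → ℝ) (x : ℝ) (g : 𝓗) :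
    corrector b ev x g 0 = 0 := by
  have h := norm_corrector_le b ev x g 0
  rw [sq, zero_mul, zero_mul] at h
  exact norm_le_zero_iff.1 h

theorem hasDerivAt_corrector (b : HilbertBasis ι ℂ 𝓗) (ev : ι → ℝ) (x : ℝ) (g : 𝓗) (s : ℝ) :
    HasDerivAt (corrector b ev x g) (Complex.I • correctorSlope b ev x g s) s := by
  refine hasDerivAt_of_norm_sub_le (K := ‖g‖) (Eventually.of_forall fun t => ?_)
  let m : ι → ℂ := fun j => kappaKernel t (ev j - x) - kappaKernel s (ev j - x) -
    (t - s) * (Complex.I * sigmaKernel s (ev j - x))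
  have hm : ∀ j, ‖m j‖ ≤ |t - s| ^ 2 := fun j => norm_kappaKernel_taylor s t _
  have h1 : corrector b ev x g t - corrector b ev x g s -
      (t - s) • (Complex.I • correctorSlope b ev x g s) = diagOp b m g := by
    refine hilbertBasis_ext b fun j => ?_
    rw [← Complex.coe_smul, inner_sub_right, inner_sub_right, inner_smul_right, inner_smul_right,
      inner_corrector, inner_corrector, inner_correctorSlope, inner_diagOp b ⟨_, hm⟩]
    simp only [m]
    push_cast
    ring
  rw [h1, mul_comm]
  exact norm_diagOp_apply_le b (by positivity) hm g

/-- The equation satisfied by the corrector; together with `hasDerivAt_corrector` it is the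
first-order Schrödinger equation. -/
theorem ham_corrector (h : IsEigenbasis (F.op k) b ev) (x : ℝ) (g : 𝓗) (t : ℝ) :
    ∃ hx : corrector b ev x g t ∈ F.D, F.ham k ⟨_, hx⟩ =
      (x : ℂ) • corrector b ev x g t + (t : ℂ) • g - correctorSlope b ev x g t := by
  refine exists_mem_of_inner_eq h fun j => ?_
  have h1 := mul_kappaKernel t (ev j - x)
  rw [inner_sub_right, inner_add_right, inner_smul_right, inner_smul_right, inner_corrector,
    inner_correctorSlope]
  push_cast at h1
  linear_combination -⟪b j, g⟫_ℂ * h1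

theorem re_form_eq (h : IsEigenbasis (F.op k) b ev) (u : F.D) :
    HasSum (fun j => (ev j + F.c) * ‖⟪b j, (u : 𝓗)⟫_ℂ‖ ^ 2) (⟪(u : 𝓗), F.lam k u⟫_ℂ).re := by
  have h1 := Complex.reCLM.hasSum (b.hasSum_inner_mul_inner (u : 𝓗) (F.lam k u))
  refine h1.congr_fun fun j => ?_
  change _ = (⟪(u : 𝓗), b j⟫_ℂ * ⟪b j, F.lam k u⟫_ℂ).re
  rw [inner_lam h, ← inner_conj_symm (b j), mul_left_comm, Complex.mul_conj, Complex.norm_conj,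
    Complex.normSq_eq_norm_sq, ← Complex.ofReal_mul, Complex.ofReal_re]

/-- The derivatives of the family map eigenvectors to the form domain. -/
theorem sum_form_grad_le (h : IsEigenbasis (F.op k) b ev) (w : E) (i : ι) (s : Finset ι) :
    ∑ j ∈ s, (ev j + F.c) * ‖⟪b j, F.grad k w ⟨b i, basis_mem h i⟩⟫_ℂ‖ ^ 2 ≤
      (F.C₂ * ‖w‖ * (ev i + F.c)) ^ 2 := by
  set g := F.grad k w ⟨b i, basis_mem h i⟩ with hg
  set S := ∑ j ∈ s, (ev j + F.c) * ‖⟪b j, g⟫_ℂ‖ ^ 2 with hS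
  have hS0 : 0 ≤ S := Finset.sum_nonneg fun j _ =>
    mul_nonneg (zero_le_one.trans (one_le_ev h j)) (sq_nonneg _)
  set u := truncD h s g with hu
  have h1 : ⟪g, F.lam k u⟫_ℂ = (S : ℂ) := by
    rw [hu, truncD_apply, map_sum, inner_sum, hS]
    push_cast
    refine Finset.sum_congr rfl fun j _ => ?_
    rw [map_smul, lam_basis h, inner_smul_right, inner_smul_right, ← inner_conj_symm g,
      mul_left_comm, Complex.mul_conj, Complex.normSq_eq_norm_sq]
    push_cast
    ring
  have h2 : ⟪(u : 𝓗), F.lam k u⟫_ℂ = (S : ℂ) := by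
    rw [← h1, hu, coe_truncD, trunc_symm, trunc_lam_truncD h subset_rfl]
  have h3 : ‖⟪g, F.lam k u⟫_ℂ‖ ^ 2 ≤ F.C₂ ^ 2 * ‖w‖ ^ 2 * ‖F.lam k ⟨b i, basis_mem h i⟩‖ ^ 2 *
      (⟪(u : 𝓗), F.lam k u⟫_ℂ).re := F.reg k w ⟨b i, basis_mem h i⟩ u
  have h4 := one_le_ev h i
  rw [h1, h2, lam_basis h, norm_smul, b.orthonormal.1, mul_one, Complex.norm_real,
    Complex.norm_real, Complex.ofReal_re, Real.norm_of_nonneg hS0,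
    Real.norm_of_nonneg (zero_le_one.trans h4), ← mul_pow, ← mul_pow] at h3
  rcases hS0.eq_or_lt with h0 | h0
  · rw [← h0]; positivity
  · rw [sq S] at h3
    exact le_of_mul_le_mul_right h3 h0

/-- The bound uses the form of the corrector only, so that no inverse power of a spectral gap
appears. -/
theorem norm_grad_corrector_le (h : IsEigenbasis (F.op k) b ev) (w : E) (i : ι) (t : ℝ) (v : E)
    (hx : corrector b ev (ev i) (F.grad k w ⟨b i, basis_mem h i⟩) t ∈ F.D) :
    ‖F.grad k v ⟨_, hx⟩‖ ≤ F.C₁ * ‖v‖ * (t ^ 2 * (F.C₂ * ‖w‖ * (ev i + F.c))) := by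
  have hC := F.C₁_nonneg
  have hC2 := F.C₂_nonneg
  have hi := one_le_ev h i
  have hi0 : 0 ≤ ev i + F.c := zero_le_one.trans hi
  have h1 := re_form_eq h ⟨_, hx⟩
  rw [← sq_le_sq₀ (norm_nonneg _) (by positivity), mul_pow, mul_pow]
  refine (norm_grad_sq_le k v _).trans ?_
  gcongr
  refine hasSum_le_of_sum_le h1 fun s => ?_
  rw [mul_pow]
  refine le_trans ?_ (mul_le_mul_of_nonneg_left (sum_form_grad_le h w i s) (sq_nonneg (t ^ 2)))
  rw [Finset.mul_sum]
  refine Finset.sum_le_sum fun j _ => ?_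
  have hj : 0 ≤ ev j + F.c := zero_le_one.trans (one_le_ev h j)
  change (ev j + F.c) * ‖⟪b j, corrector b ev (ev i) _ t⟫_ℂ‖ ^ 2 ≤ _
  rw [inner_corrector, norm_mul, mul_pow, mul_left_comm ((t ^ 2) ^ 2)]
  gcongr
  exact norm_kappaKernel_le _ _

end

end RegularFamily

/-! ### The partial inverse of the Liouvillian -/

section

variable {ι : Type*} {H : Type*} [NormedAddCommGroup H] [InnerProductSpace ℂ H] [CompleteSpace H]
  {A : H →ₗ.[ℂ] H} {b : HilbertBasis ι ℂ H} {ev : ι → ℝ} {μ : ℝ}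

/-- An off-diagonal operator that commutes with `A` vanishes. -/
theorem IsEigenbasis.partialInverse_unique (h : IsEigenbasis A b ev) {Y X X' : H →L[ℂ] H}
    (hX : IsPartialInverse A (specProj A (μ : EReal)) Y X)
    (hX' : IsPartialInverse A (specProj A (μ : EReal)) Y X') : X = X' := by
  refine hilbertBasis_clm_ext b fun j => ?_
  refine hilbertBasis_ext b fun l => ?_
  set P := specProj A (μ : EReal) with hP
  by_cases hjl : ev l = ev j
  · -- within a block, both matrix elements vanish
    have key : ∀ {X : H →L[ℂ] H}, IsOffDiag P X → ⟪b l, X (b j)⟫_ℂ = 0 := by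
      intro X hX
      rcases le_or_gt (ev j) μ with hj | hj
      · have h1 := congrArg (fun T : H →L[ℂ] H => ⟪b l, T (b j)⟫_ℂ) hX.1
        simp only [ContinuousLinearMap.comp_apply, hP] at h1
        rw [h.specProj_basis_of_le hj, ← h.specProj_symm,
          h.specProj_basis_of_le (hjl.le.trans hj)] at h1
        simpa using h1
      · have h1 := congrArg (fun T : H →L[ℂ] H => ⟪b l, T (b j)⟫_ℂ) hX.2
        simp only [ContinuousLinearMap.comp_apply, sub_apply, hP] at h1
        rw [h.specProj_basis_of_lt hj, inner_sub_right, ← h.specProj_symm,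
          h.specProj_basis_of_lt (hjl ▸ hj), inner_zero_left, sub_zero, sub_zero] at h1
        simpa using h1
    rw [key hX.1, key hX'.1]
  · have key : ∀ {X : H →L[ℂ] H}, IsCommutator A X (offDiag P Y) →
        ((ev l : ℂ) - ev j) * ⟪b l, X (b j)⟫_ℂ = ⟪b l, offDiag P Y (b j)⟫_ℂ := by
      intro X hX
      have h1 := h.inner_graph (hX _ _ (h.mem j)) l
      rw [map_smul, inner_add_right, inner_smul_right] at h1
      linear_combination -h1
    have h0 : (ev l : ℂ) - ev j ≠ 0 := by
      rw [← Complex.ofReal_sub, Complex.ofReal_ne_zero]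
      exact sub_ne_zero.2 hjl
    exact mul_left_cancel₀ h0 ((key hX.2).trans (key hX'.2).symm)

theorem IsEigenbasis.liouvPlus_eq (h : IsEigenbasis A b ev) {Y X : H →L[ℂ] H}
    (hX : IsPartialInverse A (specProj A (μ : EReal)) Y X) :
    liouvPlus A (specProj A (μ : EReal)) Y = X := by
  have hex : ∃ X, IsPartialInverse A (specProj A (μ : EReal)) Y X := ⟨X, hX⟩
  rw [liouvPlus, dif_pos hex]
  exact h.partialInverse_unique hex.choose_spec hX

theorem exp_bound (ev : ι → ℝ) (t : ℝ) :
    ∃ K : ℝ, ∀ i, ‖Complex.exp (-(Complex.I * t * ev i))‖ ≤ K :=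
  ⟨1, fun i => (norm_exp_neg_I t (ev i)).le⟩

theorem IsEigenbasis.inner_expGroup (h : IsEigenbasis A b ev) (t : ℝ) (u : H) (i : ι) :
    ⟪b i, expGroup A t u⟫_ℂ = Complex.exp (-(Complex.I * t * ev i)) * ⟪b i, u⟫_ℂ := by
  rw [h.expGroup_eq, inner_diagOp b (exp_bound ev t)]

theorem IsEigenbasis.expGroup_basis (h : IsEigenbasis A b ev) (t : ℝ) (i : ι) :
    expGroup A t (b i) = Complex.exp (-(Complex.I * t * ev i)) • b i := by
  rw [h.expGroup_eq, diagOp_apply_self b (exp_bound ev t)]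

theorem IsEigenbasis.expGroup_symm (h : IsEigenbasis A b ev) (t : ℝ) (u v : H) :
    ⟪expGroup A t u, v⟫_ℂ = ⟪u, expGroup A (-t) v⟫_ℂ := by
  rw [h.expGroup_eq, h.expGroup_eq, diagOp_symm b (exp_bound ev t)]
  congr 3
  ext i
  rw [← Complex.exp_conj]
  congr 1
  simp

end

namespace RegularFamily

open QuadFamily

universe u

variable {E : Type*} {𝓗 : Type u} [NormedAddCommGroup E] [InnerProductSpace ℝ E]
  [NormedAddCommGroup 𝓗] [InnerProductSpace ℂ 𝓗] [CompleteSpace 𝓗] {F : RegularFamily E 𝓗}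

section

variable {ι : Type*} {k w : E} {b : HilbertBasis ι ℂ 𝓗} {ev : ι → ℝ} {μ : ℝ} {P' : 𝓗 →L[ℂ] 𝓗}

open Classical in
/-- The reduced resolvent `(1 - P) (H - x)⁻¹` applied to `g`. -/
def reducedResolvent (b : HilbertBasis ι ℂ 𝓗) (ev : ι → ℝ) (μ x : ℝ) (g : 𝓗) : 𝓗 :=
  diagOp b (fun j => if ev j ≤ μ then 0 else ((ev j - x : ℝ) : ℂ)⁻¹) g

theorem inner_reducedResolvent (h : IsEigenbasis (F.op k) b ev) {x : ℝ} (hx : x ≤ μ) (g : 𝓗)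
    (j : ι) [Decidable (ev j ≤ μ)] : ⟪b j, reducedResolvent b ev μ x g⟫_ℂ =
      if ev j ≤ μ then 0 else ((ev j - x : ℝ) : ℂ)⁻¹ * ⟪b j, g⟫_ℂ := by
  classical
  obtain ⟨y, hy, hgap⟩ := h.exists_gap μ
  rw [reducedResolvent, inner_diagOp b ⟨(y - μ)⁻¹, fun j => ?_⟩]
  · by_cases hj : ev j ≤ μ <;> simp [hj]
  · by_cases hj : ev j ≤ μ
    · simp only [if_pos hj, norm_zero]
      exact inv_nonneg.2 (by linarith)
    · have h1 : y < ev j := not_le.1 fun h2 => hj (hgap j h2)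
      rw [if_neg hj, norm_inv, Complex.norm_real, Real.norm_of_nonneg (by linarith)]
      exact inv_anti₀ (by linarith) (by linarith)

theorem inner_dproj_eq_zero (h : IsEigenbasis (F.op k) b ev)
    (hd : HasLineDerivAt ℝ (F.proj μ) P' k w) {i j : ι} (hi : ev i ≤ μ) (hj : ev j ≤ μ) :
    ⟪b j, P' (b i)⟫_ℂ = 0 := by
  have h1 := proj_dproj_proj hd (b i)
  rw [proj, h.specProj_basis_of_le hi] at h1
  rw [← h.specProj_basis_of_le hj, h.specProj_symm, h1, inner_zero_right]

/-- The values of the partial inverse on occupied eigenvectors. -/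
def response (b : HilbertBasis ι ℂ 𝓗) (ev : ι → ℝ) (μ : ℝ) (P' : 𝓗 →L[ℂ] 𝓗) (i : ι) : 𝓗 :=
  reducedResolvent b ev μ (ev i) (P' (b i))

theorem inner_response_of_le (h : IsEigenbasis (F.op k) b ev) {i j : ι} (hi : ev i ≤ μ)
    (hj : ev j ≤ μ) : ⟪b j, response b ev μ P' i⟫_ℂ = 0 := by
  classical
  rw [response, inner_reducedResolvent h hi, if_pos hj]

theorem mul_inner_response (h : IsEigenbasis (F.op k) b ev)
    (hd : HasLineDerivAt ℝ (F.proj μ) P' k w) {i : ι} (hi : ev i ≤ μ) (j : ι) :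
    ((ev j : ℂ) - ev i) * ⟪b j, response b ev μ P' i⟫_ℂ = ⟪b j, P' (b i)⟫_ℂ := by
  classical
  rcases le_or_gt (ev j) μ with hj | hj
  · rw [inner_response_of_le h hi hj, inner_dproj_eq_zero h hd hi hj, mul_zero]
  · have h1 : ((ev j : ℂ) - ev i) ≠ 0 := by
      rw [← Complex.ofReal_sub, Complex.ofReal_ne_zero]
      linarith
    rw [response, inner_reducedResolvent h hi, if_neg hj.not_ge, Complex.ofReal_sub,
      mul_inv_cancel_left₀ h1]

theorem response_graph (h : IsEigenbasis (F.op k) b ev)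
    (hd : HasLineDerivAt ℝ (F.proj μ) P' k w) {i : ι} (hi : ev i ≤ μ) :
    (response b ev μ P' i, (ev i : ℂ) • response b ev μ P' i + P' (b i)) ∈ (F.op k).graph := by
  refine mem_graph_op.2 (exists_mem_of_inner_eq h fun j => ?_)
  rw [inner_add_right, inner_smul_right]
  linear_combination -mul_inner_response h hd hi j

/-- The finite rank operator `∑ |yᵢ⟩⟨bᵢ| - |bᵢ⟩⟨yᵢ|`. -/
def skewRank (b : HilbertBasis ι ℂ 𝓗) (s : Finset ι) (y : ι → 𝓗) : 𝓗 →L[ℂ] 𝓗 :=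
  ∑ i ∈ s, ((innerSL ℂ (b i)).smulRight (y i) - (innerSL ℂ (y i)).smulRight (b i))

theorem skewRank_apply (b : HilbertBasis ι ℂ 𝓗) (s : Finset ι) (y : ι → 𝓗) (u : 𝓗) :
    skewRank b s y u = ∑ i ∈ s, (⟪b i, u⟫_ℂ • y i - ⟪y i, u⟫_ℂ • b i) := by
  simp [skewRank]

/-- The partial inverse of the Liouvillian has finite rank, with values on occupied eigenvectors
given by the reduced resolvent. -/
theorem isPartialInverse_skewRank (h : IsEigenbasis (F.op k) b ev)
    (hd : HasLineDerivAt ℝ (F.proj μ) P' k w) :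
    IsPartialInverse (F.op k) (F.proj μ k) P'
      (skewRank b (h.finite μ).toFinset (response b ev μ P')) := by
  classical
  set s := (h.finite μ).toFinset with hs
  have hmem : ∀ i, i ∈ s ↔ ev i ≤ μ := by intro i; simp [hs]
  set y := response b ev μ P' with hy
  have hPy : ∀ i ∈ s, F.proj μ k (y i) = 0 := by
    intro i hi
    rw [proj, h.specProj_apply]
    exact Finset.sum_eq_zero fun j hj => by
      rw [inner_response_of_le h ((hmem i).1 hi) ((hmem j).1 hj), zero_smul]
  refine ⟨⟨?_, ?_⟩, ?_⟩
  · refine hilbertBasis_clm_ext b fun j => ?_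
    simp only [ContinuousLinearMap.comp_apply, zero_apply]
    rcases le_or_gt (ev j) μ with hj | hj
    · rw [proj, h.specProj_basis_of_le hj, ← proj, skewRank_apply, map_sum]
      refine Finset.sum_eq_zero fun i hi => ?_
      have h1 : ⟪y i, b j⟫_ℂ = 0 := by
        rw [← inner_conj_symm, inner_response_of_le h ((hmem i).1 hi) hj, map_zero]
      rw [h1, zero_smul, sub_zero, map_smul, hPy i hi, smul_zero]
    · rw [proj, h.specProj_basis_of_lt hj, map_zero, map_zero]
  · refine hilbertBasis_clm_ext b fun j => ?_
    simp only [ContinuousLinearMap.comp_apply, zero_apply, sub_apply]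
    have hone : ∀ x, (1 : 𝓗 →L[ℂ] 𝓗) x = x := fun _ => rfl
    rcases le_or_gt (ev j) μ with hj | hj
    · rw [proj, h.specProj_basis_of_le hj, hone (b j), sub_self, map_zero, map_zero]
      simp
    · rw [proj, h.specProj_basis_of_lt hj, ← proj, sub_zero, hone, hone, skewRank_apply, map_sum,
        ← Finset.sum_sub_distrib]
      refine Finset.sum_eq_zero fun i hi => ?_
      have h1 : ⟪b i, b j⟫_ℂ = 0 := b.orthonormal.2 (by
        rintro rfl
        exact absurd ((hmem i).1 hi) hj.not_ge)
      rw [h1, zero_smul, zero_sub, map_neg, map_smul, proj, h.specProj_basis_of_le ((hmem i).1 hi),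
        sub_self]
  · intro u f huf
    rw [dproj_offDiag hd]
    have h1 : (skewRank b s y u, ∑ i ∈ s, (⟪b i, u⟫_ℂ • ((ev i : ℂ) • y i + P' (b i)) -
        ⟪y i, u⟫_ℂ • ((ev i : ℂ) • b i))) ∈ (F.op k).graph := by
      have h2 : (skewRank b s y u, ∑ i ∈ s, (⟪b i, u⟫_ℂ • ((ev i : ℂ) • y i + P' (b i)) -
          ⟪y i, u⟫_ℂ • ((ev i : ℂ) • b i))) = ∑ i ∈ s,
          (⟪b i, u⟫_ℂ • (y i, (ev i : ℂ) • y i + P' (b i)) -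
            ⟪y i, u⟫_ℂ • (b i, (ev i : ℂ) • b i)) := by
        rw [skewRank_apply]
        ext1
        · simp [Prod.fst_sum]
        · simp [Prod.snd_sum]
      rw [h2]
      exact Submodule.sum_mem _ fun i hi => Submodule.sub_mem _
        (Submodule.smul_mem _ _ (response_graph h hd ((hmem i).1 hi)))
        (Submodule.smul_mem _ _ (h.mem i))
    convert h1 using 2
    have h3 : P' u = ∑ i ∈ s, (⟪b i, u⟫_ℂ • P' (b i) + ⟪P' (b i), u⟫_ℂ • b i) := by
      have h4 := congrArg (fun T : 𝓗 →L[ℂ] 𝓗 => T u) (dproj_leibniz hd)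
      simp only [add_apply, mul_apply_eq_comp] at h4
      rw [← h4, proj, h.specProj_apply, h.specProj_apply, map_sum, ← Finset.sum_add_distrib]
      refine Finset.sum_congr rfl fun i _ => ?_
      rw [map_smul, dproj_symm hd]
    rw [h3, skewRank_apply, ← Finset.sum_add_distrib]
    refine Finset.sum_congr rfl fun i hi => ?_
    have h4 := h.inner_graph huf i
    have h5 := h.symm (response_graph h hd ((hmem i).1 hi)) huf
    rw [inner_add_left, inner_smul_left, Complex.conj_ofReal] at h5
    rw [h4, ← h5]
    module

/-- The response after evolution with the frozen Hamiltonian, minus the response. -/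
def dephased (A : 𝓗 →ₗ.[ℂ] 𝓗) (ev : ι → ℝ) (t : ℝ) (y : ι → 𝓗) (i : ι) : 𝓗 :=
  Complex.exp (Complex.I * t * ev i) • expGroup A t (y i) - y i

theorem liouvExp_sub_skewRank (h : IsEigenbasis (F.op k) b ev) (t : ℝ) (s : Finset ι) (y : ι → 𝓗) :
    liouvExp (F.op k) t (skewRank b s y) - skewRank b s y =
      skewRank b s (dephased (F.op k) ev t y) := by
  ext u
  rw [sub_apply, liouvExp, ContinuousLinearMap.comp_apply, ContinuousLinearMap.comp_apply,
    skewRank_apply, skewRank_apply, skewRank_apply, map_sum, ← Finset.sum_sub_distrib]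
  refine Finset.sum_congr rfl fun i _ => ?_
  rw [map_sub, map_smul, map_smul, h.expGroup_basis, h.inner_expGroup, ← h.expGroup_symm, dephased,
    inner_sub_left, inner_smul_left, ← Complex.exp_conj]
  have e1 : (starRingEnd ℂ) (Complex.I * t * ev i) = -(Complex.I * t * ev i) := by simp
  have e2 : -(Complex.I * ((-t : ℝ) : ℂ) * ev i) = Complex.I * t * ev i := by push_cast; ring
  rw [e1, e2]
  module

theorem inner_dephased (h : IsEigenbasis (F.op k) b ev) (t : ℝ) (y : ι → 𝓗) (i j : ι) :
    ⟪b j, dephased (F.op k) ev t y i⟫_ℂ =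
      (Complex.exp (-(Complex.I * t * (ev j - ev i : ℝ))) - 1) * ⟪b j, y i⟫_ℂ := by
  rw [dephased, inner_sub_right, inner_smul_right, h.inner_expGroup, ← mul_assoc, ← Complex.exp_add,
    sub_mul, one_mul]
  congr 4
  push_cast
  ring

theorem dephased_mem (h : IsEigenbasis (F.op k) b ev) (t : ℝ) {y : ι → 𝓗} {i : ι}
    (hy : y i ∈ F.D) : dephased (F.op k) ev t y i ∈ F.D := by
  refine F.D.sub_mem (F.D.smul_mem _ ?_) hy
  refine (exists_mem_of_inner_eq h (z := expGroup (F.op k) t (F.ham k ⟨y i, hy⟩)) fun j => ?_).1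
  rw [h.inner_expGroup, h.inner_expGroup, h.inner_graph (mem_graph_op_coe ⟨y i, hy⟩)]
  ring

end

end RegularFamily

namespace RegularFamily

open QuadFamily

universe u

variable {E : Type*} {𝓗 : Type u} [NormedAddCommGroup E] [InnerProductSpace ℝ E]
  [NormedAddCommGroup 𝓗] [InnerProductSpace ℂ 𝓗] [CompleteSpace 𝓗] {F : RegularFamily E 𝓗}

/-! ### Expansion of the current carried by one orbit -/

section

variable {ι : Type*} {k v w : E} {b : HilbertBasis ι ℂ 𝓗} {ev : ι → ℝ}

theorem norm_grad_basis_le (h : IsEigenbasis (F.op k) b ev) (v : E) {i : ι} {M : ℝ}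
    (hM : ev i + F.c ≤ M) : ‖F.grad k v ⟨b i, basis_mem h i⟩‖ ≤ F.C₁ * ‖v‖ * M := by
  have hC := F.C₁_nonneg
  have h1 := one_le_ev h i
  refine (norm_grad_le k v _).trans ?_
  rw [lam_basis h, norm_smul, b.orthonormal.1, mul_one, Complex.norm_real,
    Real.norm_of_nonneg (zero_le_one.trans h1)]
  gcongr

/-- The orbit of an eigenvector stays close to the stationary state with its first-order correction:
the error is of order `ε ^ 2`, without any inverse power of a spectral gap. -/
theorem norm_orbit_sub_le (h : IsEigenbasis (F.op k) b ev) (w : E) {i : ι} {M : ℝ}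
    (hM : ev i + F.c ≤ M) {ε t : ℝ} (hε : 0 ≤ ε) (ht : 0 ≤ t) (hεt : ε * t ≤ 1) :
    ‖F.orbit k (ε • w) ⟨b i, basis_mem h i⟩ t - Complex.exp (-(Complex.I * t * ev i)) •
      (b i + (ε : ℂ) • corrector b ev (ev i) (F.grad k w ⟨b i, basis_mem h i⟩) t)‖ ≤
      ε ^ 2 * t ^ 3 * ((1 + t) * (‖w‖ ^ 2 * (1 + F.C₁ * ‖w‖ * M) +
        F.C₁ * ‖w‖ * (F.C₂ * ‖w‖ * M))) := by
  have hC := F.C₁_nonneg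
  have hC2 := F.C₂_nonneg
  have hM1 : 1 ≤ M := (one_le_ev h i).trans hM
  have hM0 : 0 ≤ M := zero_le_one.trans hM1
  set φ : F.D := ⟨b i, basis_mem h i⟩ with hφ
  set g := F.grad k w φ with hg
  have hgM : ‖g‖ ≤ F.C₁ * ‖w‖ * M := norm_grad_basis_le h w hM
  choose hmem hham using ham_corrector h (ev i) g
  let χ : ℝ → F.D := fun s => ⟨corrector b ev (ev i) g s, hmem s⟩
  let z : ℝ → F.D := fun s => φ + (ε : ℂ) • χ s
  let p : ℝ → ℂ := fun s => Complex.exp (-(Complex.I * s * ev i))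
  have hp : ∀ s, ‖p s‖ = 1 := fun s => norm_exp_neg_I s (ev i)
  -- the defect of the approximate solution `p z` in the Schrödinger equation
  let d : ℝ → 𝓗 := fun s => p s • (Complex.I • (((s ^ 2 * ε ^ 2 * ‖w‖ ^ 2 / 2 : ℝ) : ℂ) • (z s : 𝓗)
    - ((s * ε ^ 2 : ℝ) : ℂ) • F.grad k w (χ s)))
  have hy : ∀ s, ((p s • z s : F.D) : 𝓗) ∈ F.D := fun s => (p s • z s).2
  have hχd : ∀ s, HasDerivAt (fun s => (χ s : 𝓗))
      (Complex.I • correctorSlope b ev (ev i) g s) s := fun s => hasDerivAt_corrector b ev (ev i) g s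
  have hpd : ∀ s, HasDerivAt p (p s * -(Complex.I * ev i)) s := by
    intro s
    have h1 := ((((hasDerivAt_id s).ofReal_comp.const_mul Complex.I).mul_const
      (ev i : ℂ)).fun_neg).cexp
    refine h1.congr_deriv ?_
    simp only [id, Complex.ofReal_one, mul_one, p]
  have hhamφ : F.ham k φ = (ev i : ℂ) • b i := by
    obtain ⟨h1, h2⟩ := mem_graph_op.1 (h.mem i)
    exact h2
  have hdy : ∀ s, HasDerivAt (fun s => ((p s • z s : F.D) : 𝓗))
      (-Complex.I • F.ham (k - s • ε • w) ⟨_, hy s⟩ + d s) s := by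
    intro s
    have h1 := (hpd s).smul (((hχd s).const_smul (ε : ℂ)).const_add (φ : 𝓗))
    refine HasDerivAt.congr_deriv h1 ?_
    have h2 : F.ham (k - s • ε • w) (p s • z s) = p s • ((ev i : ℂ) • b i + (ε : ℂ) •
        ((ev i : ℂ) • (χ s : 𝓗) + (s : ℂ) • g - correctorSlope b ev (ev i) g s) -
        ((s * ε : ℝ) : ℂ) • (g + (ε : ℂ) • F.grad k w (χ s)) +
        ((s ^ 2 * ε ^ 2 * ‖w‖ ^ 2 / 2 : ℝ) : ℂ) • (z s : 𝓗)) := by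
      have h3 : F.ham k (z s) = (ev i : ℂ) • b i + (ε : ℂ) •
        ((ev i : ℂ) • (χ s : 𝓗) + (s : ℂ) • g - correctorSlope b ev (ev i) g s) := by
        rw [map_add, map_smul, hhamφ]
        congr 2
        exact hham s
      have h4 : F.grad k w (z s) = g + (ε : ℂ) • F.grad k w (χ s) := by
        rw [map_add, map_smul]
      rw [map_smul, smul_smul s, sub_eq_add_neg, ← neg_smul, ham_add, grad_smul, h3, h4, norm_smul,
        mul_pow, Real.norm_eq_abs, sq_abs, neg_sq, mul_pow]
      push_cast
      module
    change _ = -Complex.I • F.ham (k - s • ε • w) (p s • z s) + d s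
    rw [h2]
    have h5 : ((φ : F.D) : 𝓗) = b i := rfl
    simp only [d, z, Submodule.coe_add, Submodule.coe_smul, χ, Pi.smul_apply, h5]
    push_cast
    module
  have h0 : ((p 0 • z 0 : F.D) : 𝓗) = F.orbit k (ε • w) φ 0 := by
    rw [orbit_zero]
    simp only [p, z, χ, Submodule.coe_smul, Submodule.coe_add, corrector_zero, smul_zero, add_zero,
      Complex.ofReal_zero, mul_zero, zero_mul, neg_zero, Complex.exp_zero, one_smul]
  refine ((isOrbit_orbit F k (ε • w) φ).norm_sub_le hy hdy h0 ht
    (δ := ε ^ 2 * t ^ 2 * ((1 + t) * (‖w‖ ^ 2 * (1 + F.C₁ * ‖w‖ * M) +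
        F.C₁ * ‖w‖ * (F.C₂ * ‖w‖ * M)))) fun s hs hst => ?_).trans (le_of_eq (by ring))
  have e1 : ‖(z s : 𝓗)‖ ≤ (1 + t) * (1 + F.C₁ * ‖w‖ * M) := by
    have h1 : ‖(χ s : 𝓗)‖ ≤ s ^ 2 * (F.C₁ * ‖w‖ * M) :=
      (norm_corrector_le b ev (ev i) g s).trans (by gcongr)
    have h2 : ‖(z s : 𝓗)‖ ≤ 1 + ε * (s ^ 2 * (F.C₁ * ‖w‖ * M)) := by
      refine (norm_add_le _ _).trans ?_
      rw [Submodule.coe_smul, norm_smul, Complex.norm_real, Real.norm_of_nonneg hε]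
      gcongr
      exact (b.orthonormal.1 i).le
    -- one factor `ε` is absorbed by `ε t ≤ 1`
    have h3 : ε * s ^ 2 ≤ t := by
      calc ε * s ^ 2 ≤ ε * t ^ 2 := by gcongr
        _ = (ε * t) * t := by ring
        _ ≤ 1 * t := by gcongr
        _ = t := one_mul t
    have h4 : 0 ≤ F.C₁ * ‖w‖ * M := by positivity
    nlinarith [mul_le_mul_of_nonneg_right h3 h4]
  have e2 : ‖F.grad k w (χ s)‖ ≤ F.C₁ * ‖w‖ * (t ^ 2 * (F.C₂ * ‖w‖ * M)) := by
    have hi0 : 0 ≤ ev i + F.c := zero_le_one.trans (one_le_ev h i)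
    refine (norm_grad_corrector_le h w i s w (hmem s)).trans ?_
    gcongr
  simp only [d]
  rw [norm_smul, norm_smul, hp, Complex.norm_I, one_mul, one_mul]
  refine (norm_sub_le _ _).trans ?_
  rw [norm_smul, norm_smul, Complex.norm_real, Complex.norm_real, Real.norm_of_nonneg
    (by positivity), Real.norm_of_nonneg (by positivity)]
  calc s ^ 2 * ε ^ 2 * ‖w‖ ^ 2 / 2 * ‖(z s : 𝓗)‖ + s * ε ^ 2 * ‖F.grad k w (χ s)‖
      ≤ t ^ 2 * ε ^ 2 * ‖w‖ ^ 2 / 1 * ((1 + t) * (1 + F.C₁ * ‖w‖ * M)) +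
        t * ε ^ 2 * (F.C₁ * ‖w‖ * (t ^ 2 * (F.C₂ * ‖w‖ * M))) := by
        gcongr
        norm_num
    _ = ε ^ 2 * t ^ 2 * ((1 + t) * (‖w‖ ^ 2 * (1 + F.C₁ * ‖w‖ * M)) +
        t * (F.C₁ * ‖w‖ * (F.C₂ * ‖w‖ * M))) := by ring
    _ ≤ _ := by
        rw [mul_add (1 + t)]
        gcongr
        linarith

/-- The three error terms collected into the form `ε ^ 2 * t ^ 3 * (1 + t ^ 3)`. -/
theorem orbit_error_le {ε t D A₁ A₂ A₃ : ℝ} (ht : 0 ≤ t) (hD0 : 0 ≤ D) (hA₁0 : 0 ≤ A₁)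
    (hA₂0 : 0 ≤ A₂) (hA₃0 : 0 ≤ A₃) :
    ε ^ 2 * t ^ 3 * ((1 + t) * D) * A₁ + (1 + t) * A₂ * (ε ^ 2 * t ^ 3 * ((1 + t) * D)) +
      ε ^ 2 * (t ^ 4 * A₃) ≤ 4 * (D * (A₁ + A₂) + A₃) * ε ^ 2 * t ^ 3 * (1 + t ^ 3) := by
  have e4 : (1 + t) ^ 2 ≤ 4 * (1 + t ^ 3) := by
    nlinarith [mul_nonneg (sq_nonneg (t - 1)) (by linarith : 0 ≤ t + 1), pow_nonneg ht 3, sq_nonneg t]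
  have e5 : 0 ≤ D * (A₁ + A₂) + A₃ := by positivity
  calc ε ^ 2 * t ^ 3 * ((1 + t) * D) * A₁ + (1 + t) * A₂ * (ε ^ 2 * t ^ 3 * ((1 + t) * D)) +
        ε ^ 2 * (t ^ 4 * A₃)
      = ε ^ 2 * t ^ 3 * ((1 + t) * D * A₁ + (1 + t) ^ 2 * (D * A₂) + t * A₃) := by ring
    _ ≤ ε ^ 2 * t ^ 3 * ((1 + t) ^ 2 * D * A₁ + (1 + t) ^ 2 * (D * A₂) + (1 + t) ^ 2 * A₃) := by
        have h1 : (1 + t) ≤ (1 + t) ^ 2 := by nlinarith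
        have h2 : t ≤ (1 + t) ^ 2 := by nlinarith
        gcongr
    _ = ε ^ 2 * t ^ 3 * ((1 + t) ^ 2 * (D * (A₁ + A₂) + A₃)) := by ring
    _ ≤ ε ^ 2 * t ^ 3 * (4 * (1 + t ^ 3) * (D * (A₁ + A₂) + A₃)) := by gcongr
    _ = _ := by ring

set_option maxHeartbeats 800000 in
/-- The current carried by the orbit of an eigenvector, up to an error of order `ε ^ 2`. -/
theorem exists_orbit_expansion (F : RegularFamily E 𝓗) (v w : E) (M : ℝ) : ∃ C : ℝ, 0 ≤ C ∧
    ∀ {ι : Type u} {k : E} {b : HilbertBasis ι ℂ 𝓗} {ev : ι → ℝ} (h : IsEigenbasis (F.op k) b ev)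
      (i : ι), ev i + F.c ≤ M → ∀ ε t : ℝ, 0 ≤ ε → 0 ≤ t → ε * t ≤ 1 →
      ‖⟪F.orbit k (ε • w) ⟨b i, basis_mem h i⟩ t, F.grad (k - t • ε • w) v
          ⟨_, (isOrbit_orbit F k (ε • w) ⟨b i, basis_mem h i⟩).mem t⟩⟫_ℂ -
        (⟪b i, F.grad k v ⟨b i, basis_mem h i⟩⟫_ℂ - (ε * t) * (⟪w, v⟫_ℝ : ℂ) +
          ε * (⟪F.grad k v ⟨b i, basis_mem h i⟩,
              corrector b ev (ev i) (F.grad k w ⟨b i, basis_mem h i⟩) t⟫_ℂ +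
            ⟪corrector b ev (ev i) (F.grad k w ⟨b i, basis_mem h i⟩) t,
              F.grad k v ⟨b i, basis_mem h i⟩⟫_ℂ))‖ ≤ C * ε ^ 2 * t ^ 3 * (1 + t ^ 3) := by
  have hC := F.C₁_nonneg
  have hC2 := F.C₂_nonneg
  let M' := max M 0
  have hM'0 : 0 ≤ M' := le_max_right _ _
  set D := ‖w‖ ^ 2 * (1 + F.C₁ * ‖w‖ * M') + F.C₁ * ‖w‖ * (F.C₂ * ‖w‖ * M') with hD
  set A₁ := F.C₁ * ‖v‖ * (Real.exp (F.C₁ * ‖w‖) * M') + ‖w‖ * ‖v‖ with hA₁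
  set A₂ := F.C₁ * ‖v‖ * M' * (1 + F.C₂ * ‖w‖) with hA₂
  set A₃ := F.C₁ * ‖w‖ * M' * (F.C₁ * ‖v‖ * (F.C₂ * ‖w‖ * M')) with hA₃
  have hD0 : 0 ≤ D := by positivity
  have hA₁0 : 0 ≤ A₁ := by positivity
  have hA₂0 : 0 ≤ A₂ := by positivity
  have hA₃0 : 0 ≤ A₃ := by positivity
  clear_value D A₁ A₂ A₃
  refine ⟨4 * (D * (A₁ + A₂) + A₃), by positivity, ?_⟩
  intro ι k b ev h i hiM ε t hε ht hεt
  replace hiM : ev i + F.c ≤ M' := hiM.trans (le_max_left _ _)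
  set φ : F.D := ⟨b i, basis_mem h i⟩ with hφ
  have hu := isOrbit_orbit F k (ε • w) φ
  set g := F.grad k w φ with hg
  obtain ⟨hχ, -⟩ := ham_corrector h (ev i) g t
  set χ : F.D := ⟨corrector b ev (ev i) g t, hχ⟩ with hχdef
  have hr := norm_orbit_sub_le h w hiM hε ht hεt
  rw [← hφ, ← hg, ← hD] at hr
  set u : F.D := ⟨_, hu.mem t⟩ with hudef
  set p := Complex.exp (-(Complex.I * t * ev i)) with hp
  have hp1 : ‖p‖ = 1 := norm_exp_neg_I t (ev i)
  let z : F.D := φ + (ε : ℂ) • χ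
  have hr' : ‖((u - p • z : F.D) : 𝓗)‖ ≤ ε ^ 2 * t ^ 3 * ((1 + t) * D) := hr
  have hun : ‖(u : 𝓗)‖ = 1 := by
    have h1 := hu.norm_eq t 0
    rw [orbit_zero] at h1
    exact h1.trans (b.orthonormal.1 i)
  have hgM : ‖g‖ ≤ F.C₁ * ‖w‖ * M' := norm_grad_basis_le h w hiM
  -- the gradient at the displaced momentum
  have hgrad : F.grad (k - t • ε • w) v u = F.grad k v u - ((ε * t * ⟪w, v⟫_ℝ : ℝ) : ℂ) • (u : 𝓗) := by
    rw [sub_eq_add_neg, grad_add_left, inner_neg_left, inner_smul_left, inner_smul_left, sub_eq_add_neg,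
      ← neg_smul]
    simp only [conj_trivial]
    push_cast
    congr 2
    ring
  have huu : ⟪(u : 𝓗), (u : 𝓗)⟫_ℂ = 1 := by
    rw [inner_self_eq_norm_sq_to_K, hun]; simp
  have hau : ‖F.grad k v u‖ ≤ A₁ := by
    have h1 : F.grad k v u = F.grad (k - t • ε • w) v u + ((ε * t * ⟪w, v⟫_ℝ : ℝ) : ℂ) • (u : 𝓗) := by
      rw [hgrad, sub_add_cancel]
    rw [h1, hA₁]
    refine (norm_add_le _ _).trans (add_le_add ?_ ?_)
    · refine (norm_grad_le _ v u).trans ?_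
      gcongr
      have hΛ : ‖F.lam k φ‖ ≤ M' := by
        rw [hφ, lam_basis h, norm_smul, b.orthonormal.1, mul_one, Complex.norm_real,
          Real.norm_of_nonneg (zero_le_one.trans (one_le_ev h i))]
        exact hiM
      refine (norm_lift_orbit_le F k (ε • w) φ t).trans ?_
      rw [norm_smul, Real.norm_of_nonneg hε, abs_of_nonneg ht]
      -- the growth of `‖(H + c) u‖` is harmless on the time scale `ε t ≤ 1`
      have hexp : F.C₁ * (ε * ‖w‖) * t ≤ F.C₁ * ‖w‖ := by
        calc F.C₁ * (ε * ‖w‖) * t = F.C₁ * ‖w‖ * (ε * t) := by ring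
          _ ≤ F.C₁ * ‖w‖ * 1 := by gcongr
          _ = _ := mul_one _
      gcongr
    · rw [norm_smul, hun, mul_one, Complex.norm_real, norm_mul, Real.norm_of_nonneg (by positivity)]
      calc ε * t * ‖⟪w, v⟫_ℝ‖ ≤ 1 * (‖w‖ * ‖v‖) := by
            gcongr
            exact norm_inner_le_norm _ _
        _ = _ := one_mul _
  have haχ : ‖F.grad k v χ‖ ≤ t ^ 2 * (F.C₁ * ‖v‖ * (F.C₂ * ‖w‖ * M')) := by
    refine (norm_grad_corrector_le h w i t v hχ).trans ?_
    calc F.C₁ * ‖v‖ * (t ^ 2 * (F.C₂ * ‖w‖ * (ev i + F.c)))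
        ≤ F.C₁ * ‖v‖ * (t ^ 2 * (F.C₂ * ‖w‖ * M')) := by gcongr
      _ = _ := by ring
  have hχn : ‖(χ : 𝓗)‖ ≤ t ^ 2 * (F.C₁ * ‖w‖ * M') :=
    (norm_corrector_le b ev (ev i) g t).trans (by gcongr)
  have haz : ‖F.grad k v (p • z)‖ ≤ (1 + t) * A₂ := by
    rw [map_smul, norm_smul, hp1, one_mul]
    have h1 : ‖F.grad k v z‖ ≤ F.C₁ * ‖v‖ * M' + ε * (t ^ 2 * (F.C₁ * ‖v‖ * (F.C₂ * ‖w‖ * M'))) := by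
      simp only [z]
      rw [map_add, map_smul]
      refine (norm_add_le _ _).trans ?_
      rw [norm_smul, Complex.norm_real, Real.norm_of_nonneg hε]
      gcongr
      exact norm_grad_basis_le h v hiM
    have h2 : ε * t ^ 2 ≤ t := by nlinarith
    have h3 : 0 ≤ F.C₁ * ‖v‖ * M' := by positivity
    have h4 : 0 ≤ F.C₁ * ‖v‖ * (F.C₂ * ‖w‖ * M') := by positivity
    have h5 := mul_le_mul_of_nonneg_right h2 h4
    rw [hA₂]
    nlinarith [mul_nonneg ht h3]
  have hzz : ⟪((p • z : F.D) : 𝓗), F.grad k v (p • z)⟫_ℂ = ⟪(φ : 𝓗), F.grad k v φ⟫_ℂ +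
      ε * (⟪F.grad k v φ, (χ : 𝓗)⟫_ℂ + ⟪(χ : 𝓗), F.grad k v φ⟫_ℂ) +
      ε ^ 2 * ⟪(χ : 𝓗), F.grad k v χ⟫_ℂ := by
    have h1 : (starRingEnd ℂ) p * p = 1 := by
      rw [Complex.conj_mul', hp1]; simp
    rw [map_smul, Submodule.coe_smul, inner_smul_left, inner_smul_right, ← mul_assoc, h1, one_mul]
    simp only [z]
    rw [map_add, map_smul, Submodule.coe_add, Submodule.coe_smul, inner_add_left, inner_add_right,
      inner_add_right, inner_smul_left, inner_smul_right, inner_smul_left, inner_smul_right,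
      Complex.conj_ofReal, grad_symm k v φ χ]
    ring
  -- polarization around the approximate solution, by symmetry of the gradient
  have hmain : ⟪(u : 𝓗), F.grad (k - t • ε • w) v u⟫_ℂ - (⟪(φ : 𝓗), F.grad k v φ⟫_ℂ -
      (ε * t) * (⟪w, v⟫_ℝ : ℂ) + ε * (⟪F.grad k v φ, (χ : 𝓗)⟫_ℂ + ⟪(χ : 𝓗), F.grad k v φ⟫_ℂ)) =
      ⟪((u - p • z : F.D) : 𝓗), F.grad k v u⟫_ℂ +
      ⟪F.grad k v (p • z), ((u - p • z : F.D) : 𝓗)⟫_ℂ + ε ^ 2 * ⟪(χ : 𝓗), F.grad k v χ⟫_ℂ := by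
    have h1 : ⟪F.grad k v (p • z), ((u - p • z : F.D) : 𝓗)⟫_ℂ =
        ⟪((p • z : F.D) : 𝓗), F.grad k v u⟫_ℂ - ⟪((p • z : F.D) : 𝓗), F.grad k v (p • z)⟫_ℂ := by
      rw [grad_symm, map_sub, inner_sub_right]
    rw [hgrad, inner_sub_right, inner_smul_right, huu, h1, hzz, Submodule.coe_sub, inner_sub_left]
    push_cast
    ring
  change ‖⟪(u : 𝓗), F.grad (k - t • ε • w) v u⟫_ℂ - (⟪(φ : 𝓗), F.grad k v φ⟫_ℂ -
      (ε * t) * (⟪w, v⟫_ℝ : ℂ) + ε * (⟪F.grad k v φ, (χ : 𝓗)⟫_ℂ + ⟪(χ : 𝓗), F.grad k v φ⟫_ℂ))‖ ≤ _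
  rw [hmain]
  have e1 : ‖⟪((u - p • z : F.D) : 𝓗), F.grad k v u⟫_ℂ‖ ≤ ε ^ 2 * t ^ 3 * ((1 + t) * D) * A₁ :=
    (norm_inner_le_norm _ _).trans (by gcongr)
  have e2 : ‖⟪F.grad k v (p • z), ((u - p • z : F.D) : 𝓗)⟫_ℂ‖ ≤
      (1 + t) * A₂ * (ε ^ 2 * t ^ 3 * ((1 + t) * D)) :=
    (norm_inner_le_norm _ _).trans (by gcongr)
  have e3 : ‖(ε : ℂ) ^ 2 * ⟪(χ : 𝓗), F.grad k v χ⟫_ℂ‖ ≤ ε ^ 2 * (t ^ 4 * A₃) := by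
    rw [norm_mul, norm_pow, Complex.norm_real, Real.norm_of_nonneg hε]
    gcongr
    refine (norm_inner_le_norm _ _).trans ((mul_le_mul hχn haχ (norm_nonneg _)
      (by positivity)).trans (le_of_eq ?_))
    rw [hA₃]
    ring
  exact (norm_add₃_le.trans (add_le_add (add_le_add e1 e2) e3)).trans
    (orbit_error_le ht hD0 hA₁0 hA₂0 hA₃0)

end

end RegularFamily

namespace RegularFamily

open QuadFamily

universe u

variable {E : Type*} {𝓗 : Type u} [NormedAddCommGroup E] [InnerProductSpace ℝ E]
  [NormedAddCommGroup 𝓗] [InnerProductSpace ℂ 𝓗] [CompleteSpace 𝓗] {F : RegularFamily E 𝓗}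

/-! ### The current of the occupied bands -/

section

variable {ι : Type*} {k v w : E} {b : HilbertBasis ι ℂ 𝓗} {ev : ι → ℝ} {μ : ℝ} {P' : 𝓗 →L[ℂ] 𝓗}

/-- For an empty final state, `θ κ_t (θ) = t - σ_t (θ)` splits the corrector into the derivative of
the projector and its dephased partial inverse. -/
theorem corrector_eq (h : IsEigenbasis (F.op k) b ev) (hd : HasLineDerivAt ℝ (F.proj μ) P' k w)
    {i : ι} (hi : ev i ≤ μ) (t : ℝ) :
    corrector b ev (ev i) (F.grad k w ⟨b i, basis_mem h i⟩) t =
      trunc b (h.finite μ).toFinset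
        (corrector b ev (ev i) (F.grad k w ⟨b i, basis_mem h i⟩) t) + (-(t : ℂ)) • P' (b i) +
      Complex.I • dephased (F.op k) ev t (response b ev μ P') i := by
  classical
  refine hilbertBasis_ext b fun j => ?_
  rw [inner_add_right, inner_add_right, inner_smul_right, inner_smul_right, inner_trunc,
    inner_dephased h]
  have hmem : j ∈ (h.finite μ).toFinset ↔ ev j ≤ μ := by simp
  rcases le_or_gt (ev j) μ with hj | hj
  · rw [if_pos (hmem.2 hj), inner_dproj_eq_zero h hd hi hj, inner_response_of_le h hi hj]
    ring
  · rw [if_neg fun h1 => hj.not_ge (hmem.1 h1), inner_corrector]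
    have h1 := inner_dproj h hd hi hj
    have h2 := mul_inner_response h hd hi j
    have h3 := mul_kappaKernel t (ev j - ev i)
    have h4 := mul_sigmaKernel t (ev j - ev i)
    have h5 : ⟪b j, F.grad k w ⟨b i, basis_mem h i⟩⟫_ℂ =
        -(((ev j : ℂ) - ev i) * ⟪b j, P' (b i)⟫_ℂ) := by rw [h1, neg_neg]
    rw [h5]
    push_cast at h3 h4 ⊢
    linear_combination (-⟪b j, P' (b i)⟫_ℂ) * h3 + ⟪b j, response b ev μ P' i⟫_ℂ * h4 -
      sigmaKernel t (ev j - ev i) * h2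

/-- Summed over the occupied states, the first-order corrections contribute to the current through
the derivative of the projector and its dephased partial inverse; the contributions of transitions
between occupied states cancel in pairs. -/
theorem sum_corrector (h : IsEigenbasis (F.op k) b ev) (hd : HasLineDerivAt ℝ (F.proj μ) P' k w)
    (v : E) (t : ℝ) :
    ∑ i ∈ (h.finite μ).toFinset,
      (⟪F.grad k v ⟨b i, basis_mem h i⟩,
          corrector b ev (ev i) (F.grad k w ⟨b i, basis_mem h i⟩) t⟫_ℂ +
        ⟪corrector b ev (ev i) (F.grad k w ⟨b i, basis_mem h i⟩) t,
          F.grad k v ⟨b i, basis_mem h i⟩⟫_ℂ) =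
    -t * ∑ i ∈ (h.finite μ).toFinset, (⟪F.grad k v ⟨b i, basis_mem h i⟩, P' (b i)⟫_ℂ +
        ⟪P' (b i), F.grad k v ⟨b i, basis_mem h i⟩⟫_ℂ) +
    Complex.I * ∑ i ∈ (h.finite μ).toFinset,
      (⟪F.grad k v ⟨b i, basis_mem h i⟩, dephased (F.op k) ev t (response b ev μ P') i⟫_ℂ -
        ⟪dephased (F.op k) ev t (response b ev μ P') i, F.grad k v ⟨b i, basis_mem h i⟩⟫_ℂ) := by
  set s := (h.finite μ).toFinset with hs
  have hmem : ∀ i ∈ s, ev i ≤ μ := by intro i hi; simpa [hs] using hi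
  let a : ι → 𝓗 := fun i => F.grad k v ⟨b i, basis_mem h i⟩
  let g : ι → 𝓗 := fun i => F.grad k w ⟨b i, basis_mem h i⟩
  let χ : ι → 𝓗 := fun i => corrector b ev (ev i) (g i) t
  let η : ι → 𝓗 := dephased (F.op k) ev t (response b ev μ P')
  have hsymm : ∀ (x : E) (i j : ι), (starRingEnd ℂ) ⟪b i, F.grad k x ⟨b j, basis_mem h j⟩⟫_ℂ =
      ⟪b j, F.grad k x ⟨b i, basis_mem h i⟩⟫_ℂ := by
    intro x i j
    exact (inner_conj_symm _ _).trans (grad_symm k x ⟨b j, basis_mem h j⟩ ⟨b i, basis_mem h i⟩)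
  -- exchanging `i` and `j` turns one double sum into the negative of the other,
  -- since the conjugate of `κ_t (-θ)` is `-κ_t (θ)`
  have hzero : ∑ i ∈ s, (⟪a i, trunc b s (χ i)⟫_ℂ + ⟪trunc b s (χ i), a i⟫_ℂ) = 0 := by
    have e1 : ∀ i, ⟪a i, trunc b s (χ i)⟫_ℂ =
        ∑ j ∈ s, kappaKernel t (ev j - ev i) * ⟪b j, g i⟫_ℂ * ⟪b i, a j⟫_ℂ := by
      intro i
      rw [trunc_apply, inner_sum]
      refine Finset.sum_congr rfl fun j _ => ?_
      rw [inner_smul_right, inner_corrector, ← inner_conj_symm (𝕜 := ℂ) (a i) (b j), hsymm]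
    have e2 : ∀ i, ⟪trunc b s (χ i), a i⟫_ℂ =
        ∑ j ∈ s, -(kappaKernel t (ev i - ev j) * ⟪b i, g j⟫_ℂ * ⟪b j, a i⟫_ℂ) := by
      intro i
      rw [trunc_apply]
      refine (sum_inner s _ (a i)).trans ?_
      refine Finset.sum_congr rfl fun j _ => ?_
      rw [inner_smul_left, inner_corrector, map_mul, hsymm, ← neg_sub, conj_kappaKernel]
      ring
    rw [Finset.sum_add_distrib, Finset.sum_congr rfl fun i _ => e1 i,
      Finset.sum_congr rfl fun i _ => e2 i, Finset.sum_comm, ← Finset.sum_add_distrib]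
    refine Finset.sum_eq_zero fun i _ => ?_
    rw [← Finset.sum_add_distrib]
    exact Finset.sum_eq_zero fun j _ => by ring
  have hterm : ∀ i ∈ s, ⟪a i, χ i⟫_ℂ + ⟪χ i, a i⟫_ℂ =
      (⟪a i, trunc b s (χ i)⟫_ℂ + ⟪trunc b s (χ i), a i⟫_ℂ) +
      (-t * (⟪a i, P' (b i)⟫_ℂ + ⟪P' (b i), a i⟫_ℂ) +
        Complex.I * (⟪a i, η i⟫_ℂ - ⟪η i, a i⟫_ℂ)) := by
    intro i hi
    have e1 := congrArg (fun x => ⟪a i, x⟫_ℂ + ⟪x, a i⟫_ℂ) (corrector_eq h hd (hmem i hi) t)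
    refine e1.trans ?_
    simp only [inner_add_left, inner_add_right, inner_smul_left, inner_smul_right, map_neg,
      Complex.conj_ofReal, Complex.conj_I]
    ring
  rw [Finset.sum_congr rfl hterm, Finset.sum_add_distrib, hzero, zero_add, Finset.sum_add_distrib,
    Finset.mul_sum, Finset.mul_sum]

theorem mem_graph_gradOp {x y : 𝓗} (z : F.D) (hx : (z : 𝓗) = x) (hy : F.grad k v z = y) :
    (x, y) ∈ (F.gradOp k v).graph := by
  rw [LinearPMap.mem_graph_iff]
  exact ⟨z, hx, hy⟩

theorem hasTrace_skewRank (h : IsEigenbasis (F.op k) b ev) (v : E) (s : Finset ι) {y : ι → 𝓗}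
    (hy : ∀ i ∈ s, y i ∈ F.D) : HasTrace (F.gradOp k v) (skewRank b s y)
      (∑ i ∈ s, (⟪F.grad k v ⟨b i, basis_mem h i⟩, y i⟫_ℂ -
        ⟪y i, F.grad k v ⟨b i, basis_mem h i⟩⟫_ℂ)) := by
  classical
  let Y : ι → F.D := fun i => if hi : y i ∈ F.D then ⟨y i, hi⟩ else 0
  have hY : ∀ i ∈ s, (Y i : 𝓗) = y i := fun i hi => by simp only [Y, dif_pos (hy i hi)]
  let φ : ι → F.D := fun i => ⟨b i, basis_mem h i⟩
  let T : 𝓗 →L[ℂ] 𝓗 := ∑ i ∈ s, ((innerSL ℂ (b i)).smulRight (F.grad k v (Y i)) -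
    (innerSL ℂ (y i)).smulRight (F.grad k v (φ i)))
  have hTu : ∀ u, T u = ∑ i ∈ s, (⟪b i, u⟫_ℂ • F.grad k v (Y i) - ⟪y i, u⟫_ℂ • F.grad k v (φ i)) := by
    intro u; simp [T]
  have h1 := hasTrace_of_finite_rank (A := F.gradOp k v) (X := skewRank b s y) (T := T)
    (s := s.disjSum s) (x := Sum.elim (fun i => F.grad k v (Y i)) (fun i => -F.grad k v (φ i)))
    (y := Sum.elim (fun i => b i) y) ?_ ?_
  · convert h1 using 1
    rw [Finset.sum_disjSum, ← Finset.sum_add_distrib]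
    refine Finset.sum_congr rfl fun i hi => ?_
    simp only [Sum.elim_inl, Sum.elim_inr]
    rw [inner_neg_right, sub_eq_add_neg, ← hY i hi]
    congr 1
    exact grad_symm k v _ _
  · intro u
    refine mem_graph_gradOp (∑ i ∈ s, (⟪b i, u⟫_ℂ • Y i - ⟪y i, u⟫_ℂ • φ i)) ?_ ?_
    · rw [skewRank_apply, Submodule.coe_sum]
      refine Finset.sum_congr rfl fun i hi => ?_
      rw [Submodule.coe_sub, Submodule.coe_smul, Submodule.coe_smul, hY i hi]
    · rw [map_sum, hTu]
      exact Finset.sum_congr rfl fun i _ => by rw [map_sub, map_smul, map_smul]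
  · intro u
    rw [hTu, Finset.sum_disjSum, ← Finset.sum_add_distrib]
    refine Finset.sum_congr rfl fun i hi => ?_
    simp only [Sum.elim_inl, Sum.elim_inr]
    rw [smul_neg, sub_eq_add_neg]

/-- The trace of the velocity operator against the evolved projector. -/
theorem hasTrace_evolved (h : IsEigenbasis (F.op k) b ev) (v e : E) (μ t : ℝ) :
    HasTrace (F.gradOp (k - t • e) v)
      (F.propagator k e t ∘L F.proj μ k ∘L ContinuousLinearMap.adjoint (F.propagator k e t))
      (∑ i ∈ (h.finite μ).toFinset, ⟪F.orbit k e ⟨b i, basis_mem h i⟩ t, F.grad (k - t • e) v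
          ⟨_, (isOrbit_orbit F k e ⟨b i, basis_mem h i⟩).mem t⟩⟫_ℂ) := by
  set s := (h.finite μ).toFinset
  let φ : ι → F.D := fun i => ⟨b i, basis_mem h i⟩
  let u : ι → F.D := fun i => ⟨_, (isOrbit_orbit F k e (φ i)).mem t⟩
  let T : 𝓗 →L[ℂ] 𝓗 := ∑ i ∈ s, (innerSL ℂ (u i : 𝓗)).smulRight (F.grad (k - t • e) v (u i))
  have hTu : ∀ f, T f = ∑ i ∈ s, ⟪(u i : 𝓗), f⟫_ℂ • F.grad (k - t • e) v (u i) := by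
    intro f; simp [T]
  refine hasTrace_of_finite_rank (T := T) (fun f => ?_) hTu
  refine mem_graph_gradOp (∑ i ∈ s, ⟪(u i : 𝓗), f⟫_ℂ • u i) ?_ ?_
  · rw [ContinuousLinearMap.comp_apply, ContinuousLinearMap.comp_apply, proj, h.specProj_apply,
      map_sum, Submodule.coe_sum]
    refine Finset.sum_congr rfl fun i _ => ?_
    rw [map_smul, ContinuousLinearMap.adjoint_inner_right, Submodule.coe_smul]
    have h1 : F.propagator k e t (b i) = u i := propagator_apply F k e t (φ i)
    rw [h1]
  · rw [map_sum, hTu]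
    exact Finset.sum_congr rfl fun i _ => by rw [map_smul]

end

theorem _root_.BlochTransport.HasTrace.mono {A A' : 𝓗 →ₗ.[ℂ] 𝓗} {X : 𝓗 →L[ℂ] 𝓗} {τ : ℂ}
    (h : HasTrace A X τ) (hA : A.graph ≤ A'.graph) : HasTrace A' X τ := by
  obtain ⟨T, hT, h1, h2⟩ := h
  exact ⟨T, fun u => hA (hT u), h1, h2⟩

/-! ### Linear response of the abstract family -/

section

variable {ι : Type*} {k v w : E} {b : HilbertBasis ι ℂ 𝓗} {ev : ι → ℝ} {μ : ℝ} {N : ℕ}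

/-- The projector on the `N` lowest bands. -/
def bands (F : RegularFamily E 𝓗) (N : ℕ) (k : E) : 𝓗 →L[ℂ] 𝓗 :=
  specProj (F.op k) (eigval (F.op k) N)

theorem bands_eq_proj (hN : numBelow (F.op k) μ = N) : F.bands N k = F.proj μ k := by
  obtain ⟨ι, b, ev, h⟩ := exists_isEigenbasis F k
  exact h.specProj_eigval ((h.numBelow_eq μ).symm.trans hN)

theorem eventually_bands_eq (hP : ContDiffAt ℝ 2 (F.proj μ) k) (hN : numBelow (F.op k) μ = N) :
    F.bands N =ᶠ[𝓝 k] F.proj μ := by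
  filter_upwards [eventually_numBelow hP] with k' hk'
  exact bands_eq_proj (hk'.trans hN)

theorem eventually_energy_eq (hP : ContDiffAt ℝ 2 (F.proj μ) k) (hN : numBelow (F.op k) μ = N) :
    (fun k' => tr (F.op k') (F.bands N k')) =ᶠ[𝓝 k] fun k' => tr (F.op k') (F.proj μ k') := by
  filter_upwards [eventually_bands_eq hP hN] with k' hk'
  rw [hk']

theorem tr_gradOp (h : IsEigenbasis (F.op k) b ev) (v : E) (μ : ℝ) :
    tr (F.gradOp k v) (F.proj μ k) =
      ∑ i ∈ (h.finite μ).toFinset, ⟪b i, F.grad k v ⟨b i, basis_mem h i⟩⟫_ℂ := by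
  rw [(hasTrace_base h fun u => gradProj_graph F k v u).tr_eq, cornerTrace_apply]
  refine Finset.sum_congr rfl fun i hi => ?_
  rw [← grad_proj]
  congr 3
  rw [proj, h.specProj_basis_of_le (by simpa using hi)]

theorem lineDeriv_energy (hP : ContDiffAt ℝ 2 (F.proj μ) k) (hN : numBelow (F.op k) μ = N) (v : E) :
    lineDeriv ℝ (fun k' => tr (F.op k') (F.bands N k')) k v = tr (F.gradOp k v) (F.proj μ k) := by
  obtain ⟨ι, b, ev, h⟩ := exists_isEigenbasis F k
  rw [(eventually_energy_eq hP hN).lineDeriv_eq]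
  exact (hasLineDerivAt_energy h hP v).lineDeriv

theorem contDiffAt_energy (hP : ContDiffAt ℝ 2 (F.proj μ) k) (hN : numBelow (F.op k) μ = N) :
    ContDiffAt ℝ 2 (fun k' => tr (F.op k') (F.bands N k')) k :=
  (contDiffAt_tr hP (contDiffAt_hamProj hP) fun k' u => hamProj_graph F k' u).congr_of_eventuallyEq
    (eventually_energy_eq hP hN)

theorem lineDeriv_lineDeriv_energy (h : IsEigenbasis (F.op k) b ev)
    (hP : ∀ᶠ k' in 𝓝 k, ContDiffAt ℝ 2 (F.proj μ) k') (hN : numBelow (F.op k) μ = N) (v w : E) :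
    lineDeriv ℝ (fun k' => lineDeriv ℝ (fun k' => tr (F.op k') (F.bands N k')) k' w) k v =
      ∑ i ∈ (h.finite μ).toFinset, ((⟪w, v⟫_ℝ : ℂ) +
        ⟪F.grad k v ⟨b i, basis_mem h i⟩, lineDeriv ℝ (F.proj μ) k w (b i)⟫_ℂ +
        ⟪lineDeriv ℝ (F.proj μ) k w (b i), F.grad k v ⟨b i, basis_mem h i⟩⟫_ℂ) := by
  have hP0 := hP.self_of_nhds
  rw [lineDeriv_lineDeriv_comm (contDiffAt_energy hP0 hN)]
  have h1 : (fun k' => lineDeriv ℝ (fun k' => tr (F.op k') (F.bands N k')) k' v) =ᶠ[𝓝 k]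
      fun k' => tr (F.gradOp k' v) (F.proj μ k') := by
    filter_upwards [hP, eventually_numBelow hP0] with k' hk' hk''
    exact lineDeriv_energy hk' (hk''.trans hN) v
  rw [h1.lineDeriv_eq]
  exact (hasLineDerivAt_tr_grad h hP0 ((hP0.differentiableAt
    (by norm_num)).lineDifferentiableAt.hasLineDerivAt) v).lineDeriv

/-- Between the level `μ` and the next eigenvalue there is a level at which the projector is smooth. -/
theorem exists_smooth_level (h : IsEigenbasis (F.op k) b ev) (hμ : 0 < μ + F.c) :
    ∃ y, (∀ i, ev i ≤ y ↔ ev i ≤ μ) ∧ ∀ᶠ k' in 𝓝 k, ContDiffAt ℝ 2 (F.proj y) k' := by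
  obtain ⟨y, hy, hgap⟩ := h.exists_gap μ
  refine ⟨y, fun i => ⟨hgap i, fun hi => hi.trans hy.le⟩, ?_⟩
  have h1 : eigenspace (F.op k) y = ⊥ := (h.eigenspace_eq_bot_iff y).2 fun i hi =>
    absurd (hgap i hi.le) (by rw [hi]; exact hy.not_ge)
  exact (eventually_contDiffAt_specProj (by linarith) h1).mono fun k' hk' => hk'.2

/-- The current carried by the evolved projector, up to an error of order `ε ^ 2`, in terms of the
level `y` slightly above `μ`. -/
theorem norm_current_sub_le (h : IsEigenbasis (F.op k) b ev)
    (hP : ∀ᶠ k' in 𝓝 k, ContDiffAt ℝ 2 (F.proj μ) k') (hN : numBelow (F.op k) μ = N) {v w : E}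
    {ε t C : ℝ}
    (hC : ∀ i, ev i ≤ μ → ‖⟪F.orbit k (ε • w) ⟨b i, basis_mem h i⟩ t, F.grad (k - t • ε • w) v
          ⟨_, (isOrbit_orbit F k (ε • w) ⟨b i, basis_mem h i⟩).mem t⟩⟫_ℂ -
        (⟪b i, F.grad k v ⟨b i, basis_mem h i⟩⟫_ℂ - (ε * t) * (⟪w, v⟫_ℝ : ℂ) +
          ε * (⟪F.grad k v ⟨b i, basis_mem h i⟩,
              corrector b ev (ev i) (F.grad k w ⟨b i, basis_mem h i⟩) t⟫_ℂ +
            ⟪corrector b ev (ev i) (F.grad k w ⟨b i, basis_mem h i⟩) t,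
              F.grad k v ⟨b i, basis_mem h i⟩⟫_ℂ))‖ ≤ C) :
    ‖∑ i ∈ (h.finite μ).toFinset, ⟪F.orbit k (ε • w) ⟨b i, basis_mem h i⟩ t,
        F.grad (k - t • ε • w) v ⟨_, (isOrbit_orbit F k (ε • w) ⟨b i, basis_mem h i⟩).mem t⟩⟫_ℂ -
      (lineDeriv ℝ (fun k' => tr (F.op k') (F.bands N k')) k v -
        (ε * t) * lineDeriv ℝ (fun k' => lineDeriv ℝ (fun k' => tr (F.op k') (F.bands N k')) k' w) k v
        + Complex.I * ε * ∑ i ∈ (h.finite μ).toFinset, (⟪F.grad k v ⟨b i, basis_mem h i⟩,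
            dephased (F.op k) ev t (response b ev μ (lineDeriv ℝ (F.proj μ) k w)) i⟫_ℂ -
          ⟪dephased (F.op k) ev t (response b ev μ (lineDeriv ℝ (F.proj μ) k w)) i,
            F.grad k v ⟨b i, basis_mem h i⟩⟫_ℂ))‖ ≤ N * C := by
  have hP0 := hP.self_of_nhds
  have hd := ((hP0.differentiableAt (by norm_num)).lineDifferentiableAt (v := w)).hasLineDerivAt
  rw [lineDeriv_energy hP0 hN, tr_gradOp h, lineDeriv_lineDeriv_energy h hP hN]
  have e1 := sum_corrector h hd v t
  have hcard : ((h.finite μ).toFinset.card : ℝ) = N := by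
    rw [← hN, h.numBelow_eq, Set.ncard_eq_toFinset_card _ (h.finite μ)]
  rw [← hcard, ← nsmul_eq_mul]
  refine le_trans (le_of_eq ?_) ((norm_sum_le _ _).trans (Finset.sum_le_card_nsmul
    (h.finite μ).toFinset _ C fun i hi => hC i (by simpa using hi)))
  congr 1
  simp only [Finset.sum_sub_distrib, Finset.sum_add_distrib, ← Finset.mul_sum, Finset.sum_const]
    at e1 ⊢
  linear_combination (ε : ℂ) * e1

end

/-- Linear response of a regular family, in terms of the propagator of the ramped operators. The
operators `G k` extend the derivative of the family in the direction `v`. -/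
theorem exists_linear_response (F : RegularFamily E 𝓗) {μ : ℝ} (hμ : 1 ≤ μ + F.c) (v w : E)
    (G : E → 𝓗 →ₗ.[ℂ] 𝓗) (hG : ∀ k, (F.gradOp k v).graph ≤ (G k).graph) :
    ∃ C : ℝ, 0 ≤ C ∧ ∀ k : E, ∀ N : ℕ, N = numBelow (F.op k) μ →
      F.proj μ k = F.bands N k ∧
      (eigenspace (F.op k) μ = ⊥ → ∀ᶠ k' in 𝓝 k, F.proj μ k' = F.bands N k') ∧
      LineDifferentiableAt ℝ (F.bands N) k w ∧
      (∀ᶠ k' in 𝓝 k, ∃ τ, HasTrace (F.op k') (F.bands N k') τ) ∧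
      ContDiffAt ℝ 2 (fun k' => tr (F.op k') (F.bands N k')) k ∧
      (∃! X, IsPartialInverse (F.op k) (F.bands N k) (lineDeriv ℝ (F.bands N) k w) X) ∧
      ∀ ε : ℝ, 0 ≤ ε → ∃ U : ℝ → (𝓗 →L[ℂ] 𝓗),
        IsPropagator (fun t => F.op (k - (ε * t) • w)) U ∧
        (∀ U', IsPropagator (fun t => F.op (k - (ε * t) • w)) U' → U' = U) ∧
        ∀ t : ℝ, 0 ≤ t → ∃ j r ρ : ℂ,
          HasTrace (G (k - (ε * t) • w))
            (U t ∘L F.proj μ k ∘L ContinuousLinearMap.adjoint (U t)) j ∧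
          HasTrace (G k)
            (liouvExp (F.op k) t (liouvPlus (F.op k) (F.bands N k) (lineDeriv ℝ (F.bands N) k w))
              - liouvPlus (F.op k) (F.bands N k) (lineDeriv ℝ (F.bands N) k w)) r ∧
          j = lineDeriv ℝ (fun k' => tr (F.op k') (F.bands N k')) k v
              - (ε * t) * lineDeriv ℝ
                (fun k' => lineDeriv ℝ (fun k' => tr (F.op k') (F.bands N k')) k' w) k v
              + Complex.I * ε * r + ρ ∧
          (ε * t ≤ 1 → ‖ρ‖ ≤ C * ε ^ 2 * t ^ 3 * (1 + t ^ 3)) := by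
  obtain ⟨C, hC0, hC⟩ := exists_orbit_expansion F v w (μ + F.c)
  refine ⟨max (F.K * (μ + F.c) ^ 2) 0 * C, by positivity, fun k N hN => ?_⟩
  obtain ⟨ι, b, ev, h⟩ := exists_isEigenbasis F k
  -- the bound on the expansion uses `μ`, the differentiation takes place at the level `y`
  obtain ⟨y, hy, hP⟩ := exists_smooth_level h (by linarith : 0 < μ + F.c)
  have hset : {i | ev i ≤ y} = {i | ev i ≤ μ} := Set.ext hy
  have hNy : numBelow (F.op k) y = N := by
    rw [hN, h.numBelow_eq, h.numBelow_eq, hset]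
  have hP0 := hP.self_of_nhds
  have hbands := bands_eq_proj hNy
  have hproj : F.proj μ k = F.bands N k := (bands_eq_proj hN.symm).symm
  have hd := ((hP0.differentiableAt (by norm_num)).lineDifferentiableAt (v := w)).hasLineDerivAt
  have hev := eventually_bands_eq hP0 hNy
  have hder : lineDeriv ℝ (F.bands N) k w = lineDeriv ℝ (F.proj y) k w := hev.lineDeriv_eq
  have hX := isPartialInverse_skewRank h hd
  have hliouv := h.liouvPlus_eq hX
  refine ⟨hproj, fun hne => ?_, ?_, ?_, contDiffAt_energy hP0 hNy, ?_, fun ε hε => ?_⟩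
  · have h1 : ContDiffAt ℝ 2 (F.proj μ) k :=
      (eventually_contDiffAt_specProj (by linarith) hne).self_of_nhds.2
    exact (eventually_bands_eq h1 hN.symm).mono fun k' hk' => hk'.symm
  · exact hev.lineDifferentiableAt_iff.2 (hP0.differentiableAt (by norm_num)).lineDifferentiableAt
  · filter_upwards [hev, eventually_hasTrace h hP0 fun k' u => hamProj_graph F k' u] with k' h1 h2
    rw [h1]
    exact ⟨_, h2⟩
  · rw [hbands, hder]
    exact ⟨_, hX, fun X' hX' => h.partialInverse_unique hX' hX⟩
  · have hfun : (fun t : ℝ => F.op (k - (ε * t) • w)) = fun t : ℝ => F.op (k - t • ε • w) := by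
      ext1 t
      rw [smul_smul, mul_comm]
    rw [hfun]
    refine ⟨F.propagator k (ε • w), isPropagator_propagator F k _,
      fun U' hU' => hU'.eq_propagator, fun t ht => ?_⟩
    rw [hbands, hder, hproj, hbands, show (ε * t) • w = t • ε • w by rw [smul_smul, mul_comm]]
    have htr : HasTrace (F.gradOp k v) (liouvExp (F.op k) t
        (liouvPlus (F.op k) (F.proj y k) (lineDeriv ℝ (F.proj y) k w)) -
          liouvPlus (F.op k) (F.proj y k) (lineDeriv ℝ (F.proj y) k w))
        (∑ i ∈ (h.finite y).toFinset, (⟪F.grad k v ⟨b i, basis_mem h i⟩,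
            dephased (F.op k) ev t (response b ev y (lineDeriv ℝ (F.proj y) k w)) i⟫_ℂ -
          ⟪dephased (F.op k) ev t (response b ev y (lineDeriv ℝ (F.proj y) k w)) i,
            F.grad k v ⟨b i, basis_mem h i⟩⟫_ℂ)) := by
      have h1 : liouvPlus (F.op k) (F.proj y k) (lineDeriv ℝ (F.proj y) k w) = _ := hliouv
      rw [h1, liouvExp_sub_skewRank h]
      refine hasTrace_skewRank h v _ fun i hi => dephased_mem h t ?_
      exact (mem_graph_op.1 (response_graph h hd (by simpa using hi))).1
    refine ⟨_, _, _, (hasTrace_evolved h v (ε • w) y t).mono (hG _), htr.mono (hG k),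
      (add_sub_cancel _ _).symm, fun hεt => ?_⟩
    have hNle : (N : ℝ) ≤ max (F.K * (μ + F.c) ^ 2) 0 := by
      rw [hN, h.numBelow_eq]
      exact (ncard_le h (by linarith)).trans (le_max_left _ _)
    refine (norm_current_sub_le h hP hNy fun i hi => hC h i ?_ ε t hε ht hεt).trans ?_
    · linarith [(hy i).1 hi]
    · calc (N : ℝ) * (C * ε ^ 2 * t ^ 3 * (1 + t ^ 3))
          ≤ max (F.K * (μ + F.c) ^ 2) 0 * (C * ε ^ 2 * t ^ 3 * (1 + t ^ 3)) := by gcongr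
        _ = _ := by ring

end RegularFamily

/-! ### Relative bounds for symmetric perturbations of diagonal operators -/

section Comparison

variable {ι : Type*} {H : Type*} [NormedAddCommGroup H] [InnerProductSpace ℂ H] [CompleteSpace H]
  (b : HilbertBasis ι ℂ H)

theorem norm_le_of_norm_inner_le {x y : H} {K : ℝ} (hK : 0 ≤ K)
    (h : ∀ i, ‖⟪b i, x⟫_ℂ‖ ≤ K * ‖⟪b i, y⟫_ℂ‖) : ‖x‖ ≤ K * ‖y‖ := by
  rw [← sq_le_sq₀ (norm_nonneg _) (by positivity), mul_pow]
  refine hasSum_le (fun i => ?_) (hasSum_norm_sq_inner b x) ((hasSum_norm_sq_inner b y).mul_left (K ^ 2))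
  rw [← mul_pow]
  exact pow_le_pow_left₀ (norm_nonneg _) (h i) 2

theorem inner_eq_inner_of_coeff {x y x' y' : H}
    (h : ∀ i, (starRingEnd ℂ) ⟪b i, x⟫_ℂ * ⟪b i, y⟫_ℂ = (starRingEnd ℂ) ⟪b i, x'⟫_ℂ * ⟪b i, y'⟫_ℂ) :
    ⟪x, y⟫_ℂ = ⟪x', y'⟫_ℂ := by
  refine (b.hasSum_inner_mul_inner x y).unique ((b.hasSum_inner_mul_inner x' y').congr_fun
    fun i => ?_)
  have h1 := h i
  rw [inner_conj_symm, inner_conj_symm] at h1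
  exact h1

theorem norm_sq_le_of_sum_le {x : H} {L : ℝ}
    (h : ∀ s : Finset ι, ∑ i ∈ s, ‖⟪b i, x⟫_ℂ‖ ^ 2 ≤ L) : ‖x‖ ^ 2 ≤ L :=
  le_of_tendsto' (hasSum_norm_sq_inner b x) h

theorem sum_norm_inner_le {x y : H} {r : ι → ℝ} {L : ℝ} {s : Finset ι} (hL : ∑ i ∈ s, r i ^ 2 ≤ L)
    (h : ∀ i, ‖⟪b i, x⟫_ℂ‖ ≤ r i * ‖⟪b i, y⟫_ℂ‖) :
    ∑ i ∈ s, ‖⟪b i, x⟫_ℂ‖ ≤ √L * ‖y‖ := by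
  have h1 : ∑ i ∈ s, r i * ‖⟪b i, y⟫_ℂ‖ ≤ √(∑ i ∈ s, r i ^ 2) * √(∑ i ∈ s, ‖⟪b i, y⟫_ℂ‖ ^ 2) :=
    Real.sum_mul_le_sqrt_mul_sqrt s _ _
  refine (Finset.sum_le_sum fun i _ => h i).trans (h1.trans ?_)
  have h2 : √(∑ i ∈ s, ‖⟪b i, y⟫_ℂ‖ ^ 2) ≤ ‖y‖ := by
    rw [← Real.sqrt_sq (norm_nonneg y)]
    exact Real.sqrt_le_sqrt (sum_le_hasSum s (fun i _ => sq_nonneg _) (hasSum_norm_sq_inner b y))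
  gcongr

end Comparison

/-- A logarithmically convex sequence of geometric growth `δ ^ n` decreases by at least the factor `δ`
in the first step. -/
theorem logConvex_step {a : ℕ → ℝ} {C δ : ℝ} (ha : ∀ n, 0 ≤ a n) (hδ : 0 < δ)
    (hconv : ∀ n, a (n + 1) ^ 2 ≤ a n * a (n + 2)) (hgrow : ∀ n, a n ≤ C * δ ^ n) :
    a 1 ≤ δ * a 0 := by
  by_contra! hlt
  have h1 : 0 < a 1 := (mul_nonneg hδ.le (ha 0)).trans_lt hlt
  have h0 : 0 < a 0 := by
    rcases (ha 0).eq_or_lt with h | h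
    · have := hconv 0
      rw [← h, zero_mul] at this
      exact absurd this (not_le.2 (pow_pos h1 2))
    · exact h
  set r := a 1 / a 0 with hr
  have hδr : δ < r := by rwa [hr, lt_div_iff₀ h0]
  have hstep : ∀ n, 0 < a n ∧ r * a n ≤ a (n + 1) := by
    intro n
    induction n with
    | zero => exact ⟨h0, by rw [hr, div_mul_cancel₀ _ h0.ne']⟩
    | succ n ih =>
      obtain ⟨ih1, ih2⟩ := ih
      have h3 : 0 < a (n + 1) := (mul_pos (hδ.trans hδr) ih1).trans_le ih2
      refine ⟨h3, ?_⟩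
      have h4 := hconv n
      have h5 : r * a n * a (n + 1) ≤ a n * a (n + 2) := by
        nlinarith
      nlinarith
  have hpow : ∀ n, a 0 * r ^ n ≤ a n := by
    intro n
    induction n with
    | zero => simp
    | succ n ih =>
      calc a 0 * r ^ (n + 1) = r * (a 0 * r ^ n) := by ring
        _ ≤ r * a n := by
          have := hδ.trans hδr
          gcongr
        _ ≤ _ := (hstep n).2
  have hbd : ∀ n, (r / δ) ^ n ≤ C / a 0 := by
    intro n
    rw [div_pow, le_div_iff₀ h0, div_mul_eq_mul_div, div_le_iff₀ (by positivity)]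
    linarith [hpow n, hgrow n]
  obtain ⟨n, hn⟩ := pow_unbounded_of_one_lt (C / a 0) ((one_lt_div hδ).2 hδr)
  exact absurd (hbd n) hn.not_ge

/-! ### Domains of diagonal operators -/

section Weighted

variable {ι : Type*} {H : Type*} [NormedAddCommGroup H] [InnerProductSpace ℂ H] [CompleteSpace H]

/-- The domain of the operator that is diagonal in the basis `b` with eigenvalues `m i`. -/
def diagDomain (b : HilbertBasis ι ℂ H) (m : ι → ℝ) : Submodule ℂ H where
  carrier := {u | ∃ f, ∀ i, ⟪b i, f⟫_ℂ = m i * ⟪b i, u⟫_ℂ}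
  add_mem' := by
    rintro u v ⟨f, hf⟩ ⟨g, hg⟩
    exact ⟨f + g, fun i => by rw [inner_add_right, inner_add_right, hf, hg, mul_add]⟩
  zero_mem' := ⟨0, by simp⟩
  smul_mem' := by
    rintro c u ⟨f, hf⟩
    exact ⟨c • f, fun i => by rw [inner_smul_right, inner_smul_right, hf]; ring⟩

variable {b : HilbertBasis ι ℂ H} {m : ι → ℝ}

theorem mem_diagDomain {u : H} : u ∈ diagDomain b m ↔ ∃ f, ∀ i, ⟪b i, f⟫_ℂ = m i * ⟪b i, u⟫_ℂ :=
  Iff.rfl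

variable (b m) in
/-- The operator that is diagonal in the basis `b` with eigenvalues `m i`, on its domain. -/
def diagWeight : diagDomain b m →ₗ[ℂ] H where
  toFun u := (mem_diagDomain.1 u.2).choose
  map_add' u v := hilbertBasis_ext b fun i => by
    rw [(mem_diagDomain.1 (u + v).2).choose_spec, inner_add_right,
      (mem_diagDomain.1 u.2).choose_spec, (mem_diagDomain.1 v.2).choose_spec, Submodule.coe_add,
      inner_add_right, mul_add]
  map_smul' c u := hilbertBasis_ext b fun i => by
    rw [(mem_diagDomain.1 (c • u).2).choose_spec, RingHom.id_apply, inner_smul_right,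
      (mem_diagDomain.1 u.2).choose_spec, Submodule.coe_smul, inner_smul_right]
    ring

theorem inner_diagWeight (u : diagDomain b m) (i : ι) :
    ⟪b i, diagWeight b m u⟫_ℂ = m i * ⟪b i, (u : H)⟫_ℂ := (mem_diagDomain.1 u.2).choose_spec i

variable (b m) in
/-- The operator that is diagonal in the basis `b` with eigenvalues `l i`, on the domain of the
operator with eigenvalues `m i`; meaningful if `l` is bounded by a multiple of `m`. -/
def diagMul (l : ι → ℂ) : diagDomain b m →ₗ[ℂ] H :=
  (diagOp b (fun i => l i / m i) : H →ₗ[ℂ] H) ∘ₗ diagWeight b m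

theorem inner_diagMul (hm : ∀ i, 0 < m i) {l : ι → ℂ} (hl : ∃ K : ℝ, ∀ i, ‖l i‖ ≤ K * m i)
    (u : diagDomain b m) (i : ι) : ⟪b i, diagMul b m l u⟫_ℂ = l i * ⟪b i, (u : H)⟫_ℂ := by
  obtain ⟨K, hK⟩ := hl
  have h1 : ∃ K : ℝ, ∀ i, ‖l i / m i‖ ≤ K := ⟨K, fun i => by
    rw [norm_div, Complex.norm_real, Real.norm_of_nonneg (hm i).le, div_le_iff₀ (hm i)]
    exact hK i⟩
  change ⟪b i, diagOp b _ (diagWeight b m u)⟫_ℂ = _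
  rw [inner_diagOp b h1, inner_diagWeight, ← mul_assoc, div_mul_cancel₀]
  rw [Complex.ofReal_ne_zero]
  exact (hm i).ne'

end Weighted

/-- The quadratic form bound for a symmetric operator `W` that is bounded relative to a positive
operator `S = T ^ 2`, with the same relative bound. The powers of `S⁻¹ W` are symmetric for the form
of `S`, so that the form norms of the iterates are logarithmically convex. -/
theorem norm_inner_le_of_relBound {H : Type*} [NormedAddCommGroup H] [InnerProductSpace ℂ H]
    {D : Submodule ℂ H} {S T W : D →ₗ[ℂ] H} {Si : H → D} {δ : ℝ} (hδ : 0 < δ)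
    (hSi : ∀ f, S (Si f) = f) (hST : ∀ u v : D, ⟪(u : H), S v⟫_ℂ = ⟪T u, T v⟫_ℂ)
    (hTS : ∀ u : D, ‖T u‖ ≤ ‖S u‖) (hW : ∀ u v : D, ⟪W u, (v : H)⟫_ℂ = ⟪(u : H), W v⟫_ℂ)
    (hWS : ∀ u : D, ‖W u‖ ≤ δ * ‖S u‖) (w u : D) : ‖⟪(w : H), W u⟫_ℂ‖ ≤ δ * ‖T w‖ * ‖T u‖ := by
  have hSsymm : ∀ u v : D, ⟪S u, (v : H)⟫_ℂ = ⟪T u, T v⟫_ℂ := by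
    intro u v
    rw [← inner_conj_symm, hST, inner_conj_symm]
  -- the iterates of `S⁻¹ W`
  let κ : ℕ → D := fun n => (fun x => Si (W x))^[n] u
  have hκ : ∀ n, S (κ (n + 1)) = W (κ n) := by
    intro n
    simp only [κ, Function.iterate_succ_apply', hSi]
  have h1 : ‖T (κ 1)‖ ≤ δ * ‖T (κ 0)‖ := by
    refine logConvex_step (a := fun n => ‖T (κ n)‖) (C := ‖S u‖) (fun n => norm_nonneg _) hδ
      (fun n => ?_) fun n => ?_
    · have h2 : ⟪T (κ (n + 1)), T (κ (n + 1))⟫_ℂ = ⟪T (κ (n + 2)), T (κ n)⟫_ℂ := by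
        rw [← hST, hκ, ← hW, ← hκ (n + 1), hSsymm]
      have h3 : ‖T (κ (n + 1))‖ ^ 2 = ‖⟪T (κ (n + 1)), T (κ (n + 1))⟫_ℂ‖ := by
        rw [inner_self_eq_norm_sq_to_K]
        simp
      change ‖T (κ (n + 1))‖ ^ 2 ≤ ‖T (κ n)‖ * ‖T (κ (n + 2))‖
      rw [h3, h2, mul_comm]
      exact norm_inner_le_norm _ _
    · refine (hTS _).trans ?_
      induction n with
      | zero => simp [κ]
      | succ n ih =>
        rw [hκ]
        refine (hWS _).trans ?_
        rw [pow_succ]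
        nlinarith
  have h2 : ⟪(w : H), W u⟫_ℂ = ⟪T w, T (κ 1)⟫_ℂ := by
    rw [← hST, hκ]
    rfl
  rw [h2]
  refine (norm_inner_le_norm _ _).trans ?_
  have h3 : ‖T (κ 1)‖ ≤ δ * ‖T u‖ := h1
  nlinarith [mul_le_mul_of_nonneg_left h3 (norm_nonneg (T w))]

/-! ### Bloch Hamiltonians in the Fourier representation -/

/-- The weights `1 + ‖ξ i‖ ^ 2` which define the Sobolev space of order two. -/
def sobolevWeight {d : ℕ} {ι : Type*} (ξ : ι → E d) (i : ι) : ℝ := 1 + ‖ξ i‖ ^ 2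

/-- The Sobolev space of order two in terms of Fourier coefficients. -/
abbrev sobolev {d : ℕ} {𝓗 ι : Type*} [NormedAddCommGroup 𝓗] [InnerProductSpace ℂ 𝓗]
    (e : HilbertBasis ι ℂ 𝓗) (ξ : ι → E d) : Submodule ℂ 𝓗 := diagDomain e (sobolevWeight ξ)

/-- The data of a family of Bloch Hamiltonians in terms of Fourier coefficients: the Hilbert basis `e`
of plane waves with wave vectors `ξ i`, the bounded multiplication operators `B v` by the components
of the vector potential, and the multiplication `V` by the scalar potential, which is defined on
elements with summable Fourier coefficients. The field `comm` provides the commutator of the `j`-th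
component of the momentum with `B v`, and `summable` is the convergence of the sums
`∑ i, (‖ξ i + k‖ ^ 2 / 2 + M) ^ (-2)` in dimension at most three, uniformly in `k`. -/
structure FourierModel (d : ℕ) (𝓗 ι : Type*) [NormedAddCommGroup 𝓗] [InnerProductSpace ℂ 𝓗]
    [CompleteSpace 𝓗] where
  e : HilbertBasis ι ℂ 𝓗
  ξ : ι → E d
  summable : ∀ δ > 0, ∃ M₀ : ℝ, ∀ M ≥ M₀, ∀ (k : E d) (s : Finset ι),
    ∑ i ∈ s, ((‖ξ i + k‖ ^ 2 / 2 + M)⁻¹) ^ 2 ≤ δ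
  B : E d →ₗ[ℝ] 𝓗 →L[ℂ] 𝓗
  B_symm : ∀ v x y, ⟪B v x, y⟫_ℂ = ⟪x, B v y⟫_ℂ
  b : ℝ
  b_nonneg : 0 ≤ b
  B_le : ∀ v, ‖B v‖ ≤ b * ‖v‖
  V : sobolev e ξ →ₗ[ℂ] 𝓗
  V_symm : ∀ x y : sobolev e ξ, ⟪V x, (y : 𝓗)⟫_ℂ = ⟪(x : 𝓗), V y⟫_ℂ
  q : ℝ
  q_nonneg : 0 ≤ q
  V_le : ∀ (u : sobolev e ξ) (L : ℝ),
    (∀ s : Finset ι, ∑ i ∈ s, ‖⟪e i, (u : 𝓗)⟫_ℂ‖ ≤ L) → ‖V u‖ ≤ q * L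
  g : ℝ
  g_nonneg : 0 ≤ g
  comm : ∀ (j : Fin d) (v : E d) (u : sobolev e ξ), ∃ f : 𝓗,
    (∀ i, ⟪e i, f⟫_ℂ = (ξ i j : ℂ) * ⟪e i, B v u⟫_ℂ -
      ⟪e i, B v (diagMul e (sobolevWeight ξ) (fun i => (ξ i j : ℂ)) u)⟫_ℂ) ∧
    ∀ L : ℝ, (∀ s : Finset ι, ∑ i ∈ s, ‖⟪e i, (u : 𝓗)⟫_ℂ‖ ≤ L) → ‖f‖ ≤ g * ‖v‖ * L

namespace FourierModel

universe u

variable {d : ℕ} {𝓗 : Type u} {ι : Type*} [NormedAddCommGroup 𝓗] [InnerProductSpace ℂ 𝓗]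
  [CompleteSpace 𝓗] (Φ : FourierModel d 𝓗 ι)

/-- The common domain of the Hamiltonians. -/
abbrev D : Submodule ℂ 𝓗 := sobolev Φ.e Φ.ξ

/-- The Fourier multiplier with symbol `l` on the Sobolev space. -/
def mul (l : ι → ℂ) : Φ.D →ₗ[ℂ] 𝓗 := diagMul Φ.e (sobolevWeight Φ.ξ) l

/-- The momentum in the direction `v`. -/
def mom (v : E d) : Φ.D →ₗ[ℂ] 𝓗 := Φ.mul fun i => (⟪Φ.ξ i, v⟫_ℝ : ℂ)

/-- The shifted kinetic energy `‖p + k‖ ^ 2 / 2 + M`. -/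
def kin (k : E d) (M : ℝ) : Φ.D →ₗ[ℂ] 𝓗 := Φ.mul fun i => ((‖Φ.ξ i + k‖ ^ 2 / 2 + M : ℝ) : ℂ)

/-- The square root of the shifted kinetic energy. -/
def kinSqrt (k : E d) (M : ℝ) : Φ.D →ₗ[ℂ] 𝓗 := Φ.mul fun i => (√(‖Φ.ξ i + k‖ ^ 2 / 2 + M) : ℂ)

variable {Φ}

theorem weight_pos (i : ι) : 0 < sobolevWeight Φ.ξ i := by
  unfold sobolevWeight
  positivity

theorem inner_mul {l : ι → ℂ} {K : ℝ} (hl : ∀ i, ‖l i‖ ≤ K * (1 + ‖Φ.ξ i‖ ^ 2)) (u : Φ.D) (i : ι) :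
    ⟪Φ.e i, Φ.mul l u⟫_ℂ = l i * ⟪Φ.e i, (u : 𝓗)⟫_ℂ :=
  inner_diagMul weight_pos ⟨K, hl⟩ u i

theorem norm_le_weight (x : E d) : ‖x‖ ≤ 1 + ‖x‖ ^ 2 := by nlinarith [sq_nonneg (‖x‖ - 1)]

theorem inner_mom (v : E d) (u : Φ.D) (i : ι) :
    ⟪Φ.e i, Φ.mom v u⟫_ℂ = (⟪Φ.ξ i, v⟫_ℝ : ℂ) * ⟪Φ.e i, (u : 𝓗)⟫_ℂ := by
  refine inner_mul (K := ‖v‖) (fun i => ?_) u i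
  rw [Complex.norm_real]
  refine (norm_inner_le_norm _ _).trans ?_
  rw [mul_comm]
  gcongr
  exact norm_le_weight _

theorem kin_symbol_le (x k : E d) {M : ℝ} (hM : 0 ≤ M) :
    ‖x + k‖ ^ 2 / 2 + M ≤ (1 + ‖k‖ ^ 2 + M) * (1 + ‖x‖ ^ 2) := by
  have h1 : ‖x + k‖ ^ 2 ≤ 2 * ‖x‖ ^ 2 + 2 * ‖k‖ ^ 2 := by
    have := norm_add_le x k
    nlinarith [sq_nonneg (‖x‖ - ‖k‖), norm_nonneg (x + k)]
  nlinarith [mul_nonneg (sq_nonneg ‖k‖) (sq_nonneg ‖x‖), mul_nonneg hM (sq_nonneg ‖x‖)]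

theorem inner_kin (k : E d) {M : ℝ} (hM : 0 ≤ M) (u : Φ.D) (i : ι) :
    ⟪Φ.e i, Φ.kin k M u⟫_ℂ = ((‖Φ.ξ i + k‖ ^ 2 / 2 + M : ℝ) : ℂ) * ⟪Φ.e i, (u : 𝓗)⟫_ℂ := by
  refine inner_mul (l := fun i => ((‖Φ.ξ i + k‖ ^ 2 / 2 + M : ℝ) : ℂ))
    (K := 1 + ‖k‖ ^ 2 + M) (fun i => ?_) u i
  rw [Complex.norm_real, Real.norm_of_nonneg (by positivity)]
  exact kin_symbol_le _ _ hM

theorem sqrt_kin_le (x : E d) {M : ℝ} (hM : 1 ≤ M) :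
    √(‖x‖ ^ 2 / 2 + M) ≤ ‖x‖ ^ 2 / 2 + M := by
  have h1 : 1 ≤ ‖x‖ ^ 2 / 2 + M := by nlinarith [sq_nonneg ‖x‖]
  rw [Real.sqrt_le_left (by linarith)]
  nlinarith

theorem inner_kinSqrt (k : E d) {M : ℝ} (hM : 1 ≤ M) (u : Φ.D) (i : ι) :
    ⟪Φ.e i, Φ.kinSqrt k M u⟫_ℂ = (√(‖Φ.ξ i + k‖ ^ 2 / 2 + M) : ℂ) * ⟪Φ.e i, (u : 𝓗)⟫_ℂ := by
  refine inner_mul (l := fun i => (√(‖Φ.ξ i + k‖ ^ 2 / 2 + M) : ℂ))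
    (K := 1 + ‖k‖ ^ 2 + M) (fun i => ?_) u i
  rw [Complex.norm_real, Real.norm_of_nonneg (by positivity)]
  exact (sqrt_kin_le _ hM).trans (kin_symbol_le _ _ (by linarith))

theorem inner_kin_eq (k : E d) {M : ℝ} (hM : 1 ≤ M) (u v : Φ.D) :
    ⟪(u : 𝓗), Φ.kin k M v⟫_ℂ = ⟪Φ.kinSqrt k M u, Φ.kinSqrt k M v⟫_ℂ := by
  refine inner_eq_inner_of_coeff Φ.e fun i => ?_
  have h1 : ((‖Φ.ξ i + k‖ ^ 2 / 2 + M : ℝ) : ℂ) =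
      (√(‖Φ.ξ i + k‖ ^ 2 / 2 + M) : ℂ) * (√(‖Φ.ξ i + k‖ ^ 2 / 2 + M) : ℂ) := by
    rw [← Complex.ofReal_mul, Real.mul_self_sqrt (by positivity)]
  rw [inner_kin k (by linarith), inner_kinSqrt k hM, inner_kinSqrt k hM, map_mul,
    Complex.conj_ofReal, h1]
  ring

theorem norm_kinSqrt_le (k : E d) {M : ℝ} (hM : 1 ≤ M) (u : Φ.D) :
    ‖Φ.kinSqrt k M u‖ ≤ ‖Φ.kin k M u‖ := by
  have h := norm_le_of_norm_inner_le Φ.e (x := Φ.kinSqrt k M u) (y := Φ.kin k M u) zero_le_one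
    fun i => ?_
  · rwa [one_mul] at h
  · rw [inner_kin k (by linarith), inner_kinSqrt k hM, norm_mul, norm_mul, one_mul, Complex.norm_real,
      Complex.norm_real, Real.norm_of_nonneg (by positivity), Real.norm_of_nonneg (by positivity)]
    gcongr
    exact sqrt_kin_le _ hM

theorem norm_le_kinSqrt (k : E d) {M : ℝ} (hM : 1 ≤ M) (u : Φ.D) :
    √M * ‖(u : 𝓗)‖ ≤ ‖Φ.kinSqrt k M u‖ := by
  have hM0 : 0 < √M := Real.sqrt_pos.2 (by linarith)
  have h := norm_le_of_norm_inner_le Φ.e (x := (u : 𝓗)) (y := Φ.kinSqrt k M u)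
    (inv_nonneg.2 hM0.le) fun i => ?_
  · rwa [inv_mul_eq_div, le_div_iff₀' hM0] at h
  · rw [inner_kinSqrt k hM, norm_mul, Complex.norm_real, Real.norm_of_nonneg (by positivity),
      ← mul_assoc]
    refine le_mul_of_one_le_left (norm_nonneg _) ?_
    rw [inv_mul_eq_div, one_le_div hM0]
    exact Real.sqrt_le_sqrt (by nlinarith [sq_nonneg ‖Φ.ξ i + k‖])

variable (Φ) in
/-- The inverse of the shifted kinetic energy. -/
def kinInv (k : E d) (M : ℝ) : 𝓗 →L[ℂ] 𝓗 :=
  diagOp Φ.e fun i => (((‖Φ.ξ i + k‖ ^ 2 / 2 + M)⁻¹ : ℝ) : ℂ)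

theorem kinInv_symbol_le (k : E d) {M : ℝ} (hM : 1 ≤ M) (i : ι) :
    ‖(((‖Φ.ξ i + k‖ ^ 2 / 2 + M)⁻¹ : ℝ) : ℂ)‖ ≤ 1 := by
  rw [Complex.norm_real, Real.norm_of_nonneg (by positivity)]
  exact inv_le_one_of_one_le₀ (by nlinarith [sq_nonneg ‖Φ.ξ i + k‖])

theorem inner_kinInv (k : E d) {M : ℝ} (hM : 1 ≤ M) (f : 𝓗) (i : ι) :
    ⟪Φ.e i, Φ.kinInv k M f⟫_ℂ =
      (((‖Φ.ξ i + k‖ ^ 2 / 2 + M)⁻¹ : ℝ) : ℂ) * ⟪Φ.e i, f⟫_ℂ :=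
  inner_diagOp Φ.e ⟨1, kinInv_symbol_le k hM⟩ f i

theorem kinInv_mem (k : E d) {M : ℝ} (hM : 1 ≤ M) (f : 𝓗) : Φ.kinInv k M f ∈ Φ.D := by
  refine mem_diagDomain.2 ⟨diagOp Φ.e (fun i => (sobolevWeight Φ.ξ i : ℂ) *
    (((‖Φ.ξ i + k‖ ^ 2 / 2 + M)⁻¹ : ℝ) : ℂ)) f, fun i => ?_⟩
  rw [inner_diagOp Φ.e ⟨5 + 2 * ‖k‖ ^ 2, fun i => ?_⟩, inner_kinInv k hM, mul_assoc]
  rw [norm_mul, Complex.norm_real, Complex.norm_real, Real.norm_of_nonneg (weight_pos i).le,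
    Real.norm_of_nonneg (by positivity), ← div_eq_mul_inv, div_le_iff₀ (by positivity), sobolevWeight]
  have h1 : ‖Φ.ξ i‖ ≤ ‖Φ.ξ i + k‖ + ‖k‖ := by
    simpa using norm_sub_le (Φ.ξ i + k) k
  have h2 : ‖Φ.ξ i‖ ^ 2 ≤ 2 * ‖Φ.ξ i + k‖ ^ 2 + 2 * ‖k‖ ^ 2 := by
    nlinarith [sq_nonneg (‖Φ.ξ i + k‖ - ‖k‖), norm_nonneg (Φ.ξ i)]
  nlinarith [mul_nonneg (sq_nonneg ‖k‖) (sq_nonneg ‖Φ.ξ i + k‖), mul_nonneg (sq_nonneg ‖k‖)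
    (by linarith : 0 ≤ M - 1), sq_nonneg ‖Φ.ξ i + k‖]

theorem kin_kinInv (k : E d) {M : ℝ} (hM : 1 ≤ M) (f : 𝓗) :
    Φ.kin k M ⟨Φ.kinInv k M f, kinInv_mem k hM f⟩ = f := by
  refine hilbertBasis_ext Φ.e fun i => ?_
  have h0 : ‖Φ.ξ i + k‖ ^ 2 / 2 + M ≠ 0 := by positivity
  rw [inner_kin k (by linarith), inner_kinInv k hM, ← mul_assoc, ← Complex.ofReal_mul,
    mul_inv_cancel₀ h0, Complex.ofReal_one, one_mul]

theorem sum_coeff_le {k : E d} {M L : ℝ} (hM : 1 ≤ M) {s : Finset ι}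
    (hL : ∑ i ∈ s, ((‖Φ.ξ i + k‖ ^ 2 / 2 + M)⁻¹) ^ 2 ≤ L) (u : Φ.D) :
    ∑ i ∈ s, ‖⟪Φ.e i, (u : 𝓗)⟫_ℂ‖ ≤ √L * ‖Φ.kin k M u‖ := by
  refine sum_norm_inner_le Φ.e hL fun i => ?_
  rw [inner_kin k (by linarith), norm_mul, Complex.norm_real, Real.norm_of_nonneg (by positivity),
    inv_mul_cancel_left₀ (by positivity)]

/-- The components of `p + k` are controlled by the square root of the kinetic energy. -/
theorem norm_mom_add_le (k v : E d) {M : ℝ} (hM : 1 ≤ M) (u : Φ.D) :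
    ‖Φ.mom v u + (⟪k, v⟫_ℝ : ℂ) • (u : 𝓗)‖ ≤ 2 * ‖v‖ * ‖Φ.kinSqrt k M u‖ := by
  refine norm_le_of_norm_inner_le Φ.e (by positivity) fun i => ?_
  rw [inner_add_right, inner_smul_right, inner_mom, ← add_mul, ← Complex.ofReal_add, ← inner_add_left,
    inner_kinSqrt k hM, norm_mul, norm_mul, Complex.norm_real, Complex.norm_real,
    Real.norm_of_nonneg (Real.sqrt_nonneg _), ← mul_assoc]
  gcongr
  refine (norm_inner_le_norm _ _).trans ?_
  rw [mul_comm, mul_comm 2, mul_assoc]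
  gcongr
  have h1 : ‖Φ.ξ i + k‖ / 2 ≤ √(‖Φ.ξ i + k‖ ^ 2 / 2 + M) :=
    Real.le_sqrt_of_sq_le (by nlinarith [sq_nonneg ‖Φ.ξ i + k‖])
  linarith

/-- The components of `p + k` are small relative to the kinetic energy with a large shift. -/
theorem norm_mom_add_le_kin (k v : E d) {M : ℝ} (hM : 1 ≤ M) (u : Φ.D) :
    √M * ‖Φ.mom v u + (⟪k, v⟫_ℝ : ℂ) • (u : 𝓗)‖ ≤ ‖v‖ * ‖Φ.kin k M u‖ := by
  have hM0 : 0 < √M := Real.sqrt_pos.2 (by linarith)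
  rw [← le_div_iff₀' hM0, mul_div_right_comm]
  refine norm_le_of_norm_inner_le Φ.e (by positivity) fun i => ?_
  rw [inner_add_right, inner_smul_right, inner_mom, ← add_mul, ← Complex.ofReal_add, ← inner_add_left,
    inner_kin k (by linarith), norm_mul, norm_mul, Complex.norm_real, Complex.norm_real,
    Real.norm_of_nonneg (by positivity : 0 ≤ ‖Φ.ξ i + k‖ ^ 2 / 2 + M), ← mul_assoc]
  gcongr
  refine (norm_inner_le_norm _ _).trans ?_
  rw [mul_comm, div_mul_eq_mul_div, mul_div_assoc]
  gcongr
  rw [le_div_iff₀ hM0]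
  nlinarith [Real.sq_sqrt (by linarith : 0 ≤ M), sq_nonneg (‖Φ.ξ i + k‖ - √M)]

theorem mom_add (v w : E d) (u : Φ.D) : Φ.mom (v + w) u = Φ.mom v u + Φ.mom w u := by
  refine hilbertBasis_ext Φ.e fun i => ?_
  rw [inner_add_right, inner_mom, inner_mom, inner_mom, inner_add_right]
  push_cast
  ring

theorem mom_smul (r : ℝ) (v : E d) (u : Φ.D) : Φ.mom (r • v) u = (r : ℂ) • Φ.mom v u := by
  refine hilbertBasis_ext Φ.e fun i => ?_
  rw [inner_smul_right, inner_mom, inner_mom, inner_smul_right]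
  push_cast
  ring

theorem mom_symm (v : E d) (x y : Φ.D) : ⟪Φ.mom v x, (y : 𝓗)⟫_ℂ = ⟪(x : 𝓗), Φ.mom v y⟫_ℂ := by
  refine inner_eq_inner_of_coeff Φ.e fun i => ?_
  rw [inner_mom, inner_mom, map_mul, Complex.conj_ofReal]
  ring

/-! ### The family of Bloch Hamiltonians -/

theorem mom_single (j : Fin d) (u : Φ.D) :
    Φ.mom (EuclideanSpace.single j 1) u = Φ.mul (fun i => (Φ.ξ i j : ℂ)) u := by
  unfold mom
  congr 2
  ext i
  rw [EuclideanSpace.inner_single_right]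
  simp

variable (Φ) in
/-- The commutator of the `j`-th component of the momentum with the vector potential. -/
def commutator (j : Fin d) (v : E d) : Φ.D →ₗ[ℂ] 𝓗 where
  toFun u := (Φ.comm j v u).choose
  map_add' u w := hilbertBasis_ext Φ.e fun i => by
    rw [inner_add_right, (Φ.comm j v (u + w)).choose_spec.1, (Φ.comm j v u).choose_spec.1,
      (Φ.comm j v w).choose_spec.1, map_add, Submodule.coe_add, map_add, map_add, inner_add_right,
      inner_add_right]
    ring
  map_smul' c u := hilbertBasis_ext Φ.e fun i => by
    rw [RingHom.id_apply, inner_smul_right, (Φ.comm j v (c • u)).choose_spec.1,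
      (Φ.comm j v u).choose_spec.1, map_smul, Submodule.coe_smul, map_smul, map_smul,
      inner_smul_right, inner_smul_right]
    ring

theorem inner_commutator (j : Fin d) (v : E d) (u : Φ.D) (i : ι) :
    ⟪Φ.e i, Φ.commutator j v u⟫_ℂ = (Φ.ξ i j : ℂ) * ⟪Φ.e i, Φ.B v u⟫_ℂ -
      ⟪Φ.e i, Φ.B v (Φ.mom (EuclideanSpace.single j 1) u)⟫_ℂ := by
  rw [mom_single]
  exact (Φ.comm j v u).choose_spec.1 i

theorem norm_commutator_le (j : Fin d) (v : E d) (u : Φ.D) {L : ℝ}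
    (hL : ∀ s : Finset ι, ∑ i ∈ s, ‖⟪Φ.e i, (u : 𝓗)⟫_ℂ‖ ≤ L) :
    ‖Φ.commutator j v u‖ ≤ Φ.g * ‖v‖ * L :=
  (Φ.comm j v u).choose_spec.2 L hL

variable (Φ) in
/-- The components of the vector potential. -/
def comp (j : Fin d) : 𝓗 →L[ℂ] 𝓗 := Φ.B (EuclideanSpace.single j 1)

variable (Φ) in
/-- The symmetrized first-order term of the Hamiltonian together with the potentials. -/
def pert : Φ.D →ₗ[ℂ] 𝓗 :=
  ∑ j, ((Φ.comp j : 𝓗 →ₗ[ℂ] 𝓗) ∘ₗ Φ.mom (EuclideanSpace.single j 1) +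
    (1 / 2 : ℂ) • Φ.commutator j (EuclideanSpace.single j 1) +
    (1 / 2 : ℂ) • ((Φ.comp j : 𝓗 →ₗ[ℂ] 𝓗) ∘ₗ (Φ.comp j : 𝓗 →ₗ[ℂ] 𝓗) ∘ₗ Φ.D.subtype)) + Φ.V

theorem pert_apply (u : Φ.D) : Φ.pert u =
    ∑ j, (Φ.comp j (Φ.mom (EuclideanSpace.single j 1) u) +
      (1 / 2 : ℂ) • Φ.commutator j (EuclideanSpace.single j 1) u +
      (1 / 2 : ℂ) • Φ.comp j (Φ.comp j u)) + Φ.V u := by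
  simp [pert]

/-- The adjoint of `B p` is `p B`, which differs from `B p` by the commutator. -/
theorem comp_mom_symm (j : Fin d) (x y : Φ.D) :
    ⟪Φ.comp j (Φ.mom (EuclideanSpace.single j 1) x), (y : 𝓗)⟫_ℂ =
      ⟪(x : 𝓗), Φ.commutator j (EuclideanSpace.single j 1) y⟫_ℂ +
        ⟪(x : 𝓗), Φ.comp j (Φ.mom (EuclideanSpace.single j 1) y)⟫_ℂ := by
  rw [comp, Φ.B_symm, ← inner_add_right]
  refine inner_eq_inner_of_coeff Φ.e fun i => ?_
  rw [inner_add_right, inner_commutator, inner_mom, map_mul, Complex.conj_ofReal,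
    EuclideanSpace.inner_single_right]
  simp only [conj_trivial, one_mul]
  ring

theorem pert_symm (x y : Φ.D) : ⟪Φ.pert x, (y : 𝓗)⟫_ℂ = ⟪(x : 𝓗), Φ.pert y⟫_ℂ := by
  rw [pert_apply, pert_apply, inner_add_left, inner_add_right, Φ.V_symm, sum_inner, inner_sum]
  congr 1
  refine Finset.sum_congr rfl fun j _ => ?_
  have h1 := comp_mom_symm j x y
  have h2 := congrArg (starRingEnd ℂ) (comp_mom_symm j y x)
  rw [map_add, inner_conj_symm, inner_conj_symm, inner_conj_symm] at h2
  have h3 : ⟪Φ.comp j (Φ.comp j x), (y : 𝓗)⟫_ℂ = ⟪(x : 𝓗), Φ.comp j (Φ.comp j y)⟫_ℂ := by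
    simp only [comp, Φ.B_symm]
  simp only [inner_add_left, inner_add_right, inner_smul_left, inner_smul_right, h3]
  have h4 : (starRingEnd ℂ) (1 / 2 : ℂ) = 1 / 2 := by
    rw [map_div₀, map_one, map_ofNat]
  rw [h4]
  linear_combination (1 / 2 : ℂ) * h1 - (1 / 2 : ℂ) * h2

variable (Φ) in
/-- The family of Bloch Hamiltonians. -/
def quad : QuadFamily (E d) 𝓗 where
  D := Φ.D
  H0 := Φ.kin 0 0 + Φ.pert
  P v := Φ.mom v + (Φ.B v : 𝓗 →ₗ[ℂ] 𝓗) ∘ₗ Φ.D.subtype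
  P_add v w u := by
    simp [mom_add]
    abel
  P_smul r v u := by
    simp [mom_smul]
  H0_symm x y := by
    simp only [LinearMap.add_apply, inner_add_left, inner_add_right, pert_symm]
    congr 1
    refine inner_eq_inner_of_coeff Φ.e fun i => ?_
    rw [inner_kin 0 le_rfl, inner_kin 0 le_rfl, map_mul, Complex.conj_ofReal]
    ring
  P_symm w x y := by
    simp only [LinearMap.add_apply, inner_add_left, inner_add_right, mom_symm]
    congr 1
    exact Φ.B_symm w x y

variable (Φ) in
/-- The perturbation of the kinetic energy `‖p + k‖ ^ 2 / 2` in the Bloch Hamiltonian. -/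
def pertAt (k : E d) : Φ.D →ₗ[ℂ] 𝓗 := Φ.pert + (Φ.B k : 𝓗 →ₗ[ℂ] 𝓗) ∘ₗ Φ.D.subtype

theorem ham_quad (k : E d) {M : ℝ} (hM : 0 ≤ M) (u : Φ.D) :
    Φ.quad.ham k u + (M : ℂ) • (u : 𝓗) = Φ.kin k M u + Φ.pertAt k u := by
  have h1 : Φ.kin k M u = Φ.kin 0 0 u + Φ.mom k u + ((‖k‖ ^ 2 / 2 : ℝ) : ℂ) • (u : 𝓗) +
      (M : ℂ) • (u : 𝓗) := by
    refine hilbertBasis_ext Φ.e fun i => ?_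
    have h2 : ‖Φ.ξ i + k‖ ^ 2 / 2 + M =
        (‖Φ.ξ i + 0‖ ^ 2 / 2 + 0) + ⟪Φ.ξ i, k⟫_ℝ + ‖k‖ ^ 2 / 2 + M := by
      rw [norm_add_sq_real, norm_add_sq_real, inner_zero_right, norm_zero]
      ring
    rw [inner_add_right, inner_add_right, inner_add_right, inner_smul_right, inner_smul_right,
      inner_kin k hM, inner_kin 0 le_rfl, inner_mom, h2]
    simp only [Complex.ofReal_add]
    ring
  rw [h1]
  change Φ.kin 0 0 u + Φ.pert u + (Φ.mom k u + Φ.B k u) + ((‖k‖ ^ 2 / 2 : ℝ) : ℂ) • (u : 𝓗) + _ =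
    _ + (Φ.pert u + Φ.B k u)
  abel

theorem grad_quad (k v : E d) (u : Φ.D) :
    Φ.quad.grad k v u = (Φ.mom v u + (⟪k, v⟫_ℝ : ℂ) • (u : 𝓗)) + Φ.B v u := by
  change Φ.mom v u + Φ.B v u + (⟪k, v⟫_ℝ : ℂ) • (u : 𝓗) = _
  abel

theorem pertAt_symm (k : E d) (x y : Φ.D) :
    ⟪Φ.pertAt k x, (y : 𝓗)⟫_ℂ = ⟪(x : 𝓗), Φ.pertAt k y⟫_ℂ := by
  simp only [pertAt, LinearMap.add_apply, inner_add_left, inner_add_right, pert_symm]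
  congr 1
  exact Φ.B_symm k x y

/-- The first-order part of the perturbation is `B · (p + k)`, so that it is controlled by the
kinetic energy at `k`. -/
theorem pertAt_apply (k : E d) (u : Φ.D) : Φ.pertAt k u =
    ∑ j, (Φ.comp j (Φ.mom (EuclideanSpace.single j 1) u + (k j : ℂ) • (u : 𝓗)) +
      (1 / 2 : ℂ) • Φ.commutator j (EuclideanSpace.single j 1) u +
      (1 / 2 : ℂ) • Φ.comp j (Φ.comp j u)) + Φ.V u := by
  have h1 : Φ.B k u = ∑ j, (k j : ℂ) • Φ.comp j u := by
    have h2 : k = ∑ j, k j • EuclideanSpace.single j (1 : ℝ) := by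
      ext j
      simp [Finset.sum_apply, Pi.single_apply]
    conv_lhs => rw [h2]
    rw [map_sum, sum_apply]
    refine Finset.sum_congr rfl fun j _ => ?_
    rw [map_smul, smul_apply]
    rfl
  change Φ.pert u + Φ.B k u = _
  rw [pert_apply, h1, add_right_comm, ← Finset.sum_add_distrib]
  congr 1
  refine Finset.sum_congr rfl fun j _ => ?_
  rw [map_add, map_smul]
  abel

end FourierModel

/-! ### Uniform regularity of the Bloch Hamiltonians -/

namespace FourierModel

variable {d : ℕ} {𝓗 : Type*} {ι : Type*} [NormedAddCommGroup 𝓗] [InnerProductSpace ℂ 𝓗]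
  [CompleteSpace 𝓗] {Φ : FourierModel d 𝓗 ι}

theorem norm_comp_le (j : Fin d) (x : 𝓗) : ‖Φ.comp j x‖ ≤ Φ.b * ‖x‖ := by
  refine (ContinuousLinearMap.le_opNorm _ _).trans ?_
  gcongr
  simpa [comp] using Φ.B_le (EuclideanSpace.single j (1 : ℝ))

/-- Every term of the perturbation is of lower order than the kinetic energy, with a constant that
does not depend on `k`. -/
theorem norm_pertAt_le {k : E d} {M η : ℝ} (hM : 1 ≤ M) (hη : 0 < η) (hηM : η⁻¹ ≤ √M)
    (hs : ∀ s : Finset ι, ∑ i ∈ s, ((‖Φ.ξ i + k‖ ^ 2 / 2 + M)⁻¹) ^ 2 ≤ η ^ 2) (u : Φ.D) :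
    ‖Φ.pertAt k u‖ ≤ (d * (Φ.b + Φ.g + Φ.b ^ 2) + Φ.q) * (η * ‖Φ.kin k M u‖) := by
  have hb := Φ.b_nonneg
  have hg := Φ.g_nonneg
  set X := ‖Φ.kin k M u‖ with hX
  have small : ∀ {y : ℝ}, 0 ≤ y → √M * y ≤ X → y ≤ η * X := by
    intro y hy h
    have h1 : η⁻¹ * y ≤ X := (mul_le_mul_of_nonneg_right hηM hy).trans h
    rwa [inv_mul_le_iff₀ hη] at h1
  have hL : ∀ s : Finset ι, ∑ i ∈ s, ‖⟪Φ.e i, (u : 𝓗)⟫_ℂ‖ ≤ η * X := by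
    intro s
    have h := sum_coeff_le hM (hs s) u
    rwa [Real.sqrt_sq hη.le] at h
  have hu : ‖(u : 𝓗)‖ ≤ η * X :=
    small (norm_nonneg _) ((norm_le_kinSqrt k hM u).trans (norm_kinSqrt_le k hM u))
  have hm : ∀ j, ‖Φ.mom (EuclideanSpace.single j 1) u + (k j : ℂ) • (u : 𝓗)‖ ≤ η * X := by
    intro j
    have h := norm_mom_add_le_kin k (EuclideanSpace.single j 1) hM u
    rw [EuclideanSpace.inner_single_right] at h
    simp only [conj_trivial, one_mul, PiLp.norm_single, norm_one] at h
    exact small (norm_nonneg _) h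
  have hY : 0 ≤ η * X := (norm_nonneg _).trans hu
  rw [pertAt_apply]
  refine (norm_add_le _ _).trans ?_
  rw [add_mul]
  refine add_le_add ?_ (Φ.V_le u _ hL)
  refine (norm_sum_le _ _).trans ?_
  have hj : ∀ j ∈ (Finset.univ : Finset (Fin d)),
      ‖Φ.comp j (Φ.mom (EuclideanSpace.single j 1) u + (k j : ℂ) • (u : 𝓗)) +
        (1 / 2 : ℂ) • Φ.commutator j (EuclideanSpace.single j 1) u +
        (1 / 2 : ℂ) • Φ.comp j (Φ.comp j u)‖ ≤ (Φ.b + Φ.g + Φ.b ^ 2) * (η * X) := by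
    intro j _
    have h1 : ‖Φ.comp j (Φ.mom (EuclideanSpace.single j 1) u + (k j : ℂ) • (u : 𝓗))‖ ≤
        Φ.b * (η * X) := (norm_comp_le j _).trans (by gcongr; exact hm j)
    have h2 : ‖Φ.commutator j (EuclideanSpace.single j 1) u‖ ≤ Φ.g * (η * X) := by
      have h := norm_commutator_le j (EuclideanSpace.single j 1) u hL
      simpa using h
    have h3 : ‖Φ.comp j (Φ.comp j u)‖ ≤ Φ.b * (Φ.b * (η * X)) :=
      (norm_comp_le j _).trans (by gcongr; exact (norm_comp_le j _).trans (by gcongr))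
    refine (norm_add₃_le).trans ?_
    rw [norm_smul, norm_smul]
    have h4 : ‖(1 / 2 : ℂ)‖ = 1 / 2 := by norm_num
    rw [h4]
    have h5 : 0 ≤ Φ.g * (η * X) := by positivity
    have h6 : 0 ≤ Φ.b * (Φ.b * (η * X)) := by positivity
    nlinarith
  refine (Finset.sum_le_sum hj).trans ?_
  rw [Finset.sum_const, Finset.card_univ, Fintype.card_fin, nsmul_eq_mul, mul_assoc]

variable (Φ) in
/-- A shift of the energy so large that the potentials are dominated by the shifted kinetic energy. -/
structure Shift where
  M : ℝ
  two_le : 2 ≤ M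
  sum_le : ∀ (k : E d) (s : Finset ι), ∑ i ∈ s, ((‖Φ.ξ i + k‖ ^ 2 / 2 + M)⁻¹) ^ 2 ≤ 1
  pert_le : ∀ k u, ‖Φ.pertAt k u‖ ≤ 1 / 2 * ‖Φ.kin k M u‖

variable (Φ) in
/-- The shift may be chosen above any prescribed value. -/
theorem exists_shift (c₀ : ℝ) : ∃ S : Φ.Shift, c₀ ≤ S.M := by
  have hb := Φ.b_nonneg
  have hg := Φ.g_nonneg
  have hq := Φ.q_nonneg
  set T := d * (Φ.b + Φ.g + Φ.b ^ 2) + Φ.q + 1 with hT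
  have hT0 : 1 ≤ T := by
    have : 0 ≤ d * (Φ.b + Φ.g + Φ.b ^ 2) + Φ.q := by positivity
    linarith
  set η := (2 * T)⁻¹ with hη
  have hη0 : 0 < η := by positivity
  have hη1 : η ≤ 1 := inv_le_one_of_one_le₀ (by linarith)
  obtain ⟨M₀, hM₀⟩ := Φ.summable (η ^ 2) (by positivity)
  set M := max (max M₀ 2) (max (η⁻¹ ^ 2) c₀) with hM
  have h1 : M₀ ≤ M := (le_max_left _ _).trans (le_max_left _ _)
  have h2 : 2 ≤ M := (le_max_right _ _).trans (le_max_left _ _)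
  have h3 : η⁻¹ ^ 2 ≤ M := (le_max_left _ _).trans (le_max_right _ _)
  have h4 : c₀ ≤ M := (le_max_right _ _).trans (le_max_right _ _)
  refine ⟨⟨M, h2, fun k s => (hM₀ M h1 k s).trans (pow_le_one₀ hη0.le hη1), fun k u => ?_⟩, h4⟩
  refine (norm_pertAt_le (by linarith) hη0 (Real.le_sqrt_of_sq_le h3) (hM₀ M h1 k) u).trans ?_
  rw [← mul_assoc]
  gcongr
  rw [hη, ← div_eq_mul_inv, div_le_iff₀ (by positivity)]
  linarith

namespace Shift

variable (S : Φ.Shift)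

theorem one_le : 1 ≤ S.M := one_le_two.trans S.two_le

/-- The inverse of the shifted kinetic energy as a map to the domain. -/
def kinInvD (k : E d) : 𝓗 →ₗ[ℂ] Φ.D :=
  (Φ.kinInv k S.M : 𝓗 →ₗ[ℂ] 𝓗).codRestrict Φ.D (kinInv_mem k S.one_le)

theorem kin_kinInvD (k : E d) (f : 𝓗) : Φ.kin k S.M (S.kinInvD k f) = f := kin_kinInv k S.one_le f

/-- The perturbation relative to the shifted kinetic energy. -/
def relPert (k : E d) : 𝓗 →L[ℂ] 𝓗 :=
  (Φ.pertAt k ∘ₗ S.kinInvD k).mkContinuous (1 / 2) fun f => by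
    refine (S.pert_le k _).trans ?_
    rw [kin_kinInvD]

theorem norm_relPert_apply_le (k : E d) (f : 𝓗) : ‖S.relPert k f‖ ≤ 1 / 2 * ‖f‖ :=
  (ContinuousLinearMap.le_opNorm _ _).trans
    (mul_le_mul_of_nonneg_right (LinearMap.mkContinuous_norm_le _ (by norm_num) _) (norm_nonneg f))

theorem norm_neg_relPert_lt (k : E d) : ‖-S.relPert k‖ < 1 := by
  rw [norm_neg]
  exact (ContinuousLinearMap.opNorm_le_bound _ (by norm_num) (S.norm_relPert_apply_le k)).trans_lt
    (by norm_num)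

/-- The sum of the Neumann series of `1 + relPert`. -/
def neumann (k : E d) : 𝓗 →L[ℂ] 𝓗 :=
  ((Units.oneSub (-S.relPert k) (S.norm_neg_relPert_lt k))⁻¹ : (𝓗 →L[ℂ] 𝓗)ˣ)

theorem neumann_add (k : E d) (f : 𝓗) : S.neumann k f + S.relPert k (S.neumann k f) = f := by
  have h := (Units.oneSub (-S.relPert k) (S.norm_neg_relPert_lt k)).mul_inv
  have h1 := congrArg (fun T : 𝓗 →L[ℂ] 𝓗 => T f) h
  simpa [neumann, mul_apply_eq_comp] using h1

theorem norm_neumann_le (k : E d) (f : 𝓗) : ‖S.neumann k f‖ ≤ 2 * ‖f‖ := by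
  have h1 := S.neumann_add k f
  have h2 : S.neumann k f = f - S.relPert k (S.neumann k f) := eq_sub_of_add_eq h1
  have h3 := S.norm_relPert_apply_le k (S.neumann k f)
  have h4 : ‖S.neumann k f‖ ≤ ‖f‖ + ‖S.relPert k (S.neumann k f)‖ := by
    conv_lhs => rw [h2]
    exact norm_sub_le _ _
  linarith

/-- The resolvent of the Bloch Hamiltonian. -/
def resolvent (k : E d) : 𝓗 →L[ℂ] 𝓗 := Φ.kinInv k S.M ∘L S.neumann k

/-- The shifted Bloch Hamiltonian. -/
def shifted (k : E d) : Φ.D →ₗ[ℂ] 𝓗 :=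
  (show Φ.D →ₗ[ℂ] 𝓗 from Φ.quad.ham k) + (S.M : ℂ) • Φ.D.subtype

theorem shifted_apply (k : E d) (u : Φ.D) :
    S.shifted k u = Φ.quad.ham k u + (S.M : ℂ) • (u : 𝓗) := rfl

theorem shifted_eq (k : E d) (u : Φ.D) : S.shifted k u = Φ.kin k S.M u + Φ.pertAt k u :=
  ham_quad k (by linarith [S.two_le]) u

theorem resolvent_mem (k : E d) (f : 𝓗) : S.resolvent k f ∈ Φ.D := kinInv_mem k S.one_le _

theorem shifted_resolvent (k : E d) (f : 𝓗) :
    S.shifted k ⟨S.resolvent k f, S.resolvent_mem k f⟩ = f := by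
  rw [shifted_eq]
  refine Eq.trans ?_ (S.neumann_add k f)
  congr 1
  exact kin_kinInv k S.one_le _

theorem shifted_symm (k : E d) (u v : Φ.D) :
    ⟪S.shifted k u, (v : 𝓗)⟫_ℂ = ⟪(u : 𝓗), S.shifted k v⟫_ℂ := by
  simp only [shifted_apply, inner_add_left, inner_add_right, inner_smul_left, inner_smul_right,
    Complex.conj_ofReal]
  congr 1
  exact Φ.quad.ham_symm k u v

theorem resolvent_symm (k : E d) (f g : 𝓗) : ⟪S.resolvent k f, g⟫_ℂ = ⟪f, S.resolvent k g⟫_ℂ := by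
  have h := S.shifted_symm k ⟨S.resolvent k f, S.resolvent_mem k f⟩
    ⟨S.resolvent k g, S.resolvent_mem k g⟩
  rw [shifted_resolvent, shifted_resolvent] at h
  exact h.symm

theorem kinInv_symm (k : E d) (f g : 𝓗) : ⟪Φ.kinInv k S.M f, g⟫_ℂ = ⟪f, Φ.kinInv k S.M g⟫_ℂ := by
  refine inner_eq_inner_of_coeff Φ.e fun i => ?_
  rw [inner_kinInv k S.one_le, inner_kinInv k S.one_le, map_mul, Complex.conj_ofReal]
  ring

/-- By symmetry, the smoothing factor of the resolvent may be moved to the right. -/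
theorem norm_resolvent_le (k : E d) (f : 𝓗) : ‖S.resolvent k f‖ ≤ 2 * ‖Φ.kinInv k S.M f‖ := by
  have h1 : ⟪S.resolvent k f, S.resolvent k f⟫_ℂ =
      ⟪Φ.kinInv k S.M f, S.neumann k (S.resolvent k f)⟫_ℂ := by
    rw [S.resolvent_symm, S.kinInv_symm]
    rfl
  have h2 := norm_inner_le_norm (𝕜 := ℂ) (Φ.kinInv k S.M f) (S.neumann k (S.resolvent k f))
  rw [← h1, inner_self_eq_norm_sq_to_K] at h2
  have h3 := S.norm_neumann_le k (S.resolvent k f)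
  have h4 : ‖S.resolvent k f‖ ^ 2 ≤ ‖Φ.kinInv k S.M f‖ * (2 * ‖S.resolvent k f‖) := by
    refine le_trans ?_ (h2.trans (by gcongr))
    simp
  rcases (norm_nonneg (S.resolvent k f)).eq_or_lt with h0 | h0
  · rw [← h0]; positivity
  · nlinarith

theorem norm_kin_le (k : E d) (u : Φ.D) : ‖Φ.kin k S.M u‖ ≤ 2 * ‖S.shifted k u‖ := by
  have h1 : Φ.kin k S.M u = S.shifted k u - Φ.pertAt k u := by
    rw [shifted_eq, add_sub_cancel_right]
  have h2 := norm_sub_le (S.shifted k u) (Φ.pertAt k u)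
  rw [← h1] at h2
  linarith [S.pert_le k u]

/-- The perturbation is small in the sense of quadratic forms. -/
theorem norm_inner_pertAt_le (k : E d) (w u : Φ.D) : ‖⟪(w : 𝓗), Φ.pertAt k u⟫_ℂ‖ ≤
    1 / 2 * ‖Φ.kinSqrt k S.M w‖ * ‖Φ.kinSqrt k S.M u‖ :=
  norm_inner_le_of_relBound (S := Φ.kin k S.M) (by norm_num) (S.kin_kinInvD k)
    (inner_kin_eq k S.one_le) (norm_kinSqrt_le k S.one_le) (pertAt_symm k) (S.pert_le k) w u

theorem norm_inner_shifted_le (k : E d) (w u : Φ.D) : ‖⟪(w : 𝓗), S.shifted k u⟫_ℂ‖ ≤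
    3 / 2 * ‖Φ.kinSqrt k S.M w‖ * ‖Φ.kinSqrt k S.M u‖ := by
  rw [shifted_eq, inner_add_right, inner_kin_eq k S.one_le]
  refine (norm_add_le _ _).trans ?_
  have h1 := norm_inner_le_norm (𝕜 := ℂ) (Φ.kinSqrt k S.M w) (Φ.kinSqrt k S.M u)
  have h2 := S.norm_inner_pertAt_le k w u
  linarith

theorem kinSqrt_sq_le (k : E d) (u : Φ.D) :
    ‖Φ.kinSqrt k S.M u‖ ^ 2 ≤ 2 * (⟪(u : 𝓗), S.shifted k u⟫_ℂ).re := by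
  have h1 : (⟪Φ.kinSqrt k S.M u, Φ.kinSqrt k S.M u⟫_ℂ).re = ‖Φ.kinSqrt k S.M u‖ ^ 2 :=
    inner_self_eq_norm_sq (𝕜 := ℂ) _
  have h2 := S.norm_inner_pertAt_le k u u
  have h3 := (abs_le.1 ((Complex.abs_re_le_norm _).trans h2)).1
  rw [shifted_eq, inner_add_right, inner_kin_eq k S.one_le, Complex.add_re, h1]
  nlinarith

theorem norm_sq_le (k : E d) (u : Φ.D) :
    ‖(u : 𝓗)‖ ^ 2 ≤ (⟪(u : 𝓗), S.shifted k u⟫_ℂ).re := by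
  have h1 := S.kinSqrt_sq_le k u
  have h2 := pow_le_pow_left₀ (by positivity) (norm_le_kinSqrt k S.one_le u) 2
  rw [mul_pow, Real.sq_sqrt (by linarith [S.two_le])] at h2
  nlinarith [S.two_le, sq_nonneg ‖(u : 𝓗)‖]

theorem norm_grad_sq_le (k v : E d) (u : Φ.D) : ‖Φ.quad.grad k v u‖ ^ 2 ≤
    (2 * (2 + Φ.b)) ^ 2 * ‖v‖ ^ 2 * (⟪(u : 𝓗), S.shifted k u⟫_ℂ).re := by
  have hb := Φ.b_nonneg
  have h1 : ‖Φ.quad.grad k v u‖ ≤ (2 + Φ.b) * ‖v‖ * ‖Φ.kinSqrt k S.M u‖ := by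
    rw [grad_quad]
    refine (norm_add_le _ _).trans ?_
    have h2 := norm_mom_add_le k v S.one_le u
    have h3 : ‖(u : 𝓗)‖ ≤ ‖Φ.kinSqrt k S.M u‖ :=
      (le_mul_of_one_le_left (norm_nonneg _) (Real.one_le_sqrt.2 S.one_le)).trans
        (norm_le_kinSqrt k S.one_le u)
    have h4 : ‖Φ.B v u‖ ≤ Φ.b * ‖v‖ * ‖Φ.kinSqrt k S.M u‖ :=
      ((Φ.B v).le_opNorm _).trans (by gcongr; exact Φ.B_le v)
    linarith
  have h5 := pow_le_pow_left₀ (norm_nonneg _) h1 2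
  refine h5.trans ?_
  have h6 := S.kinSqrt_sq_le k u
  have h7 : 0 ≤ (⟪(u : 𝓗), S.shifted k u⟫_ℂ).re := (sq_nonneg _).trans (S.norm_sq_le k u)
  calc ((2 + Φ.b) * ‖v‖ * ‖Φ.kinSqrt k S.M u‖) ^ 2
      = ((2 + Φ.b) * ‖v‖) ^ 2 * ‖Φ.kinSqrt k S.M u‖ ^ 2 := by ring
    _ ≤ ((2 + Φ.b) * ‖v‖) ^ 2 * (4 * (⟪(u : 𝓗), S.shifted k u⟫_ℂ).re) := by
        gcongr
        linarith
    _ = _ := by ring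

/-- The Hilbert–Schmidt norm of the resolvent, uniformly in `k`. -/
theorem hilbertSchmidt_le (k : E d) (n : ℕ) (φ : Fin n → 𝓗) (hφ : Orthonormal ℂ φ) :
    ∑ i, ‖S.resolvent k (φ i)‖ ^ 2 ≤ 4 := by
  have h1 : HasSum (fun m => ∑ i, ‖⟪Φ.e m, Φ.kinInv k S.M (φ i)⟫_ℂ‖ ^ 2)
      (∑ i, ‖Φ.kinInv k S.M (φ i)‖ ^ 2) := hasSum_sum fun i _ => hasSum_norm_sq_inner Φ.e _
  have h2 : ∑ i, ‖Φ.kinInv k S.M (φ i)‖ ^ 2 ≤ 1 := by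
    refine le_of_tendsto' h1 fun s => (Finset.sum_le_sum fun m _ => ?_).trans (S.sum_le k s)
    have h3 : ∀ i, ‖⟪Φ.e m, Φ.kinInv k S.M (φ i)⟫_ℂ‖ ^ 2 =
        ((‖Φ.ξ m + k‖ ^ 2 / 2 + S.M)⁻¹) ^ 2 * ‖⟪φ i, Φ.e m⟫_ℂ‖ ^ 2 := by
      intro i
      rw [inner_kinInv k S.one_le, norm_mul, mul_pow, Complex.norm_real, Real.norm_eq_abs, sq_abs,
        norm_inner_symm]
    simp only [h3]
    rw [← Finset.mul_sum]
    refine mul_le_of_le_one_right (sq_nonneg _) ?_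
    refine (hφ.sum_inner_products_le (Φ.e m)).trans ?_
    rw [Φ.e.orthonormal.1 m, one_pow]
  calc ∑ i, ‖S.resolvent k (φ i)‖ ^ 2 ≤ ∑ i, 4 * ‖Φ.kinInv k S.M (φ i)‖ ^ 2 := by
        refine Finset.sum_le_sum fun i _ => ?_
        have := pow_le_pow_left₀ (norm_nonneg _) (S.norm_resolvent_le k (φ i)) 2
        linarith
    _ ≤ 4 := by
        rw [← Finset.mul_sum]
        linarith

theorem isCompactOperator_trunc {ι : Type*} (b : HilbertBasis ι ℂ 𝓗) (s : Finset ι) :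
    IsCompactOperator (trunc b s) := by
  classical
  have h : ∀ s : Finset ι, trunc b s ∈ compactOperator (RingHom.id ℂ) 𝓗 𝓗 := by
    intro s
    refine Submodule.sum_mem _ fun i _ => ?_
    have h1 : IsCompactOperator ((ContinuousLinearMap.toSpanSingleton ℂ (b i)) : ℂ →L[ℂ] 𝓗) :=
      isCompactOperator_of_locallyCompactSpace_rng _
    exact h1.comp_clm (innerSL ℂ (b i))
  exact h s

/-- The inverse of the kinetic energy is a norm limit of finite rank operators. -/
theorem isCompactOperator_kinInv (k : E d) : IsCompactOperator (Φ.kinInv k S.M) := by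
  classical
  set r : ι → ℝ := fun i => (‖Φ.ξ i + k‖ ^ 2 / 2 + S.M)⁻¹ with hr
  have hr0 : ∀ i, 0 ≤ r i := fun i => by
    have := S.one_le
    simp only [hr]
    positivity
  have h1 : Summable fun i => r i ^ 2 :=
    summable_of_sum_le (fun i => sq_nonneg _) (S.sum_le k)
  refine isCompactOperator_of_tendsto
    (F := fun s : Finset ι => Φ.kinInv k S.M ∘L trunc Φ.e s) (l := atTop) ?_
    (Eventually.of_forall fun s => (isCompactOperator_trunc Φ.e s).clm_comp _)
  rw [Metric.tendsto_nhds]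
  intro ε hε
  have h2 := h1.tendsto_cofinite_zero.eventually (gt_mem_nhds (by positivity : 0 < (ε / 2) ^ 2))
  have h3 : {i | ¬ r i ^ 2 < (ε / 2) ^ 2}.Finite := h2
  filter_upwards [eventually_ge_atTop h3.toFinset] with s hs
  rw [dist_eq_norm]
  refine lt_of_le_of_lt ?_ (half_lt_self hε)
  refine ContinuousLinearMap.opNorm_le_bound _ (by positivity) fun f => ?_
  refine norm_le_of_norm_inner_le Φ.e (by positivity) fun i => ?_
  rw [sub_apply, inner_sub_right, ContinuousLinearMap.comp_apply, inner_kinInv k S.one_le,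
    inner_kinInv k S.one_le, inner_trunc]
  by_cases hi : i ∈ s
  · rw [if_pos hi, sub_self, norm_zero]
    positivity
  · rw [if_neg hi, mul_zero, zero_sub, norm_neg, norm_mul, Complex.norm_real,
      Real.norm_of_nonneg (hr0 i)]
    gcongr
    by_contra! hlt
    refine hi (hs (h3.mem_toFinset.2 ?_))
    rw [Set.mem_ofPred_eq, not_lt]
    exact pow_le_pow_left₀ (by positivity) hlt.le 2

end Shift

theorem trunc_mem (s : Finset ι) (w : 𝓗) : trunc Φ.e s w ∈ Φ.D := by
  classical
  refine mem_diagDomain.2 ⟨∑ i ∈ s, ((sobolevWeight Φ.ξ i : ℂ) * ⟪Φ.e i, w⟫_ℂ) • Φ.e i, fun j => ?_⟩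
  rw [inner_trunc, inner_sum]
  simp only [inner_smul_right, orthonormal_iff_ite.1 Φ.e.orthonormal, mul_ite, mul_one, mul_zero]
  exact Finset.sum_ite_eq s j _

/-- The components of `p + k` applied to `B v u`. -/
def momPotential (k v : E d) (u : Φ.D) (j : Fin d) : 𝓗 :=
  Φ.commutator j v u + Φ.B v (Φ.mom (EuclideanSpace.single j 1) u + (k j : ℂ) • (u : 𝓗))

theorem inner_momPotential (k v : E d) (u : Φ.D) (j : Fin d) (i : ι) :
    ⟪Φ.e i, momPotential k v u j⟫_ℂ = ((Φ.ξ i + k) j : ℂ) * ⟪Φ.e i, Φ.B v u⟫_ℂ := by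
  rw [momPotential, inner_add_right, inner_commutator, map_add, map_smul, inner_add_right,
    inner_smul_right, PiLp.add_apply]
  push_cast
  ring

/-- The coefficients of `grad k v u` weighted by the kinetic energy: the potential is moved through the
momentum by means of the commutator. -/
theorem weight_mul_inner_grad_sq_le (k v : E d) {M : ℝ} (hM : 1 ≤ M) (u : Φ.D) (i : ι) :
    (‖Φ.ξ i + k‖ ^ 2 / 2 + M) * ‖⟪Φ.e i, Φ.quad.grad k v u⟫_ℂ‖ ^ 2 ≤
      4 * ‖v‖ ^ 2 * ‖⟪Φ.e i, Φ.kin k M u⟫_ℂ‖ ^ 2 +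
        ∑ j, ‖⟪Φ.e i, momPotential k v u j⟫_ℂ‖ ^ 2 + 2 * M * ‖⟪Φ.e i, Φ.B v u⟫_ℂ‖ ^ 2 := by
  set x := Φ.ξ i + k with hx
  set U := ⟪Φ.e i, (u : 𝓗)⟫_ℂ with hU
  set Y := ⟪Φ.e i, Φ.B v u⟫_ℂ with hY
  have hg : ⟪Φ.e i, Φ.quad.grad k v u⟫_ℂ = (⟪x, v⟫_ℝ : ℂ) * U + Y := by
    rw [grad_quad, inner_add_right, inner_add_right, inner_smul_right, inner_mom, hx, inner_add_left]
    push_cast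
    ring
  have hs : ∑ j, ‖⟪Φ.e i, momPotential k v u j⟫_ℂ‖ ^ 2 = ‖x‖ ^ 2 * ‖Y‖ ^ 2 := by
    simp only [inner_momPotential, ← hx, ← hY, norm_mul, mul_pow, Complex.norm_real]
    rw [← Finset.sum_mul, EuclideanSpace.norm_sq_eq]
  rw [hg, hs, inner_kin k (by linarith), ← hx, ← hU, norm_mul, Complex.norm_real,
    Real.norm_of_nonneg (by positivity)]
  set t := ‖x‖ ^ 2 / 2 + M with ht
  have ht0 : 0 ≤ t := by positivity
  have h1 : ‖(⟪x, v⟫_ℝ : ℂ) * U + Y‖ ≤ ‖x‖ * ‖v‖ * ‖U‖ + ‖Y‖ := by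
    refine (norm_add_le _ _).trans ?_
    rw [norm_mul, Complex.norm_real]
    gcongr
    exact norm_inner_le_norm _ _
  have h2 : ‖(⟪x, v⟫_ℝ : ℂ) * U + Y‖ ^ 2 ≤ 2 * (‖x‖ ^ 2 * (‖v‖ ^ 2 * ‖U‖ ^ 2)) + 2 * ‖Y‖ ^ 2 := by
    refine (pow_le_pow_left₀ (norm_nonneg _) h1 2).trans ?_
    nlinarith [sq_nonneg (‖x‖ * ‖v‖ * ‖U‖ - ‖Y‖)]
  have h3 : ‖x‖ ^ 2 * (‖v‖ ^ 2 * ‖U‖ ^ 2) ≤ 2 * t * (‖v‖ ^ 2 * ‖U‖ ^ 2) := by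
    gcongr
    linarith
  calc t * ‖(⟪x, v⟫_ℝ : ℂ) * U + Y‖ ^ 2
      ≤ t * (2 * (2 * t * (‖v‖ ^ 2 * ‖U‖ ^ 2)) + 2 * ‖Y‖ ^ 2) := by
        gcongr
        linarith
    _ = _ := by rw [ht]; ring

namespace Shift

variable (S : Φ.Shift)

theorem norm_momPotential_le (k v : E d) (u : Φ.D) (j : Fin d) :
    ‖momPotential k v u j‖ ≤ (Φ.g + Φ.b) * (‖v‖ * ‖Φ.kin k S.M u‖) := by
  have hb := Φ.b_nonneg
  have h1 := norm_commutator_le j v u (L := ‖Φ.kin k S.M u‖) fun s => by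
    simpa using sum_coeff_le S.one_le (S.sum_le k s) u
  have h2 : ‖Φ.mom (EuclideanSpace.single j 1) u + (k j : ℂ) • (u : 𝓗)‖ ≤ ‖Φ.kin k S.M u‖ := by
    have h := norm_mom_add_le_kin k (EuclideanSpace.single j 1) S.one_le u
    rw [EuclideanSpace.inner_single_right] at h
    simp only [conj_trivial, one_mul, PiLp.norm_single, norm_one] at h
    exact (le_mul_of_one_le_left (norm_nonneg _) (Real.one_le_sqrt.2 S.one_le)).trans h
  have h3 : ‖Φ.B v (Φ.mom (EuclideanSpace.single j 1) u + (k j : ℂ) • (u : 𝓗))‖ ≤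
      Φ.b * ‖v‖ * ‖Φ.kin k S.M u‖ := ((Φ.B v).le_opNorm _).trans (by gcongr; exact Φ.B_le v)
  refine (norm_add_le _ _).trans ?_
  linarith

variable (Φ) in
/-- The constant in the bound of `grad k v u` in the form domain. -/
def gradConst : ℝ := 4 + d * (Φ.g + Φ.b) ^ 2 + 2 * Φ.b ^ 2

/-- The derivatives of the family map the domain to the form domain. The truncation makes the
left-hand side meaningful before this is known. -/
theorem norm_kinSqrt_trunc_sq_le (k v : E d) (u : Φ.D) (s : Finset ι) :
    ‖Φ.kinSqrt k S.M ⟨trunc Φ.e s (Φ.quad.grad k v u), trunc_mem s _⟩‖ ^ 2 ≤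
      gradConst Φ * ‖v‖ ^ 2 * ‖Φ.kin k S.M u‖ ^ 2 := by
  classical
  have hb := Φ.b_nonneg
  have hg := Φ.g_nonneg
  have hM := S.one_le
  have bessel : ∀ (s : Finset ι) (x : 𝓗), ∑ i ∈ s, ‖⟪Φ.e i, x⟫_ℂ‖ ^ 2 ≤ ‖x‖ ^ 2 := fun s x =>
    Φ.e.orthonormal.sum_inner_products_le x
  refine norm_sq_le_of_sum_le Φ.e fun s' => ?_
  have h1 : ∀ i ∈ s', ‖⟪Φ.e i, Φ.kinSqrt k S.M ⟨trunc Φ.e s (Φ.quad.grad k v u), trunc_mem s _⟩⟫_ℂ‖ ^ 2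
      ≤ 4 * ‖v‖ ^ 2 * ‖⟪Φ.e i, Φ.kin k S.M u⟫_ℂ‖ ^ 2 +
        ∑ j, ‖⟪Φ.e i, momPotential k v u j⟫_ℂ‖ ^ 2 + 2 * S.M * ‖⟪Φ.e i, Φ.B v u⟫_ℂ‖ ^ 2 := by
    intro i _
    refine le_trans ?_ (weight_mul_inner_grad_sq_le k v hM u i)
    rw [inner_kinSqrt k hM, norm_mul, mul_pow, Complex.norm_real, Real.norm_eq_abs, sq_abs,
      Real.sq_sqrt (by positivity)]
    gcongr
    rw [inner_trunc]
    split_ifs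
    · exact le_rfl
    · rw [norm_zero]; exact norm_nonneg _
  refine (Finset.sum_le_sum h1).trans ?_
  rw [Finset.sum_add_distrib, Finset.sum_add_distrib, ← Finset.mul_sum, ← Finset.mul_sum,
    Finset.sum_comm]
  have h2 : ∑ j, ∑ i ∈ s', ‖⟪Φ.e i, momPotential k v u j⟫_ℂ‖ ^ 2 ≤
      d * ((Φ.g + Φ.b) * (‖v‖ * ‖Φ.kin k S.M u‖)) ^ 2 := by
    have h := Finset.sum_le_sum fun (j : Fin d) (_ : j ∈ Finset.univ) =>
      (bessel s' (momPotential k v u j)).trans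
        (pow_le_pow_left₀ (norm_nonneg _) (S.norm_momPotential_le k v u j) 2)
    simpa using h
  have h3 : S.M * ∑ i ∈ s', ‖⟪Φ.e i, Φ.B v u⟫_ℂ‖ ^ 2 ≤ Φ.b ^ 2 * ‖v‖ ^ 2 * ‖Φ.kin k S.M u‖ ^ 2 := by
    have h4 : ‖Φ.B v u‖ ≤ Φ.b * ‖v‖ * ‖(u : 𝓗)‖ :=
      ((Φ.B v).le_opNorm _).trans (by gcongr; exact Φ.B_le v)
    have h5 := pow_le_pow_left₀ (by positivity)
      ((norm_le_kinSqrt k hM u).trans (norm_kinSqrt_le k hM u)) 2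
    rw [mul_pow, Real.sq_sqrt (by linarith)] at h5
    calc S.M * ∑ i ∈ s', ‖⟪Φ.e i, Φ.B v u⟫_ℂ‖ ^ 2
        ≤ S.M * (Φ.b * ‖v‖ * ‖(u : 𝓗)‖) ^ 2 := by
          gcongr
          exact (bessel s' _).trans (pow_le_pow_left₀ (norm_nonneg _) h4 2)
      _ = Φ.b ^ 2 * ‖v‖ ^ 2 * (S.M * ‖(u : 𝓗)‖ ^ 2) := by ring
      _ ≤ _ := by gcongr
  have h6 : 4 * ‖v‖ ^ 2 * ∑ i ∈ s', ‖⟪Φ.e i, Φ.kin k S.M u⟫_ℂ‖ ^ 2 ≤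
      4 * ‖v‖ ^ 2 * ‖Φ.kin k S.M u‖ ^ 2 := by
    gcongr
    exact bessel s' _
  rw [gradConst]
  nlinarith

/-- The bound for truncated vectors passes to the limit. -/
theorem norm_inner_grad_sq_le (k v : E d) (u' u : Φ.D) :
    ‖⟪Φ.quad.grad k v u', S.shifted k u⟫_ℂ‖ ^ 2 ≤
      √(18 * gradConst Φ) ^ 2 * ‖v‖ ^ 2 * ‖S.shifted k u'‖ ^ 2 *
        (⟪(u : 𝓗), S.shifted k u⟫_ℂ).re := by
  have hC : 0 ≤ gradConst Φ := by
    rw [gradConst]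
    positivity
  have hlim : Tendsto (fun s => ‖⟪trunc Φ.e s (Φ.quad.grad k v u'), S.shifted k u⟫_ℂ‖ ^ 2) atTop
      (𝓝 (‖⟪Φ.quad.grad k v u', S.shifted k u⟫_ℂ‖ ^ 2)) :=
    (((tendsto_trunc Φ.e (Φ.quad.grad k v u')).inner tendsto_const_nhds).norm).pow 2
  refine le_of_tendsto' hlim fun s => ?_
  have h1 := pow_le_pow_left₀ (norm_nonneg _)
    (S.norm_inner_shifted_le k ⟨trunc Φ.e s (Φ.quad.grad k v u'), trunc_mem s _⟩ u) 2
  have h2 := S.norm_kinSqrt_trunc_sq_le k v u' s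
  have h3 := S.kinSqrt_sq_le k u
  have h4 := pow_le_pow_left₀ (norm_nonneg _) (S.norm_kin_le k u') 2
  have h5 : 0 ≤ (⟪(u : 𝓗), S.shifted k u⟫_ℂ).re := (sq_nonneg _).trans (S.norm_sq_le k u)
  refine h1.trans ?_
  rw [Real.sq_sqrt (by positivity), mul_pow, mul_pow]
  calc (3 / 2) ^ 2 * ‖Φ.kinSqrt k S.M ⟨trunc Φ.e s (Φ.quad.grad k v u'), trunc_mem s _⟩‖ ^ 2 *
        ‖Φ.kinSqrt k S.M u‖ ^ 2
      ≤ (3 / 2) ^ 2 * (gradConst Φ * ‖v‖ ^ 2 * (2 * ‖S.shifted k u'‖) ^ 2) *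
        (2 * (⟪(u : 𝓗), S.shifted k u⟫_ℂ).re) := by
        gcongr
        exact h2.trans (by gcongr)
    _ = _ := by ring

/-- The Bloch Hamiltonians form a regular family. -/
def regularFamily : RegularFamily (E d) 𝓗 where
  toQuadFamily := Φ.quad
  c := S.M
  R := S.resolvent
  R_mem := S.resolvent_mem
  ham_R := S.shifted_resolvent
  lower := S.norm_sq_le
  C₁ := 2 * (2 + Φ.b)
  C₁_nonneg := by
    have := Φ.b_nonneg
    positivity
  form := S.norm_grad_sq_le
  C₂ := √(18 * gradConst Φ)
  C₂_nonneg := Real.sqrt_nonneg _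
  reg := S.norm_inner_grad_sq_le
  compact k := (S.isCompactOperator_kinInv k).comp_clm (S.neumann k)
  K := 4
  hilbertSchmidt := S.hilbertSchmidt_le

end Shift

end FourierModel

/-! ### Plane waves -/

section PlaneWaves

variable {d : ℕ} (a : Module.Basis (Fin d) ℝ (E d))

/-- The vectors of the dual lattice: `⟪dualVec a n, a j⟫ = 2 π n j`. -/
def dualVec (n : Fin d → ℤ) : E d :=
  (InnerProductSpace.toDual ℝ (E d)).symm
    (LinearMap.toContinuousLinearMap (∑ j, (2 * Real.pi * n j) • a.coord j))

theorem inner_dualVec (n : Fin d → ℤ) (x : E d) :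
    ⟪dualVec a n, x⟫_ℝ = ∑ j, 2 * Real.pi * n j * a.repr x j := by
  rw [dualVec, InnerProductSpace.toDual_symm_apply]
  simp

theorem inner_dualVec_basis (n : Fin d → ℤ) (j : Fin d) :
    ⟪dualVec a n, a j⟫_ℝ = 2 * Real.pi * n j := by
  rw [inner_dualVec, Finset.sum_eq_single j]
  · simp
  · intro i _ hi
    simp [hi.symm]
  · simp

theorem dualVec_add (n m : Fin d → ℤ) : dualVec a (n + m) = dualVec a n + dualVec a m := by
  refine ext_inner_right ℝ fun x => ?_
  rw [inner_add_left, inner_dualVec, inner_dualVec, inner_dualVec, ← Finset.sum_add_distrib]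
  refine Finset.sum_congr rfl fun j _ => ?_
  push_cast [Pi.add_apply]
  ring

theorem dualVec_neg (n : Fin d → ℤ) : dualVec a (-n) = -dualVec a n := by
  refine ext_inner_right ℝ fun x => ?_
  rw [inner_neg_left, inner_dualVec, inner_dualVec, ← Finset.sum_neg_distrib]
  refine Finset.sum_congr rfl fun j _ => ?_
  push_cast [Pi.neg_apply]
  ring

theorem dualVec_ne_zero {n : Fin d → ℤ} (hn : n ≠ 0) : dualVec a n ≠ 0 := by
  intro h
  refine hn (funext fun j => ?_)
  have h1 := inner_dualVec_basis a n j
  rw [h, inner_zero_left] at h1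
  have h2 : (n j : ℝ) = 0 := by
    rcases mul_eq_zero.1 h1.symm with h3 | h3
    · exact absurd h3 (by positivity)
    · exact h3
  exact_mod_cast h2

/-- The plane wave with wave vector `dualVec a n`. -/
def wave (n : Fin d → ℤ) (x : E d) : ℂ := Complex.exp ((⟪dualVec a n, x⟫_ℝ : ℂ) * Complex.I)

theorem norm_wave (n : Fin d → ℤ) (x : E d) : ‖wave a n x‖ = 1 := Complex.norm_exp_ofReal_mul_I _

theorem conj_wave (n : Fin d → ℤ) (x : E d) : (starRingEnd ℂ) (wave a n x) = wave a (-n) x := by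
  rw [wave, wave, ← Complex.exp_conj, map_mul, Complex.conj_ofReal, Complex.conj_I, dualVec_neg,
    inner_neg_left]
  push_cast
  ring_nf

theorem wave_mul (n m : Fin d → ℤ) (x : E d) : wave a n x * wave a m x = wave a (n + m) x := by
  rw [wave, wave, wave, ← Complex.exp_add, dualVec_add, inner_add_left]
  push_cast
  ring_nf

theorem wave_zero (x : E d) : wave a 0 x = 1 := by
  rw [wave, inner_dualVec]
  simp

theorem contDiff_wave (n : Fin d → ℤ) : ContDiff ℝ ∞ (wave a n) := by
  have h : ContDiff ℝ ∞ fun x : E d => (⟪dualVec a n, x⟫_ℝ : ℂ) :=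
    (Complex.ofRealCLM ∘L innerSL ℝ (dualVec a n)).contDiff
  exact (h.mul contDiff_const).cexp

theorem continuous_wave (n : Fin d → ℤ) : Continuous (wave a n) := (contDiff_wave a n).continuous

theorem fderiv_wave (n : Fin d → ℤ) (x v : E d) :
    fderiv ℝ (wave a n) x v = Complex.I * (⟪dualVec a n, v⟫_ℝ : ℂ) * wave a n x := by
  have h1 : HasFDerivAt (fun x : E d => (⟪dualVec a n, x⟫_ℝ : ℂ))
      (Complex.ofRealCLM ∘L innerSL ℝ (dualVec a n)) x :=
    (Complex.ofRealCLM ∘L innerSL ℝ (dualVec a n)).hasFDerivAt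
  have h2 := (h1.mul_const Complex.I).cexp
  have h3 := congrArg (fun T : E d →L[ℝ] ℂ => T v) h2.fderiv
  refine h3.trans ?_
  simp [wave]
  ring

theorem isPeriodic_wave (n : Fin d → ℤ) : IsPeriodic a (wave a n) := by
  intro R hR x
  obtain ⟨m, hm⟩ : ∃ m : Fin d → ℤ, ∀ j, a.repr R j = m j := by
    have h := (a.mem_span_iff_repr_mem ℤ R).1 hR
    choose m hm using h
    exact ⟨m, fun j => by simpa using (hm j).symm⟩
  have h1 : ⟪dualVec a n, x + R⟫_ℝ = ⟪dualVec a n, x⟫_ℝ + (∑ j, n j * m j : ℤ) * (2 * Real.pi) := by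
    rw [inner_add_right, inner_dualVec a n R, Int.cast_sum, Finset.sum_mul]
    congr 1
    refine Finset.sum_congr rfl fun j _ => ?_
    rw [hm]
    push_cast
    ring
  rw [wave, wave, h1]
  refine Complex.exp_eq_exp_iff_exists_int.2 ⟨∑ j, n j * m j, ?_⟩
  push_cast
  ring

instance isFiniteMeasure_cellVol : IsFiniteMeasure (cellVol a) := ⟨by
  rw [Measure.restrict_apply_univ]
  exact (ZSpan.fundamentalDomain_isBounded a).measure_lt_top⟩

/-- The volume of the unit cell. -/
def cellVolume : ℝ := (cellVol a).real Set.univ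

theorem cellVolume_pos : 0 < cellVolume a := by
  refine ENNReal.toReal_pos ?_ (measure_ne_top _ _)
  rw [Measure.restrict_apply_univ]
  exact ZSpan.measure_fundamentalDomain_ne_zero a

/-- The square root of the inverse of the volume of the unit cell. -/
def waveNorm : ℝ := (√(cellVolume a))⁻¹

theorem waveNorm_pos : 0 < waveNorm a := inv_pos.2 (Real.sqrt_pos.2 (cellVolume_pos a))

variable {a}

open scoped Pointwise in
/-- The integral of a periodic function over the cell does not change under translations. -/
theorem integral_translate {F : Type*} [NormedAddCommGroup F] [NormedSpace ℝ F] {f : E d → F}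
    (hf : IsPeriodic a f) (w : E d) :
    ∫ x, f (x + w) ∂(cellVol a) = ∫ x, f x ∂(cellVol a) := by
  have h1 := ZSpan.isAddFundamentalDomain' a (volume : Measure (E d))
  have h2 := h1.vadd_of_comm w
  have hf' : ∀ (g : (Submodule.span ℤ (Set.range a)).toAddSubgroup) (x : E d), f (g +ᵥ x) = f x := by
    intro g x
    rw [AddSubgroup.vadd_def, vadd_eq_add, add_comm]
    exact hf g g.2 x
  have : Countable (Submodule.span ℤ (Set.range a)).toAddSubgroup :=
    inferInstanceAs (Countable (Submodule.span ℤ (Set.range a)))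
  rw [h1.setIntegral_eq h2 hf']
  have h3 : (fun x => x + w) ⁻¹' (w +ᵥ cell a) = cell a := by
    ext x
    rw [Set.mem_preimage, Set.mem_vadd_set_iff_neg_vadd_mem, vadd_eq_add]
    simp
  have h4 := (measurePreserving_add_right (volume : Measure (E d)) w).setIntegral_preimage_emb
    (measurableEmbedding_addRight w) f (w +ᵥ cell a)
  rw [← h4, h3]

/-- The integral of a derivative of a smooth periodic function vanishes, because the integral over
the cell is invariant under translations. -/
theorem integral_fderiv_eq_zero {f : E d → ℂ} (hf : ContDiff ℝ ∞ f) (hp : IsPeriodic a f) (v : E d) :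
    ∫ x, fderiv ℝ f x v ∂(cellVol a) = 0 := by
  have hb : Bornology.IsBounded (cell a) := ZSpan.fundamentalDomain_isBounded a
  have hc : IsCompact (closure (cell a) ×ˢ Set.Icc (-1 : ℝ) 1) :=
    hb.isCompact_closure.prod isCompact_Icc
  have hcd := continuous_dir hf v
  obtain ⟨C, hC⟩ := hc.exists_bound_of_continuousOn
    (f := fun p : E d × ℝ => fderiv ℝ f (p.1 + p.2 • v) v)
    (by exact (hcd.comp (by fun_prop)).continuousOn)
  have hder := (hasDerivAt_integral_of_dominated_loc_of_deriv_le (μ := cellVol a) (𝕜 := ℝ)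
    (F := fun s x => f (x + s • v)) (F' := fun s x => fderiv ℝ f (x + s • v) v) (x₀ := 0)
    (s := Set.Icc (-1) 1) (bound := fun _ => C) (Icc_mem_nhds (by norm_num) (by norm_num))
    (Eventually.of_forall fun s => (hf.continuous.comp (by fun_prop)).aestronglyMeasurable)
    (((memLp_of_continuous (hf.continuous.comp (by fun_prop :
      Continuous fun x : E d => x + (0 : ℝ) • v))).integrable one_le_two))
    (hcd.comp (by fun_prop)).aestronglyMeasurable
    ((ae_restrict_iff' (ZSpan.fundamentalDomain_measurableSet a)).2 (ae_of_all _ fun x hx s hs =>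
      hC (x, s) ⟨subset_closure hx, hs⟩)) (integrable_const C)
    (ae_of_all _ fun x s _ => ?_)).2
  · have h1 : (fun s : ℝ => ∫ x, f (x + s • v) ∂(cellVol a)) = fun _ => ∫ x, f x ∂(cellVol a) :=
      funext fun s => integral_translate hp (s • v)
    rw [h1] at hder
    have h2 := hder.unique (hasDerivAt_const (0 : ℝ) _)
    simpa using h2
  · have h3 : HasDerivAt (fun s : ℝ => x + s • v) v s := by
      simpa using ((hasDerivAt_id s).smul_const v).const_add x
    exact ((hf.differentiable (by simp)) (x + s • v)).hasFDerivAt.comp_hasDerivAt s h3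

theorem integral_wave {n : Fin d → ℤ} (hn : n ≠ 0) : ∫ x, wave a n x ∂(cellVol a) = 0 := by
  have h1 := integral_fderiv_eq_zero (contDiff_wave a n) (isPeriodic_wave a n) (dualVec a n)
  simp only [fderiv_wave] at h1
  rw [integral_const_mul] at h1
  refine (mul_eq_zero.1 h1).resolve_left (mul_ne_zero Complex.I_ne_zero ?_)
  rw [Complex.ofReal_ne_zero]
  exact (real_inner_self_pos.2 (dualVec_ne_zero a hn)).ne'

theorem inner_toLp {f : E d → ℂ} (hf : MemLp f 2 (cellVol a)) (u : L2per a) :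
    ⟪hf.toLp f, u⟫_ℂ = ∫ x, (starRingEnd ℂ) (f x) * u x ∂(cellVol a) := by
  rw [L2.inner_def]
  refine integral_congr_ae ?_
  filter_upwards [hf.coeFn_toLp] with x hx
  rw [hx, RCLike.inner_apply, mul_comm]

variable (a) in
/-- The normalized plane waves in the Hilbert space. -/
def planeWave (n : Fin d → ℤ) : L2per a :=
  (waveNorm a : ℂ) • (memLp_of_continuous (continuous_wave a n)).toLp (wave a n)

theorem inner_planeWave (n : Fin d → ℤ) (u : L2per a) :
    ⟪planeWave a n, u⟫_ℂ = waveNorm a * ∫ x, wave a (-n) x * u x ∂(cellVol a) := by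
  rw [planeWave, inner_smul_left, Complex.conj_ofReal, inner_toLp]
  simp only [conj_wave]

theorem coeFn_planeWave (n : Fin d → ℤ) :
    planeWave a n =ᵐ[cellVol a] fun x => (waveNorm a : ℂ) * wave a n x := by
  filter_upwards [Lp.coeFn_smul (waveNorm a : ℂ)
    ((memLp_of_continuous (a := a) (continuous_wave a n)).toLp (wave a n)),
    (memLp_of_continuous (a := a) (continuous_wave a n)).coeFn_toLp] with x h1 h2
  rw [planeWave, h1, Pi.smul_apply, h2, smul_eq_mul]

theorem inner_planeWave_planeWave (n m : Fin d → ℤ) :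
    ⟪planeWave a n, planeWave a m⟫_ℂ = if n = m then 1 else 0 := by
  have h1 : ∫ x, wave a (-n) x * planeWave a m x ∂(cellVol a) =
      waveNorm a * ∫ x, wave a (m - n) x ∂(cellVol a) := by
    rw [← integral_const_mul]
    refine integral_congr_ae ?_
    filter_upwards [coeFn_planeWave (a := a) m] with x hx
    rw [hx, sub_eq_add_neg, ← wave_mul]
    ring
  rw [inner_planeWave, h1]
  split_ifs with h
  · subst h
    simp only [sub_self, wave_zero, integral_const, Complex.real_smul, mul_one]
    rw [← Complex.ofReal_mul, ← Complex.ofReal_mul, ← mul_assoc, waveNorm, ← mul_inv,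
      Real.mul_self_sqrt (cellVolume_pos a).le]
    exact_mod_cast inv_mul_cancel₀ (cellVolume_pos a).ne'
  · rw [integral_wave (sub_ne_zero.2 (Ne.symm h)), mul_zero, mul_zero]

theorem orthonormal_planeWave : Orthonormal ℂ (planeWave a) :=
  orthonormal_iff_ite.2 inner_planeWave_planeWave

end PlaneWaves

/-! ### Fourier series of periodic functions -/

section FourierSeries

variable {d : ℕ} (a : Module.Basis (Fin d) ℝ (E d))

/-- The projection of Euclidean space to the torus, in the coordinates of the basis `a`. -/
def toTorus (x : E d) : UnitAddTorus (Fin d) := fun i => (a.repr x i : UnitAddCircle)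

/-- The representative in the unit cell of a point of the torus. -/
def ofTorus (y : UnitAddTorus (Fin d)) : E d :=
  ∑ i, ((AddCircle.measurableEquivIco 1 0 (y i) : Set.Ico (0 : ℝ) (0 + 1)) : ℝ) • a i

theorem measurable_toTorus : Measurable (toTorus a) := by
  refine measurable_pi_lambda _ fun i => AddCircle.measurable_mk'.comp ?_
  exact (LinearMap.continuous_of_finiteDimensional (a.coord i)).measurable

theorem measurable_ofTorus : Measurable (ofTorus a) := by
  refine Finset.measurable_sum _ fun i _ => Measurable.smul_const ?_ _
  exact measurable_subtype_coe.comp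
    ((AddCircle.measurableEquivIco 1 0).measurable.comp (measurable_pi_apply i))

variable {a}

theorem ofTorus_toTorus {x : E d} (hx : x ∈ cell a) : ofTorus a (toTorus a x) = x := by
  have h1 : ∀ i, ((AddCircle.measurableEquivIco 1 0 (toTorus a x i) :
      Set.Ico (0 : ℝ) (0 + 1)) : ℝ) = a.repr x i := by
    intro i
    have h2 : ((AddCircle.equivIco 1 0 (a.repr x i : UnitAddCircle) : Set.Ico (0 : ℝ) (0 + 1)) : ℝ) =
        Int.fract (a.repr x i / 1) * 1 := AddCircle.coe_equivIco_mk_apply 1 (a.repr x i)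
    rw [div_one, mul_one, Int.fract_eq_self.2 ((ZSpan.mem_fundamentalDomain a).1 hx i)] at h2
    exact h2
  rw [ofTorus]
  simp only [h1]
  exact a.sum_repr x

theorem mFourier_toTorus (n : Fin d → ℤ) (x : E d) :
    UnitAddTorus.mFourier n (toTorus a x) = wave a n x := by
  rw [UnitAddTorus.mFourier, ContinuousMap.coe_mk, wave, inner_dualVec]
  simp only [toTorus, fourier_coe_apply]
  rw [← Complex.exp_sum]
  congr 1
  push_cast
  rw [Finset.sum_mul]
  refine Finset.sum_congr rfl fun i _ => ?_
  ring

/-- Completeness of the plane waves, by density of the trigonometric polynomials in the continuous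
functions on the torus. -/
theorem eq_zero_of_inner_planeWave {u : L2per a} (h : ∀ n, ⟪planeWave a n, u⟫_ℂ = 0) : u = 0 := by
  set m : Measure (UnitAddTorus (Fin d)) := Measure.map (toTorus a) (cellVol a) with hm
  have hT := measurable_toTorus a
  have : IsFiniteMeasure m := Measure.isFiniteMeasure_map _ _
  have huT : (fun x => u (ofTorus a (toTorus a x))) =ᵐ[cellVol a] u := by
    refine (ae_restrict_iff' (ZSpan.fundamentalDomain_measurableSet a)).2 (ae_of_all _ fun x hx => ?_)
    exact congrArg u (ofTorus_toTorus hx)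
  have hsm : StronglyMeasurable fun y => u (ofTorus a y) :=
    (Lp.stronglyMeasurable u).comp_measurable (measurable_ofTorus a)
  have hF : MemLp (fun y => u (ofTorus a y)) 2 m := by
    rw [hm, memLp_map_measure_iff hsm.aestronglyMeasurable hT.aemeasurable]
    exact (memLp_congr_ae huT).2 (Lp.memLp u)
  set F := hF.toLp (fun y => u (ofTorus a y)) with hFdef
  have hdense : (Submodule.span ℂ (Set.range fun n =>
      ContinuousMap.toLp (E := ℂ) 2 m ℂ (UnitAddTorus.mFourier n))).topologicalClosure = ⊤ := by
    have h1 := (ContinuousMap.toLp_denseRange ℂ m ℂ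
      (ENNReal.ofNat_ne_top : (2 : ENNReal) ≠ ⊤)).topologicalClosure_map_submodule
      (UnitAddTorus.span_mFourier_closure_eq_top (d := Fin d))
    simpa only [Submodule.map_span, ContinuousLinearMap.coe_coe, ← Set.range_comp,
      Function.comp_def] using h1
  have hF0 : F = 0 := by
    have h1 : F ∈ (Submodule.span ℂ (Set.range fun n =>
        ContinuousMap.toLp (E := ℂ) 2 m ℂ (UnitAddTorus.mFourier n)))ᗮ := by
      rw [Submodule.mem_orthogonal]
      intro x hx
      induction hx using Submodule.span_induction with
      | mem x hx =>
        obtain ⟨n, rfl⟩ := hx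
        have h2 := h n
        rw [inner_planeWave, mul_eq_zero, Complex.ofReal_eq_zero] at h2
        rw [L2.inner_def]
        refine Eq.trans ?_ (h2.resolve_left (waveNorm_pos a).ne')
        have h3 : ∫ y, ⟪ContinuousMap.toLp (E := ℂ) 2 m ℂ (UnitAddTorus.mFourier n) y, F y⟫_ℂ ∂m =
            ∫ y, UnitAddTorus.mFourier (-n) y * u (ofTorus a y) ∂m := by
          refine integral_congr_ae ?_
          filter_upwards [ContinuousMap.coeFn_toLp (p := 2) (𝕜 := ℂ) m (UnitAddTorus.mFourier n),
            hF.coeFn_toLp] with y h4 h5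
          rw [h4, h5, UnitAddTorus.mFourier_neg, RCLike.inner_apply, mul_comm]
        rw [h3, hm, integral_map hT.aemeasurable]
        · refine integral_congr_ae ?_
          filter_upwards [huT] with x hx
          rw [hx, mFourier_toTorus]
        · exact (ContinuousMap.continuous _).aestronglyMeasurable.mul hsm.aestronglyMeasurable
      | zero => exact inner_zero_left _
      | add x y _ _ hx hy => rw [inner_add_left, hx, hy, add_zero]
      | smul c x _ hx => rw [inner_smul_left, hx, mul_zero]
    rw [(Submodule.topologicalClosure_eq_top_iff).1 hdense] at h1
    exact (Submodule.mem_bot ℂ).1 h1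
  have h1 : (fun y => u (ofTorus a y)) =ᵐ[m] 0 := by
    rw [← (MemLp.toLp_eq_toLp_iff hF MemLp.zero), MemLp.toLp_zero]
    exact hF0
  have h2 := ae_of_ae_map hT.aemeasurable h1
  refine Lp.ext ?_
  filter_upwards [huT, h2, Lp.coeFn_zero ℂ 2 (cellVol a)] with x h3 h4 h5
  rw [← h3, h5]
  exact h4

variable (a) in
/-- The Hilbert basis of plane waves. -/
def planeBasis : HilbertBasis (Fin d → ℤ) ℂ (L2per a) :=
  HilbertBasis.mkOfOrthogonalEqBot orthonormal_planeWave (by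
    rw [Submodule.eq_bot_iff]
    intro u hu
    refine eq_zero_of_inner_planeWave fun n => ?_
    exact (Submodule.mem_orthogonal _ _).1 hu _ (Submodule.subset_span ⟨n, rfl⟩))

theorem planeBasis_apply (n : Fin d → ℤ) : planeBasis a n = planeWave a n := by
  rw [planeBasis, HilbertBasis.coe_mkOfOrthogonalEqBot]

theorem inner_planeBasis (n : Fin d → ℤ) (u : L2per a) :
    ⟪planeBasis a n, u⟫_ℂ = waveNorm a * ∫ x, wave a (-n) x * u x ∂(cellVol a) := by
  rw [planeBasis_apply, inner_planeWave]

theorem inner_toLp_planeBasis {f : E d → ℂ} (hf : MemLp f 2 (cellVol a)) (n : Fin d → ℤ) :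
    ⟪hf.toLp f, planeBasis a n⟫_ℂ =
      waveNorm a * ∫ x, (starRingEnd ℂ) (f x) * wave a n x ∂(cellVol a) := by
  rw [inner_toLp, planeBasis_apply, ← integral_const_mul]
  refine integral_congr_ae ?_
  filter_upwards [coeFn_planeWave (a := a) n] with x hx
  rw [hx]
  ring

/-- Weak derivatives in terms of Fourier coefficients. -/
theorem isWeakDeriv_iff {v : E d} {u g : L2per a} : IsWeakDeriv a v u g ↔
    ∀ n, ⟪planeBasis a n, g⟫_ℂ =
      Complex.I * (⟪dualVec a n, v⟫_ℝ : ℂ) * ⟪planeBasis a n, u⟫_ℂ := by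
  constructor
  · intro h n
    have h1 := h _ (contDiff_wave a (-n)) (isPeriodic_wave a (-n))
    simp only [fderiv_wave, dualVec_neg, inner_neg_left] at h1
    have h2 : ∫ x, u x * (Complex.I * ((-⟪dualVec a n, v⟫_ℝ : ℝ) : ℂ) * wave a (-n) x) ∂(cellVol a) =
        -(Complex.I * (⟪dualVec a n, v⟫_ℝ : ℂ)) * ∫ x, wave a (-n) x * u x ∂(cellVol a) := by
      rw [← integral_const_mul]
      congr 1
      ext x
      push_cast
      ring
    rw [h2] at h1
    have h3 : ∫ x, g x * wave a (-n) x ∂(cellVol a) = ∫ x, wave a (-n) x * g x ∂(cellVol a) := by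
      simp only [mul_comm]
    rw [h3] at h1
    rw [inner_planeBasis, inner_planeBasis]
    linear_combination (waveNorm a : ℂ) * h1
  · intro h φ hφ hp
    have hcd := continuous_dir hφ v
    have m1 : MemLp (fun x => (starRingEnd ℂ) (φ x)) 2 (cellVol a) :=
      memLp_of_continuous (Complex.continuous_conj.comp hφ.continuous)
    have m2 : MemLp (fun x => (starRingEnd ℂ) (fderiv ℝ φ x v)) 2 (cellVol a) :=
      memLp_of_continuous (Complex.continuous_conj.comp hcd)
    have h1 : ∫ x, u x * fderiv ℝ φ x v ∂(cellVol a) = ⟪m2.toLp _, u⟫_ℂ := by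
      rw [inner_toLp]
      simp only [Complex.conj_conj, mul_comm]
    have h2 : ∫ x, g x * φ x ∂(cellVol a) = ⟪m1.toLp _, g⟫_ℂ := by
      rw [inner_toLp]
      simp only [Complex.conj_conj, mul_comm]
    rw [h1, h2]
    refine ((planeBasis a).hasSum_inner_mul_inner (m2.toLp _) u).unique
      (((planeBasis a).hasSum_inner_mul_inner (m1.toLp _) g).neg.congr_fun fun n => ?_)
    have h3 : ∫ x, fderiv ℝ φ x v * wave a n x ∂(cellVol a) =
        -(Complex.I * (⟪dualVec a n, v⟫_ℝ : ℂ)) * ∫ x, φ x * wave a n x ∂(cellVol a) := by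
      have hprod : ∀ x, fderiv ℝ (fun x => φ x * wave a n x) x v = fderiv ℝ φ x v * wave a n x +
          Complex.I * (⟪dualVec a n, v⟫_ℝ : ℂ) * (φ x * wave a n x) := by
        intro x
        rw [fderiv_fun_mul (hφ.differentiable (by simp) x)
          ((contDiff_wave a n).differentiable (by simp) x)]
        simp only [add_apply, smul_apply, smul_eq_mul, fderiv_wave]
        ring
      have h4 := integral_fderiv_eq_zero (hφ.mul (contDiff_wave a n))
        (fun R hR x => congrArg₂ (· * ·) (hp R hR x) (isPeriodic_wave a n R hR x)) v
      have i1 : Integrable (fun x => fderiv ℝ φ x v * wave a n x) (cellVol a) :=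
        integrable_mul_cont (memLp_of_continuous hcd) (continuous_wave a n)
      have i2 : Integrable (fun x => φ x * wave a n x) (cellVol a) :=
        integrable_mul_cont (memLp_of_continuous hφ.continuous) (continuous_wave a n)
      simp only [hprod] at h4
      rw [integral_add i1 (i2.const_mul _), integral_const_mul] at h4
      linear_combination h4
    rw [inner_toLp_planeBasis, inner_toLp_planeBasis, h n]
    simp only [Complex.conj_conj]
    rw [h3]
    ring

/-- A function with summable Fourier coefficients is bounded. -/
theorem ae_norm_le_of_sum_le {u : L2per a} {L : ℝ}
    (hL : ∀ s : Finset (Fin d → ℤ), ∑ n ∈ s, ‖⟪planeBasis a n, u⟫_ℂ‖ ≤ L) :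
    ∀ᵐ x ∂(cellVol a), ‖u x‖ ≤ waveNorm a * L := by
  classical
  -- a subsequence of the partial sums converges almost everywhere
  have h0 : ∀ s : Finset (Fin d → ℤ), (trunc (planeBasis a) s u : L2per a) =ᵐ[cellVol a]
      fun x => ∑ n ∈ s, ⟪planeBasis a n, u⟫_ℂ * (waveNorm a * wave a n x) := by
    intro s
    rw [trunc_apply]
    induction s using Finset.induction_on with
    | empty =>
      filter_upwards [Lp.coeFn_zero ℂ 2 (cellVol a)] with x hx
      rw [Finset.sum_empty, Finset.sum_empty, hx, Pi.zero_apply]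
    | insert n s hn ih =>
      rw [Finset.sum_insert hn]
      filter_upwards [ih, Lp.coeFn_add (⟪planeBasis a n, u⟫_ℂ • planeBasis a n)
        (∑ n ∈ s, ⟪planeBasis a n, u⟫_ℂ • planeBasis a n),
        Lp.coeFn_smul ⟪planeBasis a n, u⟫_ℂ (planeBasis a n), coeFn_planeWave (a := a) n]
        with x h1 h2 h3 h4
      rw [h2, Pi.add_apply, h1, h3, Pi.smul_apply, planeBasis_apply, h4, Finset.sum_insert hn,
        smul_eq_mul, ← planeBasis_apply]
  have h1 : ∀ s : Finset (Fin d → ℤ), ∀ᵐ x ∂(cellVol a),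
      ‖(trunc (planeBasis a) s u : L2per a) x‖ ≤ waveNorm a * L := by
    intro s
    filter_upwards [h0 s] with x hx
    rw [hx]
    refine (norm_sum_le _ _).trans ?_
    have h2 : ∀ n ∈ s, ‖⟪planeBasis a n, u⟫_ℂ * (waveNorm a * wave a n x)‖ =
        waveNorm a * ‖⟪planeBasis a n, u⟫_ℂ‖ := by
      intro n _
      rw [norm_mul, norm_mul, norm_wave, Complex.norm_real, Real.norm_of_nonneg (waveNorm_pos a).le]
      ring
    rw [Finset.sum_congr rfl h2, ← Finset.mul_sum]
    exact mul_le_mul_of_nonneg_left (hL s) (waveNorm_pos a).le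
  obtain ⟨ns, -, hns⟩ :=
    (tendstoInMeasure_of_tendsto_Lp (tendsto_trunc (planeBasis a) u)).exists_seq_tendsto_ae'
  filter_upwards [hns, ae_all_iff.2 fun i => h1 (ns i)] with x h2 h3
  exact le_of_tendsto' h2.norm h3

/-- The Fourier coefficients of a product are a convolution. -/
theorem hasSum_inner_mul (f u : L2per a) (n : Fin d → ℤ) :
    HasSum (fun m => waveNorm a * (⟪planeBasis a (n - m), f⟫_ℂ * ⟪planeBasis a m, u⟫_ℂ))
      (waveNorm a * ∫ x, wave a (-n) x * (f x * u x) ∂(cellVol a)) := by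
  have m1 : MemLp (fun x => (starRingEnd ℂ) (f x) * wave a n x) 2 (cellVol a) := by
    refine (Lp.memLp f).of_le ?_ (ae_of_all _ fun x => ?_)
    · exact (Complex.continuous_conj.comp_aestronglyMeasurable (Lp.aestronglyMeasurable f)).mul
        (continuous_wave a n).aestronglyMeasurable
    · rw [norm_mul, norm_wave, mul_one, RCLike.norm_conj]
  have h := ((planeBasis a).hasSum_inner_mul_inner (m1.toLp _) u).mul_left (waveNorm a : ℂ)
  rw [inner_toLp] at h
  have h1 : ∀ x, (starRingEnd ℂ) ((starRingEnd ℂ) (f x) * wave a n x) * u x =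
      wave a (-n) x * (f x * u x) := by
    intro x
    rw [map_mul, Complex.conj_conj, conj_wave]
    ring
  simp only [h1] at h
  refine h.congr_fun fun m => ?_
  rw [inner_toLp_planeBasis, inner_planeBasis]
  have h2 : ∀ x, (starRingEnd ℂ) ((starRingEnd ℂ) (f x) * wave a n x) * wave a m x =
      wave a (-(n - m)) x * f x := by
    intro x
    rw [map_mul, Complex.conj_conj, conj_wave, mul_assoc, wave_mul, mul_comm]
    congr 2
    abel
  simp only [h2]

/-- The commutator of the momentum with a multiplication operator is multiplication by the
derivative. -/
theorem integral_commutator {v : E d} {f f' u w : L2per a} (hf : IsWeakDeriv a v f f')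
    (hw : ∀ n, ⟪planeBasis a n, w⟫_ℂ = (⟪dualVec a n, v⟫_ℝ : ℂ) * ⟪planeBasis a n, u⟫_ℂ)
    (n : Fin d → ℤ) :
    waveNorm a * ∫ x, wave a (-n) x * (f' x * u x) ∂(cellVol a) =
      Complex.I * ((⟪dualVec a n, v⟫_ℝ : ℂ) *
          (waveNorm a * ∫ x, wave a (-n) x * (f x * u x) ∂(cellVol a)) -
        waveNorm a * ∫ x, wave a (-n) x * (f x * w x) ∂(cellVol a)) := by
  refine (hasSum_inner_mul f' u n).unique (((((hasSum_inner_mul f u n).mul_left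
    (⟪dualVec a n, v⟫_ℝ : ℂ)).sub (hasSum_inner_mul f w n)).mul_left Complex.I).congr_fun
      fun m => ?_)
  rw [isWeakDeriv_iff.1 hf, hw, sub_eq_add_neg n m, dualVec_add, dualVec_neg, inner_add_left,
    inner_neg_left]
  push_cast
  ring

end FourierSeries

/-! ### Sums over the dual lattice -/

section LatticeSums

variable {d : ℕ}

/-- This is where the dimension enters. -/
theorem summable_inv_norm_pow_four (hd : d ≤ 3) : Summable fun n : Fin d → ℤ => ‖n‖⁻¹ ^ 4 := by
  set b := Pi.basisFun ℝ (Fin d)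
  set L := Submodule.span ℤ (Set.range b)
  have h1 : Module.finrank ℤ L = d := by
    rw [ZLattice.rank ℝ L]
    simp
  have h2 := ZLattice.summable_norm_pow_inv L 4 (by omega)
  have hmem : ∀ n : Fin d → ℤ, (fun i => (n i : ℝ)) ∈ L := by
    intro n
    rw [Module.Basis.mem_span_iff_repr_mem]
    intro i
    exact ⟨n i, by simp [b]⟩
  have hinj : Function.Injective fun n : Fin d → ℤ => (⟨fun i => (n i : ℝ), hmem n⟩ : L) := by
    intro n m h
    funext i
    have h3 : (n i : ℝ) = m i := congrFun (congrArg Subtype.val h) i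
    exact_mod_cast h3
  refine (h2.comp_injective hinj).congr fun n => ?_
  have h4 : ‖(⟨fun i => (n i : ℝ), hmem n⟩ : L)‖ = ‖n‖ := by
    rw [Submodule.coe_norm, Pi.norm_def, Pi.norm_def]
    congr 2
  simp only [Function.comp_apply, h4]

/-- A translation of the argument may be absorbed up to a bounded remainder by a shift of the
summation index. -/
theorem exists_norm_add_le (a : Module.Basis (Fin d) ℝ (E d)) : ∃ A : ℝ, 1 ≤ A ∧ ∀ k : E d,
    ∃ m : Fin d → ℤ, ∀ n, ‖n + m‖ ≤ A * ‖dualVec a n + k‖ + 1 := by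
  have hs : 0 ≤ ∑ j, ‖a j‖ := Finset.sum_nonneg fun j _ => norm_nonneg _
  refine ⟨1 + ∑ j, ‖a j‖, by linarith, fun k => ⟨fun j => ⌊⟪k, a j⟫_ℝ / (2 * Real.pi)⌋,
    fun n => ?_⟩⟩
  rw [pi_norm_le_iff_of_nonneg (by positivity)]
  intro j
  set x := ⟪k, a j⟫_ℝ / (2 * Real.pi) with hx
  have hpi : 1 ≤ 2 * Real.pi := by linarith [Real.pi_gt_three]
  have h1 : ⟪dualVec a n + k, a j⟫_ℝ = 2 * Real.pi * (n j + x) := by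
    rw [inner_add_left, inner_dualVec_basis, hx]
    field_simp
  have h2 : |(n j : ℝ) + x| ≤ ‖dualVec a n + k‖ * ‖a j‖ := by
    have h3 := abs_real_inner_le_norm (dualVec a n + k) (a j)
    rw [h1, abs_mul, abs_of_pos (by linarith)] at h3
    exact (le_mul_of_one_le_left (abs_nonneg _) hpi).trans h3
  have h4 : ‖a j‖ ≤ 1 + ∑ j, ‖a j‖ := by
    have := Finset.single_le_sum (f := fun j => ‖a j‖) (fun j _ => norm_nonneg _)
      (Finset.mem_univ j)
    linarith
  have h5 : |(n j : ℝ) + x| ≤ (1 + ∑ j, ‖a j‖) * ‖dualVec a n + k‖ := by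
    refine h2.trans ?_
    rw [mul_comm]
    gcongr
  rw [Pi.add_apply, Int.norm_eq_abs]
  push_cast
  have h6 : (n j : ℝ) + (⌊x⌋ : ℝ) = (n j + x) - Int.fract x := by
    rw [← Int.self_sub_fract]
    ring
  rw [h6]
  refine (abs_sub _ _).trans (add_le_add h5 ?_)
  rw [abs_of_nonneg (Int.fract_nonneg x)]
  exact (Int.fract_lt_one x).le

/-- The sums of the squared inverse kinetic energies over the dual lattice are small for large
shifts, uniformly in `k`. -/
theorem exists_lattice_sum_le (hd : d ≤ 3) (a : Module.Basis (Fin d) ℝ (E d)) :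
    ∀ δ > 0, ∃ M₀ : ℝ, ∀ M ≥ M₀, ∀ (k : E d) (s : Finset (Fin d → ℤ)),
      ∑ n ∈ s, ((‖dualVec a n + k‖ ^ 2 / 2 + M)⁻¹) ^ 2 ≤ δ := by
  intro δ hδ
  obtain ⟨A, hA, hm⟩ := exists_norm_add_le a
  set h : ℝ → (Fin d → ℤ) → ℝ := fun M n => ((‖n‖ ^ 2 / (4 * A ^ 2) + M / 2)⁻¹) ^ 2 with hh
  have h0 : ∀ M n, 0 ≤ h M n := fun M n => sq_nonneg _
  have hmono : ∀ M ≥ (2 : ℝ), ∀ n, h M n ≤ h 2 n := by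
    intro M hM n
    simp only [hh]
    gcongr
  have hsum2 : Summable (h 2) := by
    refine Summable.of_norm_bounded_eventually
      ((summable_inv_norm_pow_four hd).mul_left (16 * A ^ 4)) ?_
    have hfin : ({0} : Set (Fin d → ℤ)).Finite := Set.finite_singleton 0
    filter_upwards [hfin.compl_mem_cofinite] with n hn
    have hn0 : 0 < ‖n‖ := norm_pos_iff.2 hn
    rw [Real.norm_of_nonneg (h0 2 n)]
    have h1 : h 2 n ≤ ((‖n‖ ^ 2 / (4 * A ^ 2))⁻¹) ^ 2 := by
      simp only [hh]
      gcongr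
      linarith
    refine h1.trans (le_of_eq ?_)
    field_simp
    ring
  have hsumM : ∀ M ≥ (2 : ℝ), Summable (h M) := fun M hM =>
    hsum2.of_nonneg_of_le (h0 M) (hmono M hM)
  have hlim : Tendsto (fun M => ∑' n, h M n) atTop (𝓝 (∑' _ : Fin d → ℤ, (0 : ℝ))) := by
    refine tendsto_tsum_of_dominated_convergence hsum2 (fun n => ?_) ?_
    · have h1 : Tendsto (fun M : ℝ => ‖n‖ ^ 2 / (4 * A ^ 2) + M / 2) atTop atTop :=
        tendsto_atTop_add_const_left _ _ (tendsto_id.atTop_div_const (by norm_num))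
      have h2 := (tendsto_inv_atTop_zero.comp h1).pow 2
      rwa [zero_pow two_ne_zero] at h2
    · filter_upwards [eventually_ge_atTop (2 : ℝ)] with M hM n
      rw [Real.norm_of_nonneg (h0 M n)]
      exact hmono M hM n
  rw [tsum_zero] at hlim
  obtain ⟨M₀, hM₀⟩ := eventually_atTop.1 (hlim.eventually (gt_mem_nhds hδ))
  refine ⟨max M₀ 2, fun M hM k s => ?_⟩
  have hM1 : M₀ ≤ M := (le_max_left _ _).trans hM
  have hM2 : 2 ≤ M := (le_max_right _ _).trans hM
  have hM0 : 0 < M := two_pos.trans_le hM2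
  obtain ⟨m, hmk⟩ := hm k
  have hterm : ∀ n ∈ s, ((‖dualVec a n + k‖ ^ 2 / 2 + M)⁻¹) ^ 2 ≤ h M (n + m) := by
    intro n _
    refine pow_le_pow_left₀ (by positivity) (inv_anti₀ (by positivity) ?_) 2
    set r := ‖dualVec a n + k‖
    have h1 := hmk n
    have h2 : ‖n + m‖ ^ 2 ≤ 2 * A ^ 2 * r ^ 2 + 2 := by
      refine (pow_le_pow_left₀ (norm_nonneg _) h1 2).trans ?_
      nlinarith [sq_nonneg (A * r - 1)]
    have h3 : ‖n + m‖ ^ 2 / (4 * A ^ 2) ≤ r ^ 2 / 2 + 1 := by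
      rw [div_le_iff₀ (by positivity)]
      nlinarith
    linarith
  refine (Finset.sum_le_sum hterm).trans (le_trans ?_ (hM₀ M hM1).le)
  rw [← (Equiv.addRight m).tsum_eq (h M)]
  exact ((Equiv.addRight m).summable_iff.2 (hsumM M hM2)).sum_le_tsum s fun n _ => h0 M _

end LatticeSums

/-! ### Multiplication operators -/

section Multiplication

open scoped ENNReal

variable {d : ℕ} {a : Module.Basis (Fin d) ℝ (E d)}

variable (a) in
/-- The periodic Sobolev space of order two, as a subspace of the Hilbert space. -/
abbrev sobolevPer : Submodule ℂ (L2per a) := sobolev (planeBasis a) (dualVec a)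

theorem memLp_top_of_sum_le {u : L2per a} {L : ℝ}
    (hL : ∀ s : Finset (Fin d → ℤ), ∑ n ∈ s, ‖⟪planeBasis a n, u⟫_ℂ‖ ≤ L) :
    MemLp u ∞ (cellVol a) :=
  memLp_top_of_bound (Lp.aestronglyMeasurable u) _ (ae_norm_le_of_sum_le hL)

/-- The Fourier coefficients of an element of the Sobolev space of order two are summable, in
dimension at most three. -/
theorem exists_sum_coeff_le (hd : d ≤ 3) {u : L2per a} (hu : u ∈ sobolevPer a) :
    ∃ L, ∀ s : Finset (Fin d → ℤ), ∑ n ∈ s, ‖⟪planeBasis a n, u⟫_ℂ‖ ≤ L := by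
  obtain ⟨f, hf⟩ := mem_diagDomain.1 hu
  obtain ⟨M₀, hM₀⟩ := exists_lattice_sum_le hd a 1 one_pos
  set M := max M₀ 1 with hM
  have hM1 : 1 ≤ M := le_max_right _ _
  refine ⟨√1 * ‖(M : ℂ) • f‖, fun s => ?_⟩
  refine sum_norm_inner_le (planeBasis a) (r := fun n => (‖dualVec a n + 0‖ ^ 2 / 2 + M)⁻¹)
    (hM₀ M (le_max_left _ _) 0 s) fun n => ?_
  rw [inner_smul_right, hf, norm_mul, norm_mul, Complex.norm_real, Complex.norm_real,
    Real.norm_of_nonneg (by linarith), Real.norm_of_nonneg (by unfold sobolevWeight; positivity),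
    add_zero, ← mul_assoc, ← mul_assoc]
  refine le_mul_of_one_le_left (norm_nonneg _) ?_
  rw [mul_assoc, inv_mul_eq_div, one_le_div (by positivity), sobolevWeight]
  nlinarith [mul_nonneg (by linarith : 0 ≤ M - 1) (sq_nonneg ‖dualVec a n‖)]

/-- The inclusion of the Sobolev space of order two in the bounded functions. -/
def toBounded (hd : d ≤ 3) : sobolevPer a →ₗ[ℂ] Lp ℂ ∞ (cellVol a) where
  toFun u := (memLp_top_of_sum_le (exists_sum_coeff_le hd u.2).choose_spec).toLp (u : L2per a)
  map_add' u w := by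
    rw [← MemLp.toLp_add, MemLp.toLp_eq_toLp_iff]
    exact Lp.coeFn_add (u : L2per a) (w : L2per a)
  map_smul' c u := by
    rw [RingHom.id_apply, ← MemLp.toLp_const_smul, MemLp.toLp_eq_toLp_iff]
    exact Lp.coeFn_smul c (u : L2per a)

theorem coeFn_toBounded (hd : d ≤ 3) (u : sobolevPer a) :
    toBounded hd u =ᵐ[cellVol a] (u : L2per a) :=
  (memLp_top_of_sum_le (exists_sum_coeff_le hd u.2).choose_spec).coeFn_toLp

theorem norm_toBounded_le (hd : d ≤ 3) (u : sobolevPer a) {L : ℝ}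
    (hL : ∀ s : Finset (Fin d → ℤ), ∑ n ∈ s, ‖⟪planeBasis a n, (u : L2per a)⟫_ℂ‖ ≤ L) :
    ‖toBounded hd u‖ ≤ waveNorm a * L := by
  have hL0 : 0 ≤ L := by simpa using hL ∅
  have h := Lp.norm_le_of_ae_bound (f := toBounded hd u) (C := waveNorm a * L)
    (mul_nonneg (waveNorm_pos a).le hL0) (by
      filter_upwards [coeFn_toBounded hd u, ae_norm_le_of_sum_le hL] with x h1 h2
      rwa [h1])
  simpa using h

/-- Multiplication by a bounded function. -/
def mulBounded (f : Lp ℂ ∞ (cellVol a)) : L2per a →L[ℂ] L2per a :=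
  LinearMap.mkContinuous
    { toFun := fun u => (f • u : Lp ℂ 2 (cellVol a))
      map_add' := fun u w => Lp.add_smul f u w
      map_smul' := fun c u => (Lp.smul_comm c f u).symm } ‖f‖ fun u => Lp.norm_smul_le f u

theorem coeFn_mulBounded (f : Lp ℂ ∞ (cellVol a)) (u : L2per a) :
    mulBounded f u =ᵐ[cellVol a] fun x => f x * u x := Lp.coeFn_lpSMul f u

/-- Multiplication of elements of the Sobolev space of order two by a square integrable function. -/
def mulSobolev (hd : d ≤ 3) (f : L2per a) : sobolevPer a →ₗ[ℂ] L2per a where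
  toFun u := (f • toBounded hd u : Lp ℂ 2 (cellVol a))
  map_add' u w := by rw [map_add, Lp.add_smul]
  map_smul' c u := by rw [map_smul, RingHom.id_apply, Lp.smul_comm]

theorem coeFn_mulSobolev (hd : d ≤ 3) (f : L2per a) (u : sobolevPer a) :
    mulSobolev hd f u =ᵐ[cellVol a] fun x => f x * (u : L2per a) x := by
  filter_upwards [Lp.coeFn_lpSMul (r := 2) f (toBounded hd u), coeFn_toBounded hd u] with x h1 h2
  rw [← h2]
  exact h1

theorem norm_mulSobolev_le (hd : d ≤ 3) (f : L2per a) (u : sobolevPer a) {L : ℝ}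
    (hL : ∀ s : Finset (Fin d → ℤ), ∑ n ∈ s, ‖⟪planeBasis a n, (u : L2per a)⟫_ℂ‖ ≤ L) :
    ‖mulSobolev hd f u‖ ≤ ‖f‖ * waveNorm a * L := by
  refine (Lp.norm_smul_le f (toBounded hd u)).trans ?_
  rw [mul_assoc]
  exact mul_le_mul_of_nonneg_left (norm_toBounded_le hd u hL) (norm_nonneg f)

theorem inner_of_coeFn {f u w : L2per a} (h : w =ᵐ[cellVol a] fun x => f x * u x)
    (n : Fin d → ℤ) : ⟪planeBasis a n, w⟫_ℂ =
      waveNorm a * ∫ x, wave a (-n) x * (f x * u x) ∂(cellVol a) := by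
  rw [inner_planeBasis]
  congr 1
  refine integral_congr_ae ?_
  filter_upwards [h] with x hx
  rw [hx]

/-- Multiplication by a real function is symmetric. -/
theorem inner_mul_symm {f : E d → ℂ} (hf : ∀ᵐ x ∂(cellVol a), (starRingEnd ℂ) (f x) = f x)
    {x y x' y' : L2per a} (hx : x' =ᵐ[cellVol a] fun z => f z * x z)
    (hy : y' =ᵐ[cellVol a] fun z => f z * y z) : ⟪x', y⟫_ℂ = ⟪x, y'⟫_ℂ := by
  rw [L2.inner_def, L2.inner_def]
  refine integral_congr_ae ?_
  filter_upwards [hf, hx, hy] with z h1 h2 h3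
  rw [h2, h3, RCLike.inner_apply, RCLike.inner_apply, map_mul, h1]
  ring

end Multiplication

section ComponentSum

variable {d : ℕ} {𝓗 : Type*} [NormedAddCommGroup 𝓗] [InnerProductSpace ℂ 𝓗]

/-- The linear map with components `T j`. -/
def componentSum (T : Fin d → 𝓗 →L[ℂ] 𝓗) : E d →ₗ[ℝ] 𝓗 →L[ℂ] 𝓗 where
  toFun v := ∑ j, (v j : ℂ) • T j
  map_add' v w := by simp [add_smul, Finset.sum_add_distrib]
  map_smul' r v := by simp [mul_smul, Finset.smul_sum]

theorem norm_coord_le (x : E d) (j : Fin d) : |x j| ≤ ‖x‖ := by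
  simpa using PiLp.norm_apply_le x j

theorem norm_componentSum_le (T : Fin d → 𝓗 →L[ℂ] 𝓗) (v : E d) :
    ‖componentSum T v‖ ≤ (∑ j, ‖T j‖) * ‖v‖ := by
  change ‖∑ j, (v j : ℂ) • T j‖ ≤ _
  rw [Finset.sum_mul]
  refine (norm_sum_le _ _).trans (Finset.sum_le_sum fun j _ => ?_)
  rw [norm_smul, mul_comm, Complex.norm_real]
  gcongr
  exact norm_coord_le v j

end ComponentSum

/-! ### The Sobolev space and the potentials -/

section Potentials

open scoped ENNReal

variable {d : ℕ} {a : Module.Basis (Fin d) ℝ (E d)}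

theorem norm_dualVec_le (n : Fin d → ℤ) : ‖dualVec a n‖ ≤ 1 * sobolevWeight (dualVec a) n := by
  rw [one_mul, sobolevWeight]
  nlinarith [sq_nonneg (‖dualVec a n‖ - 1)]

theorem inner_diagMul_sobolev {l : (Fin d → ℤ) → ℂ} {K : ℝ}
    (hl : ∀ n, ‖l n‖ ≤ K * sobolevWeight (dualVec a) n) (u : sobolevPer a) (n : Fin d → ℤ) :
    ⟪planeBasis a n, diagMul (planeBasis a) (sobolevWeight (dualVec a)) l u⟫_ℂ =
      l n * ⟪planeBasis a n, (u : L2per a)⟫_ℂ :=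
  inner_diagMul (fun n => by unfold sobolevWeight; positivity) ⟨K, hl⟩ u n

/-- The periodic Sobolev space of order two in terms of Fourier coefficients. -/
theorem memHper_two_iff {u : L2per a} : MemHper a 2 u ↔ u ∈ sobolevPer a := by
  constructor
  · rintro ⟨-, h⟩
    have h1 : ∀ j : Fin d, ∃ f : L2per a, ∀ n, ⟪planeBasis a n, f⟫_ℂ =
        -((dualVec a n j : ℂ) ^ 2) * ⟪planeBasis a n, u⟫_ℂ := by
      intro j
      obtain ⟨g, hg, hg2, h2⟩ := h (EuclideanSpace.single j 1)
      obtain ⟨f, hf, hf2⟩ := h2 (EuclideanSpace.single j 1)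
      have e1 := (isWeakDeriv_iff (u := u) (g := hg2.toLp g)).1
        (hg.congr (ae_eq_refl _) hg2.coeFn_toLp.symm)
      have e2 := (isWeakDeriv_iff (u := hg2.toLp g) (g := hf2.memLp.toLp f)).1
        (hf.congr hg2.coeFn_toLp.symm hf2.memLp.coeFn_toLp.symm)
      refine ⟨hf2.memLp.toLp f, fun n => ?_⟩
      rw [e2, e1, EuclideanSpace.inner_single_right]
      simp only [conj_trivial, one_mul]
      linear_combination (dualVec a n j : ℂ) ^ 2 * ⟪planeBasis a n, u⟫_ℂ * Complex.I_mul_I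
    choose f hf using h1
    refine mem_diagDomain.2 ⟨u - ∑ j, f j, fun n => ?_⟩
    rw [inner_sub_right, inner_sum]
    simp only [hf]
    rw [← Finset.sum_mul, sobolevWeight, EuclideanSpace.real_norm_sq_eq]
    push_cast
    rw [Finset.sum_neg_distrib]
    ring
  · intro hu
    set U : sobolevPer a := ⟨u, hu⟩
    refine ⟨Lp.memLp u, fun v => ?_⟩
    have e1 := fun n => inner_diagMul_sobolev (l := fun n => Complex.I * (⟪dualVec a n, v⟫_ℝ : ℂ))
      (K := ‖v‖) (fun n => by
        rw [norm_mul, Complex.norm_I, one_mul, Complex.norm_real, mul_comm]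
        refine (norm_inner_le_norm _ _).trans ?_
        gcongr
        simpa using norm_dualVec_le n) U n
    refine ⟨_, isWeakDeriv_iff.2 e1, Lp.memLp _, fun w => ?_⟩
    have e2 := fun n => inner_diagMul_sobolev
      (l := fun n => Complex.I * (⟪dualVec a n, w⟫_ℝ : ℂ) * (Complex.I * (⟪dualVec a n, v⟫_ℝ : ℂ)))
      (K := ‖w‖ * ‖v‖) (fun n => by
        rw [norm_mul, norm_mul, norm_mul, Complex.norm_I, one_mul, one_mul, Complex.norm_real,
          Complex.norm_real]
        have h1 := norm_inner_le_norm (𝕜 := ℝ) (dualVec a n) w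
        have h2 := norm_inner_le_norm (𝕜 := ℝ) (dualVec a n) v
        calc _ ≤ (‖dualVec a n‖ * ‖w‖) * (‖dualVec a n‖ * ‖v‖) := by gcongr
          _ = ‖w‖ * ‖v‖ * ‖dualVec a n‖ ^ 2 := by ring
          _ ≤ _ := by
            rw [sobolevWeight]
            gcongr
            linarith) U n
    exact ⟨_, isWeakDeriv_iff.2 fun n => (e2 n).trans (by rw [e1]; ring), Lp.memLp _⟩

/-- A periodic function of class `H²` defines an element of the Sobolev space. -/
theorem toLp_mem_sobolevPer {f : E d → ℂ} (hf : MemHper a 2 f) :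
    hf.memLp.toLp f ∈ sobolevPer a :=
  memHper_two_iff.1 (hf.congr hf.memLp.coeFn_toLp.symm)

/-- The components of the vector potential as bounded functions. -/
def potential (hd : d ≤ 3) {A : E d → E d}
    (hA : ∀ j, MemHper a 2 (fun x => ((A x j : ℝ) : ℂ))) (j : Fin d) : Lp ℂ ∞ (cellVol a) :=
  toBounded hd ⟨_, toLp_mem_sobolevPer (hA j)⟩

theorem coeFn_potential (hd : d ≤ 3) {A : E d → E d}
    (hA : ∀ j, MemHper a 2 (fun x => ((A x j : ℝ) : ℂ))) (j : Fin d) :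
    potential hd hA j =ᵐ[cellVol a] fun x => ((A x j : ℝ) : ℂ) :=
  (coeFn_toBounded hd _).trans (hA j).memLp.coeFn_toLp

/-- The derivatives of the components of the vector potential. -/
theorem exists_potential_deriv {A : E d → E d}
    (hA : ∀ j, MemHper a 2 (fun x => ((A x j : ℝ) : ℂ))) (j l : Fin d) :
    ∃ f : L2per a, IsWeakDeriv a (EuclideanSpace.single j 1) ((hA l).memLp.toLp _) f := by
  obtain ⟨g, hg, hg2⟩ := (hA l).2 (EuclideanSpace.single j 1)
  exact ⟨hg2.memLp.toLp g, hg.congr (hA l).memLp.coeFn_toLp.symm hg2.memLp.coeFn_toLp.symm⟩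

/-- Multiplication by the component of the vector potential in the direction `v`. -/
def vectorMul (hd : d ≤ 3) {A : E d → E d}
    (hA : ∀ j, MemHper a 2 (fun x => ((A x j : ℝ) : ℂ))) (v : E d) : L2per a →L[ℂ] L2per a :=
  ∑ j, (v j : ℂ) • mulBounded (potential hd hA j)

theorem vectorMul_apply (hd : d ≤ 3) {A : E d → E d}
    (hA : ∀ j, MemHper a 2 (fun x => ((A x j : ℝ) : ℂ))) (v : E d) (u : L2per a) :
    vectorMul hd hA v u = ∑ j, (v j : ℂ) • mulBounded (potential hd hA j) u := by
  rw [vectorMul, sum_apply]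
  rfl

theorem inner_eq_sum (x v : E d) : ⟪x, v⟫_ℝ = ∑ j, v j * x j := by
  rw [PiLp.inner_apply]
  simp

theorem coeFn_vectorMul (hd : d ≤ 3) {A : E d → E d}
    (hA : ∀ j, MemHper a 2 (fun x => ((A x j : ℝ) : ℂ))) (v : E d) (u : L2per a) :
    vectorMul hd hA v u =ᵐ[cellVol a] fun x => ((⟪A x, v⟫_ℝ : ℝ) : ℂ) * u x := by
  rw [vectorMul_apply]
  have h1 := fun j => coeFn_mulBounded (potential hd hA j) u
  have h2 := fun j => coeFn_potential hd hA j
  have h3 := fun j => Lp.coeFn_smul (v j : ℂ) (mulBounded (potential hd hA j) u)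
  filter_upwards [ae_all_iff.2 h1, ae_all_iff.2 h2, ae_all_iff.2 h3, Lp.coeFn_finsetSum
    Finset.univ fun j => (v j : ℂ) • mulBounded (potential hd hA j) u] with x e1 e2 e3 e4
  rw [e4, Finset.sum_apply, inner_eq_sum]
  push_cast
  rw [Finset.sum_mul]
  refine Finset.sum_congr rfl fun j _ => ?_
  rw [e3, Pi.smul_apply, e1, e2, smul_eq_mul, mul_assoc]

/-- The Bloch Hamiltonians on the unit cell in the Fourier representation. -/
def blochModel (hd : d ≤ 3) {A : E d → E d} {V : E d → ℝ}
    (hA : ∀ j, MemHper a 2 (fun x => ((A x j : ℝ) : ℂ)))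
    (hV : MemLp (fun x => (V x : ℂ)) 2 (cellVol a)) : FourierModel d (L2per a) (Fin d → ℤ) where
  e := planeBasis a
  ξ := dualVec a
  summable := exists_lattice_sum_le hd a
  B := componentSum fun j => mulBounded (potential hd hA j)
  B_symm v x y := inner_mul_symm (ae_of_all _ fun z => Complex.conj_ofReal _)
    (coeFn_vectorMul hd hA v x) (coeFn_vectorMul hd hA v y)
  b := ∑ j, ‖mulBounded (potential hd hA j)‖
  b_nonneg := Finset.sum_nonneg fun j _ => norm_nonneg _
  B_le := norm_componentSum_le _
  V := mulSobolev hd (hV.toLp _)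
  V_symm x y := inner_mul_symm (f := hV.toLp _) (by
      filter_upwards [hV.coeFn_toLp] with z hz
      rw [hz, Complex.conj_ofReal]) (coeFn_mulSobolev hd _ x) (coeFn_mulSobolev hd _ y)
  q := ‖hV.toLp _‖ * waveNorm a
  q_nonneg := mul_nonneg (norm_nonneg _) (waveNorm_pos a).le
  V_le u L hL := norm_mulSobolev_le hd _ u hL
  g := ∑ j, ∑ l, ‖(exists_potential_deriv hA j l).choose‖ * waveNorm a
  g_nonneg := Finset.sum_nonneg fun j _ => Finset.sum_nonneg fun l _ =>
    mul_nonneg (norm_nonneg _) (waveNorm_pos a).le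
  comm j v u := by
    have hmom := fun n => inner_diagMul_sobolev (l := fun n => (dualVec a n j : ℂ)) (K := 1)
      (fun n => by
        rw [Complex.norm_real]
        exact (norm_coord_le _ j).trans (norm_dualVec_le n)) u n
    refine ⟨∑ l, (v l : ℂ) •
      (-Complex.I) • mulSobolev hd (exists_potential_deriv hA j l).choose u, fun n => ?_, fun L hL => ?_⟩
    · change _ = _ * ⟪_, vectorMul hd hA v (u : L2per a)⟫_ℂ - ⟪_, vectorMul hd hA v _⟫_ℂ
      rw [vectorMul_apply, vectorMul_apply, inner_sum, inner_sum, inner_sum, Finset.mul_sum,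
        ← Finset.sum_sub_distrib]
      refine Finset.sum_congr rfl fun l _ => ?_
      have hb : ∀ w : L2per a, mulBounded (potential hd hA l) w =ᵐ[cellVol a]
          fun x => ((hA l).memLp.toLp _ : L2per a) x * w x := by
        intro w
        filter_upwards [coeFn_mulBounded (potential hd hA l) w, coeFn_toBounded hd
          ⟨_, toLp_mem_sobolevPer (hA l)⟩] with x h1 h2
        rw [h1, potential, h2]
      have h1 := integral_commutator (exists_potential_deriv hA j l).choose_spec
        (u := u) (w := diagMul (planeBasis a) (sobolevWeight (dualVec a))
          (fun n => (dualVec a n j : ℂ)) u) (fun n => by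
            rw [hmom, EuclideanSpace.inner_single_right]
            simp) n
      rw [← inner_of_coeFn (coeFn_mulSobolev hd _ u), ← inner_of_coeFn (hb _),
        ← inner_of_coeFn (hb _), EuclideanSpace.inner_single_right] at h1
      simp only [conj_trivial, one_mul] at h1
      rw [inner_smul_right, inner_smul_right, inner_smul_right, inner_smul_right, h1]
      linear_combination -(v l : ℂ) * ((dualVec a n j : ℂ) *
        ⟪planeBasis a n, mulBounded (potential hd hA l) u⟫_ℂ - ⟪planeBasis a n, mulBounded
          (potential hd hA l) (diagMul (planeBasis a) (sobolevWeight (dualVec a))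
            (fun n => (dualVec a n j : ℂ)) u)⟫_ℂ) * Complex.I_mul_I
    · have hL0 : 0 ≤ L := by simpa using hL ∅
      have hw := (waveNorm_pos a).le
      have h1 : ∀ l ∈ Finset.univ, ‖(v l : ℂ) • (-Complex.I) •
          mulSobolev hd (exists_potential_deriv hA j l).choose u‖ ≤
            ‖(exists_potential_deriv hA j l).choose‖ * waveNorm a * (‖v‖ * L) := by
        intro l _
        rw [norm_smul, norm_smul, norm_neg, Complex.norm_I, one_mul, Complex.norm_real]
        calc _ ≤ ‖v‖ * (‖(exists_potential_deriv hA j l).choose‖ * waveNorm a * L) := by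
              gcongr
              · exact norm_coord_le v l
              · exact norm_mulSobolev_le hd _ u hL
          _ = _ := by ring
      refine (norm_sum_le _ _).trans ((Finset.sum_le_sum h1).trans ?_)
      rw [← Finset.sum_mul, mul_assoc]
      refine mul_le_mul_of_nonneg_right ?_ (by positivity)
      exact Finset.single_le_sum (f := fun j => ∑ l, ‖(exists_potential_deriv hA j l).choose‖ *
        waveNorm a) (fun j _ => Finset.sum_nonneg fun l _ => mul_nonneg (norm_nonneg _) hw)
        (Finset.mem_univ j)

end Potentials

/-! ### Identification of the Bloch Hamiltonians -/

namespace FourierModel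

variable {d : ℕ} {𝓗 : Type*} {ι : Type*} [NormedAddCommGroup 𝓗] [InnerProductSpace ℂ 𝓗]
  [CompleteSpace 𝓗] {Φ : FourierModel d 𝓗 ι}

theorem inner_grad (k v : E d) (u : Φ.D) (i : ι) : ⟪Φ.e i, Φ.quad.grad k v u⟫_ℂ =
    (⟪Φ.ξ i + k, v⟫_ℝ : ℂ) * ⟪Φ.e i, (u : 𝓗)⟫_ℂ + ⟪Φ.e i, Φ.B v u⟫_ℂ := by
  rw [grad_quad, inner_add_right, inner_add_right, inner_smul_right, inner_mom, inner_add_left]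
  push_cast
  ring

/-- The square of the `j`-th component of the kinetic momentum. -/
def square (k : E d) (u : Φ.D) (j : Fin d) : 𝓗 :=
  Φ.mul (fun i => (((Φ.ξ i + k) j : ℝ) : ℂ) ^ 2) u + momPotential k (EuclideanSpace.single j 1) u j +
    Φ.comp j (Φ.quad.grad k (EuclideanSpace.single j 1) u)

theorem inner_mul_square (k : E d) (u : Φ.D) (j : Fin d) (i : ι) :
    ⟪Φ.e i, Φ.mul (fun i => (((Φ.ξ i + k) j : ℝ) : ℂ) ^ 2) u⟫_ℂ =
      (((Φ.ξ i + k) j : ℝ) : ℂ) ^ 2 * ⟪Φ.e i, (u : 𝓗)⟫_ℂ := by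
  refine inner_mul (l := fun i => (((Φ.ξ i + k) j : ℝ) : ℂ) ^ 2) (K := 2 * (1 + ‖k‖ ^ 2 + 0))
    (fun i => ?_) u i
  have h1 := kin_symbol_le (Φ.ξ i) k le_rfl
  have h2 := pow_le_pow_left₀ (abs_nonneg _) (norm_coord_le (Φ.ξ i + k) j) 2
  rw [norm_pow, Complex.norm_real, Real.norm_eq_abs]
  linarith

theorem inner_square (k : E d) (u : Φ.D) (j : Fin d) (i : ι) : ⟪Φ.e i, square k u j⟫_ℂ =
    (⟪Φ.ξ i + k, EuclideanSpace.single j 1⟫_ℝ : ℂ) *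
        ⟪Φ.e i, Φ.quad.grad k (EuclideanSpace.single j 1) u⟫_ℂ +
      ⟪Φ.e i, Φ.B (EuclideanSpace.single j 1) (Φ.quad.grad k (EuclideanSpace.single j 1) u)⟫_ℂ := by
  rw [square, inner_add_right, inner_add_right, inner_mul_square, inner_momPotential, inner_grad,
    EuclideanSpace.inner_single_right, comp]
  simp only [conj_trivial, one_mul]
  ring

/-- Expanding the squares recovers the quadratic family. -/
theorem half_sum_square (k : E d) (u : Φ.D) :
    (1 / 2 : ℂ) • ∑ j, square k u j + Φ.V u = Φ.quad.ham k u := by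
  have h1 := ham_quad k le_rfl u
  rw [Complex.ofReal_zero, zero_smul, add_zero] at h1
  rw [h1, pertAt_apply, ← add_assoc]
  congr 1
  have h2 : Φ.kin k 0 u =
      (1 / 2 : ℂ) • ∑ j, Φ.mul (fun i => (((Φ.ξ i + k) j : ℝ) : ℂ) ^ 2) u := by
    refine hilbertBasis_ext Φ.e fun i => ?_
    rw [inner_kin k le_rfl, inner_smul_right, inner_sum]
    simp only [inner_mul_square]
    rw [← Finset.sum_mul, add_zero, EuclideanSpace.real_norm_sq_eq]
    push_cast
    ring
  rw [h2, Finset.smul_sum, Finset.smul_sum, ← Finset.sum_add_distrib]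
  refine Finset.sum_congr rfl fun j _ => ?_
  have h3 : Φ.comp j (Φ.quad.grad k (EuclideanSpace.single j 1) u) =
      Φ.comp j (Φ.mom (EuclideanSpace.single j 1) u + (k j : ℂ) • (u : 𝓗)) +
        Φ.comp j (Φ.comp j u) := by
    rw [grad_quad, map_add, EuclideanSpace.inner_single_right]
    simp only [conj_trivial, one_mul]
    rfl
  rw [square, h3, momPotential]
  change _ = _ + (Φ.comp j _ + _ + _)
  simp only [comp]
  module

end FourierModel

section Identification

variable {d : ℕ} {a : Module.Basis (Fin d) ℝ (E d)}

theorem coeFn_kinetic (hd : d ≤ 3) {A : E d → E d}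
    (hA : ∀ j, MemHper a 2 (fun x => ((A x j : ℝ) : ℂ))) (k v : E d) (u g : L2per a) (c : ℂ) :
    (c • g + (⟪k, v⟫_ℝ : ℂ) • u + vectorMul hd hA v u : L2per a) =ᵐ[cellVol a]
      fun x => c * g x + ((⟪k + A x, v⟫_ℝ : ℝ) : ℂ) * u x := by
  filter_upwards [Lp.coeFn_add (c • g + (⟪k, v⟫_ℝ : ℂ) • u) (vectorMul hd hA v u),
    Lp.coeFn_add (c • g) ((⟪k, v⟫_ℝ : ℂ) • u), Lp.coeFn_smul c g,
    Lp.coeFn_smul (⟪k, v⟫_ℝ : ℂ) u, coeFn_vectorMul hd hA v u] with x h1 h2 h3 h4 h5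
  rw [h1, Pi.add_apply, h2, Pi.add_apply, h3, h4, h5, inner_add_left]
  simp only [Pi.smul_apply, smul_eq_mul]
  push_cast
  ring

/-- The operator `(-i∇ + k + A) · v` in terms of Fourier coefficients. -/
theorem mem_kinGraph_iff (hd : d ≤ 3) {A : E d → E d}
    (hA : ∀ j, MemHper a 2 (fun x => ((A x j : ℝ) : ℂ))) {k v : E d} {u f : L2per a} :
    (u, f) ∈ kinGraph a A k v ↔ ∀ n, ⟪planeBasis a n, f⟫_ℂ =
      (⟪dualVec a n + k, v⟫_ℝ : ℂ) * ⟪planeBasis a n, u⟫_ℂ +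
        ⟪planeBasis a n, vectorMul hd hA v u⟫_ℂ := by
  constructor
  · rintro ⟨g, hg, hf⟩ n
    have h1 : f = (-Complex.I) • g + (⟪k, v⟫_ℝ : ℂ) • u + vectorMul hd hA v u :=
      Lp.ext (hf.trans (coeFn_kinetic hd hA k v u g (-Complex.I)).symm)
    rw [h1, inner_add_right, inner_add_right, inner_smul_right, inner_smul_right,
      isWeakDeriv_iff.1 hg, inner_add_left]
    push_cast
    linear_combination -(⟪dualVec a n, v⟫_ℝ : ℂ) * ⟪planeBasis a n, u⟫_ℂ * Complex.I_mul_I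
  · intro h
    set g : L2per a := Complex.I • (f - (⟪k, v⟫_ℝ : ℂ) • u - vectorMul hd hA v u) with hgdef
    have hf : f = (-Complex.I) • g + (⟪k, v⟫_ℝ : ℂ) • u + vectorMul hd hA v u := by
      rw [hgdef, smul_smul, neg_mul, Complex.I_mul_I, neg_neg, one_smul]
      abel
    refine ⟨g, isWeakDeriv_iff.2 fun n => ?_, ?_⟩
    · rw [hgdef, inner_smul_right, inner_sub_right, inner_sub_right, inner_smul_right, h,
        inner_add_left]
      push_cast
      ring
    · have h1 := coeFn_kinetic hd hA k v u g (-Complex.I)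
      rw [← hf] at h1
      exact h1

theorem kinGraph_unique (hd : d ≤ 3) {A : E d → E d}
    (hA : ∀ j, MemHper a 2 (fun x => ((A x j : ℝ) : ℂ))) {k v : E d} {u f f' : L2per a}
    (h : (u, f) ∈ kinGraph a A k v) (h' : (u, f') ∈ kinGraph a A k v) : f = f' := by
  refine hilbertBasis_ext (planeBasis a) fun n => ?_
  rw [(mem_kinGraph_iff hd hA).1 h, (mem_kinGraph_iff hd hA).1 h']

theorem graph_dHam (hd : d ≤ 3) {A : E d → E d}
    (hA : ∀ j, MemHper a 2 (fun x => ((A x j : ℝ) : ℂ))) (k v : E d) :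
    (dHam a A k v).graph = kinGraph a A k v := by
  refine Submodule.toLinearPMap_graph_eq _ fun p hp hp0 => ?_
  obtain ⟨u, f⟩ := p
  obtain rfl : u = 0 := hp0
  exact kinGraph_unique hd hA hp (zero_mem _)

variable (hd : d ≤ 3) {A : E d → E d} {V : E d → ℝ}
  (hA : ∀ j, MemHper a 2 (fun x => ((A x j : ℝ) : ℂ)))
  (hV : MemLp (fun x => (V x : ℂ)) 2 (cellVol a))

theorem kinGraph_grad (k v : E d) (u : (blochModel hd hA hV).D) :
    ((u : L2per a), (blochModel hd hA hV).quad.grad k v u) ∈ kinGraph a A k v :=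
  (mem_kinGraph_iff hd hA).2 fun n => FourierModel.inner_grad k v u n

theorem kinGraph_square (k : E d) (u : (blochModel hd hA hV).D) (j : Fin d) :
    ((blochModel hd hA hV).quad.grad k (EuclideanSpace.single j 1) u, FourierModel.square k u j) ∈
      kinGraph a A k (EuclideanSpace.single j 1) :=
  (mem_kinGraph_iff hd hA).2 fun n => FourierModel.inner_square k u j n

theorem coeFn_ham (k : E d) (u : (blochModel hd hA hV).D) :
    (blochModel hd hA hV).quad.ham k u =ᵐ[cellVol a] fun x => (1 / 2 : ℂ) *
      (∑ j, FourierModel.square k u j : L2per a) x + (V x : ℂ) * (u : L2per a) x := by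
  have h1 := coeFn_mulSobolev hd (hV.toLp _) u
  rw [← FourierModel.half_sum_square]
  filter_upwards [Lp.coeFn_add ((1 / 2 : ℂ) • (∑ j, FourierModel.square k u j : L2per a))
    (mulSobolev hd (hV.toLp _) u), Lp.coeFn_smul (1 / 2 : ℂ)
    (∑ j, FourierModel.square k u j : L2per a), h1, hV.coeFn_toLp] with x h2 h3 h4 h5
  refine h2.trans ?_
  rw [Pi.add_apply, h3, h4, h5, Pi.smul_apply, smul_eq_mul]

/-- The iterated kinetic momenta in the definition of the Hamiltonian are those of the Fourier
representation. -/
theorem mem_hamGraph_iff {k : E d} {u f : L2per a} : (u, f) ∈ hamGraph a A V k ↔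
    (u, f) ∈ ((blochModel hd hA hV).quad.op k).graph := by
  rw [QuadFamily.mem_graph_op]
  constructor
  · rintro ⟨hu, w, z, hw, hz, hf⟩
    have hu' : u ∈ (blochModel hd hA hV).D := memHper_two_iff.1 hu
    refine ⟨hu', ?_⟩
    have e1 : ∀ j, w j = (blochModel hd hA hV).quad.grad k (EuclideanSpace.single j 1) ⟨u, hu'⟩ :=
      fun j => kinGraph_unique hd hA (hw j) (kinGraph_grad hd hA hV k _ ⟨u, hu'⟩)
    have e2 : z = FourierModel.square k (⟨u, hu'⟩ : (blochModel hd hA hV).D) := by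
      funext j
      refine kinGraph_unique hd hA (hz j) ?_
      rw [e1]
      exact kinGraph_square hd hA hV k ⟨u, hu'⟩ j
    subst e2
    exact Lp.ext ((coeFn_ham hd hA hV k ⟨u, hu'⟩).trans hf.symm)
  · rintro ⟨hu, rfl⟩
    exact ⟨memHper_two_iff.2 hu, _, _, fun j => kinGraph_grad hd hA hV k _ ⟨u, hu⟩,
      fun j => kinGraph_square hd hA hV k ⟨u, hu⟩ j, coeFn_ham hd hA hV k ⟨u, hu⟩⟩

/-- The Bloch Hamiltonian is the operator of the Fourier representation. -/
theorem ham_eq_op (k : E d) : ham a A V k = (blochModel hd hA hV).quad.op k := by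
  have h1 : hamGraph a A V k = ((blochModel hd hA hV).quad.op k).graph :=
    SetLike.ext fun p => mem_hamGraph_iff hd hA hV
  rw [ham, h1]
  refine LinearPMap.eq_of_eq_graph (Submodule.toLinearPMap_graph_eq _ fun p hp hp0 => ?_)
  exact LinearPMap.graph_fst_eq_zero_snd _ hp hp0

/-- The operator `∂H` on its maximal domain extends the derivative of the family on the domain of
the Hamiltonian. -/
theorem graph_gradOp_le (S : (blochModel hd hA hV).Shift) (k v : E d) :
    (S.regularFamily.gradOp k v).graph ≤ (dHam a A k v).graph := by
  rw [graph_dHam hd hA]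
  intro p hp
  obtain ⟨u, h1, h2⟩ := (LinearPMap.mem_graph_iff _).1 hp
  have h3 := kinGraph_grad hd hA hV k v u
  have h4 : p = ((u : L2per a), (blochModel hd hA hV).quad.grad k v u) := Prod.ext h1.symm h2.symm
  rw [h4]
  exact h3

end Identification

end BlochTransport

end

theorem proposition6 {d : ℕ} (hd : 1 ≤ d) (hd' : d ≤ 3)
    (a : Module.Basis (Fin d) ℝ (E d)) (e : Module.Basis (Fin d) ℝ (E d)) (α β : Fin d)
    (A : E d → E d) (V : E d → ℝ) (μF : ℝ)
    (hAper : IsPeriodic a A) (hVper : IsPeriodic a V)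
    (hV : MemHper a 1 (fun x => (V x : ℂ)))
    (hA : ∀ j, MemHper a 2 (fun x => ((A x j : ℝ) : ℂ)))
    (hdiv : ∀ φ : E d → ℝ, ContDiff ℝ ∞ φ → IsPeriodic a φ →
      ∫ x, fderiv ℝ φ x (A x) ∂(cellVol a) = 0) :
    ∃ C : ℝ, 0 ≤ C ∧ ∀ k : E d, ∀ N : ℕ, N = numBelow (ham a A V k) μF →
      eigval (ham a A V k) N < eigval (ham a A V k) (N + 1) →
      -- the state is the projector on the `N` lowest bands, also nearby if `μF` is not an eigenvalue
      densityMatrix a A V μF k = bandProj a A V N k ∧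
      (eigenspace (ham a A V k) μF = ⊥ →
        ∀ᶠ k' in 𝓝 k, densityMatrix a A V μF k' = bandProj a A V N k') ∧
      -- the derivatives and the partial inverse below are well defined
      LineDifferentiableAt ℝ (bandProj a A V N) k (e β) ∧
      (∀ᶠ k' in 𝓝 k, ∃ τ, HasTrace (ham a A V k') (bandProj a A V N k') τ) ∧
      ContDiffAt ℝ 2 (bandEnergy a A V N) k ∧
      (∃! X, IsPartialInverse (ham a A V k) (bandProj a A V N k)
        (lineDeriv ℝ (bandProj a A V N) k (e β)) X) ∧
      ∀ ε : ℝ, 0 ≤ ε → ∃ U : ℝ → (L2per a →L[ℂ] L2per a),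
        IsPropagator (fun t => ham a A V (k - (ε * t) • e β)) U ∧
        (∀ U', IsPropagator (fun t => ham a A V (k - (ε * t) • e β)) U' → U' = U) ∧
        ∀ t : ℝ, 0 ≤ t → ∃ j r ρ : ℂ,
          HasTrace (dHam a A (k - (ε * t) • e β) (e α))
            (U t ∘L densityMatrix a A V μF k ∘L ContinuousLinearMap.adjoint (U t)) j ∧
          HasTrace (dHam a A k (e α))
            (liouvExp (ham a A V k) t (liouvPlus (ham a A V k) (bandProj a A V N k)
                (lineDeriv ℝ (bandProj a A V N) k (e β)))
              - liouvPlus (ham a A V k) (bandProj a A V N k)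
                (lineDeriv ℝ (bandProj a A V N) k (e β))) r ∧
          j = lineDeriv ℝ (bandEnergy a A V N) k (e α)
              - (ε * t) * lineDeriv ℝ (fun k' => lineDeriv ℝ (bandEnergy a A V N) k' (e β)) k (e α)
              + Complex.I * ε * r + ρ ∧
          (ε * t ≤ 1 → ‖ρ‖ ≤ C * ε ^ 2 * t ^ 3 * (1 + t ^ 3)) := by
  obtain ⟨S, hS⟩ := (blochModel hd' hA hV.memLp).exists_shift (|μF| + 1)
  have hop : ham a A V = S.regularFamily.op := funext fun k => ham_eq_op hd' hA hV.memLp k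
  have hμ : 1 ≤ μF + S.regularFamily.c := by
    change 1 ≤ μF + S.M
    linarith [neg_abs_le μF]
  obtain ⟨C, hC, H⟩ := S.regularFamily.exists_linear_response hμ (e α) (e β)
    (fun k => dHam a A k (e α)) (fun k => graph_gradOp_le hd' hA hV.memLp S k (e α))
  refine ⟨C, hC, fun k N hN _ => ?_⟩
  have hD : densityMatrix a A V μF = S.regularFamily.proj μF := by
    funext k
    rw [densityMatrix, hop]
    rfl
  have hB : bandProj a A V = S.regularFamily.bands := by
    funext N k
    rw [bandProj, hop]
    rfl
  have hE : ∀ N, bandEnergy a A V N =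
      fun k' => tr (S.regularFamily.op k') (S.regularFamily.bands N k') := by
    intro N
    funext k
    rw [bandEnergy, hop, hB]
  rw [hop] at hN
  rw [hD, hB, hE]
  simp only [hop]
  exact H k N hN
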